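/- Let $k$ be a field of characteristic $\neq 2$ and let $n\ge 0$ be an integer. **Modules.** Let $V_n$ be the superspace with basis $v_i$, $i\in I=\{1,\dots,n,-1,\dots,-n\}$, where $v_i$ is even for $i>0$ and odd for $i<0$, with the bilinear form $(v_i,v_j)=\delta_{i,-j}$. Let $\mathfrak p(n)\subseteq\mathfrak{gl}(V_n)$ be the Lie superalgebra spanned by the homogeneous $f$ with $(f(v),w)+(-1)^{|f||v|}(v,f(w))=0$ for all homogeneous $v,w$. Consider $\mathfrak p(n)$-supermodules with all (even and odd) homomorphisms, where $f$ is a homogeneous homomorphism if it is homogeneous and linear with $f(x.m)=(-1)^{|x||f|}x.f(m)$; this is a monoidal supercategory, with $x.(m\otimes l)=x.m\otimes l+(-1)^{|x||m|}m\otimes x.l$ and $(f\otimes g)(m\otimes l)=(-1)^{|g||m|}f(m)\otimes g(l)$. Duals carry the action $(x.f)(m)=-(-1)^{|x||f|}f(x.m)$. Let $S^a(V_n)$ be the degree $a$ part of the symmetric superalgebra, the algebra generated by $V_n$ with the relations $vw=(-1)^{|v||w|}wv$ for homogeneous $v,w\in V_n$ (so $S^0(V_n)=k$). Let $\mathfrak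 p(n)\text{-mod}_{\mathcal S,\mathcal S^*}$ be the full monoidal subcategory generated by the $S^a(V_n)$ and $S^a(V_n)^*$, $a\ge 0$. **Webs.** Let $\mathfrak p\text{-}\mathbf{Web}_{\uparrow\downarrow}$ be the strict monoidal $k$-linear supercategory generated by objects $\uparrow_a,\downarrow_a$ ($a\ge1$; $\uparrow_0,\downarrow_0$ denote the unit object) and, for $a,b\ge0$, the even morphisms: split $\uparrow_{a+b}\to\uparrow_a\uparrow_b$, merge $\uparrow_a\uparrow_b\to\uparrow_{a+b}$, leftward cap $\downarrow_a\uparrow_a\to 1$, leftward cup $1\to\uparrow_a\downarrow_a$, rightward crossing $\uparrow_a\downarrow_b\to\downarrow_b\uparrow_a$; and the odd morphisms tag-in $\uparrow_1\to\downarrow_1$ and tag-out $\downarrow_1\to\uparrow_1$. Strands labelled $0$ are deleted, and a diagram with a negatively labelled strand is zero. Write $\cap=(\text{leftward cap}_1)\circ(\text{tag-in}\otimes\mathrm{id}):\uparrow_1\uparrow_1\to1$, $\cup=(\mathrm{id}\otimes\text{tag-out})\circ(\text{leftward cup}_1):1\to\uparrow_1\uparrow_1$, $\mathrm{ant}=\tfrac12\,\cap\circ\text{split}:\uparrow_2\to1$.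 On $\uparrow_a\uparrow_b$, let $R_s$ be the rightward rung (split off $s$ from the left strand and merge it into the right one), $L_r$ the leftward rung, $C$ the morphism to $\uparrow_{a-1}\uparrow_{b-1}$ which splits a strand $1$ off the right of the left strand and off the left of the right strand and applies $\cap$ to them, $U$ the morphism to $\uparrow_{a+1}\uparrow_{b+1}$ which creates $\cup$ between the strands and merges its legs into them, and $A_\ell,A_r$ the morphisms which split a strand $2$ off the left, respectively the right, strand into the middle and apply $\mathrm{ant}$ to it. Let the upward crossing be $X_{a,b}=\sum_{s-r=a-b}(-1)^{a-s}L_rR_s:\uparrow_a\uparrow_b\to\uparrow_b\uparrow_a$, and let the leftward crossing $\downarrow_a\uparrow_b\to\uparrow_b\downarrow_a$ be $(\text{cap}_a\otimes\mathrm{id}\otimes\mathrm{id})(\mathrm{id}\otimes X_{b,a}\otimes\mathrm{id})(\mathrm{id}\otimes\mathrm{id}\otimes\text{cup}_a)$. The defining relations are, for all $a,b,c,r,s\ge0$: 1. splits are coassociative and merges are associative; 2. on $\uparrow_a\uparrow_b$: $L_rR_s=\sum_{t\ge0}\binom{a-b+r-s}{t}R_{s-t}L_{r-t}$; 3. $(\mathrm{id}\otimes\cap)(\cup\otimes\mathrm{id})=\mathrm{id}_{\uparrow_1}=-(\cap\otimes\mathrm{id})(\mathrm{id}\otimes\cup)$;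 4. $\mathrm{ant}\circ\text{merge}=\cap$ on $\uparrow_1\uparrow_1$; 5. $CR_r=R_rC+2R_{r-1}A_\ell$ and $CL_r=L_rC+2L_{r-1}A_r$; 6. $R_rU=UR_r$ and $L_rU=UL_r$; 7. $(\mathrm{id}\otimes\text{cap}_a)(\text{cup}_a\otimes\mathrm{id})=\mathrm{id}_{\uparrow_a}$ and $(\text{cap}_a\otimes\mathrm{id})(\mathrm{id}\otimes\text{cup}_a)=\mathrm{id}_{\downarrow_a}$; 8. the leftward crossing $\downarrow_a\uparrow_b\to\uparrow_b\downarrow_a$ and the rightward crossing $\uparrow_b\downarrow_a\to\downarrow_a\uparrow_b$ are inverse to each other; 9. for $a>0$, $\text{cap}_a\circ(\text{rightward crossing}_{a,a})\circ\text{cup}_a=0$. **Theorem.** There is a well-defined monoidal superfunctor (a $k$-linear, parity preserving functor with even coherence isomorphisms) $$G_{\uparrow\downarrow}:\mathfrak p\text{-}\mathbf{Web}_{\uparrow\downarrow}\to\mathfrak p(n)\text{-mod}_{\mathcal S,\mathcal S^*}$$ with $G_{\uparrow\downarrow}(\uparrow_a)=S^a(V_n)$ and $G_{\uparrow\downarrow}(\downarrow_a)=S^a(V_n)^*$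 for $a\ge1$ (for $a=0$ the unit object is sent to the trivial module up to the coherence isomorphism, identified with $S^0(V_n)$ and $S^0(V_n)^*$ in the obvious way) which, up to the coherence isomorphisms, is given on the generating morphisms, for all $a,b\ge0$, as follows. - The split goes to $x_1\cdots x_{a+b}\mapsto\sum_{T,U}(-1)^{\varepsilon(T,U)}x_T\otimes x_U$ for homogeneous $x_i\in V_n$. The sum is over the partitions of $\{1,\dots,a+b\}$ into sets $T$, $U$ of sizes $a$, $b$; $x_T=x_{t_1}\cdots x_{t_a}$ for $T=\{t_1<\dots<t_a\}$, and likewise for $x_U$; and $\varepsilon(T,U)=\#\{(t,u)\in T\times U: t>u,\ x_t,x_u\text{ odd}\}$. - The merge goes to $x\otimes y\mapsto xy$. - The leftward cap goes to the evaluation $S^a(V_n)^*\otimes S^a(V_n)\to k$, $f\otimes x\mapsto f(x)$, and the leftward cup to the coevaluation $k\to S^a(V_n)\otimes S^a(V_n)^*$, $1\mapsto\sum_x x\otimes x^*$ (sum over a basis and its dual basis). - The tag-in goes to the odd isomorphism $D:V_n\to V_n^*$, $v\mapsto(v,-)$, and the tag-out to $D^{-1}$. - The rightward crossing goes to the super swap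 $S^a(V_n)\otimes S^b(V_n)^*\to S^b(V_n)^*\otimes S^a(V_n)$, $x\otimes f\mapsto(-1)^{|x||f|}f\otimes x$ for homogeneous $x,f$. -/

import Mathlib

open CategoryTheory TensorProduct

universe u v w u₁ v₁ u₂ v₂

set_option linter.unusedSectionVars false

namespace TypeP

noncomputable section

/-! ## Signs and monoidal supercategories -/

/-- The sign `(-1)^p` of a parity `p ∈ ℤ/2`, as an element of the ground ring. -/
def sgn (k : Type u) [CommRing k] (p : ZMod 2) : k := if p = 0 then 1 else -1

theorem zmod_cases (p : ZMod 2) : p = 0 ∨ p = 1 := by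
  revert p; decide

@[simp] theorem sgn_zero (k : Type u) [CommRing k] : sgn k 0 = 1 := if_pos rfl

@[simp] theorem sgn_one (k : Type u) [CommRing k] : sgn k 1 = -1 := if_neg (by decide)

theorem sgn_add (k : Type u) [CommRing k] (p q : ZMod 2) :
    sgn k (p + q) = sgn k p * sgn k q := by
  rcases zmod_cases p with rfl | rfl <;> rcases zmod_cases q with rfl | rfl <;>
    simp [show (1 : ZMod 2) + 1 = 0 by decide]

theorem sgn_eq (k : Type u) [CommRing k] (p : ZMod 2) : sgn k p = 1 ∨ sgn k p = -1 := by
  rcases zmod_cases p with rfl | rfl <;> simp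

theorem sgn_mul_self (k : Type u) [CommRing k] (p : ZMod 2) : sgn k p * sgn k p = 1 := by
  rcases zmod_cases p with rfl | rfl <;> simp

/-- A `k`-linear supercategory: the morphism modules are `ℤ/2`-graded and composition is even. -/
class Supercategory (k : Type w) [CommRing k] (C : Type u) [Category.{v} C] [Preadditive C]
    [Linear k C] where
  /-- `parity X Y p` is the submodule of the morphisms of parity `p`. -/
  parity (X Y : C) : ZMod 2 → Submodule k (X ⟶ Y)
  isCompl (X Y : C) : IsCompl (parity X Y 0) (parity X Y 1)
  id_mem (X : C) : 𝟙 X ∈ parity X X 0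
  comp_mem {X Y Z : C} {p q : ZMod 2} {f : X ⟶ Y} {g : Y ⟶ Z} :
    f ∈ parity X Y p → g ∈ parity Y Z q → f ≫ g ∈ parity X Z (p + q)

/-- A monoidal supercategory. The tensor product of morphisms is bilinear and even, and it
satisfies the super-interchange law `(h ⊗ l) ∘ (f ⊗ g) = (-1)^{|l||f|} (h ∘ f) ⊗ (l ∘ g)`.
The associators and unitors are even, and natural for all morphisms. -/
class MonoidalSupercategory (k : Type w) [CommRing k] (C : Type u) [Category.{v} C]
    [Preadditive C] [Linear k C] [Supercategory k C] where
  tensorObj : C → C → C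
  tensorHom {X₁ Y₁ X₂ Y₂ : C} :
    (X₁ ⟶ Y₁) →ₗ[k] (X₂ ⟶ Y₂) →ₗ[k] (tensorObj X₁ X₂ ⟶ tensorObj Y₁ Y₂)
  tensorHom_mem {X₁ Y₁ X₂ Y₂ : C} {p q : ZMod 2} {f : X₁ ⟶ Y₁} {g : X₂ ⟶ Y₂} :
    f ∈ Supercategory.parity (k := k) X₁ Y₁ p → g ∈ Supercategory.parity (k := k) X₂ Y₂ q →
      tensorHom f g ∈ Supercategory.parity (k := k) _ _ (p + q)
  tensorHom_id (X Y : C) : tensorHom (𝟙 X) (𝟙 Y) = 𝟙 (tensorObj X Y)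
  interchange {X₁ Y₁ Z₁ X₂ Y₂ Z₂ : C} {p q : ZMod 2} {f : X₁ ⟶ Y₁} (g : X₂ ⟶ Y₂)
    (h : Y₁ ⟶ Z₁) {l : Y₂ ⟶ Z₂} :
    f ∈ Supercategory.parity (k := k) X₁ Y₁ p → l ∈ Supercategory.parity (k := k) Y₂ Z₂ q →
      tensorHom f g ≫ tensorHom h l = sgn k (q * p) • tensorHom (f ≫ h) (g ≫ l)
  unit : C
  assoc (X Y Z : C) : tensorObj (tensorObj X Y) Z ≅ tensorObj X (tensorObj Y Z)
  lunit (X : C) : tensorObj unit X ≅ X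
  runit (X : C) : tensorObj X unit ≅ X
  assoc_mem (X Y Z : C) : (assoc X Y Z).hom ∈ Supercategory.parity (k := k) _ _ 0
  lunit_mem (X : C) : (lunit X).hom ∈ Supercategory.parity (k := k) _ _ 0
  runit_mem (X : C) : (runit X).hom ∈ Supercategory.parity (k := k) _ _ 0
  assoc_naturality {X₁ Y₁ X₂ Y₂ X₃ Y₃ : C} (f : X₁ ⟶ Y₁) (g : X₂ ⟶ Y₂) (h : X₃ ⟶ Y₃) :
    tensorHom (tensorHom f g) h ≫ (assoc Y₁ Y₂ Y₃).hom =
      (assoc X₁ X₂ X₃).hom ≫ tensorHom f (tensorHom g h)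
  lunit_naturality {X Y : C} (f : X ⟶ Y) :
    tensorHom (𝟙 unit) f ≫ (lunit Y).hom = (lunit X).hom ≫ f
  runit_naturality {X Y : C} (f : X ⟶ Y) :
    tensorHom f (𝟙 unit) ≫ (runit Y).hom = (runit X).hom ≫ f
  pentagon (W X Y Z : C) :
    tensorHom (assoc W X Y).hom (𝟙 Z) ≫ (assoc W (tensorObj X Y) Z).hom ≫
        tensorHom (𝟙 W) (assoc X Y Z).hom =
      (assoc (tensorObj W X) Y Z).hom ≫ (assoc W X (tensorObj Y Z)).hom
  triangle (X Y : C) :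
    (assoc X unit Y).hom ≫ tensorHom (𝟙 X) (lunit Y).hom = tensorHom (runit X).hom (𝟙 Y)

open Supercategory MonoidalSupercategory

/-- A (strong) monoidal superfunctor: a `k`-linear functor preserving parities, with even
coherence isomorphisms `F X ⊗ F Y ≅ F (X ⊗ Y)`, natural for all morphisms, and `1 ≅ F 1`, which
are compatible with the associators and unitors. -/
structure MonoidalSuperfunctor (k : Type w) [CommRing k]
    (C : Type u₁) [Category.{v₁} C] [Preadditive C] [Linear k C] [Supercategory k C]
    [MonoidalSupercategory k C]
    (D : Type u₂) [Category.{v₂} D] [Preadditive D] [Linear k D] [Supercategory k D]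
    [MonoidalSupercategory k D] extends C ⥤ D where
  map_add {X Y : C} (f g : X ⟶ Y) : map (f + g) = map f + map g
  map_smul {X Y : C} (c : k) (f : X ⟶ Y) : map (c • f) = c • map f
  map_mem {X Y : C} {p : ZMod 2} {f : X ⟶ Y} :
    f ∈ parity (k := k) X Y p → map f ∈ parity (k := k) (obj X) (obj Y) p
  μ (X Y : C) : tensorObj k (obj X) (obj Y) ≅ obj (tensorObj k X Y)
  μ_mem (X Y : C) : (μ X Y).hom ∈ parity (k := k) _ _ 0
  μ_naturality {X₁ Y₁ X₂ Y₂ : C} (f : X₁ ⟶ Y₁) (g : X₂ ⟶ Y₂) :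
    tensorHom (k := k) (map f) (map g) ≫ (μ Y₁ Y₂).hom =
      (μ X₁ X₂).hom ≫ map (tensorHom (k := k) f g)
  ε : unit k ≅ obj (unit k)
  ε_mem : ε.hom ∈ parity (k := k) _ _ 0
  associativity (X Y Z : C) :
    tensorHom (k := k) (μ X Y).hom (𝟙 (obj Z)) ≫ (μ (tensorObj k X Y) Z).hom ≫
        map (assoc (k := k) X Y Z).hom =
      (assoc (k := k) (obj X) (obj Y) (obj Z)).hom ≫ tensorHom (k := k) (𝟙 (obj X)) (μ Y Z).hom ≫
        (μ X (tensorObj k Y Z)).hom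
  left_unitality (X : C) :
    (lunit (k := k) (obj X)).hom =
      tensorHom (k := k) ε.hom (𝟙 (obj X)) ≫ (μ (unit k) X).hom ≫ map (lunit (k := k) X).hom
  right_unitality (X : C) :
    (runit (k := k) (obj X)).hom =
      tensorHom (k := k) (𝟙 (obj X)) ε.hom ≫ (μ X (unit k)).hom ≫ map (runit (k := k) X).hom

/-! ## The Lie superalgebra of type P and its supermodules -/

section TypePAlgebra

variable (k : Type u) [Field k] (n : ℕ)

/-- The index set `{1, …, n, -1, …, -n}`: `Sum.inl` gives the positive (even) indices and
`Sum.inr` the negative (odd) ones, so that `Sum.swap` is the negation of indices. -/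
abbrev Ix (n : ℕ) : Type := Fin n ⊕ Fin n

/-- The parity of an index. -/
def Ix.par {n : ℕ} : Ix n → ZMod 2
  | Sum.inl _ => 0
  | Sum.inr _ => 1

/-- The underlying vector space of the natural module, with the `v_i = Pi.single i 1` as basis. -/
abbrev NatV : Type u := Ix n → k

/-- The homogeneous components of the natural module. -/
def natGrade (p : ZMod 2) : Submodule k (NatV k n) where
  carrier := {v | ∀ i, i.par ≠ p → v i = 0}
  add_mem' hv hw i hi := by simp [hv i hi, hw i hi]
  zero_mem' i _ := rfl
  smul_mem' c v hv i hi := by simp [hv i hi]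

/-- The odd bilinear form with `(v_i, v_j) = δ_{i,-j}`. -/
def form (v w : NatV k n) : k := ∑ i : Ix n, v i * w i.swap

theorem form_smul_left (c : k) (a w : NatV k n) : form k n (c • a) w = c * form k n a w := by
  simp only [form, Pi.smul_apply, smul_eq_mul, Finset.mul_sum, mul_assoc]

theorem form_smul_right (c : k) (a w : NatV k n) : form k n w (c • a) = c * form k n w a := by
  simp only [form, Pi.smul_apply, smul_eq_mul, Finset.mul_sum, mul_left_comm]

/-- The homogeneous component of parity `p` of the Lie superalgebra `𝔭(n) ⊆ 𝔤𝔩(n|n)`: the linear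
maps `f` of parity `p` with `(f v, w) + (-1)^{|f||v|} (v, f w) = 0`. -/
def typeP (p : ZMod 2) : Submodule k (NatV k n →ₗ[k] NatV k n) where
  carrier := {f | (∀ s, ∀ v ∈ natGrade k n s, f v ∈ natGrade k n (p + s)) ∧
    ∀ s, ∀ v ∈ natGrade k n s, ∀ w, form k n (f v) w + sgn k (p * s) * form k n v (f w) = 0}
  add_mem' := by
    rintro f g ⟨hf, hf'⟩ ⟨hg, hg'⟩
    refine ⟨fun s v hv => add_mem (hf s v hv) (hg s v hv), fun s v hv w => ?_⟩
    have h1 := hf' s v hv w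
    have h2 := hg' s v hv w
    simp only [form, LinearMap.add_apply, Pi.add_apply, add_mul, mul_add,
      Finset.sum_add_distrib] at h1 h2 ⊢
    linear_combination h1 + h2
  zero_mem' := ⟨fun s v _ => zero_mem _, fun s v _ w => by simp [form]⟩
  smul_mem' := by
    rintro c f ⟨hf, hf'⟩
    refine ⟨fun s v hv => Submodule.smul_mem _ c (hf s v hv), fun s v hv w => ?_⟩
    have h1 := hf' s v hv w
    rw [LinearMap.smul_apply, LinearMap.smul_apply, form_smul_left, form_smul_right]
    linear_combination c * h1

theorem form_sub_left (a b w : NatV k n) : form k n (a - b) w = form k n a w - form k n b w := by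
  simp [form, sub_mul, Finset.sum_sub_distrib]

theorem form_sub_right (a b w : NatV k n) : form k n w (a - b) = form k n w a - form k n w b := by
  simp [form, mul_sub, Finset.sum_sub_distrib]

/-- The superbracket `[x, y] = x ∘ y - (-1)^{|x||y|} y ∘ x` of `𝔭(n)`. -/
def bracket {p q : ZMod 2} (x : typeP k n p) (y : typeP k n q) : typeP k n (p + q) :=
  ⟨x.1 ∘ₗ y.1 - sgn k (p * q) • (y.1 ∘ₗ x.1), by
    obtain ⟨x, hx, hx'⟩ := x
    obtain ⟨y, hy, hy'⟩ := y
    refine ⟨fun s v hv => ?_, fun s v hv w => ?_⟩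
    · refine sub_mem ?_ (Submodule.smul_mem _ _ ?_)
      · rw [add_assoc]; exact hx _ _ (hy _ _ hv)
      · rw [add_comm p q, add_assoc]; exact hy _ _ (hx _ _ hv)
    · have h1 := hx' _ _ (hy _ _ hv) w
      have h2 := hy' _ _ hv (x w)
      have h3 := hy' _ _ (hx _ _ hv) w
      have h4 := hx' _ _ hv (y w)
      simp only [LinearMap.sub_apply, LinearMap.comp_apply, LinearMap.smul_apply,
        form_sub_left, form_sub_right, form_smul_left, form_smul_right, mul_add, add_mul,
        sgn_add, mul_comm q p] at h1 h2 h3 h4 ⊢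
      have e1 := sgn_mul_self k (p * q)
      linear_combination h1 - sgn k (p * q) * h3 - sgn k (p * s) * sgn k (p * q) * h2 +
        sgn k (q * s) * h4 + (form k n (x v) (y w) * sgn k (q * s)) * e1⟩

/-- A `𝔭(n)`-supermodule: a `ℤ/2`-graded vector space with an action of `𝔭(n)`, given on its
homogeneous components, which respects the gradings and the superbracket. -/
structure PMod where
  carrier : Type u
  [addCommGroup : AddCommGroup carrier]
  [module : Module k carrier]
  /-- the homogeneous components -/
  grade : ZMod 2 → Submodule k carrier
  isCompl : IsCompl (grade 0) (grade 1)
  /-- the action of the elements of parity `p` -/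
  act (p : ZMod 2) : typeP k n p →ₗ[k] (carrier →ₗ[k] carrier)
  act_mem {p q : ZMod 2} (x : typeP k n p) {m : carrier} :
    m ∈ grade q → act p x m ∈ grade (p + q)
  act_bracket {p q : ZMod 2} (x : typeP k n p) (y : typeP k n q) (m : carrier) :
    act (p + q) (bracket k n x y) m =
      act p x (act q y m) - sgn k (p * q) • act q y (act p x m)

attribute [instance] PMod.addCommGroup PMod.module

end TypePAlgebra
namespace PMod

variable {k : Type u} [Field k] {n : ℕ}

theorem exists_add (M : PMod k n) (m : M.carrier) :
    ∃ a ∈ M.grade 0, ∃ b ∈ M.grade 1, a + b = m :=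
  Submodule.mem_sup.1 (M.isCompl.sup_eq_top ▸ Submodule.mem_top)

/-- Linear maps which agree on all homogeneous elements are equal. -/
theorem lin_ext {M : PMod k n} {P : Type v} [AddCommGroup P] [Module k P]
    {f g : M.carrier →ₗ[k] P} (h : ∀ p, ∀ m ∈ M.grade p, f m = g m) : f = g := by
  ext m
  obtain ⟨a, ha, b, hb, rfl⟩ := M.exists_add m
  rw [map_add, map_add, h 0 a ha, h 1 b hb]

/-- The parity operator, `m ↦ (-1)^{|m|} m` on homogeneous elements. -/
def par (M : PMod k n) : M.carrier →ₗ[k] M.carrier :=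
  Submodule.projection _ _ M.isCompl - Submodule.projection _ _ M.isCompl.symm

theorem par_apply (M : PMod k n) {p : ZMod 2} {m : M.carrier} (hm : m ∈ M.grade p) :
    M.par m = sgn k p • m := by
  rcases zmod_cases p with rfl | rfl
  · rw [par, LinearMap.sub_apply, Submodule.projection_apply_of_mem_left M.isCompl hm,
      Submodule.projection_apply_of_mem_right M.isCompl.symm hm]
    simp
  · rw [par, LinearMap.sub_apply, Submodule.projection_apply_of_mem_left M.isCompl.symm hm,
      Submodule.projection_apply_of_mem_right M.isCompl hm]
    simp

/-- The map `m ↦ (-1)^{q|m|} m`. -/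
def tw (M : PMod k n) (q : ZMod 2) : M.carrier →ₗ[k] M.carrier :=
  if q = 0 then LinearMap.id else M.par

theorem tw_apply (M : PMod k n) (q : ZMod 2) {p : ZMod 2} {m : M.carrier} (hm : m ∈ M.grade p) :
    M.tw q m = sgn k (q * p) • m := by
  rcases zmod_cases q with rfl | rfl
  · simp [tw]
  · simp [tw, M.par_apply hm]

/-- The `𝔭(n)`-module homomorphisms of parity `p`: the linear maps `f` of parity `p` with
`f(x.m) = (-1)^{|x||f|} x.f(m)`. -/
def homGrade (M N : PMod k n) (p : ZMod 2) : Submodule k (M.carrier →ₗ[k] N.carrier) where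
  carrier := {f | (∀ s, ∀ m ∈ M.grade s, f m ∈ N.grade (p + s)) ∧
    ∀ q (x : typeP k n q) m, f (M.act q x m) = sgn k (q * p) • N.act q x (f m)}
  add_mem' := by
    rintro f g ⟨hf, hf'⟩ ⟨hg, hg'⟩
    exact ⟨fun s m hm => add_mem (hf s m hm) (hg s m hm), fun q x m => by simp [hf', hg']⟩
  zero_mem' := ⟨fun s m _ => zero_mem _, fun q x m => by simp⟩
  smul_mem' := by
    rintro c f ⟨hf, hf'⟩
    exact ⟨fun s m hm => Submodule.smul_mem _ c (hf s m hm), fun q x m => by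
      simp [hf', smul_comm c]⟩

/-- All `𝔭(n)`-module homomorphisms: the sums of the even and the odd ones. -/
def homSub (M N : PMod k n) : Submodule k (M.carrier →ₗ[k] N.carrier) :=
  homGrade M N 0 ⊔ homGrade M N 1

theorem homGrade_le (M N : PMod k n) (p : ZMod 2) : homGrade M N p ≤ homSub M N := by
  rcases zmod_cases p with rfl | rfl
  · exact le_sup_left
  · exact le_sup_right

theorem id_mem (M : PMod k n) : LinearMap.id ∈ homGrade M M 0 :=
  ⟨fun s m hm => by simpa using hm, fun q x m => by simp⟩

theorem comp_mem {M N P : PMod k n} {p q : ZMod 2} {f : M.carrier →ₗ[k] N.carrier}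
    {g : N.carrier →ₗ[k] P.carrier} (hf : f ∈ homGrade M N p) (hg : g ∈ homGrade N P q) :
    g ∘ₗ f ∈ homGrade M P (p + q) := by
  refine ⟨fun s m hm => ?_, fun r x m => ?_⟩
  · rw [add_comm p q, add_assoc]
    exact hg.1 _ _ (hf.1 _ _ hm)
  · simp only [LinearMap.comp_apply, hf.2, map_smul, hg.2, mul_add, sgn_add, mul_smul]

theorem comp_mem_homSub {M N P : PMod k n} {f : M.carrier →ₗ[k] N.carrier}
    {g : N.carrier →ₗ[k] P.carrier} (hf : f ∈ homSub M N) (hg : g ∈ homSub N P) :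
    g ∘ₗ f ∈ homSub M P := by
  obtain ⟨f₀, hf₀, f₁, hf₁, rfl⟩ := Submodule.mem_sup.1 hf
  obtain ⟨g₀, hg₀, g₁, hg₁, rfl⟩ := Submodule.mem_sup.1 hg
  simp only [LinearMap.comp_add, LinearMap.add_comp]
  have h {p q f g} (hf : f ∈ homGrade M N p) (hg : g ∈ homGrade N P q) :=
    homGrade_le _ _ _ (comp_mem hf hg)
  refine add_mem (add_mem ?_ ?_) (add_mem ?_ ?_) <;> apply h <;> assumption

theorem homGrade_disjoint (M N : PMod k n) : Disjoint (homGrade M N 0) (homGrade M N 1) := by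
  rw [Submodule.disjoint_def]
  intro f h₀ h₁
  refine lin_ext fun p m hm => ?_
  have a := h₀.1 p m hm
  have b := h₁.1 p m hm
  rcases zmod_cases p with rfl | rfl
  · exact (Submodule.disjoint_def.1 N.isCompl.disjoint) _ (by simpa using a) (by simpa using b)
  · exact (Submodule.disjoint_def.1 N.isCompl.disjoint) _
      (by simpa [show (1 : ZMod 2) + 1 = 0 by decide] using b) (by simpa using a)

/-- The category of `𝔭(n)`-supermodules and all (not only even) homomorphisms. -/
instance : Category (PMod k n) where
  Hom M N := homSub M N
  id M := ⟨LinearMap.id, homGrade_le _ _ _ (id_mem M)⟩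
  comp f g := ⟨g.1 ∘ₗ f.1, comp_mem_homSub f.2 g.2⟩

/-- The linear map underlying a homomorphism. -/
def lin {M N : PMod k n} (f : M ⟶ N) : M.carrier →ₗ[k] N.carrier := f.1

theorem lin_mem {M N : PMod k n} (f : M ⟶ N) : lin f ∈ homSub M N := f.2

@[simp] theorem lin_id (M : PMod k n) : lin (𝟙 M) = LinearMap.id := rfl

@[simp] theorem lin_comp {M N P : PMod k n} (f : M ⟶ N) (g : N ⟶ P) :
    lin (f ≫ g) = lin g ∘ₗ lin f := rfl

theorem hom_ext {M N : PMod k n} {f g : M ⟶ N} (h : lin f = lin g) : f = g := Subtype.ext h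

instance : Preadditive (PMod k n) where
  homGroup M N := inferInstanceAs (AddCommGroup (homSub M N))
  add_comp _ _ _ f f' g := hom_ext (LinearMap.comp_add f.1 f'.1 g.1)
  comp_add _ _ _ f g g' := hom_ext (LinearMap.add_comp f.1 g'.1 g.1)

instance : Linear k (PMod k n) where
  homModule M N := inferInstanceAs (Module k (homSub M N))
  smul_comp _ _ _ c f g := hom_ext (LinearMap.comp_smul g.1 c f.1)
  comp_smul _ _ _ f c g := hom_ext (LinearMap.smul_comp c g.1 f.1)

@[simp] theorem lin_add {M N : PMod k n} (f g : M ⟶ N) : lin (f + g) = lin f + lin g := rfl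

@[simp] theorem lin_smul {M N : PMod k n} (c : k) (f : M ⟶ N) : lin (c • f) = c • lin f := rfl

/-- `lin` as a linear map. -/
def linHom (M N : PMod k n) : (M ⟶ N) →ₗ[k] (M.carrier →ₗ[k] N.carrier) where
  toFun := lin
  map_add' := lin_add
  map_smul' := lin_smul

/-- A linear map which is a homomorphism of parity `p`, as a morphism. -/
def ofMem {M N : PMod k n} {p : ZMod 2} (f : M.carrier →ₗ[k] N.carrier)
    (h : f ∈ homGrade M N p) : M ⟶ N := ⟨f, homGrade_le M N p h⟩

@[simp] theorem lin_ofMem {M N : PMod k n} {p : ZMod 2} (f : M.carrier →ₗ[k] N.carrier)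
    (h : f ∈ homGrade M N p) : lin (ofMem f h) = f := rfl

instance : Supercategory k (PMod k n) where
  parity M N p := (homGrade M N p).comap (linHom M N)
  isCompl M N := by
    constructor
    · rw [Submodule.disjoint_def]
      intro f h₀ h₁
      exact hom_ext ((Submodule.disjoint_def.1 (homGrade_disjoint M N)) _ h₀ h₁)
    · rw [codisjoint_iff, eq_top_iff]
      intro f _
      obtain ⟨f₀, hf₀, f₁, hf₁, h⟩ := Submodule.mem_sup.1 f.2
      exact Submodule.mem_sup.2 ⟨ofMem f₀ hf₀, hf₀, ofMem f₁ hf₁, hf₁, hom_ext h⟩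
  id_mem M := id_mem M
  comp_mem hf hg := comp_mem hf hg

theorem mem_parity {M N : PMod k n} {p : ZMod 2} {f : M ⟶ N} :
    f ∈ parity (k := k) M N p ↔ lin f ∈ homGrade M N p := Iff.rfl

/-- Every morphism is the sum of an even and an odd one. -/
theorem hom_exists_add {M N : PMod k n} (f : M ⟶ N) :
    ∃ f₀ f₁ : M ⟶ N, lin f₀ ∈ homGrade M N 0 ∧ lin f₁ ∈ homGrade M N 1 ∧ f = f₀ + f₁ := by
  obtain ⟨f₀, hf₀, f₁, hf₁, h⟩ := Submodule.mem_sup.1 f.2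
  exact ⟨ofMem f₀ hf₀, ofMem f₁ hf₁, hf₀, hf₁, hom_ext h.symm⟩

/-! ### Tensor products -/

theorem isCompl_of_parity [NeZero (2 : k)] {M : Type v} [AddCommGroup M] [Module k M]
    (P : M →ₗ[k] M) (gr : ZMod 2 → Submodule k M)
    (hP : ∀ p, ∀ m ∈ gr p, P m = sgn k p • m) (hs : ∀ m, m ∈ gr 0 ⊔ gr 1) :
    IsCompl (gr 0) (gr 1) := by
  constructor
  · rw [Submodule.disjoint_def]
    intro m h₀ h₁
    have a := hP 0 m h₀
    rw [hP 1 m h₁, sgn_zero, sgn_one, neg_smul, one_smul, neg_eq_iff_add_eq_zero,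
      ← two_smul k] at a
    exact (smul_eq_zero.1 a).resolve_left (NeZero.ne (2 : k))
  · exact codisjoint_iff.2 (eq_top_iff.2 fun m _ => hs m)

/-- The homogeneous components of the tensor product: `m ⊗ n` has parity `|m| + |n|`. -/
def tensorGrade (M N : PMod k n) (r : ZMod 2) : Submodule k (M.carrier ⊗[k] N.carrier) :=
  Submodule.span k {t | ∃ p q, p + q = r ∧ ∃ m ∈ M.grade p, ∃ l ∈ N.grade q, m ⊗ₜ[k] l = t}

theorem tmul_mem {M N : PMod k n} {p q : ZMod 2} {m : M.carrier} {l : N.carrier}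
    (hm : m ∈ M.grade p) (hl : l ∈ N.grade q) : m ⊗ₜ[k] l ∈ tensorGrade M N (p + q) :=
  Submodule.subset_span ⟨p, q, rfl, m, hm, l, hl, rfl⟩

theorem tensorGrade_le {M N : PMod k n} {r : ZMod 2} {S : Submodule k (M.carrier ⊗[k] N.carrier)}
    (h : ∀ p q, p + q = r → ∀ m ∈ M.grade p, ∀ l ∈ N.grade q, m ⊗ₜ[k] l ∈ S) :
    tensorGrade M N r ≤ S := by
  refine Submodule.span_le.2 ?_
  rintro _ ⟨p, q, e, m, hm, l, hl, rfl⟩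
  exact h p q e m hm l hl

theorem tensor_ext {M N : PMod k n} {P : Type v} [AddCommGroup P] [Module k P]
    {f g : M.carrier ⊗[k] N.carrier →ₗ[k] P}
    (h : ∀ p q, ∀ m ∈ M.grade p, ∀ l ∈ N.grade q, f (m ⊗ₜ l) = g (m ⊗ₜ l)) : f = g := by
  refine TensorProduct.ext (lin_ext fun p m hm => lin_ext fun q l hl => ?_)
  simpa using h p q m hm l hl

theorem tensorGrade_sup (M N : PMod k n) (t : M.carrier ⊗[k] N.carrier) :
    t ∈ tensorGrade M N 0 ⊔ tensorGrade M N 1 := by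
  have key : ∀ {p q : ZMod 2} {m : M.carrier} {l : N.carrier}, m ∈ M.grade p → l ∈ N.grade q →
      m ⊗ₜ[k] l ∈ tensorGrade M N 0 ⊔ tensorGrade M N 1 := by
    intro p q m l hm hl
    have h := tmul_mem hm hl
    rcases zmod_cases (p + q) with e | e <;> rw [e] at h
    · exact Submodule.mem_sup_left h
    · exact Submodule.mem_sup_right h
  induction t with
  | zero => exact zero_mem _
  | add x y hx hy => exact add_mem hx hy
  | tmul m l =>
    obtain ⟨a, ha, b, hb, rfl⟩ := M.exists_add m
    obtain ⟨c, hc, d, hd, rfl⟩ := N.exists_add l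
    simp only [TensorProduct.add_tmul, TensorProduct.tmul_add]
    refine add_mem (add_mem ?_ ?_) (add_mem ?_ ?_) <;> apply key <;> assumption

/-- The action on the tensor product: `x.(m ⊗ l) = x.m ⊗ l + (-1)^{|x||m|} m ⊗ x.l`. -/
def tensorAct (M N : PMod k n) (p : ZMod 2) :
    typeP k n p →ₗ[k] (M.carrier ⊗[k] N.carrier →ₗ[k] M.carrier ⊗[k] N.carrier) where
  toFun x := TensorProduct.map (M.act p x) LinearMap.id + TensorProduct.map (M.tw p) (N.act p x)
  map_add' x y := by
    simp only [map_add, TensorProduct.map_add_left, TensorProduct.map_add_right]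
    abel
  map_smul' c x := by
    simp only [map_smul, TensorProduct.map_smul_left, TensorProduct.map_smul_right, smul_add,
      RingHom.id_apply]

theorem tensorAct_apply (M N : PMod k n) {p q : ZMod 2} (x : typeP k n p) {m : M.carrier}
    (hm : m ∈ M.grade q) (l : N.carrier) :
    tensorAct M N p x (m ⊗ₜ l) = M.act p x m ⊗ₜ l + sgn k (p * q) • (m ⊗ₜ N.act p x l) := by
  simp [tensorAct, M.tw_apply p hm, TensorProduct.smul_tmul']

/-- The tensor product of two supermodules. -/
def tensor [NeZero (2 : k)] (M N : PMod k n) : PMod k n where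
  carrier := M.carrier ⊗[k] N.carrier
  grade := tensorGrade M N
  isCompl := by
    refine isCompl_of_parity (TensorProduct.map M.par N.par) _ (fun r => ?_) (tensorGrade_sup M N)
    suffices tensorGrade M N r ≤
        LinearMap.eqLocus (TensorProduct.map M.par N.par) (sgn k r • LinearMap.id) from this
    refine tensorGrade_le ?_
    rintro p q rfl m hm l hl
    simp [M.par_apply hm, N.par_apply hl, ← TensorProduct.smul_tmul', sgn_add, smul_smul,
      mul_comm]
  act := tensorAct M N
  act_mem := by
    intro p r x t ht
    suffices tensorGrade M N r ≤ (tensorGrade M N (p + r)).comap (tensorAct M N p x) from this ht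
    refine tensorGrade_le ?_
    rintro q s rfl m hm l hl
    rw [Submodule.mem_comap, tensorAct_apply M N x hm]
    refine add_mem ?_ (Submodule.smul_mem _ _ ?_)
    · rw [← add_assoc]
      exact tmul_mem (M.act_mem x hm) hl
    · rw [add_left_comm]
      exact tmul_mem hm (N.act_mem x hl)
  act_bracket := by
    intro p q x y t
    suffices h : tensorAct M N (p + q) (bracket k n x y) =
        tensorAct M N p x ∘ₗ tensorAct M N q y -
          sgn k (p * q) • (tensorAct M N q y ∘ₗ tensorAct M N p x) from
      LinearMap.congr_fun h t
    refine tensor_ext fun r s m hm l hl => ?_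
    simp only [LinearMap.sub_apply, LinearMap.smul_apply, LinearMap.comp_apply,
      tensorAct_apply M N _ hm, map_add, map_smul, tensorAct_apply M N _ (M.act_mem _ hm),
      M.act_bracket, N.act_bracket, mul_add, add_mul, sgn_add, TensorProduct.sub_tmul,
      TensorProduct.tmul_sub, ← TensorProduct.smul_tmul', TensorProduct.tmul_smul, map_smul,
      mul_comm q p]
    rcases sgn_eq k (p * q) with e | e <;> rw [e] <;> module

/-- The trivial module. -/
def triv (k : Type u) [Field k] (n : ℕ) : PMod k n where
  carrier := k
  grade p := if p = 0 then ⊤ else ⊥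
  isCompl := by simpa using isCompl_top_bot
  act _ := 0
  act_mem _ _ := by simp
  act_bracket _ _ _ := by simp

/-- The basis vector of the trivial module. -/
def trivOne : (triv k n).carrier := (1 : k)

theorem trivOne_mem : (trivOne : (triv k n).carrier) ∈ (triv k n).grade 0 :=
  (Submodule.mem_top : (1 : k) ∈ (⊤ : Submodule k k))

theorem triv_odd {c : (triv k n).carrier} (hc : c ∈ (triv k n).grade 1) : c = 0 :=
  (Submodule.mem_bot k).1 (show c ∈ (⊥ : Submodule k k) from hc)

theorem triv_ext {P : Type v} [AddCommGroup P] [Module k P]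
    {f g : (triv k n).carrier →ₗ[k] P} (h : f trivOne = g trivOne) : f = g :=
  LinearMap.ext_ring h

/-- The even part of a linear map. -/
def evenPart (M N : PMod k n) :
    (M.carrier →ₗ[k] N.carrier) →ₗ[k] (M.carrier →ₗ[k] N.carrier) where
  toFun g := (2 : k)⁻¹ • (g + N.par ∘ₗ g ∘ₗ M.par)
  map_add' g h := by
    simp only [LinearMap.add_comp, LinearMap.comp_add]
    module
  map_smul' c g := by
    simp only [LinearMap.smul_comp, LinearMap.comp_smul, RingHom.id_apply]
    module

/-- The odd part of a linear map. -/
def oddPart (M N : PMod k n) :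
    (M.carrier →ₗ[k] N.carrier) →ₗ[k] (M.carrier →ₗ[k] N.carrier) where
  toFun g := (2 : k)⁻¹ • (g - N.par ∘ₗ g ∘ₗ M.par)
  map_add' g h := by
    simp only [LinearMap.add_comp, LinearMap.comp_add]
    module
  map_smul' c g := by
    simp only [LinearMap.smul_comp, LinearMap.comp_smul, RingHom.id_apply]
    module

theorem par_comp_par {M N : PMod k n} {q : ZMod 2} {g : M.carrier →ₗ[k] N.carrier}
    (hg : ∀ s, ∀ m ∈ M.grade s, g m ∈ N.grade (q + s)) :
    N.par ∘ₗ g ∘ₗ M.par = sgn k q • g := by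
  refine lin_ext fun s m hm => ?_
  simp only [LinearMap.comp_apply, M.par_apply hm, map_smul, N.par_apply (hg s m hm), smul_smul,
    LinearMap.smul_apply, sgn_add]
  rcases sgn_eq k s with e | e <;> simp [e]

/-- The tensor product of linear maps, with `(f ⊗ g)(m ⊗ l) = (-1)^{|g||m|} f(m) ⊗ g(l)`. -/
def tensorLin {M M' N N' : PMod k n} (f : M.carrier →ₗ[k] M'.carrier)
    (g : N.carrier →ₗ[k] N'.carrier) :
    M.carrier ⊗[k] N.carrier →ₗ[k] M'.carrier ⊗[k] N'.carrier :=
  TensorProduct.map f (evenPart N N' g) + TensorProduct.map (f ∘ₗ M.par) (oddPart N N' g)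

theorem tensorLin_add_left {M M' N N' : PMod k n} (f f' : M.carrier →ₗ[k] M'.carrier)
    (g : N.carrier →ₗ[k] N'.carrier) :
    tensorLin (f + f') g = tensorLin f g + tensorLin f' g := by
  simp only [tensorLin, TensorProduct.map_add_left, LinearMap.add_comp]
  abel

theorem tensorLin_add_right {M M' N N' : PMod k n} (f : M.carrier →ₗ[k] M'.carrier)
    (g g' : N.carrier →ₗ[k] N'.carrier) :
    tensorLin f (g + g') = tensorLin f g + tensorLin f g' := by
  simp only [tensorLin, TensorProduct.map_add_right, map_add]
  abel

theorem tensorLin_smul_left {M M' N N' : PMod k n} (c : k) (f : M.carrier →ₗ[k] M'.carrier)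
    (g : N.carrier →ₗ[k] N'.carrier) : tensorLin (c • f) g = c • tensorLin f g := by
  simp only [tensorLin, TensorProduct.map_smul_left, LinearMap.smul_comp, smul_add]

theorem tensorLin_smul_right {M M' N N' : PMod k n} (c : k) (f : M.carrier →ₗ[k] M'.carrier)
    (g : N.carrier →ₗ[k] N'.carrier) : tensorLin f (c • g) = c • tensorLin f g := by
  simp only [tensorLin, TensorProduct.map_smul_right, map_smul, smul_add]

theorem tensorLin_apply [NeZero (2 : k)] {M M' N N' : PMod k n} (f : M.carrier →ₗ[k] M'.carrier)
    {g : N.carrier →ₗ[k] N'.carrier} {q s : ZMod 2} (hg : g ∈ homGrade N N' q)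
    {m : M.carrier} (hm : m ∈ M.grade s) (l : N.carrier) :
    tensorLin f g (m ⊗ₜ l) = sgn k (q * s) • (f m ⊗ₜ g l) := by
  have h2 : (2 : k) ≠ 0 := NeZero.ne _
  have e : N'.par (g (N.par l)) = sgn k q • g l := LinearMap.congr_fun (par_comp_par hg.1) l
  rcases zmod_cases q with rfl | rfl
  · simp [tensorLin, evenPart, oddPart, e, ← two_smul k, smul_smul, h2]
  · simp [tensorLin, evenPart, oddPart, e, M.par_apply hm, ← TensorProduct.tmul_smul,
      TensorProduct.smul_tmul, smul_smul, ← two_smul k, h2]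

theorem symm_mem {M N : PMod k n} (e : M.carrier ≃ₗ[k] N.carrier)
    (h : e.toLinearMap ∈ homGrade M N 0) : e.symm.toLinearMap ∈ homGrade N M 0 := by
  refine ⟨fun s m hm => ?_, fun q x m => ?_⟩
  · obtain ⟨a, ha, b, hb, hab⟩ := M.exists_add (e.symm m)
    have hm' : m = e a + e b := by rw [← map_add, hab, e.apply_symm_apply]
    have h₀ : e a ∈ N.grade 0 := by simpa using h.1 _ _ ha
    have h₁ : e b ∈ N.grade 1 := by simpa using h.1 _ _ hb
    rw [zero_add]
    rcases zmod_cases s with rfl | rfl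
    · have : e b = 0 := (Submodule.disjoint_def.1 N.isCompl.disjoint) _
        (by rw [show e b = m - e a by rw [hm']; abel]; exact sub_mem hm h₀) h₁
      rw [LinearEquiv.map_eq_zero_iff] at this
      change e.symm m ∈ _
      rwa [← hab, this, add_zero]
    · have : e a = 0 := (Submodule.disjoint_def.1 N.isCompl.disjoint) _ h₀
        (by rw [show e a = m - e b by rw [hm']; abel]; exact sub_mem hm h₁)
      rw [LinearEquiv.map_eq_zero_iff] at this
      change e.symm m ∈ _
      rwa [← hab, this, zero_add]
  · apply e.injective
    have := h.2 q x (e.symm m)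
    simp only [mul_zero, sgn_zero, one_smul, LinearEquiv.coe_coe, e.apply_symm_apply] at this ⊢
    exact this.symm

/-- An even linear equivalence which commutes with the action, as an isomorphism. -/
def isoOfEquiv {M N : PMod k n} (e : M.carrier ≃ₗ[k] N.carrier)
    (h : e.toLinearMap ∈ homGrade M N 0) (h' : e.symm.toLinearMap ∈ homGrade N M 0) : M ≅ N where
  hom := ofMem e.toLinearMap h
  inv := ofMem e.symm.toLinearMap h'
  hom_inv_id := hom_ext (by ext m; simp)
  inv_hom_id := hom_ext (by ext m; simp)

theorem isoOfEquiv_mem {M N : PMod k n} (e : M.carrier ≃ₗ[k] N.carrier)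
    (h : e.toLinearMap ∈ homGrade M N 0) (h' : e.symm.toLinearMap ∈ homGrade N M 0) :
    lin (isoOfEquiv e h h').hom ∈ homGrade M N 0 := h

section

variable [NeZero (2 : k)]

theorem tensorLin_mem {M M' N N' : PMod k n} {p q : ZMod 2} {f : M.carrier →ₗ[k] M'.carrier}
    {g : N.carrier →ₗ[k] N'.carrier} (hf : f ∈ homGrade M M' p) (hg : g ∈ homGrade N N' q) :
    tensorLin f g ∈ homGrade (M.tensor N) (M'.tensor N') (p + q) := by
  refine ⟨fun r t ht => ?_, fun r x t => ?_⟩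
  · suffices tensorGrade M N r ≤ (tensorGrade M' N' (p + q + r)).comap (tensorLin f g) from this ht
    refine tensorGrade_le ?_
    rintro s s' rfl m hm l hl
    rw [Submodule.mem_comap, tensorLin_apply f hg hm, add_add_add_comm]
    exact Submodule.smul_mem _ _ (tmul_mem (hf.1 _ _ hm) (hg.1 _ _ hl))
  · suffices h : tensorLin f g ∘ₗ tensorAct M N r x =
        sgn k (r * (p + q)) • (tensorAct M' N' r x ∘ₗ tensorLin f g) from LinearMap.congr_fun h t
    refine tensor_ext fun s s' m hm l hl => ?_
    simp only [LinearMap.comp_apply, LinearMap.smul_apply, tensorAct_apply M N x hm, map_add,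
      map_smul, tensorLin_apply f hg hm, tensorLin_apply f hg (M.act_mem x hm),
      tensorAct_apply M' N' x (hf.1 _ _ hm), hf.2, hg.2, mul_add, sgn_add,
      ← TensorProduct.smul_tmul', TensorProduct.tmul_smul, mul_comm q r]
    rcases sgn_eq k (r * q) with e | e <;> rcases sgn_eq k (r * p) with e' | e' <;>
      rw [e, e'] <;> module

theorem tensorLin_mem_homSub {M M' N N' : PMod k n} {f : M.carrier →ₗ[k] M'.carrier}
    {g : N.carrier →ₗ[k] N'.carrier} (hf : f ∈ homSub M M') (hg : g ∈ homSub N N') :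
    tensorLin f g ∈ homSub (M.tensor N) (M'.tensor N') := by
  obtain ⟨f₀, hf₀, f₁, hf₁, rfl⟩ := Submodule.mem_sup.1 hf
  obtain ⟨g₀, hg₀, g₁, hg₁, rfl⟩ := Submodule.mem_sup.1 hg
  simp only [tensorLin_add_left, tensorLin_add_right]
  have h {p q f g} (hf : f ∈ homGrade M M' p) (hg : g ∈ homGrade N N' q) :=
    homGrade_le _ _ _ (tensorLin_mem hf hg)
  refine add_mem (add_mem ?_ ?_) (add_mem ?_ ?_) <;> apply h <;> assumption

/-- The tensor product of homomorphisms. -/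
def tensorMor {M M' N N' : PMod k n} :
    (M ⟶ M') →ₗ[k] (N ⟶ N') →ₗ[k] (M.tensor N ⟶ M'.tensor N') :=
  LinearMap.mk₂ k (fun f g => ⟨tensorLin (lin f) (lin g), tensorLin_mem_homSub f.2 g.2⟩)
    (fun f f' g => hom_ext (tensorLin_add_left f.1 f'.1 g.1))
    (fun c f g => hom_ext (tensorLin_smul_left c f.1 g.1))
    (fun f g g' => hom_ext (tensorLin_add_right f.1 g.1 g'.1))
    (fun c f g => hom_ext (tensorLin_smul_right c f.1 g.1))

@[simp] theorem lin_tensorMor {M M' N N' : PMod k n} (f : M ⟶ M') (g : N ⟶ N') :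
    lin (tensorMor f g) = tensorLin (lin f) (lin g) := rfl

theorem tensor_hom_ext {M N P : PMod k n} {f g : M.tensor N ⟶ P}
    (h : ∀ p q, ∀ m ∈ M.grade p, ∀ l ∈ N.grade q, lin f (m ⊗ₜ l) = lin g (m ⊗ₜ l)) : f = g :=
  hom_ext (tensor_ext h)

theorem tensor_hom_ext₃ {M N P Q : PMod k n} {f g : (M.tensor N).tensor P ⟶ Q}
    (h : ∀ p q r, ∀ m ∈ M.grade p, ∀ l ∈ N.grade q, ∀ o ∈ P.grade r,
      lin f ((m ⊗ₜ l) ⊗ₜ o) = lin g ((m ⊗ₜ l) ⊗ₜ o)) : f = g := by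
  refine hom_ext (TensorProduct.ext (tensor_ext fun p q m hm l hl => lin_ext fun r o ho => ?_))
  exact h p q r m hm l hl o ho

/-- The associator `(m ⊗ l) ⊗ o ↦ m ⊗ (l ⊗ o)`. -/
def tensorAssoc (M N P : PMod k n) : (M.tensor N).tensor P ≅ M.tensor (N.tensor P) :=
  have h : (TensorProduct.assoc k M.carrier N.carrier P.carrier).toLinearMap ∈
      homGrade ((M.tensor N).tensor P) (M.tensor (N.tensor P)) 0 := by
    refine ⟨fun r t ht => ?_, fun r x t => ?_⟩
    · rw [zero_add]
      suffices tensorGrade (M.tensor N) P r ≤ (tensorGrade M (N.tensor P) r).comap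
          (TensorProduct.assoc k M.carrier N.carrier P.carrier).toLinearMap from this ht
      refine tensorGrade_le ?_
      rintro s s' rfl t ht o ho
      suffices tensorGrade M N s ≤ (tensorGrade M (N.tensor P) (s + s')).comap
          ((TensorProduct.assoc k M.carrier N.carrier P.carrier).toLinearMap ∘ₗ
            (TensorProduct.mk k (M.carrier ⊗[k] N.carrier) P.carrier).flip o) from this ht
      refine tensorGrade_le ?_
      rintro a b rfl m hm l hl
      rw [add_assoc]
      exact tmul_mem (N := N.tensor P) hm (tmul_mem hl ho)
    · suffices h : (TensorProduct.assoc k M.carrier N.carrier P.carrier).toLinearMap ∘ₗ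
          tensorAct (M.tensor N) P r x = tensorAct M (N.tensor P) r x ∘ₗ
            (TensorProduct.assoc k M.carrier N.carrier P.carrier).toLinearMap by
        rw [mul_zero, sgn_zero, one_smul]
        exact LinearMap.congr_fun h t
      refine TensorProduct.ext
        (tensor_ext fun p q m hm l hl => LinearMap.ext fun o => ?_)
      have e₁ := tensorAct_apply (M.tensor N) P x (tmul_mem hm hl) o
      have e₂ := tensorAct_apply M (N.tensor P) x hm (l ⊗ₜ o)
      have e₃ : (M.tensor N).act r x (m ⊗ₜ l) = _ := tensorAct_apply M N x hm l
      have e₄ : (N.tensor P).act r x (l ⊗ₜ o) = _ := tensorAct_apply N P x hl o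
      rw [e₃] at e₁
      rw [e₄] at e₂
      refine ((congrArg (TensorProduct.assoc k M.carrier N.carrier P.carrier) e₁).trans ?_).trans
        e₂.symm
      change TensorProduct.assoc k M.carrier N.carrier P.carrier
          ((M.act r x m ⊗ₜ[k] l + sgn k (r * p) • (m ⊗ₜ[k] N.act r x l)) ⊗ₜ[k] o +
            sgn k (r * (p + q)) • ((m ⊗ₜ[k] l) ⊗ₜ[k] P.act r x o)) =
        M.act r x m ⊗ₜ[k] (l ⊗ₜ[k] o) + sgn k (r * p) •
          (m ⊗ₜ[k] (N.act r x l ⊗ₜ[k] o + sgn k (r * q) • (l ⊗ₜ[k] P.act r x o)))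
      simp only [map_add, map_smul, TensorProduct.add_tmul, TensorProduct.tmul_add,
        ← TensorProduct.smul_tmul', TensorProduct.tmul_smul, TensorProduct.assoc_tmul, mul_add,
        sgn_add]
      module
  isoOfEquiv (M := (M.tensor N).tensor P) (N := M.tensor (N.tensor P))
    (TensorProduct.assoc k M.carrier N.carrier P.carrier) h (symm_mem _ h)

/-- The left unitor `1 ⊗ m ↦ m`. -/
def tensorLeft (M : PMod k n) : (triv k n).tensor M ≅ M :=
  have h : (TensorProduct.lid k M.carrier).toLinearMap ∈ homGrade ((triv k n).tensor M) M 0 := by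
    refine ⟨fun r t ht => ?_, fun r x t => ?_⟩
    · rw [zero_add]
      suffices tensorGrade (triv k n) M r ≤
          (M.grade r).comap (TensorProduct.lid k M.carrier).toLinearMap from this ht
      refine tensorGrade_le ?_
      rintro p q rfl c hc m hm
      rcases zmod_cases p with rfl | rfl
      · rw [zero_add]
        exact Submodule.smul_mem _ (show k from c) hm
      · obtain rfl := triv_odd hc
        rw [TensorProduct.zero_tmul]
        exact zero_mem _
    · suffices h : (TensorProduct.lid k M.carrier).toLinearMap ∘ₗ tensorAct (triv k n) M r x =
          M.act r x ∘ₗ (TensorProduct.lid k M.carrier).toLinearMap by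
        rw [mul_zero, sgn_zero, one_smul]
        exact LinearMap.congr_fun h t
      refine TensorProduct.ext (triv_ext (LinearMap.ext fun m => ?_))
      have e := tensorAct_apply (triv k n) M x trivOne_mem m
      refine (congrArg (TensorProduct.lid k M.carrier) e).trans ?_
      change TensorProduct.lid k M.carrier
        ((0 : k) ⊗ₜ[k] m + sgn k (r * 0) • ((1 : k) ⊗ₜ[k] M.act r x m)) = M.act r x ((1 : k) • m)
      simp
  isoOfEquiv (M := (triv k n).tensor M) (TensorProduct.lid k M.carrier) h (symm_mem _ h)

/-- The right unitor `m ⊗ 1 ↦ m`. -/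
def tensorRight (M : PMod k n) : M.tensor (triv k n) ≅ M :=
  have h : (TensorProduct.rid k M.carrier).toLinearMap ∈ homGrade (M.tensor (triv k n)) M 0 := by
    refine ⟨fun r t ht => ?_, fun r x t => ?_⟩
    · rw [zero_add]
      suffices tensorGrade M (triv k n) r ≤
          (M.grade r).comap (TensorProduct.rid k M.carrier).toLinearMap from this ht
      refine tensorGrade_le ?_
      rintro p q rfl m hm c hc
      rcases zmod_cases q with rfl | rfl
      · rw [add_zero]
        exact Submodule.smul_mem _ (show k from c) hm
      · obtain rfl := triv_odd hc
        rw [TensorProduct.tmul_zero]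
        exact zero_mem _
    · suffices h : (TensorProduct.rid k M.carrier).toLinearMap ∘ₗ tensorAct M (triv k n) r x =
          M.act r x ∘ₗ (TensorProduct.rid k M.carrier).toLinearMap by
        rw [mul_zero, sgn_zero, one_smul]
        exact LinearMap.congr_fun h t
      refine TensorProduct.ext (lin_ext fun q m hm => triv_ext ?_)
      have e := tensorAct_apply M (triv k n) x hm trivOne
      refine (congrArg (TensorProduct.rid k M.carrier) e).trans ?_
      change TensorProduct.rid k M.carrier
        (M.act r x m ⊗ₜ[k] (1 : k) + sgn k (r * q) • (m ⊗ₜ[k] (0 : k))) = M.act r x ((1 : k) • m)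
      simp
  isoOfEquiv (M := M.tensor (triv k n)) (TensorProduct.rid k M.carrier) h (symm_mem _ h)

/-- The pure tensors, as elements of the tensor product of supermodules. -/
def tm {M N : PMod k n} (m : M.carrier) (l : N.carrier) : (M.tensor N).carrier := m ⊗ₜ[k] l

theorem smul_tm {M N : PMod k n} (c : k) (m : M.carrier) (l : N.carrier) :
    tm (c • m) l = c • tm m l := (TensorProduct.smul_tmul' c m l).symm

theorem tm_smul {M N : PMod k n} (c : k) (m : M.carrier) (l : N.carrier) :
    tm m (c • l) = c • tm m l := TensorProduct.tmul_smul c m l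

theorem tm_mem {M N : PMod k n} {p q : ZMod 2} {m : M.carrier} {l : N.carrier}
    (hm : m ∈ M.grade p) (hl : l ∈ N.grade q) : tm m l ∈ (M.tensor N).grade (p + q) :=
  tmul_mem hm hl

theorem tm_hom_ext {M N P : PMod k n} {f g : M.tensor N ⟶ P}
    (h : ∀ p q, ∀ m ∈ M.grade p, ∀ l ∈ N.grade q, lin f (tm m l) = lin g (tm m l)) : f = g :=
  hom_ext (tensor_ext h)

theorem tm_hom_ext₃ {M N P Q : PMod k n} {f g : (M.tensor N).tensor P ⟶ Q}
    (h : ∀ p q r, ∀ m ∈ M.grade p, ∀ l ∈ N.grade q, ∀ o ∈ P.grade r,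
      lin f (tm (tm m l) o) = lin g (tm (tm m l) o)) : f = g :=
  hom_ext (TensorProduct.ext (tensor_ext fun p q m hm l hl => lin_ext fun r o ho =>
    h p q r m hm l hl o ho))

theorem tm_hom_ext₄ {M N P Q R : PMod k n} {f g : ((M.tensor N).tensor P).tensor Q ⟶ R}
    (h : ∀ m l o t, lin f (tm (tm (tm m l) o) t) = lin g (tm (tm (tm m l) o) t)) : f = g :=
  hom_ext (TensorProduct.ext (TensorProduct.ext (TensorProduct.ext
    (LinearMap.ext fun m => LinearMap.ext fun l => LinearMap.ext fun o => LinearMap.ext fun t =>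
      h m l o t))))

theorem tensorMor_tm {M M' N N' : PMod k n} (f : M ⟶ M') {g : N ⟶ N'} {q s : ZMod 2}
    (hg : lin g ∈ homGrade N N' q) {m : M.carrier} (hm : m ∈ M.grade s) (l : N.carrier) :
    lin (tensorMor f g) (tm m l) = sgn k (q * s) • tm (lin f m) (lin g l) :=
  tensorLin_apply _ hg hm l

theorem tensorMor_tm_of_even {M M' N N' : PMod k n} (f : M ⟶ M') {g : N ⟶ N'}
    (hg : lin g ∈ homGrade N N' 0) (m : M.carrier) (l : N.carrier) :
    lin (tensorMor f g) (tm m l) = tm (lin f m) (lin g l) := by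
  suffices h : (lin (tensorMor f g)) ∘ₗ (TensorProduct.mk k M.carrier N.carrier).flip l =
      (TensorProduct.mk k M'.carrier N'.carrier).flip (lin g l) ∘ₗ lin f from
    LinearMap.congr_fun h m
  refine lin_ext fun p m hm => ?_
  have e := tensorMor_tm f hg hm l
  rw [zero_mul, sgn_zero, one_smul] at e
  exact e

theorem tensorMor_id_tm {M M' N : PMod k n} (f : M ⟶ M') (m : M.carrier) (l : N.carrier) :
    lin (tensorMor f (𝟙 N)) (tm m l) = tm (lin f m) l :=
  tensorMor_tm_of_even f (id_mem N) m l

theorem tensorAssoc_tm (M N P : PMod k n) (m : M.carrier) (l : N.carrier) (o : P.carrier) :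
    lin (tensorAssoc M N P).hom (tm (tm m l) o) = tm m (tm l o) := rfl

theorem tensorLeft_tm (M : PMod k n) (m : M.carrier) :
    lin (tensorLeft M).hom (tm trivOne m) = m := one_smul k m

theorem tensorRight_tm (M : PMod k n) (m : M.carrier) :
    lin (tensorRight M).hom (tm m trivOne) = m := one_smul k m

theorem tensorAssoc_mem (M N P : PMod k n) : lin (tensorAssoc M N P).hom ∈ homGrade ((M.tensor N).tensor P) (M.tensor (N.tensor P)) 0 :=
  isoOfEquiv_mem _ _ _

theorem tensorLeft_mem (M : PMod k n) : lin (tensorLeft M).hom ∈ homGrade ((triv k n).tensor M) M 0 :=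
  isoOfEquiv_mem _ _ _

theorem tensorRight_mem (M : PMod k n) : lin (tensorRight M).hom ∈ homGrade (M.tensor (triv k n)) M 0 :=
  isoOfEquiv_mem _ _ _

theorem tensorMor_interchange {X₁ Y₁ Z₁ X₂ Y₂ Z₂ : PMod k n} {p q : ZMod 2} {f : X₁ ⟶ Y₁}
    (g : X₂ ⟶ Y₂) (h : Y₁ ⟶ Z₁) {l : Y₂ ⟶ Z₂} (hf : lin f ∈ homGrade X₁ Y₁ p)
    (hl : lin l ∈ homGrade Y₂ Z₂ q) :
    tensorMor f g ≫ tensorMor h l = sgn k (q * p) • tensorMor (f ≫ h) (g ≫ l) := by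
  have key : ∀ {r} {g : X₂ ⟶ Y₂}, lin g ∈ homGrade X₂ Y₂ r →
      tensorMor f g ≫ tensorMor h l = sgn k (q * p) • tensorMor (f ≫ h) (g ≫ l) := by
    intro r g hg
    refine tm_hom_ext fun s t m hm o ho => ?_
    rw [lin_comp, lin_smul, LinearMap.comp_apply, LinearMap.smul_apply, tensorMor_tm f hg hm o,
      tensorMor_tm (f ≫ h) (g := g ≫ l) (comp_mem hg hl) hm o, map_smul,
      tensorMor_tm h hl (hf.1 s m hm) (lin g o), lin_comp, lin_comp, LinearMap.comp_apply,
      LinearMap.comp_apply, smul_smul, smul_smul, mul_add, add_mul, sgn_add, sgn_add]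
    ring_nf
  obtain ⟨g₀, g₁, h₀, h₁, rfl⟩ := hom_exists_add g
  rw [map_add, Preadditive.add_comp, key h₀, key h₁, ← smul_add, ← map_add, Preadditive.add_comp]

theorem tensorMor_assoc {X₁ Y₁ X₂ Y₂ X₃ Y₃ : PMod k n} (f : X₁ ⟶ Y₁) (g : X₂ ⟶ Y₂)
    (h : X₃ ⟶ Y₃) : tensorMor (tensorMor f g) h ≫ (tensorAssoc Y₁ Y₂ Y₃).hom =
      (tensorAssoc X₁ X₂ X₃).hom ≫ tensorMor f (tensorMor g h) := by
  have key : ∀ {q r} {g : X₂ ⟶ Y₂} {h : X₃ ⟶ Y₃}, lin g ∈ homGrade X₂ Y₂ q →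
      lin h ∈ homGrade X₃ Y₃ r → tensorMor (tensorMor f g) h ≫ (tensorAssoc Y₁ Y₂ Y₃).hom =
        (tensorAssoc X₁ X₂ X₃).hom ≫ tensorMor f (tensorMor g h) := by
    intro q r g h hg hh
    refine tm_hom_ext₃ fun a b c m hm l hl o ho => ?_
    rw [lin_comp, lin_comp, LinearMap.comp_apply, LinearMap.comp_apply,
      tensorMor_tm _ hh (tm_mem hm hl), tensorMor_tm f hg hm, smul_tm, map_smul, map_smul,
      tensorAssoc_tm, tensorAssoc_tm, tensorMor_tm f (tensorLin_mem hg hh) hm,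
      tensorMor_tm g hh hl, tm_smul, smul_smul, smul_smul, mul_add, add_mul, sgn_add, sgn_add]
    ring_nf
  obtain ⟨g₀, g₁, hg₀, hg₁, rfl⟩ := hom_exists_add g
  obtain ⟨h₀, h₁, hh₀, hh₁, rfl⟩ := hom_exists_add h
  simp only [map_add, LinearMap.add_apply, Preadditive.add_comp, Preadditive.comp_add, key hg₀ hh₀,
    key hg₀ hh₁, key hg₁ hh₀, key hg₁ hh₁]

instance : MonoidalSupercategory k (PMod k n) where
  tensorObj := tensor
  tensorHom := tensorMor
  tensorHom_mem hf hg := tensorLin_mem hf hg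
  tensorHom_id M N := tm_hom_ext fun p q m hm l hl => tensorMor_id_tm _ m l
  interchange g h _ hf hl := tensorMor_interchange g h hf hl
  unit := triv k n
  assoc := tensorAssoc
  lunit := tensorLeft
  runit := tensorRight
  assoc_mem := tensorAssoc_mem
  lunit_mem := tensorLeft_mem
  runit_mem := tensorRight_mem
  assoc_naturality := tensorMor_assoc
  lunit_naturality {X Y} f := by
    have key : ∀ {r} {f : X ⟶ Y}, lin f ∈ homGrade X Y r →
        tensorMor (𝟙 (triv k n)) f ≫ (tensorLeft Y).hom = (tensorLeft X).hom ≫ f := by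
      intro r f hf
      refine hom_ext (TensorProduct.ext (triv_ext (LinearMap.ext fun m => ?_)))
      change lin (tensorLeft Y).hom (lin (tensorMor (𝟙 (triv k n)) f) (tm trivOne m))
        = lin f (lin (tensorLeft X).hom (tm trivOne m))
      rw [tensorMor_tm _ hf trivOne_mem, map_smul, lin_id, LinearMap.id_apply, tensorLeft_tm,
        tensorLeft_tm, mul_zero, sgn_zero, one_smul]
    obtain ⟨f₀, f₁, h₀, h₁, rfl⟩ := hom_exists_add f
    rw [map_add, Preadditive.add_comp, Preadditive.comp_add, key h₀, key h₁]
  runit_naturality {X Y} f := by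
    refine hom_ext (TensorProduct.ext (LinearMap.ext fun m => triv_ext ?_))
    change lin (tensorRight Y).hom (lin (tensorMor f (𝟙 (triv k n))) (tm m trivOne))
      = lin f (lin (tensorRight X).hom (tm m trivOne))
    rw [tensorMor_id_tm, tensorRight_tm, tensorRight_tm]
  pentagon W X Y Z := by
    refine tm_hom_ext₄ fun m l o t => ?_
    simp only [lin_comp, LinearMap.comp_apply, tensorMor_id_tm, tensorAssoc_tm,
      tensorMor_tm_of_even _ (tensorAssoc_mem X Y Z), lin_id, LinearMap.id_apply]
  triangle X Y := by
    refine hom_ext (TensorProduct.ext (TensorProduct.ext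
      (LinearMap.ext fun m => triv_ext (LinearMap.ext fun l => ?_))))
    change lin (tensorMor (𝟙 X) (tensorLeft Y).hom)
        (lin (tensorAssoc X (triv k n) Y).hom (tm (tm m trivOne) l)) =
      lin (tensorMor (tensorRight X).hom (𝟙 Y)) (tm (tm m trivOne) l)
    rw [tensorAssoc_tm, tensorMor_id_tm, tensorMor_tm_of_even _ (tensorLeft_mem Y), lin_id,
      LinearMap.id_apply]
    rw [tensorLeft_tm, tensorRight_tm]

end

/-! ### Duals -/

theorem tw_act (M : PMod k n) (r : ZMod 2) {p : ZMod 2} (x : typeP k n p) (m : M.carrier) :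
    M.tw r (M.act p x m) = sgn k (r * p) • M.act p x (M.tw r m) := by
  suffices h : M.tw r ∘ₗ M.act p x = sgn k (r * p) • (M.act p x ∘ₗ M.tw r) from
    LinearMap.congr_fun h m
  refine lin_ext fun s m hm => ?_
  simp only [LinearMap.comp_apply, LinearMap.smul_apply, M.tw_apply r hm,
    M.tw_apply r (M.act_mem x hm), map_smul, smul_smul, mul_add, sgn_add]

theorem tw_add (M : PMod k n) (p q : ZMod 2) (m : M.carrier) :
    M.tw (p + q) m = M.tw p (M.tw q m) := by
  suffices h : M.tw (p + q) = M.tw p ∘ₗ M.tw q from LinearMap.congr_fun h m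
  refine lin_ext fun s m hm => ?_
  rw [LinearMap.comp_apply, M.tw_apply _ hm, M.tw_apply _ hm, map_smul, M.tw_apply _ hm,
    smul_smul, add_mul, sgn_add, mul_comm]

/-- The homogeneous components of the dual: the functionals of parity `p` vanish on the elements
of the other parity. -/
def dualGrade (M : PMod k n) (p : ZMod 2) : Submodule k (Module.Dual k M.carrier) where
  carrier := {f | ∀ q, q ≠ p → ∀ m ∈ M.grade q, f m = 0}
  add_mem' hf hg q hq m hm := by simp [hf q hq m hm, hg q hq m hm]
  zero_mem' _ _ _ _ := rfl
  smul_mem' c f hf q hq m hm := by simp [hf q hq m hm]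

/-- The dual supermodule, with the action `(x.f)(m) = -(-1)^{|x||f|} f(x.m)`. -/
def dual [NeZero (2 : k)] (M : PMod k n) : PMod k n where
  carrier := Module.Dual k M.carrier
  grade := dualGrade M
  isCompl := by
    have e2 : (2 : k)⁻¹ + 2⁻¹ = 1 := by
      rw [← two_mul, mul_inv_cancel₀ (NeZero.ne _)]
    have hpar : ∀ p, ∀ f ∈ dualGrade M p, f ∘ₗ M.par = sgn k p • f := by
      intro p f hf
      refine lin_ext fun s m hm => ?_
      rw [LinearMap.comp_apply, M.par_apply hm, map_smul, LinearMap.smul_apply]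
      by_cases h : s = p
      · rw [h]
      · rw [hf s h m hm, smul_zero, smul_zero]
    refine isCompl_of_parity (LinearMap.lcomp k k M.par) _ hpar fun f => ?_
    refine Submodule.mem_sup.2 ⟨(2 : k)⁻¹ • (f + f ∘ₗ M.par), ?_,
      (2 : k)⁻¹ • (f - f ∘ₗ M.par), ?_, ?_⟩
    · intro q hq m hm
      obtain rfl := (zmod_cases q).resolve_left hq
      simp [M.par_apply hm]
    · intro q hq m hm
      obtain rfl := (zmod_cases q).resolve_right hq
      simp [M.par_apply hm]
    · rw [← smul_add, add_add_sub_cancel, smul_add, ← add_smul, e2, one_smul]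
  act p :=
    { toFun := fun x => -LinearMap.lcomp k k (M.tw p ∘ₗ M.act p x)
      map_add' := fun x y => by ext; simp; ring
      map_smul' := fun c x => by ext; simp }
  act_mem := by
    intro p q x f hf r hr m hm
    have h : f (M.tw p (M.act p x m)) = 0 := by
      rw [M.tw_apply p (M.act_mem x hm), map_smul, hf (p + r) _ _ (M.act_mem x hm), smul_zero]
      rintro rfl
      refine hr ?_
      rw [← add_assoc, CharTwo.add_self_eq_zero, zero_add]
    exact neg_eq_zero.2 h
  act_bracket := by
    intro p q x y f
    refine LinearMap.ext fun m => ?_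
    change -(f (M.tw (p + q) (M.act (p + q) (bracket k n x y) m))) =
      -(-(f (M.tw q (M.act q y (M.tw p (M.act p x m)))))) - sgn k (p * q) *
        -(-(f (M.tw p (M.act p x (M.tw q (M.act q y m))))))
    have e₁ : M.act q y (M.tw p (M.act p x m)) =
        sgn k (p * q) • M.tw p (M.act q y (M.act p x m)) := by
      rw [M.tw_act p y (M.act p x m), smul_smul, sgn_mul_self, one_smul]
    have e₂ : M.act p x (M.tw q (M.act q y m)) =
        sgn k (p * q) • M.tw q (M.act p x (M.act q y m)) := by
      rw [M.tw_act q x (M.act q y m), smul_smul, mul_comm q p, sgn_mul_self, one_smul]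
    rw [e₁, e₂, M.act_bracket, map_smul (M.tw q), map_smul (M.tw p), ← M.tw_add, ← M.tw_add,
      add_comm q p]
    simp only [map_smul, map_sub, smul_eq_mul]
    linear_combination f (M.tw (p + q) (M.act p x (M.act q y m))) * sgn_mul_self k (p * q)


end PMod

/-! ### Symmetric powers of the natural module -/

section Symmetric

variable (k : Type u) [Field k] (n : ℕ)

/-- The natural supermodule. -/
def natMod : PMod k n where
  carrier := NatV k n
  grade := natGrade k n
  isCompl := by
    constructor
    · rw [Submodule.disjoint_def]
      intro v h₀ h₁
      ext i
      rcases zmod_cases i.par with h | h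
      · exact h₁ i (by rw [h]; decide)
      · exact h₀ i (by rw [h]; decide)
    · refine codisjoint_iff.2 (eq_top_iff.2 fun v _ => Submodule.mem_sup.2
        ⟨fun i => if i.par = 0 then v i else 0, fun i hi => if_neg hi,
          fun i => if i.par = 0 then 0 else v i, fun i hi => if_pos ?_, ?_⟩)
      · exact (zmod_cases i.par).resolve_right hi
      · ext i
        by_cases h : i.par = 0 <;> simp [h]
  act p := (typeP k n p).subtype
  act_mem x _ hm := x.2.1 _ _ hm
  act_bracket _ _ _ := rfl

/-- The relations `v w = (-1)^{|v||w|} w v` for homogeneous `v`, `w`. -/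
inductive SymRel : TensorAlgebra k (NatV k n) → TensorAlgebra k (NatV k n) → Prop
  | swap {p q : ZMod 2} {v w : NatV k n} : v ∈ natGrade k n p → w ∈ natGrade k n q →
      SymRel (TensorAlgebra.ι k v * TensorAlgebra.ι k w)
        (sgn k (p * q) • (TensorAlgebra.ι k w * TensorAlgebra.ι k v))

/-- The symmetric superalgebra `S(V_n)`. -/
abbrev SymAlg : Type u := RingQuot (SymRel k n)

/-- The inclusion of the natural module into the symmetric superalgebra. -/
def symι : NatV k n →ₗ[k] SymAlg k n :=
  (RingQuot.mkAlgHom k (SymRel k n)).toLinearMap ∘ₗ TensorAlgebra.ι k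

variable {k n}

theorem symι_mul_comm {p q : ZMod 2} {v w : NatV k n} (hv : v ∈ natGrade k n p)
    (hw : w ∈ natGrade k n q) :
    symι k n v * symι k n w = sgn k (p * q) • (symι k n w * symι k n v) := by
  have h := RingQuot.mkAlgHom_rel k (SymRel.swap hv hw)
  rw [map_mul, map_smul, map_mul] at h
  exact h

/-- The universal property of the symmetric superalgebra. -/
def symLift {B : Type v} [Ring B] [Algebra k B] (f : NatV k n →ₗ[k] B)
    (hf : ∀ p q, ∀ v ∈ natGrade k n p, ∀ w ∈ natGrade k n q,
      f v * f w = sgn k (p * q) • (f w * f v)) : SymAlg k n →ₐ[k] B :=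
  RingQuot.liftAlgHom k ⟨TensorAlgebra.lift k f, by
    rintro _ _ ⟨hv, hw⟩
    simpa using hf _ _ _ hv _ hw⟩

@[simp] theorem symLift_symι {B : Type v} [Ring B] [Algebra k B] (f : NatV k n →ₗ[k] B)
    (hf : ∀ p q, ∀ v ∈ natGrade k n p, ∀ w ∈ natGrade k n q,
      f v * f w = sgn k (p * q) • (f w * f v)) (v : NatV k n) : symLift f hf (symι k n v) = f v := by
  simp [symLift, symι]

theorem symAlg_induction {C : SymAlg k n → Prop} (h₀ : ∀ c : k, C (algebraMap k _ c))
    (h₁ : ∀ v, C (symι k n v)) (ha : ∀ a b, C a → C b → C (a + b))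
    (hm : ∀ a b, C a → C b → C (a * b)) (a : SymAlg k n) : C a := by
  obtain ⟨t, rfl⟩ := RingQuot.mkAlgHom_surjective k (SymRel k n) a
  induction t using TensorAlgebra.induction with
  | algebraMap c => simpa using h₀ c
  | ι v => exact h₁ v
  | mul a b ha hb => simpa using hm _ _ ha hb
  | add a b ha' hb => simpa using ha _ _ ha' hb

/-- The map `v ↦ (-1)^{q|v|} v` of the natural module. -/
def natTw (q : ZMod 2) : NatV k n →ₗ[k] NatV k n := (natMod k n).tw q

theorem natTw_apply (q : ZMod 2) {p : ZMod 2} {v : NatV k n} (hv : v ∈ natGrade k n p) :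
    natTw q v = sgn k (q * p) • v := (natMod k n).tw_apply q hv

/-- The algebra endomorphism of `S(V_n)` with `v ↦ (-1)^{q|v|} v` for `v ∈ V_n`. -/
def symTw (q : ZMod 2) : SymAlg k n →ₐ[k] SymAlg k n :=
  symLift (symι k n ∘ₗ natTw q) (by
    intro p r v hv w hw
    have e₁ : (symι k n ∘ₗ natTw q) v = sgn k (q * p) • symι k n v := by
      rw [← map_smul, ← natTw_apply q hv]; rfl
    have e₂ : (symι k n ∘ₗ natTw q) w = sgn k (q * r) • symι k n w := by
      rw [← map_smul, ← natTw_apply q hw]; rfl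
    rw [e₁, e₂, smul_mul_smul_comm, smul_mul_smul_comm, symι_mul_comm hv hw, smul_comm,
      mul_comm (sgn k (q * p))])

theorem symTw_symι (q : ZMod 2) {p : ZMod 2} {v : NatV k n} (hv : v ∈ natGrade k n p) :
    symTw q (symι k n v) = sgn k (q * p) • symι k n v := by
  rw [symTw, symLift_symι, ← map_smul, ← natTw_apply q hv]
  rfl

/-- Auxiliary: `v ↦ [[(-1)^{|x||v|} v, x.v], [0, v]]`. -/
def derLin {p : ZMod 2} (x : typeP k n p) :
    NatV k n →ₗ[k] Matrix (Fin 2) (Fin 2) (SymAlg k n) where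
  toFun v := !![symTw p (symι k n v), symι k n (x.1 v); 0, symι k n v]
  map_add' v w := by ext i j; fin_cases i <;> fin_cases j <;> simp
  map_smul' c v := by ext i j; fin_cases i <;> fin_cases j <;> simp

/-- Auxiliary: the algebra homomorphism `a ↦ [[(-1)^{|x||a|} a, x.a], [0, a]]`. -/
def derHom {p : ZMod 2} (x : typeP k n p) :
    SymAlg k n →ₐ[k] Matrix (Fin 2) (Fin 2) (SymAlg k n) :=
  symLift (derLin x) (by
    intro q r v hv w hw
    have e := sgn_mul_self k (q * r)
    have h := symι_mul_comm hv hw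
    have h₁ := symι_mul_comm (x.2.1 q v hv) hw
    have h₂ := symι_mul_comm hv (x.2.1 r w hw)
    ext i j
    fin_cases i <;> fin_cases j
    · simpa [derLin] using congrArg (symTw p) h
    · simp only [derLin, LinearMap.coe_mk, AddHom.coe_mk, symTw_symι p hv, symTw_symι p hw]
      simp only [Fin.zero_eta, Fin.mk_one, Matrix.mul_apply, Fin.sum_univ_two, Matrix.of_apply,
        Matrix.cons_val', Matrix.cons_val_zero, Matrix.cons_val_one, Matrix.smul_apply,
        Matrix.cons_val_fin_one, smul_mul_assoc, h₁, h₂, add_mul, mul_add, sgn_add, smul_smul,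
        smul_add, mul_comm q p, mul_comm q r]
      rw [mul_comm r q, add_comm]
      rcases sgn_eq k (p * r) with e₁ | e₁ <;> rcases sgn_eq k (p * q) with e₂ | e₂ <;>
        rcases sgn_eq k (q * r) with e₃ | e₃ <;> rw [e₁, e₂, e₃] <;> module
    · simp [derLin]
    · simpa [derLin] using h)

theorem derHom_apply {p : ZMod 2} (x : typeP k n p) (a : SymAlg k n) :
    derHom x a 0 0 = symTw p a ∧ derHom x a 1 0 = 0 ∧ derHom x a 1 1 = a := by
  induction a using symAlg_induction with
  | h₀ c => simp [Matrix.algebraMap_matrix_apply]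
  | h₁ v => simp [derHom, derLin]
  | ha a b ha hb => simp [ha, hb]
  | hm a b ha hb => simp [Matrix.mul_apply, ha, hb]

/-- The action of `𝔭(n)` on `S(V_n)` by superderivations. -/
def symDer {p : ZMod 2} (x : typeP k n p) : SymAlg k n →ₗ[k] SymAlg k n where
  toFun a := derHom x a 0 1
  map_add' a b := by simp
  map_smul' c a := by simp

theorem symDer_algebraMap {p : ZMod 2} (x : typeP k n p) (c : k) :
    symDer x (algebraMap k (SymAlg k n) c) = 0 := by
  simp [symDer, Matrix.algebraMap_matrix_apply]

theorem symDer_symι {p : ZMod 2} (x : typeP k n p) (v : NatV k n) :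
    symDer x (symι k n v) = symι k n (x.1 v) := by
  simp [symDer, derHom, derLin]

theorem symDer_mul {p : ZMod 2} (x : typeP k n p) (a b : SymAlg k n) :
    symDer x (a * b) = symTw p a * symDer x b + symDer x a * b := by
  simp [symDer, Matrix.mul_apply, derHom_apply]

theorem symDer_add {p : ZMod 2} (x y : typeP k n p) (a : SymAlg k n) :
    symDer (x + y) a = symDer x a + symDer y a := by
  induction a using symAlg_induction with
  | h₀ c => simp [symDer_algebraMap]
  | h₁ v => simp [symDer_symι]
  | ha a b ha hb => rw [map_add, map_add, map_add, ha, hb]; abel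
  | hm a b ha hb => rw [symDer_mul, symDer_mul, symDer_mul, ha, hb, mul_add, add_mul]; abel

theorem symDer_smul {p : ZMod 2} (c : k) (x : typeP k n p) (a : SymAlg k n) :
    symDer (c • x) a = c • symDer x a := by
  induction a using symAlg_induction with
  | h₀ c => simp [symDer_algebraMap]
  | h₁ v => simp [symDer_symι]
  | ha a b ha hb => rw [map_add, map_add, smul_add, ha, hb]
  | hm a b ha hb => rw [symDer_mul, symDer_mul, ha, hb, smul_add, mul_smul_comm, smul_mul_assoc]

theorem symι_induction {C : SymAlg k n → Prop} (h₀ : ∀ p, ∀ v ∈ natGrade k n p, C (symι k n v))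
    (ha : ∀ a b, C a → C b → C (a + b)) (v : NatV k n) : C (symι k n v) := by
  obtain ⟨a, ha', b, hb, rfl⟩ := (natMod k n).exists_add v
  have e : symι k n (a + b) = symι k n a + symι k n b := map_add _ _ _
  exact e ▸ ha _ _ (h₀ 0 a ha') (h₀ 1 b hb)

theorem symDer_symTw {p : ZMod 2} (x : typeP k n p) (q : ZMod 2) (a : SymAlg k n) :
    symTw q (symDer x a) = sgn k (q * p) • symDer x (symTw q a) := by
  induction a using symAlg_induction with
  | h₀ c => simp [symDer_algebraMap]
  | h₁ v =>
    refine symι_induction (C := fun a => symTw q (symDer x a) = sgn k (q * p) • symDer x (symTw q a))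
      (fun r v hv => ?_) (fun a b ha hb => ?_) v
    · rw [symDer_symι, symTw_symι q (x.2.1 r v hv), symTw_symι q hv, map_smul, symDer_symι,
        smul_smul, mul_add, sgn_add]
    · simp only [map_add, ha, hb, smul_add]
  | ha a b ha hb => simp only [map_add, ha, hb, smul_add]
  | hm a b ha hb =>
    have e (a : SymAlg k n) : symTw q (symTw p a) = symTw p (symTw q a) := by
      induction a using symAlg_induction with
      | h₀ c => simp
      | h₁ v =>
        refine symι_induction (C := fun a => symTw q (symTw p a) = symTw p (symTw q a))
          (fun r v hv => ?_) (fun a b ha hb => ?_) v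
        · rw [symTw_symι p hv, symTw_symι q hv, map_smul, map_smul, symTw_symι p hv,
            symTw_symι q hv, smul_comm]
        · simp only [map_add, ha, hb]
      | ha a b ha hb => simp only [map_add, ha, hb]
      | hm a b ha hb => simp only [map_mul, ha, hb]
    simp only [symDer_mul, map_mul, map_add, ha, hb, e, smul_add, mul_smul_comm, smul_mul_assoc]

theorem symTw_add (p q : ZMod 2) (a : SymAlg k n) : symTw (p + q) a = symTw p (symTw q a) := by
  induction a using symAlg_induction with
  | h₀ c => simp
  | h₁ v =>
    refine symι_induction (C := fun a => symTw (p + q) a = symTw p (symTw q a))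
      (fun r v hv => ?_) (fun a b ha hb => ?_) v
    · rw [symTw_symι q hv, symTw_symι (p + q) hv, map_smul, symTw_symι p hv, smul_smul, add_mul,
        sgn_add, mul_comm]
    · simp only [map_add, ha, hb]
  | ha a b ha hb => simp only [map_add, ha, hb]
  | hm a b ha hb => simp only [map_mul, ha, hb]

theorem symDer_bracket {p q : ZMod 2} (x : typeP k n p) (y : typeP k n q) (a : SymAlg k n) :
    symDer (bracket k n x y) a =
      symDer x (symDer y a) - sgn k (p * q) • symDer y (symDer x a) := by
  induction a using symAlg_induction with
  | h₀ c => simp [symDer_algebraMap]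
  | h₁ v => simp [symDer_symι, bracket]
  | ha a b ha hb => simp only [map_add, ha, hb, smul_add]; abel
  | hm a b ha hb =>
    have e₁ := symDer_symTw x q a
    have e₂ := symDer_symTw y p a
    rw [mul_comm q p] at e₁
    simp only [symDer_mul, map_add, ha, hb, e₁, e₂, symTw_add, mul_sub, sub_mul, smul_add,
      smul_mul_assoc, mul_smul_comm, smul_smul, sgn_mul_self]
    have e₃ : symTw p (symTw q a) = symTw q (symTw p a) := by
      rw [← symTw_add, add_comm, symTw_add]
    rw [e₃]
    module

theorem symTw_zero (a : SymAlg k n) : symTw 0 a = a := by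
  induction a using symAlg_induction with
  | h₀ c => simp
  | h₁ v =>
    refine symι_induction (C := fun a => symTw 0 a = a)
      (fun r v hv => ?_) (fun a b ha hb => ?_) v
    · rw [symTw_symι 0 hv, zero_mul, sgn_zero, one_smul]
    · simp only [map_add, ha, hb]
  | ha a b ha hb => simp only [map_add, ha, hb]
  | hm a b ha hb => simp only [map_mul, ha, hb]

/-- The symmetric power `S^a(V_n)`, the span of the products of `a` elements of `V_n`. -/
abbrev SymPow (k : Type u) [Field k] (n a : ℕ) : Submodule k (SymAlg k n) :=
  LinearMap.range (symι k n) ^ a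

theorem symTw_mem (q : ZMod 2) {a : ℕ} {x : SymAlg k n} (hx : x ∈ SymPow k n a) :
    symTw q x ∈ SymPow k n a := by
  have h : Submodule.map (symTw q).toLinearMap (SymPow k n a) ≤ SymPow k n a := by
    rw [Submodule.map_pow]
    refine pow_le_pow_left' ?_ a
    rintro _ ⟨_, ⟨v, rfl⟩, rfl⟩
    exact ⟨natTw q v, by
      show symι k n (natTw q v) = symTw q (symι k n v)
      rw [symTw, symLift_symι]; rfl⟩
  exact h (Submodule.mem_map_of_mem hx)

theorem symDer_mem {p : ZMod 2} (x : typeP k n p) {a : ℕ} {y : SymAlg k n}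
    (hy : y ∈ SymPow k n a) : symDer x y ∈ SymPow k n a := by
  induction a generalizing y with
  | zero =>
    rw [SymPow, pow_zero] at hy
    obtain ⟨c, rfl⟩ := Submodule.mem_one.1 hy
    rw [symDer_algebraMap]
    exact zero_mem _
  | succ a ih =>
    rw [SymPow, pow_succ] at hy ⊢
    induction hy using Submodule.mul_induction_on' with
    | mem_mul_mem y hy v hv =>
      obtain ⟨v, rfl⟩ := hv
      rw [symDer_mul, symDer_symι]
      exact add_mem (Submodule.mul_mem_mul (symTw_mem p hy) ⟨_, rfl⟩)
        (Submodule.mul_mem_mul (ih hy) ⟨_, rfl⟩)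
    | add y _ z _ hy hz =>
      rw [map_add]
      exact add_mem hy hz

instance (a : ℕ) : FiniteDimensional k (SymPow k n a) :=
  Module.Finite.iff_fg.2 (Submodule.FG.pow (Module.Finite.iff_fg.1 inferInstance) a)

/-- The product `v_1 ⋯ v_a` in `S^a(V_n)`. -/
def symProd {a : ℕ} (v : Fin a → NatV k n) : SymPow k n a :=
  ⟨(List.ofFn fun i => symι k n (v i)).prod, by
    induction a with
    | zero => exact Submodule.mem_one.2 ⟨1, by simp⟩
    | succ a ih =>
      rw [List.ofFn_succ, List.prod_cons, SymPow, pow_succ']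
      exact Submodule.mul_mem_mul ⟨_, rfl⟩ (ih fun i => v i.succ)⟩

/-- The multiplication `S^a(V_n) × S^b(V_n) → S^{a+b}(V_n)`. -/
def symMul {a b : ℕ} (x : SymPow k n a) (y : SymPow k n b) : SymPow k n (a + b) :=
  ⟨x.1 * y.1, by rw [SymPow, pow_add]; exact Submodule.mul_mem_mul x.2 y.2⟩

/-- The homogeneous components of `S^a(V_n)`, as the eigenspaces of the parity operator (a product
of homogeneous elements of `V_n` has the sum of their parities as its parity). -/
def symGrade (k : Type u) [Field k] (n a : ℕ) (p : ZMod 2) : Submodule k (SymPow k n a) where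
  carrier := {x | symTw 1 x.1 = sgn k p • x.1}
  add_mem' {x y} hx hy := by
    have hx : symTw 1 x.1 = sgn k p • x.1 := hx
    have hy : symTw 1 y.1 = sgn k p • y.1 := hy
    show symTw 1 (x.1 + y.1) = sgn k p • (x.1 + y.1)
    rw [map_add, hx, hy, smul_add]
  zero_mem' := by
    show symTw 1 (0 : SymAlg k n) = sgn k p • (0 : SymAlg k n)
    rw [map_zero, smul_zero]
  smul_mem' c x hx := by
    have hx : symTw 1 x.1 = sgn k p • x.1 := hx
    show symTw 1 (c • x.1) = sgn k p • (c • x.1)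
    rw [map_smul, hx, smul_comm]

theorem symProd_mem {a : ℕ} {v : Fin a → NatV k n} {p : Fin a → ZMod 2}
    (h : ∀ i, v i ∈ natGrade k n (p i)) : symProd v ∈ symGrade k n a (∑ i, p i) := by
  show symTw 1 (List.ofFn fun i => symι k n (v i)).prod =
    sgn k (∑ i, p i) • (List.ofFn fun i => symι k n (v i)).prod
  induction a with
  | zero => simp
  | succ a ih =>
    rw [List.ofFn_succ, List.prod_cons, map_mul, symTw_symι 1 (h 0), ih fun i => h i.succ,
      smul_mul_smul_comm, one_mul, ← sgn_add, Fin.sum_univ_succ]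

/-- The `𝔭(n)`-supermodule `S^a(V_n)`. -/
def symObj (k : Type u) [Field k] [NeZero (2 : k)] (n a : ℕ) : PMod k n where
  carrier := SymPow k n a
  grade := symGrade k n a
  isCompl := by
    have e2 : (2 : k)⁻¹ + 2⁻¹ = 1 := by
      rw [← two_mul, mul_inv_cancel₀ (NeZero.ne _)]
    let P : SymPow k n a →ₗ[k] SymPow k n a :=
      (symTw 1).toLinearMap.restrict (fun _ hx => symTw_mem 1 hx)
    have hP : ∀ x, P (P x) = x := fun x => Subtype.ext (by
      show symTw 1 (symTw 1 x.1) = x.1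
      rw [← symTw_add, show (1 : ZMod 2) + 1 = 0 by decide, symTw_zero])
    have hg : ∀ p, ∀ x ∈ symGrade k n a p, P x = sgn k p • x := fun p x hx => Subtype.ext hx
    refine PMod.isCompl_of_parity (M := SymPow k n a) P (symGrade k n a) hg fun x => ?_
    refine Submodule.mem_sup.2 ⟨(2 : k)⁻¹ • (x + P x), ?_, (2 : k)⁻¹ • (x + (-1 : k) • P x), ?_, ?_⟩
    · refine congrArg Subtype.val
        (?_ : P ((2 : k)⁻¹ • (x + P x)) = sgn k 0 • ((2 : k)⁻¹ • (x + P x)))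
      rw [map_smul, map_add, hP, sgn_zero, one_smul, add_comm]
    · refine congrArg Subtype.val
        (?_ : P ((2 : k)⁻¹ • (x + (-1 : k) • P x)) = sgn k 1 • ((2 : k)⁻¹ • (x + (-1 : k) • P x)))
      rw [map_smul, map_add, map_smul, hP, sgn_one]
      module
    · have e : (2 : k)⁻¹ • (x + P x) + (2 : k)⁻¹ • (x + (-1 : k) • P x) =
          ((2 : k)⁻¹ + 2⁻¹) • x := by module
      rw [e, e2, one_smul]
  act p :=
    { toFun := fun x => (symDer x).restrict (fun _ hy => symDer_mem x hy)
      map_add' := fun x y => LinearMap.ext fun m => Subtype.ext (symDer_add x y m.1)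
      map_smul' := fun c x => LinearMap.ext fun m => Subtype.ext (symDer_smul c x m.1) }
  act_mem := by
    intro p q x m hm
    have hm : symTw 1 m.1 = sgn k q • m.1 := hm
    show symTw 1 (symDer x m.1) = sgn k (p + q) • symDer x m.1
    rw [symDer_symTw, hm, map_smul, smul_smul, one_mul, sgn_add]
  act_bracket x y m := Subtype.ext (symDer_bracket x y m.1)

end Symmetric

/-! ### The monoidal supercategory generated by the symmetric powers and their duals -/

section Generated

variable (k : Type u) [Field k] [NeZero (2 : k)] (n : ℕ)

/-- The supermodules which are tensor products of symmetric powers `S^a(V_n)` and of duals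
`S^a(V_n)^*`. -/
inductive IsSS : PMod k n → Prop
  | triv : IsSS (PMod.triv k n)
  | sym (a : ℕ) : IsSS (symObj k n a)
  | dual (a : ℕ) : IsSS (symObj k n a).dual
  | tensor {M N : PMod k n} : IsSS M → IsSS N → IsSS (M.tensor N)

/-- The full monoidal subcategory of the `𝔭(n)`-supermodules generated by the symmetric powers
`S^a(V_n)` and their duals. -/
structure ModSS : Type (u + 1) where
  obj : PMod k n
  property : IsSS k n obj

variable {k n}

instance : Category (ModSS k n) where
  Hom M N := M.obj ⟶ N.obj
  id M := 𝟙 M.obj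
  comp f g := CategoryStruct.comp (obj := PMod k n) f g
  id_comp f := Category.id_comp (obj := PMod k n) f
  comp_id f := Category.comp_id (obj := PMod k n) f
  assoc f g h := Category.assoc (obj := PMod k n) f g h

instance : Preadditive (ModSS k n) where
  homGroup M N := inferInstanceAs (AddCommGroup (M.obj ⟶ N.obj))
  add_comp _ _ _ f f' g := Preadditive.add_comp (C := PMod k n) _ _ _ f f' g
  comp_add _ _ _ f g g' := Preadditive.comp_add (C := PMod k n) _ _ _ f g g'

instance : Linear k (ModSS k n) where
  homModule M N := inferInstanceAs (Module k (M.obj ⟶ N.obj))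
  smul_comp _ _ _ c f g := Linear.smul_comp (C := PMod k n) _ _ _ c f g
  comp_smul _ _ _ f c g := Linear.comp_smul (C := PMod k n) _ _ _ f c g

instance : Supercategory k (ModSS k n) where
  parity M N := parity (k := k) M.obj N.obj
  isCompl M N := Supercategory.isCompl M.obj N.obj
  id_mem M := Supercategory.id_mem M.obj
  comp_mem hf hg := Supercategory.comp_mem (C := PMod k n) hf hg

/-- An isomorphism of supermodules, as an isomorphism of the full subcategory. -/
def ModSS.mkIso {M N : ModSS k n} (e : M.obj ≅ N.obj) : M ≅ N where
  hom := e.hom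
  inv := e.inv
  hom_inv_id := e.hom_inv_id
  inv_hom_id := e.inv_hom_id

instance : MonoidalSupercategory k (ModSS k n) where
  tensorObj M N := ⟨M.obj.tensor N.obj, IsSS.tensor M.property N.property⟩
  tensorHom {X₁ Y₁ X₂ Y₂} := PMod.tensorMor (M := X₁.obj) (M' := Y₁.obj) (N := X₂.obj)
    (N' := Y₂.obj)
  tensorHom_mem hf hg := tensorHom_mem (C := PMod k n) hf hg
  tensorHom_id M N := tensorHom_id (k := k) M.obj N.obj
  interchange {X₁ Y₁ Z₁ X₂ Y₂ Z₂ _ _ _} g h _ hf hl :=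
    PMod.tensorMor_interchange (X₁ := X₁.obj) (Y₁ := Y₁.obj) (Z₁ := Z₁.obj) (X₂ := X₂.obj)
      (Y₂ := Y₂.obj) (Z₂ := Z₂.obj) g h hf hl
  unit := ⟨PMod.triv k n, IsSS.triv⟩
  assoc M N P := ModSS.mkIso (PMod.tensorAssoc M.obj N.obj P.obj)
  lunit M := ModSS.mkIso (PMod.tensorLeft M.obj)
  runit M := ModSS.mkIso (PMod.tensorRight M.obj)
  assoc_mem M N P := assoc_mem (k := k) M.obj N.obj P.obj
  lunit_mem M := lunit_mem (k := k) M.obj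
  runit_mem M := runit_mem (k := k) M.obj
  assoc_naturality f g h := assoc_naturality (k := k) (C := PMod k n) f g h
  lunit_naturality f := lunit_naturality (k := k) (C := PMod k n) f
  runit_naturality f := runit_naturality (k := k) (C := PMod k n) f
  pentagon W X Y Z := pentagon (k := k) W.obj X.obj Y.obj Z.obj
  triangle X Y := triangle (k := k) X.obj Y.obj

namespace ModSS

/-- The linear map underlying a morphism. -/
def lin {M N : ModSS k n} (f : M ⟶ N) : M.obj.carrier →ₗ[k] N.obj.carrier :=
  PMod.lin (M := M.obj) (N := N.obj) f

variable (k n)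

/-- The object `S^a(V_n)`. -/
def sym (a : ℕ) : ModSS k n := ⟨symObj k n a, IsSS.sym a⟩

/-- The object `S^a(V_n)^*`. -/
def symDual (a : ℕ) : ModSS k n := ⟨(symObj k n a).dual, IsSS.dual a⟩

end ModSS

end Generated

/-! ## The category of oriented webs of type P

The morphisms are the `k`-linear combinations of diagrams, which are represented by formal terms
modulo the congruence generated by the axioms of a strict monoidal `k`-linear supercategory and the
defining relations. -/

/-- The generating objects `↑_a` and `↓_a`, for `a ≥ 1`. -/
inductive Arrow : Type
  | up (a : ℕ+)
  | down (a : ℕ+)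

/-- The objects: words in the generating objects, with concatenation as the tensor product. -/
abbrev Word : Type := List Arrow

/-- The object `↑_a`, which is the unit object if `a = 0`. -/
def up (a : ℕ) : Word := if h : 0 < a then [Arrow.up ⟨a, h⟩] else []

/-- The object `↓_a`, which is the unit object if `a = 0`. -/
def down (a : ℕ) : Word := if h : 0 < a then [Arrow.down ⟨a, h⟩] else []

@[simp] theorem up_zero : up 0 = [] := rfl

@[simp] theorem down_zero : down 0 = [] := rfl

/-- The generating morphisms. -/
inductive Gen : Word → Word → Type
  /-- the upward split -/
  | split (a b c : ℕ) (h : a + b = c) : Gen (up c) (up a ++ up b)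
  /-- the upward merge -/
  | merge (a b c : ℕ) (h : a + b = c) : Gen (up a ++ up b) (up c)
  /-- the leftward cap -/
  | lcap (a : ℕ) : Gen (down a ++ up a) []
  /-- the leftward cup -/
  | lcup (a : ℕ) : Gen [] (up a ++ down a)
  /-- the tag-in -/
  | tagIn : Gen (up 1) (down 1)
  /-- the tag-out -/
  | tagOut : Gen (down 1) (up 1)
  /-- the rightward crossing -/
  | cross (a b : ℕ) : Gen (up a ++ down b) (down b ++ up a)

/-- The parity of a generating morphism. -/
def Gen.par {x y : Word} : Gen x y → ZMod 2
  | .split _ _ _ _ => 0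
  | .merge _ _ _ _ => 0
  | .lcap _ => 0
  | .lcup _ => 0
  | .tagIn => 1
  | .tagOut => 1
  | .cross _ _ => 0

/-- The formal linear combinations of diagrams. Diagrams are read from bottom to top, so
`comp f g` is `g` on top of `f`, and `tens f g` has `f` on the left of `g`. -/
inductive Tm (k : Type u) : Word → Word → Type u
  | gen {x y : Word} : Gen x y → Tm k x y
  /-- the identity of a word, between two equal words -/
  | cast {x y : Word} : x = y → Tm k x y
  | comp {x y z : Word} : Tm k x y → Tm k y z → Tm k x z
  | tens {x y x' y' : Word} : Tm k x y → Tm k x' y' → Tm k (x ++ x') (y ++ y')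
  | zero {x y : Word} : Tm k x y
  | sum {x y : Word} : Tm k x y → Tm k x y → Tm k x y
  | smul {x y : Word} : k → Tm k x y → Tm k x y

namespace Tm

section Diagrams

variable {k : Type u}

/-- The identity diagram of a word. -/
def one (k : Type u) (x : Word) : Tm k x x := .cast rfl

/-- Composition along an equality of words. -/
def seq {x y y' z : Word} (f : Tm k x y) (g : Tm k y' z) (h : y = y' := by simp) : Tm k x z :=
  .comp f (.comp (.cast h) g)

/-- The sum of `f 0, …, f (m - 1)`. -/
def bigSum {x y : Word} : ℕ → (ℕ → Tm k x y) → Tm k x y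
  | 0, _ => .zero
  | m + 1, f => .sum (bigSum m f) (f m)

/-- The homogeneous linear combinations of parity `p`. -/
inductive Homog : ∀ {x y : Word}, ZMod 2 → Tm k x y → Prop
  | gen {x y : Word} (g : Gen x y) : Homog g.par (.gen g)
  | cast {x y : Word} (h : x = y) : Homog 0 (.cast h)
  | comp {x y z : Word} {p q : ZMod 2} {f : Tm k x y} {g : Tm k y z} :
      Homog p f → Homog q g → Homog (p + q) (.comp f g)
  | tens {x y x' y' : Word} {p q : ZMod 2} {f : Tm k x y} {g : Tm k x' y'} :
      Homog p f → Homog q g → Homog (p + q) (.tens f g)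
  | zero {x y : Word} (p : ZMod 2) : Homog p (.zero : Tm k x y)
  | sum {x y : Word} {p : ZMod 2} {f g : Tm k x y} :
      Homog p f → Homog p g → Homog p (.sum f g)
  | smul {x y : Word} {p : ZMod 2} (c : k) {f : Tm k x y} : Homog p f → Homog p (.smul c f)

/-- The upward split. -/
def split (k : Type u) (a b c : ℕ) (h : a + b = c) : Tm k (up c) (up a ++ up b) :=
  .gen (.split a b c h)

/-- The upward merge. -/
def merge (k : Type u) (a b c : ℕ) (h : a + b = c) : Tm k (up a ++ up b) (up c) :=
  .gen (.merge a b c h)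

/-- The leftward cap. -/
def lcap (k : Type u) (a : ℕ) : Tm k (down a ++ up a) [] := .gen (.lcap a)

/-- The leftward cup. -/
def lcup (k : Type u) (a : ℕ) : Tm k [] (up a ++ down a) := .gen (.lcup a)

/-- The rightward crossing. -/
def rcross (k : Type u) (a b : ℕ) : Tm k (up a ++ down b) (down b ++ up a) := .gen (.cross a b)

/-- The upward cap. -/
def ucap (k : Type u) : Tm k (up 1 ++ up 1) [] :=
  .comp (.tens (.gen .tagIn) (one k (up 1))) (lcap k 1)

/-- The upward cup. -/
def ucup (k : Type u) : Tm k [] (up 1 ++ up 1) :=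
  .comp (lcup k 1) (.tens (one k (up 1)) (.gen .tagOut))

/-- The upward antenna. -/
def antenna (k : Type u) [Field k] : Tm k (up 2) [] :=
  .smul (2 : k)⁻¹ (.comp (split k 1 1 2 rfl) (ucap k))

/-- The rightward rung: `(a, b)` → `(a', b')` through a strand labelled `s`, or zero if a label
is negative. -/
def rungR (k : Type u) (a b s a' b' : ℕ) : Tm k (up a ++ up b) (up a' ++ up b') :=
  if h : a' + s = a ∧ s + b = b' then
    seq (.tens (split k a' s a h.1) (one k (up b))) (.tens (one k (up a')) (merge k s b b' h.2))
  else .zero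

/-- The leftward rung: `(a, b)` → `(a', b')` through a strand labelled `r`, or zero if a label
is negative. -/
def rungL (k : Type u) (a b r a' b' : ℕ) : Tm k (up a ++ up b) (up a' ++ up b') :=
  if h : r + b' = b ∧ a + r = a' then
    seq (.tens (one k (up a)) (split k r b' b h.1)) (.tens (merge k a r a' h.2) (one k (up b')))
  else .zero

/-- The upward cap between two strands: `(a, b)` → `(a', b') = (a - 1, b - 1)`. -/
def capRung (k : Type u) (a b a' b' : ℕ) : Tm k (up a ++ up b) (up a' ++ up b') :=
  if h : a' + 1 = a ∧ 1 + b' = b then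
    seq (.tens (split k a' 1 a h.1) (split k 1 b' b h.2))
      (.tens (one k (up a')) (.tens (ucap k) (one k (up b'))))
  else .zero

/-- The upward cup between two strands: `(a, b)` → `(a', b') = (a + 1, b + 1)`. -/
def cupRung (k : Type u) (a b a' b' : ℕ) : Tm k (up a ++ up b) (up a' ++ up b') :=
  if h : a + 1 = a' ∧ 1 + b = b' then
    seq (x := up a ++ ([] ++ up b)) (.tens (one k (up a)) (.tens (ucup k) (one k (up b))))
      (.tens (merge k a 1 a' h.1) (merge k 1 b b' h.2))
  else .zero

/-- An antenna split off to the right from the left strand: `(a, b)` → `(a', b) = (a - 2, b)`. -/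
def antR (k : Type u) [Field k] (a b a' : ℕ) : Tm k (up a ++ up b) (up a' ++ up b) :=
  if h : a' + 2 = a then
    seq (.tens (split k a' 2 a h) (one k (up b)))
      (.tens (one k (up a')) (.tens (antenna k) (one k (up b))))
  else .zero

/-- An antenna split off to the left from the right strand: `(a, b)` → `(a, b') = (a, b - 2)`. -/
def antL (k : Type u) [Field k] (a b b' : ℕ) : Tm k (up a ++ up b) (up a ++ up b') :=
  if h : 2 + b' = b then
    seq (.tens (one k (up a)) (split k 2 b' b h))
      (.tens (one k (up a)) (.tens (antenna k) (one k (up b'))))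
  else .zero

/-- The upward crossing, `∑_{s - r = a - b} (-1)^{a - s}` (a rightward rung labelled `s`, then a
leftward rung labelled `r`). -/
def ucross (k : Type u) [Field k] (a b : ℕ) : Tm k (up a ++ up b) (up b ++ up a) :=
  bigSum (a + 1) fun s =>
    if a ≤ b + s then
      .smul ((-1) ^ (a - s))
        (.comp (rungR k a b s (a - s) (b + s)) (rungL k (a - s) (b + s) (b + s - a) b a))
    else .zero

/-- The leftward crossing. -/
def lcross (k : Type u) [Field k] (a b : ℕ) : Tm k (down a ++ up b) (up b ++ down a) :=
  .comp (.cast (by simp))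
    (seq (x := (down a ++ up b) ++ []) (z := [] ++ (up b ++ down a))
      (.tens (.tens (one k (down a)) (one k (up b))) (lcup k a))
      (seq (z := [] ++ (up b ++ down a))
        (.tens (one k (down a)) (.tens (ucross k b a) (one k (down a))))
        (.tens (lcap k a) (.tens (one k (up b)) (one k (down a))))))

/-- The defining relations of the category of oriented webs. -/
inductive DefRel (k : Type u) [Field k] : ∀ {x y : Word}, Tm k x y → Tm k x y → Prop
  /- strands labelled by zero are deleted -/
  | split_right_zero (a : ℕ) : DefRel k (split k a 0 a (add_zero a)) (.cast (by simp))
  | split_left_zero (a : ℕ) : DefRel k (split k 0 a a (zero_add a)) (.cast (by simp))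
  | merge_right_zero (a : ℕ) : DefRel k (merge k a 0 a (add_zero a)) (.cast (by simp))
  | merge_left_zero (a : ℕ) : DefRel k (merge k 0 a a (zero_add a)) (.cast (by simp))
  | lcap_zero : DefRel k (lcap k 0) (.cast (by simp))
  | lcup_zero : DefRel k (lcup k 0) (.cast (by simp))
  | cross_right_zero (a : ℕ) : DefRel k (rcross k a 0) (.cast (by simp))
  | cross_left_zero (b : ℕ) : DefRel k (rcross k 0 b) (.cast (by simp))
  /- web-associativity -/
  | split_assoc (a b c : ℕ) : DefRel k
      (seq (.comp (split k (a + b) c (a + b + c) rfl)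
        (.tens (split k a b (a + b) rfl) (one k (up c)))) (.cast rfl) (List.append_assoc _ _ _))
      (.comp (split k a (b + c) (a + b + c) (add_assoc a b c).symm)
        (.tens (one k (up a)) (split k b c (b + c) rfl)))
  | merge_assoc (a b c : ℕ) : DefRel k
      (.comp (.tens (merge k a b (a + b) rfl) (one k (up c)))
        (merge k (a + b) c (a + b + c) rfl))
      (seq (.cast rfl) (.comp (.tens (one k (up a)) (merge k b c (b + c) rfl))
        (merge k a (b + c) (a + b + c) (add_assoc a b c).symm)))
  /- rung swap -/
  | rung_swap (a b r s c d : ℕ) (hc : c + s = a + r) (hd : d + r = b + s) : DefRel k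
      (.comp (rungR k a b s (a - s) (b + s)) (rungL k (a - s) (b + s) r c d))
      (bigSum (min r s + 1) fun t =>
        .smul ((Ring.choose ((a : ℤ) - b + r - s) t : ℤ) : k)
          (.comp (rungL k a b (r - t) (a + (r - t)) (b - (r - t)))
            (rungR k (a + (r - t)) (b - (r - t)) (s - t) c d)))
  /- straightening -/
  | straight_left : DefRel k
      (seq (x := [] ++ up 1) (z := up 1 ++ []) (.tens (ucup k) (one k (up 1)))
        (.tens (one k (up 1)) (ucap k)))
      (.cast (by simp))
  | straight_right : DefRel k
      (.cast (by simp))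
      (.smul (-1) (seq (x := up 1 ++ []) (z := [] ++ up 1) (.tens (one k (up 1)) (ucup k))
        (.tens (ucap k) (one k (up 1)))))
  /- antenna retraction -/
  | antenna_retract : DefRel k (.comp (merge k 1 1 2 rfl) (antenna k)) (ucap k)
  /- cap/rung swap -/
  | cap_rung_right (a b r c d : ℕ) (hc : c + r + 1 = a) (hd : d + 1 = b + r) : DefRel k
      (.comp (rungR k a b r (c + 1) (b + r)) (capRung k (c + 1) (b + r) c d))
      (.sum (.comp (capRung k a b (a - 1) (b - 1)) (rungR k (a - 1) (b - 1) r c d))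
        (.smul 2 (if 1 ≤ r then
          .comp (antR k a b (a - 2)) (rungR k (a - 2) b (r - 1) c d) else .zero)))
  | cap_rung_left (a b r c d : ℕ) (hc : c + 1 = a + r) (hd : d + r + 1 = b) : DefRel k
      (.comp (rungL k a b r (a + r) (d + 1)) (capRung k (a + r) (d + 1) c d))
      (.sum (.comp (capRung k a b (a - 1) (b - 1)) (rungL k (a - 1) (b - 1) r c d))
        (.smul 2 (if 1 ≤ r then
          .comp (antL k a b (b - 2)) (rungL k a (b - 2) (r - 1) c d) else .zero)))
  /- cup/rung swap -/
  | cup_rung_right (a b r c d : ℕ) (hc : c + r = a + 1) (hd : d = b + r + 1) : DefRel k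
      (.comp (cupRung k a b (a + 1) (b + 1)) (rungR k (a + 1) (b + 1) r c d))
      (.comp (rungR k a b r (a - r) (b + r)) (cupRung k (a - r) (b + r) c d))
  | cup_rung_left (a b r c d : ℕ) (hc : c = a + r + 1) (hd : d + r = b + 1) : DefRel k
      (.comp (cupRung k a b (a + 1) (b + 1)) (rungL k (a + 1) (b + 1) r c d))
      (.comp (rungL k a b r (a + r) (b - r)) (cupRung k (a + r) (b - r) c d))
  /- leftward straightening -/
  | left_straight_up (a : ℕ) : DefRel k
      (seq (x := [] ++ up a) (z := up a ++ []) (.tens (lcup k a) (one k (up a)))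
        (.tens (one k (up a)) (lcap k a)))
      (.cast (by simp))
  | left_straight_down (a : ℕ) : DefRel k
      (seq (x := down a ++ []) (z := [] ++ down a) (.tens (one k (down a)) (lcup k a))
        (.tens (lcap k a) (one k (down a))))
      (.cast (by simp))
  /- left/right crossing inversion -/
  | cross_inv_left (a b : ℕ) : DefRel k (.comp (lcross k a b) (rcross k b a)) (.cast rfl)
  | cross_inv_right (a b : ℕ) : DefRel k (.comp (rcross k a b) (lcross k b a)) (.cast rfl)
  /- bubble annihilation -/
  | bubble (a : ℕ) (ha : 0 < a) : DefRel k
      (.comp (lcup k a) (.comp (rcross k a a) (lcap k a))) .zero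

end Diagrams

/-- The congruence generated by the axioms of a strict monoidal `k`-linear supercategory and the
defining relations. -/
inductive Rel (k : Type u) [Field k] : ∀ {x y : Word}, Tm k x y → Tm k x y → Prop
  | of {x y : Word} {f g : Tm k x y} : DefRel k f g → Rel k f g
  /- congruence -/
  | refl {x y : Word} (f : Tm k x y) : Rel k f f
  | symm {x y : Word} {f g : Tm k x y} : Rel k f g → Rel k g f
  | trans {x y : Word} {f g h : Tm k x y} : Rel k f g → Rel k g h → Rel k f h
  | comp {x y z : Word} {f f' : Tm k x y} {g g' : Tm k y z} :
      Rel k f f' → Rel k g g' → Rel k (.comp f g) (.comp f' g')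
  | tens {x y x' y' : Word} {f f' : Tm k x y} {g g' : Tm k x' y'} :
      Rel k f f' → Rel k g g' → Rel k (.tens f g) (.tens f' g')
  | sum {x y : Word} {f f' g g' : Tm k x y} :
      Rel k f f' → Rel k g g' → Rel k (.sum f g) (.sum f' g')
  | smul {x y : Word} (c : k) {f f' : Tm k x y} : Rel k f f' → Rel k (.smul c f) (.smul c f')
  /- the morphisms form `k`-modules -/
  | sum_assoc {x y : Word} (f g h : Tm k x y) : Rel k (.sum (.sum f g) h) (.sum f (.sum g h))
  | sum_comm {x y : Word} (f g : Tm k x y) : Rel k (.sum f g) (.sum g f)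
  | zero_sum {x y : Word} (f : Tm k x y) : Rel k (.sum .zero f) f
  | neg_sum {x y : Word} (f : Tm k x y) : Rel k (.sum (.smul (-1) f) f) .zero
  | smul_sum {x y : Word} (c : k) (f g : Tm k x y) :
      Rel k (.smul c (.sum f g)) (.sum (.smul c f) (.smul c g))
  | sum_smul {x y : Word} (c d : k) (f : Tm k x y) :
      Rel k (.smul (c + d) f) (.sum (.smul c f) (.smul d f))
  | mul_smul {x y : Word} (c d : k) (f : Tm k x y) :
      Rel k (.smul (c * d) f) (.smul c (.smul d f))
  | one_smul {x y : Word} (f : Tm k x y) : Rel k (.smul 1 f) f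
  /- composition and tensor product are bilinear -/
  | sum_comp {x y z : Word} (f f' : Tm k x y) (g : Tm k y z) :
      Rel k (.comp (.sum f f') g) (.sum (.comp f g) (.comp f' g))
  | comp_sum {x y z : Word} (f : Tm k x y) (g g' : Tm k y z) :
      Rel k (.comp f (.sum g g')) (.sum (.comp f g) (.comp f g'))
  | smul_comp {x y z : Word} (c : k) (f : Tm k x y) (g : Tm k y z) :
      Rel k (.comp (.smul c f) g) (.smul c (.comp f g))
  | comp_smul {x y z : Word} (c : k) (f : Tm k x y) (g : Tm k y z) :
      Rel k (.comp f (.smul c g)) (.smul c (.comp f g))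
  | sum_tens {x y x' y' : Word} (f f' : Tm k x y) (g : Tm k x' y') :
      Rel k (.tens (.sum f f') g) (.sum (.tens f g) (.tens f' g))
  | tens_sum {x y x' y' : Word} (f : Tm k x y) (g g' : Tm k x' y') :
      Rel k (.tens f (.sum g g')) (.sum (.tens f g) (.tens f g'))
  | smul_tens {x y x' y' : Word} (c : k) (f : Tm k x y) (g : Tm k x' y') :
      Rel k (.tens (.smul c f) g) (.smul c (.tens f g))
  | tens_smul {x y x' y' : Word} (c : k) (f : Tm k x y) (g : Tm k x' y') :
      Rel k (.tens f (.smul c g)) (.smul c (.tens f g))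
  /- category -/
  | one_comp {x y : Word} (f : Tm k x y) : Rel k (.comp (.cast rfl) f) f
  | comp_one {x y : Word} (f : Tm k x y) : Rel k (.comp f (.cast rfl)) f
  | comp_assoc {x y z w : Word} (f : Tm k x y) (g : Tm k y z) (h : Tm k z w) :
      Rel k (.comp (.comp f g) h) (.comp f (.comp g h))
  /- the tensor product is functorial, with the super-interchange law -/
  | one_tens_one (x y : Word) : Rel k (.tens (one k x) (one k y)) (one k (x ++ y))
  | interchange {x y z x' y' z' : Word} {p q : ZMod 2} {f : Tm k x y} (g : Tm k x' y')
      (h : Tm k y z) {l : Tm k y' z'} : Homog p f → Homog q l →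
      Rel k (.comp (.tens f g) (.tens h l))
        (.smul (sgn k (q * p)) (.tens (.comp f h) (.comp g l)))
  /- the tensor product is strictly associative and unital -/
  | tens_assoc {x y x' y' x'' y'' : Word} (f : Tm k x y) (g : Tm k x' y') (h : Tm k x'' y'') :
      Rel k (.comp (.tens (.tens f g) h) (.cast (List.append_assoc y y' y'')))
        (.comp (.cast (List.append_assoc x x' x'')) (.tens f (.tens g h)))
  | one_tens {x y : Word} (f : Tm k x y) :
      Rel k (.comp (.tens (one k []) f) (.cast (List.nil_append y)))
        (.comp (.cast (List.nil_append x)) f)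
  | tens_one {x y : Word} (f : Tm k x y) :
      Rel k (.comp (.tens f (one k [])) (.cast (List.append_nil y)))
        (.comp (.cast (List.append_nil x)) f)

section Signs

variable {k : Type u} [Field k]

theorem Homog.of_eq {x y : Word} {p q : ZMod 2} {f : Tm k x y} (h : Homog p f) (e : p = q) :
    Homog q f := e ▸ h

/-- The map with `f ↦ (-1)^{|f|} f`. -/
def inv : ∀ {x y : Word}, Tm k x y → Tm k x y
  | _, _, .gen g => .smul (sgn k g.par) (.gen g)
  | _, _, .cast h => .cast h
  | _, _, .comp f g => .comp (inv f) (inv g)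
  | _, _, .tens f g => .tens (inv f) (inv g)
  | _, _, .zero => .zero
  | _, _, .sum f g => .sum (inv f) (inv g)
  | _, _, .smul c f => .smul c (inv f)

theorem homog_inv {x y : Word} {p : ZMod 2} {f : Tm k x y} (h : Homog p f) : Homog p (inv f) := by
  induction h with
  | gen g => exact .smul _ (.gen g)
  | cast h => exact .cast h
  | comp _ _ h₁ h₂ => exact .comp h₁ h₂
  | tens _ _ h₁ h₂ => exact .tens h₁ h₂
  | zero p => exact .zero p
  | sum _ _ h₁ h₂ => exact .sum h₁ h₂
  | smul c _ h => exact .smul c h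

theorem Rel.smul_zero {x y : Word} (c : k) : Rel k (.smul c (.zero : Tm k x y)) .zero := by
  have h₀ : ∀ f : Tm k x y, Rel k (.smul 0 f) .zero := fun f => by
    have h := Rel.sum_smul (-1) 1 f
    rw [neg_add_cancel] at h
    exact h.trans ((Rel.sum (.refl _) (.one_smul f)).trans (.neg_sum f))
  have h₁ := (Rel.mul_smul c 0 (.zero : Tm k x y)).symm
  rw [mul_zero] at h₁
  exact ((Rel.smul c (h₀ .zero)).symm.trans h₁).trans (h₀ _)

theorem Rel.smul_comm {x y : Word} (c d : k) (f : Tm k x y) :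
    Rel k (.smul c (.smul d f)) (.smul d (.smul c f)) := by
  refine (Rel.mul_smul c d f).symm.trans ?_
  rw [mul_comm]
  exact Rel.mul_smul d c f

theorem inv_rel {x y : Word} {p : ZMod 2} {f : Tm k x y} (h : Homog p f) :
    Rel k (inv f) (.smul (sgn k p) f) := by
  induction h with
  | gen g => exact .refl _
  | cast h =>
    rw [sgn_zero]
    exact (Rel.one_smul _).symm
  | @comp x y z p q f g _ _ h₁ h₂ =>
    rw [sgn_add]
    exact (Rel.comp h₁ h₂).trans ((Rel.smul_comp _ _ _).trans
      ((Rel.smul _ (Rel.comp_smul _ _ _)).trans (Rel.mul_smul _ _ _).symm))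
  | @tens x y x' y' p q f g _ _ h₁ h₂ =>
    rw [sgn_add]
    exact (Rel.tens h₁ h₂).trans ((Rel.smul_tens _ _ _).trans
      ((Rel.smul _ (Rel.tens_smul _ _ _)).trans (Rel.mul_smul _ _ _).symm))
  | zero p => exact (Rel.smul_zero _).symm
  | sum _ _ h₁ h₂ => exact (Rel.sum h₁ h₂).trans (Rel.smul_sum _ _ _).symm
  | smul c _ h => exact (Rel.smul c h).trans (Rel.smul_comm _ _ _)

theorem Homog.one (x : Word) : Homog 0 (one k x) := .cast rfl

theorem Homog.seq {x y y' z : Word} {p q : ZMod 2} {f : Tm k x y} {g : Tm k y' z} (h : y = y')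
    (hf : Homog p f) (hg : Homog q g) : Homog (p + q) (seq f g h) := by
  have := Homog.comp hf (Homog.comp (Homog.cast h) hg)
  rwa [zero_add] at this

theorem Homog.bigSum {x y : Word} {p : ZMod 2} {f : ℕ → Tm k x y} (h : ∀ i, Homog p (f i)) (m : ℕ) :
    Homog p (bigSum m f) := by
  induction m with
  | zero => exact .zero p
  | succ m ih => exact .sum ih (h m)

theorem Homog.split (a b c : ℕ) (h : a + b = c) : Homog 0 (split k a b c h) := .gen (.split a b c h)

theorem Homog.merge (a b c : ℕ) (h : a + b = c) : Homog 0 (merge k a b c h) := .gen (.merge a b c h)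

theorem Homog.lcap (a : ℕ) : Homog 0 (lcap k a) := .gen (.lcap a)

theorem Homog.lcup (a : ℕ) : Homog 0 (lcup k a) := .gen (.lcup a)

theorem Homog.rcross (a b : ℕ) : Homog 0 (rcross k a b) := .gen (.cross a b)

theorem Homog.ucap : Homog 1 (ucap k) := .comp (.tens (.gen .tagIn) (.one _)) (.lcap 1)

theorem Homog.ucup : Homog 1 (ucup k) := .comp (.lcup 1) (.tens (.one _) (.gen .tagOut))

theorem Homog.antenna : Homog 1 (antenna k) := .smul _ (.comp (.split _ _ _ _) .ucap)

theorem Homog.rungR (a b s a' b' : ℕ) : Homog 0 (rungR k a b s a' b') := by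
  unfold Tm.rungR
  split_ifs
  · exact .seq _ (.tens (.split _ _ _ _) (.one _)) (.tens (.one _) (.merge _ _ _ _))
  · exact .zero 0

theorem Homog.rungL (a b s a' b' : ℕ) : Homog 0 (rungL k a b s a' b') := by
  unfold Tm.rungL
  split_ifs
  · exact .seq _ (.tens (.one _) (.split _ _ _ _)) (.tens (.merge _ _ _ _) (.one _))
  · exact .zero 0

theorem Homog.capRung (a b a' b' : ℕ) : Homog 1 (capRung k a b a' b') := by
  unfold Tm.capRung
  split_ifs
  · exact .seq _ (.tens (.split _ _ _ _) (.split _ _ _ _)) (.tens (.one _) (.tens .ucap (.one _)))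
  · exact .zero 1

theorem Homog.cupRung (a b a' b' : ℕ) : Homog 1 (cupRung k a b a' b') := by
  unfold Tm.cupRung
  split_ifs
  · exact .seq _ (.tens (.one _) (.tens .ucup (.one _))) (.tens (.merge _ _ _ _) (.merge _ _ _ _))
  · exact .zero 1

theorem Homog.antR (a b a' : ℕ) : Homog 1 (antR k a b a') := by
  unfold Tm.antR
  split_ifs
  · exact .seq _ (.tens (.split _ _ _ _) (.one _)) (.tens (.one _) (.tens .antenna (.one _)))
  · exact .zero 1

theorem Homog.antL (a b b' : ℕ) : Homog 1 (antL k a b b') := by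
  unfold Tm.antL
  split_ifs
  · exact .seq _ (.tens (.one _) (.split _ _ _ _)) (.tens (.one _) (.tens .antenna (.one _)))
  · exact .zero 1

theorem Homog.ucross (a b : ℕ) : Homog 0 (ucross k a b) := by
  refine .bigSum (fun s => ?_) _
  split_ifs
  · exact .smul _ (.comp (.rungR _ _ _ _ _) (.rungL _ _ _ _ _))
  · exact .zero 0

theorem Homog.lcross (a b : ℕ) : Homog 0 (lcross k a b) :=
  .comp (.cast _) (.seq _ (.tens (.tens (.one _) (.one _)) (.lcup a))
    (.seq _ (.tens (.one _) (.tens (.ucross b a) (.one _)))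
      (.tens (.lcap a) (.tens (.one _) (.one _)))))

/-- The defining relations are homogeneous. -/
theorem DefRel.homog {x y : Word} {f g : Tm k x y} (h : DefRel k f g) :
    ∃ p, Homog p f ∧ Homog p g := by
  have two : (1 : ZMod 2) + 1 = 0 := by decide
  cases h with
  | split_right_zero a => exact ⟨0, .split _ _ _ _, .cast _⟩
  | split_left_zero a => exact ⟨0, .split _ _ _ _, .cast _⟩
  | merge_right_zero a => exact ⟨0, .merge _ _ _ _, .cast _⟩
  | merge_left_zero a => exact ⟨0, .merge _ _ _ _, .cast _⟩
  | lcap_zero => exact ⟨0, .lcap _, .cast _⟩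
  | lcup_zero => exact ⟨0, .lcup _, .cast _⟩
  | cross_right_zero a => exact ⟨0, .rcross _ _, .cast _⟩
  | cross_left_zero a => exact ⟨0, .rcross _ _, .cast _⟩
  | split_assoc a b c =>
    exact ⟨0, .seq _ (.comp (.split _ _ _ _) (.tens (.split _ _ _ _) (.one _))) (.cast _),
      .comp (.split _ _ _ _) (.tens (.one _) (.split _ _ _ _))⟩
  | merge_assoc a b c =>
    exact ⟨0, .comp (.tens (.merge _ _ _ _) (.one _)) (.merge _ _ _ _),
      .seq _ (.cast _) (.comp (.tens (.one _) (.merge _ _ _ _)) (.merge _ _ _ _))⟩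
  | rung_swap a b r s c d =>
    exact ⟨0, .comp (.rungR _ _ _ _ _) (.rungL _ _ _ _ _),
      .bigSum (fun t => .smul _ (.comp (.rungL _ _ _ _ _) (.rungR _ _ _ _ _))) _⟩
  | straight_left =>
    exact ⟨0, (Homog.seq _ (.tens .ucup (.one _)) (.tens (.one _) .ucap)).of_eq two, .cast _⟩
  | straight_right =>
    exact ⟨0, .cast _,
      .smul _ ((Homog.seq _ (.tens (.one _) .ucup) (.tens .ucap (.one _))).of_eq two)⟩
  | antenna_retract => exact ⟨1, .comp (.merge _ _ _ _) .antenna, .ucap⟩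
  | cap_rung_right a b r c d =>
    refine ⟨1, .comp (.rungR _ _ _ _ _) (.capRung _ _ _ _),
      .sum (.comp (.capRung _ _ _ _) (.rungR _ _ _ _ _)) (.smul _ ?_)⟩
    split_ifs
    · exact .comp (.antR _ _ _) (.rungR _ _ _ _ _)
    · exact .zero 1
  | cap_rung_left a b r c d =>
    refine ⟨1, .comp (.rungL _ _ _ _ _) (.capRung _ _ _ _),
      .sum (.comp (.capRung _ _ _ _) (.rungL _ _ _ _ _)) (.smul _ ?_)⟩
    split_ifs
    · exact .comp (.antL _ _ _) (.rungL _ _ _ _ _)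
    · exact .zero 1
  | cup_rung_right a b r c d =>
    exact ⟨1, .comp (.cupRung _ _ _ _) (.rungR _ _ _ _ _),
      .comp (.rungR _ _ _ _ _) (.cupRung _ _ _ _)⟩
  | cup_rung_left a b r c d =>
    exact ⟨1, .comp (.cupRung _ _ _ _) (.rungL _ _ _ _ _),
      .comp (.rungL _ _ _ _ _) (.cupRung _ _ _ _)⟩
  | left_straight_up a =>
    exact ⟨0, .seq _ (.tens (.lcup _) (.one _)) (.tens (.one _) (.lcap _)), .cast _⟩
  | left_straight_down a =>
    exact ⟨0, .seq _ (.tens (.one _) (.lcup _)) (.tens (.lcap _) (.one _)), .cast _⟩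
  | cross_inv_left a b => exact ⟨0, .comp (.lcross _ _) (.rcross _ _), .cast _⟩
  | cross_inv_right a b => exact ⟨0, .comp (.rcross _ _) (.lcross _ _), .cast _⟩
  | bubble a =>
    exact ⟨0, .comp (.lcup _) (.comp (.rcross _ _) (.lcap _)), .zero 0⟩

theorem Rel.inv {x y : Word} {f g : Tm k x y} (h : Rel k f g) : Rel k f.inv g.inv := by
  induction h with
  | of h =>
    obtain ⟨p, hf, hg⟩ := h.homog
    exact (inv_rel hf).trans ((Rel.smul _ (.of h)).trans (inv_rel hg).symm)
  | refl f => exact .refl _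
  | symm _ h => exact h.symm
  | trans _ _ h₁ h₂ => exact h₁.trans h₂
  | comp _ _ h₁ h₂ => exact .comp h₁ h₂
  | tens _ _ h₁ h₂ => exact .tens h₁ h₂
  | sum _ _ h₁ h₂ => exact .sum h₁ h₂
  | smul c _ h => exact .smul c h
  | sum_assoc f g h => exact .sum_assoc _ _ _
  | sum_comm f g => exact .sum_comm _ _
  | zero_sum f => exact .zero_sum _
  | neg_sum f => exact .neg_sum _
  | smul_sum c f g => exact .smul_sum _ _ _
  | sum_smul c d f => exact .sum_smul _ _ _
  | mul_smul c d f => exact .mul_smul _ _ _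
  | one_smul f => exact .one_smul _
  | sum_comp f f' g => exact .sum_comp _ _ _
  | comp_sum f g g' => exact .comp_sum _ _ _
  | smul_comp c f g => exact .smul_comp _ _ _
  | comp_smul c f g => exact .comp_smul _ _ _
  | sum_tens f f' g => exact .sum_tens _ _ _
  | tens_sum f g g' => exact .tens_sum _ _ _
  | smul_tens c f g => exact .smul_tens _ _ _
  | tens_smul c f g => exact .tens_smul _ _ _
  | one_comp f => exact .one_comp _
  | comp_one f => exact .comp_one _
  | comp_assoc f g h => exact .comp_assoc _ _ _
  | one_tens_one x y => exact .one_tens_one x y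
  | interchange g h hf hl => exact .interchange _ _ (homog_inv hf) (homog_inv hl)
  | tens_assoc f g h => exact .tens_assoc _ _ _
  | one_tens f => exact .one_tens _
  | tens_one f => exact .tens_one _

end Signs

end Tm

section WebCategory

variable (k : Type u) [Field k]

/-- The equivalence of formal linear combinations of diagrams. -/
instance Tm.setoid (x y : Word) : Setoid (Tm k x y) :=
  ⟨Tm.Rel k, Tm.Rel.refl, Tm.Rel.symm, Tm.Rel.trans⟩

/-- The morphisms between two words in the category of oriented webs: the formal linear
combinations of diagrams modulo the relations. -/
def WebHom (x y : Word) : Type u := Quotient (Tm.setoid k x y)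

/-- The objects of the category of oriented webs of type P over `k`, which are the words in the
`↑_a` and `↓_a`. -/
structure PWebUD (_k : Type u) : Type where
  word : Word

variable {k}

namespace PWebUD

/-- The morphism represented by a formal linear combination of diagrams. -/
def diag {x y : Word} (f : Tm k x y) : WebHom k x y := Quotient.mk (Tm.setoid k x y) f

theorem diag_eq {x y : Word} {f g : Tm k x y} (h : Tm.Rel k f g) : diag f = diag g := Quotient.sound h

theorem diag_surjective {x y : Word} (f : WebHom k x y) : ∃ t : Tm k x y, diag t = f :=
  Quotient.exists_rep f

/-- Composition. -/
def compHom {x y z : Word} : WebHom k x y → WebHom k y z → WebHom k x z :=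
  Quotient.map₂ Tm.comp fun _ _ h _ _ h' => Tm.Rel.comp h h'

/-- Tensor product. -/
def tensHom {x y x' y' : Word} : WebHom k x y → WebHom k x' y' →
    WebHom k (x ++ x' : Word) (y ++ y' : Word) :=
  Quotient.map₂ Tm.tens fun _ _ h _ _ h' => Tm.Rel.tens h h'

instance (x y : Word) : Add (WebHom k x y) :=
  ⟨Quotient.map₂ Tm.sum fun _ _ h _ _ h' => Tm.Rel.sum h h'⟩

instance (x y : Word) : Zero (WebHom k x y) := ⟨diag .zero⟩

instance (x y : Word) : Neg (WebHom k x y) :=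
  ⟨Quotient.map (Tm.smul (-1)) fun _ _ h => Tm.Rel.smul (-1) h⟩

instance (x y : Word) : AddCommGroup (WebHom k x y) where
  add_assoc := by rintro ⟨f⟩ ⟨g⟩ ⟨h⟩; exact diag_eq (.sum_assoc f g h)
  add_comm := by rintro ⟨f⟩ ⟨g⟩; exact diag_eq (.sum_comm f g)
  zero_add := by rintro ⟨f⟩; exact diag_eq (.zero_sum f)
  add_zero := by rintro ⟨f⟩; exact diag_eq ((Tm.Rel.sum_comm _ _).trans (.zero_sum f))
  neg_add_cancel := by rintro ⟨f⟩; exact diag_eq (.neg_sum f)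
  nsmul := nsmulRec
  zsmul := zsmulRec

instance (x y : Word) : Module k (WebHom k x y) where
  smul c := Quotient.map (Tm.smul c) fun _ _ h => Tm.Rel.smul c h
  one_smul := by rintro ⟨f⟩; exact diag_eq (.one_smul f)
  mul_smul := by rintro c d ⟨f⟩; exact diag_eq (.mul_smul c d f)
  smul_zero c := diag_eq (Tm.Rel.smul_zero c)
  smul_add := by rintro c ⟨f⟩ ⟨g⟩; exact diag_eq (.smul_sum c f g)
  add_smul := by rintro c d ⟨f⟩; exact diag_eq (.sum_smul c d f)
  zero_smul := by
    rintro ⟨f⟩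
    refine diag_eq ?_
    have h := Tm.Rel.sum_smul (-1) 1 f
    rw [neg_add_cancel] at h
    exact h.trans ((Tm.Rel.sum (.refl _) (.one_smul f)).trans (.neg_sum f))

theorem diag_sum {x y : Word} (f g : Tm k x y) : diag (.sum f g) = diag f + diag g := rfl

theorem diag_smul {x y : Word} (c : k) (f : Tm k x y) : diag (.smul c f) = c • diag f := rfl

instance : Category (PWebUD k) where
  Hom x y := WebHom k x.word y.word
  id x := diag (Tm.one k x.word)
  comp f g := compHom f g
  id_comp := by rintro x y ⟨f⟩; exact diag_eq (.one_comp f)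
  comp_id := by rintro x y ⟨f⟩; exact diag_eq (.comp_one f)
  assoc := by rintro x y z w ⟨f⟩ ⟨g⟩ ⟨h⟩; exact diag_eq (.comp_assoc f g h)

instance : Preadditive (PWebUD k) where
  homGroup x y := inferInstanceAs (AddCommGroup (WebHom k x.word y.word))
  add_comp := by rintro x y z ⟨f⟩ ⟨f'⟩ ⟨g⟩; exact diag_eq (.sum_comp f f' g)
  comp_add := by rintro x y z ⟨f⟩ ⟨g⟩ ⟨g'⟩; exact diag_eq (.comp_sum f g g')

instance : Linear k (PWebUD k) where
  homModule x y := inferInstanceAs (Module k (WebHom k x.word y.word))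
  smul_comp := by rintro x y z c ⟨f⟩ ⟨g⟩; exact diag_eq (.smul_comp c f g)
  comp_smul := by rintro x y z ⟨f⟩ c ⟨g⟩; exact diag_eq (.comp_smul c f g)

/-- The morphisms of parity `p`. -/
def homParity (x y : Word) (p : ZMod 2) : Submodule k (WebHom k x y) where
  carrier := {f | ∃ t, Tm.Homog p t ∧ diag t = f}
  add_mem' := by
    rintro _ _ ⟨f, hf, rfl⟩ ⟨g, hg, rfl⟩
    exact ⟨_, .sum hf hg, rfl⟩
  zero_mem' := ⟨_, .zero p, rfl⟩
  smul_mem' := by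
    rintro c _ ⟨f, hf, rfl⟩
    exact ⟨_, .smul c hf, rfl⟩

/-- The map with `f ↦ (-1)^{|f|} f`. -/
def invHom (x y : Word) : WebHom k x y →ₗ[k] WebHom k x y where
  toFun := Quotient.map Tm.inv fun _ _ h => Tm.Rel.inv h
  map_add' := by rintro ⟨f⟩ ⟨g⟩; rfl
  map_smul' := by rintro c ⟨f⟩; rfl

theorem exists_homog {x y : Word} (f : Tm k x y) :
    diag f ∈ homParity x y 0 ⊔ homParity (k := k) x y 1 := by
  have of_homog : ∀ {x y : Word} {p : ZMod 2} {f : Tm k x y}, Tm.Homog p f →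
      diag f ∈ homParity x y 0 ⊔ homParity (k := k) x y 1 := by
    intro x y p f h
    rcases zmod_cases p with rfl | rfl
    · exact Submodule.mem_sup_left ⟨f, h, rfl⟩
    · exact Submodule.mem_sup_right ⟨f, h, rfl⟩
  induction f with
  | gen g => exact of_homog (.gen g)
  | cast h => exact of_homog (.cast h)
  | zero => exact zero_mem _
  | sum f g hf hg => exact add_mem hf hg
  | smul c f hf => exact Submodule.smul_mem _ c hf
  | comp f g hf hg =>
    obtain ⟨_, ⟨f₀, hf₀, rfl⟩, _, ⟨f₁, hf₁, rfl⟩, ef⟩ := Submodule.mem_sup.1 hf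
    obtain ⟨_, ⟨g₀, hg₀, rfl⟩, _, ⟨g₁, hg₁, rfl⟩, eg⟩ := Submodule.mem_sup.1 hg
    have e : diag (.comp f g) = diag (.comp f₀ g₀) + diag (.comp f₀ g₁) +
        (diag (.comp f₁ g₀) + diag (.comp f₁ g₁)) := by
      have h : compHom (diag f) (diag g) = compHom (diag (.sum f₀ f₁)) (diag (.sum g₀ g₁)) := by
        rw [diag_sum, diag_sum, ef, eg]
      exact h.trans (diag_eq ((Tm.Rel.sum_comp _ _ _).trans
        (.sum (.comp_sum _ _ _) (.comp_sum _ _ _))))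
    rw [e]
    exact add_mem (add_mem (of_homog (.comp hf₀ hg₀)) (of_homog (.comp hf₀ hg₁)))
      (add_mem (of_homog (.comp hf₁ hg₀)) (of_homog (.comp hf₁ hg₁)))
  | tens f g hf hg =>
    obtain ⟨_, ⟨f₀, hf₀, rfl⟩, _, ⟨f₁, hf₁, rfl⟩, ef⟩ := Submodule.mem_sup.1 hf
    obtain ⟨_, ⟨g₀, hg₀, rfl⟩, _, ⟨g₁, hg₁, rfl⟩, eg⟩ := Submodule.mem_sup.1 hg
    have e : diag (.tens f g) = diag (.tens f₀ g₀) + diag (.tens f₀ g₁) +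
        (diag (.tens f₁ g₀) + diag (.tens f₁ g₁)) := by
      have h : tensHom (diag f) (diag g) = tensHom (diag (.sum f₀ f₁)) (diag (.sum g₀ g₁)) := by
        rw [diag_sum, diag_sum, ef, eg]
      exact h.trans (diag_eq ((Tm.Rel.sum_tens _ _ _).trans
        (.sum (.tens_sum _ _ _) (.tens_sum _ _ _))))
    rw [e]
    exact add_mem (add_mem (of_homog (.tens hf₀ hg₀)) (of_homog (.tens hf₀ hg₁)))
      (add_mem (of_homog (.tens hf₁ hg₀)) (of_homog (.tens hf₁ hg₁)))

theorem diag_cast_comp {x y z : Word} (h : x = y) (h' : y = z) :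
    diag (k := k) (.comp (.cast h) (.cast h')) = diag (.cast (h.trans h')) := by
  subst h
  exact diag_eq (.one_comp _)

theorem diag_cast_tens {x y x' y' : Word} (h : x = y) (h' : x' = y') :
    diag (k := k) (.tens (.cast h) (.cast h')) = diag (.cast (congrArg₂ _ h h')) := by
  subst h h'
  exact diag_eq (.one_tens_one _ _)

/-- Equal words are isomorphic. -/
def castIso {x y : Word} (h : x = y) : (⟨x⟩ : PWebUD k) ≅ ⟨y⟩ where
  hom := diag (.cast h)
  inv := diag (.cast h.symm)
  hom_inv_id := diag_cast_comp h h.symm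
  inv_hom_id := diag_cast_comp h.symm h

/-- The tensor product of morphisms, as a bilinear map. -/
def tensLin {x y x' y' : Word} : WebHom k x y →ₗ[k] WebHom k x' y' →ₗ[k]
    WebHom k (x ++ x' : Word) (y ++ y' : Word) :=
  LinearMap.mk₂ k tensHom
    (by rintro ⟨f⟩ ⟨f'⟩ ⟨g⟩; exact diag_eq (.sum_tens f f' g))
    (by rintro c ⟨f⟩ ⟨g⟩; exact diag_eq (.smul_tens c f g))
    (by rintro ⟨f⟩ ⟨g⟩ ⟨g'⟩; exact diag_eq (.tens_sum f g g'))
    (by rintro c ⟨f⟩ ⟨g⟩; exact diag_eq (.tens_smul c f g))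

variable [NeZero (2 : k)]

instance : Supercategory k (PWebUD k) where
  parity x y := homParity x.word y.word
  isCompl x y := by
    refine PMod.isCompl_of_parity (M := WebHom k x.word y.word) (invHom x.word y.word)
      (homParity x.word y.word) ?_ ?_
    · rintro p _ ⟨f, hf, rfl⟩
      exact diag_eq (Tm.inv_rel hf)
    · rintro ⟨f⟩
      exact exists_homog f
  id_mem x := ⟨_, .one x.word, rfl⟩
  comp_mem := by
    rintro x y z p q _ _ ⟨f, hf, rfl⟩ ⟨g, hg, rfl⟩
    exact ⟨_, .comp hf hg, rfl⟩

instance : MonoidalSupercategory k (PWebUD k) where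
  tensorObj x y := ⟨x.word ++ y.word⟩
  tensorHom := tensLin
  tensorHom_mem := by
    rintro x y x' y' p q _ _ ⟨f, hf, rfl⟩ ⟨g, hg, rfl⟩
    exact ⟨_, .tens hf hg, rfl⟩
  tensorHom_id x y := diag_eq (.one_tens_one x.word y.word)
  interchange := by
    rintro x y z x' y' z' p q _ ⟨g⟩ ⟨h⟩ _ ⟨f, hf, rfl⟩ ⟨l, hl, rfl⟩
    exact diag_eq (.interchange g h hf hl)
  unit := ⟨[]⟩
  assoc x y z := castIso (List.append_assoc x.word y.word z.word)
  lunit x := castIso (List.nil_append x.word)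
  runit x := castIso (List.append_nil x.word)
  assoc_mem _ _ _ := ⟨_, .cast _, rfl⟩
  lunit_mem _ := ⟨_, .cast _, rfl⟩
  runit_mem _ := ⟨_, .cast _, rfl⟩
  assoc_naturality := by
    rintro x y x' y' x'' y'' ⟨f⟩ ⟨g⟩ ⟨h⟩
    exact diag_eq (.tens_assoc f g h)
  lunit_naturality := by
    rintro x y ⟨f⟩
    exact diag_eq (.one_tens f)
  runit_naturality := by
    rintro x y ⟨f⟩
    exact diag_eq (.tens_one f)
  pentagon := by
    rintro ⟨x⟩ ⟨y⟩ ⟨z⟩ ⟨w⟩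
    have e₁ := diag_cast_tens (k := k) (List.append_assoc x y z) (rfl : w = w)
    have e₂ := diag_cast_tens (k := k) (rfl : x = x) (List.append_assoc y z w)
    change compHom (diag (.tens (.cast (List.append_assoc x y z)) (.cast (rfl : w = w))))
      (compHom (diag (.cast (List.append_assoc x (y ++ z) w)))
        (diag (.tens (.cast (rfl : x = x)) (.cast (List.append_assoc y z w))))) =
      compHom (diag (.cast (List.append_assoc (x ++ y) z w)))
        (diag (.cast (List.append_assoc x y (z ++ w))))
    rw [e₁, e₂]
    exact (congrArg (compHom _) (diag_cast_comp _ _)).trans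
      ((diag_cast_comp _ _).trans (diag_cast_comp _ _).symm)
  triangle := by
    rintro ⟨x⟩ ⟨y⟩
    have e₁ := diag_cast_tens (k := k) (rfl : x = x) (List.nil_append y)
    have e₂ := diag_cast_tens (k := k) (List.append_nil x) (rfl : y = y)
    change compHom (diag (.cast (List.append_assoc x [] y)))
        (diag (.tens (.cast (rfl : x = x)) (.cast (List.nil_append y)))) =
      diag (.tens (.cast (List.append_nil x)) (.cast (rfl : y = y)))
    rw [e₁, e₂]
    exact diag_cast_comp _ _

variable (k)

/-- The object `↑_a`. -/
def up (a : ℕ) : PWebUD k := ⟨TypeP.up a⟩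

/-- The object `↓_a`. -/
def down (a : ℕ) : PWebUD k := ⟨TypeP.down a⟩

/-- The upward split. -/
def split (a b : ℕ) : up k (a + b) ⟶ tensorObj k (up k a) (up k b) :=
  diag (Tm.split k a b (a + b) rfl)

/-- The upward merge. -/
def merge (a b : ℕ) : tensorObj k (up k a) (up k b) ⟶ up k (a + b) :=
  diag (Tm.merge k a b (a + b) rfl)

/-- The leftward cap. -/
def lcap (a : ℕ) : tensorObj k (down k a) (up k a) ⟶ unit k := diag (Tm.lcap k a)

/-- The leftward cup. -/
def lcup (a : ℕ) : unit k ⟶ tensorObj k (up k a) (down k a) := diag (Tm.lcup k a)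

/-- The tag-in. -/
def tagIn : up k 1 ⟶ down k 1 := diag (.gen .tagIn)

/-- The tag-out. -/
def tagOut : down k 1 ⟶ up k 1 := diag (.gen .tagOut)

/-- The rightward crossing. -/
def rcross (a b : ℕ) : tensorObj k (up k a) (down k b) ⟶ tensorObj k (down k b) (up k a) :=
  diag (Tm.rcross k a b)

end PWebUD

end WebCategory

/-! ## The basic module homomorphisms -/

section BasicMaps

variable {k : Type u} [Field k] [NeZero (2 : k)] {n : ℕ}

/-- The value of a functional at an element of `S^a(V_n)`. -/
def symEval {a : ℕ} (f : (symObj k n a).dual.carrier) (x : (symObj k n a).carrier) : k :=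
  (show Module.Dual k (symObj k n a).carrier from f) x

/-- The product `x_{t_1} ⋯ x_{t_a}` for `T = {t_1 < ⋯ < t_a}`. -/
def subProd {m a : ℕ} (x : Fin m → NatV k n) (T : Finset (Fin m)) (h : T.card = a) :
    (symObj k n a).carrier :=
  symProd fun i => x (T.orderEmbOfFin h i)

/-- The sign `(-1)^{ε(T, U)}`, where `U` is the complement of `T` and `ε(T, U)` is the number of
the pairs `(t, u) ∈ T × U` with `t > u` and with both elements odd. -/
def splSign (k : Type u) [Field k] {m : ℕ} (p : Fin m → ZMod 2) (T : Finset (Fin m)) : k :=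
  (-1) ^ ((T ×ˢ Tᶜ).filter fun z => z.2 < z.1 ∧ p z.1 = 1 ∧ p z.2 = 1).card

/-- `f` is the split: `x_1 ⋯ x_{a+b} ↦ ∑ (-1)^{ε(T, U)} x_T ⊗ x_U` for homogeneous `x_i`, where the
sum is over the partitions of `{1, …, a + b}` into a set `T` of size `a` and a set `U` of size
`b`. -/
def IsSpl (a b : ℕ)
    (f : ModSS.sym k n (a + b) ⟶ tensorObj k (ModSS.sym k n a) (ModSS.sym k n b)) : Prop :=
  ∀ (x : Fin (a + b) → NatV k n) (p : Fin (a + b) → ZMod 2), (∀ i, x i ∈ natGrade k n (p i)) →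
    ModSS.lin f (symProd x) = ∑ T : {T : Finset (Fin (a + b)) // T.card = a},
      splSign k p T.1 • PMod.tm (subProd x T.1 T.2)
        (subProd x T.1ᶜ (by rw [Finset.card_compl, Fintype.card_fin, T.2, Nat.add_sub_cancel_left]))

/-- `f` is the merge: `x ⊗ y ↦ x y`. -/
def IsMer (a b : ℕ)
    (f : tensorObj k (ModSS.sym k n a) (ModSS.sym k n b) ⟶ ModSS.sym k n (a + b)) : Prop :=
  ∀ (x : (symObj k n a).carrier) (y : (symObj k n b).carrier),
    ModSS.lin f (PMod.tm x y) = symMul x y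

/-- `f` is the evaluation: `φ ⊗ x ↦ φ(x)`. -/
def IsEval (a : ℕ)
    (f : tensorObj k (ModSS.symDual k n a) (ModSS.sym k n a) ⟶ unit k) : Prop :=
  ∀ (φ : (symObj k n a).dual.carrier) (x : (symObj k n a).carrier),
    ModSS.lin f (PMod.tm φ x) = symEval φ x • PMod.trivOne

/-- The canonical element of `S^a(V_n) ⊗ S^a(V_n)^*`, the sum of the `x ⊗ x^*` over a basis. -/
def canonElt (k : Type u) [Field k] [NeZero (2 : k)] (n a : ℕ) :
    ((symObj k n a).tensor (symObj k n a).dual).carrier :=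
  coevaluation k (SymPow k n a) 1

/-- `f` is the coevaluation: `1 ↦ ∑ x ⊗ x^*`. -/
def IsCoeval (a : ℕ)
    (f : unit k ⟶ tensorObj k (ModSS.sym k n a) (ModSS.symDual k n a)) : Prop :=
  ModSS.lin f PMod.trivOne = canonElt k n a

/-- `f` is the isomorphism `D : V_n → V_n^*`, `v ↦ (v, -)`. -/
def IsD (f : ModSS.sym k n 1 ⟶ ModSS.symDual k n 1) : Prop :=
  ∀ v w : NatV k n, symEval (ModSS.lin f (symProd fun _ : Fin 1 => v))
    (symProd fun _ : Fin 1 => w) = form k n v w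

/-- `f` is the tensor swap: `x ⊗ φ ↦ (-1)^{|x||φ|} φ ⊗ x` for homogeneous `x` and `φ`. -/
def IsSwap (a b : ℕ)
    (f : tensorObj k (ModSS.sym k n a) (ModSS.symDual k n b) ⟶
      tensorObj k (ModSS.symDual k n b) (ModSS.sym k n a)) : Prop :=
  ∀ (p q : ZMod 2), ∀ x ∈ (symObj k n a).grade p, ∀ φ ∈ (symObj k n b).dual.grade q,
    ModSS.lin f (PMod.tm x φ) = sgn k (p * q) • PMod.tm φ x

end BasicMaps

end

end TypeP

open TypeP TypeP.Supercategory TypeP.MonoidalSupercategory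

/-! The category of webs is presented by generators and relations, and the supermodules already form
a monoidal supercategory. A superfunctor therefore exists as soon as the chosen images of the
generators are homomorphisms of the right parity and satisfy the defining relations. `ev` extends
the choice to all formal diagrams, `ev_rel` disposes of the axioms of a monoidal supercategory, and
`el_defRel` collects the defining relations.

The relations between upward strands are checked inside `S(V) ⊗ S(V)`, which contains every `S^a(V)
⊗ S^b(V)` (`jT_injective`). This space is generated from `1 ⊗ 1` by the operators `X_v` and `Y_v` of
multiplication by `v` in the first and in the second copy, the latter with the Koszul sign. The
comultiplication is the algebra homomorphism `v ↦ X_v + t Y_v`, and each ladder operator has a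
simple commutation rule with `X_v` and `Y_v`. In coordinates the rungs are the divided powers of `∑
y ∂/∂x` and `∑ x ∂/∂y`, the cap is a contraction `∂/∂x ∂/∂y` along the form, the antenna is half of
such a contraction within one strand, and the cup is multiplication by an invariant element. Every
relation between such operators follows by induction along the generation by `X_v`, `Y_v`. No
factorials are inverted, so the characteristic matters only through `2`.

The rung swap `opL_opR` is the commutation rule of divided powers for the action of `gl_2` on `S(V)
⊗ S(V)`; its induction steps are Pascal's rule. The alternating sum of ladders telescopes to an
operator which carries `X_v` to `Y_v`, so it is the super swap (`opCross_eq_swapT`). In the cap/rung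
relations `opC_opR` and `opC_opL` the commutator of a cap with a rung is a double contraction on one
strand, that is, twice an antenna. The cup commutes with rungs because `∑ ± v_i v_{-i}` vanishes in
`S(V)`.

The relations with downward strands are the duality of a finite-dimensional space. They are verified
through `M ⊗ M^* → End M`, which is injective and sends the canonical element to the identity. The
leftward crossing becomes a swap as well, hence inverse to the rightward one. The bubble is the
supertrace of the identity of `S^a(V)`. Its vanishing for `a > 0` reflects the generating function
`((1 - t)/(1 - t))^n = 1` of the superdimensions. The proof `trace_symParity` removes the pairs
`v_i`, `v_{-i}` one at a time by a Koszul homotopy that is valid in every characteristic other than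
`2`.

Equivariance comes from the same sources: `X_v` and `Y_v` are covariant in `v`, so the
comultiplication is equivariant (`comulR_symDer`), and `D` is an odd homomorphism because `𝔭(n)` is
defined by the invariance of an odd form (`form_typeP`).

Coherence is proved for right-nested tensor products with a trivial last factor, where concatenation
of elements is visibly associative, and is then transported to `wobj`. The latter drops the trivial
factor for words of length one, so that `↑_a` and `↓_a` have exactly the required values for `a >
0`. -/

namespace TypeP

noncomputable section

/-! ## Operators on `S(V) ⊗ S(V)` -/

section Operators

variable {k : Type u} [Field k] {n : ℕ}

/-- The projection of the natural module to its component of parity `p`. -/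
def natProj (p : ZMod 2) : NatV k n →ₗ[k] NatV k n where
  toFun v i := if i.par = p then v i else 0
  map_add' v w := by ext i; by_cases h : i.par = p <;> simp [h]
  map_smul' c v := by ext i; by_cases h : i.par = p <;> simp [h]

theorem natProj_mem (p : ZMod 2) (v : NatV k n) : natProj p v ∈ natGrade k n p :=
  fun _ hi => if_neg hi

theorem natProj_of_mem {p : ZMod 2} {v : NatV k n} (hv : v ∈ natGrade k n p) :
    natProj p v = v := by
  ext i
  by_cases h : i.par = p
  · exact if_pos h
  · exact (if_neg h).trans (hv i h).symm

theorem natProj_of_mem_ne {p q : ZMod 2} (hpq : p ≠ q) {v : NatV k n} (hv : v ∈ natGrade k n p) :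
    natProj q v = 0 := by
  ext i
  by_cases h : i.par = q
  · exact (if_pos h).trans (hv i (h ▸ hpq.symm))
  · exact if_neg h

theorem natProj_add (v : NatV k n) : natProj 0 v + natProj 1 v = v := by
  ext i
  rcases zmod_cases i.par with h | h <;> simp [natProj, h]

/-- Two linear maps on the natural module agree if they agree on homogeneous elements. -/
theorem nat_ext {M : Type v} [AddCommGroup M] [Module k M] {f g : NatV k n →ₗ[k] M}
    (h : ∀ p, ∀ v ∈ natGrade k n p, f v = g v) : f = g :=
  PMod.lin_ext (M := natMod k n) h

/-- A subspace of `S(V)` which contains `1` and is stable under the left multiplications by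
homogeneous elements of `V` is everything. -/
theorem symAlg_left_induction {C : SymAlg k n → Prop} (h₁ : C 1)
    (ha : ∀ a b, C a → C b → C (a + b)) (hs : ∀ (c : k) a, C a → C (c • a))
    (hm : ∀ p, ∀ v ∈ natGrade k n p, ∀ a, C a → C (symι k n v * a)) (a : SymAlg k n) : C a := by
  -- The general induction principle has a product step for two arbitrary elements. Stability of `C`
  -- under left multiplication by `a` passes through products, whereas `C a` itself need not.
  suffices h : ∀ b, C b → C (a * b) by simpa using h 1 h₁
  induction a using symAlg_induction with
  | h₀ c => intro b hb; rw [← Algebra.smul_def]; exact hs c b hb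
  | h₁ v =>
    intro b hb
    rw [← natProj_add v, map_add, add_mul]
    exact ha _ _ (hm 0 _ (natProj_mem 0 v) b hb) (hm 1 _ (natProj_mem 1 v) b hb)
  | ha x y hx hy => intro b hb; rw [add_mul]; exact ha _ _ (hx b hb) (hy b hb)
  | hm x y hx hy => intro b hb; rw [mul_assoc]; exact hx _ (hy b hb)

theorem one_mem_symPow : (1 : SymAlg k n) ∈ SymPow k n 0 := by
  rw [SymPow, pow_zero]
  exact Submodule.one_le.1 le_rfl

theorem symι_mul_mem {a : ℕ} (v : NatV k n) {x : SymAlg k n} (hx : x ∈ SymPow k n a) :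
    symι k n v * x ∈ SymPow k n (a + 1) := by
  rw [SymPow, pow_succ']
  exact Submodule.mul_mem_mul ⟨v, rfl⟩ hx

/-- The graded form of the preceding induction. The motive depends on the degree and on the proof of
membership because the multiplication step raises the degree by one. -/
theorem symPow_induction {C : ∀ (m : ℕ) (a : SymAlg k n), a ∈ SymPow k n m → Prop}
    (h₁ : C 0 1 one_mem_symPow)
    (ha : ∀ m a b ha hb, C m a ha → C m b hb → C m (a + b) (add_mem ha hb))
    (hs : ∀ m (c : k) a ha, C m a ha → C m (c • a) (Submodule.smul_mem _ c ha))
    (hm : ∀ m p, ∀ v ∈ natGrade k n p, ∀ a ha, C m a ha →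
      C (m + 1) (symι k n v * a) (symι_mul_mem v ha))
    {m : ℕ} {a : SymAlg k n} (h : a ∈ SymPow k n m) : C m a h := by
  induction m generalizing a with
  | zero =>
    have h' := h
    rw [SymPow, pow_zero] at h'
    obtain ⟨c, rfl⟩ := Submodule.mem_one.1 h'
    have := hs 0 c 1 one_mem_symPow h₁
    simpa only [Algebra.algebraMap_eq_smul_one] using this
  | succ m ih =>
    -- The membership proof is existentially quantified so that the induction over sums of products
    -- can supply its own; proof irrelevance identifies it with the given one.
    suffices h' : ∃ h'', C (m + 1) a h'' from h'.2
    rw [SymPow, pow_succ'] at h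
    induction h using Submodule.mul_induction_on' with
    | mem_mul_mem v hv y hy =>
      obtain ⟨v, rfl⟩ := hv
      have h₂ := ha _ _ _ _ _ (hm m 0 _ (natProj_mem 0 v) y hy (ih hy))
        (hm m 1 _ (natProj_mem 1 v) y hy (ih hy))
      simp only [← add_mul, ← map_add, natProj_add v] at h₂
      exact ⟨_, h₂⟩
    | add y _ z _ hy hz => exact ⟨_, ha _ _ _ _ _ hy.2 hz.2⟩

theorem symTw_symι_mul (q : ZMod 2) {p : ZMod 2} {v : NatV k n} (hv : v ∈ natGrade k n p)
    (x : SymAlg k n) : symTw q (symι k n v * x) = sgn k (q * p) • (symι k n v * symTw q x) := by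
  rw [map_mul, symTw_symι q hv, smul_mul_assoc]

theorem symTw_symTw (p q : ZMod 2) (a : SymAlg k n) : symTw p (symTw q a) = symTw q (symTw p a) := by
  rw [← symTw_add, add_comm, symTw_add]

theorem symTw_self (p : ZMod 2) (a : SymAlg k n) : symTw p (symTw p a) = a := by
  rw [← symTw_add, CharTwo.add_self_eq_zero, symTw_zero]

/-- Supercommutativity. -/
theorem mul_symι {p : ZMod 2} {v : NatV k n} (hv : v ∈ natGrade k n p) (x : SymAlg k n) :
    symTw p x * symι k n v = symι k n v * x := by
  induction x using symAlg_left_induction with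
  | h₁ => simp
  | ha a b ha hb => rw [map_add, add_mul, mul_add, ha, hb]
  | hs c a ha => rw [map_smul, smul_mul_assoc, mul_smul_comm, ha]
  | hm q w hw a ha =>
    rw [symTw_symι_mul p hw, smul_mul_assoc, mul_assoc, ha, ← mul_assoc, ← mul_assoc,
      symι_mul_comm hv hw, smul_mul_assoc]

/-- The space `S(V) ⊗ S(V)`. -/
abbrev SymT (k : Type u) [Field k] (n : ℕ) : Type u := SymAlg k n ⊗[k] SymAlg k n

variable (k n) in
/-- Left multiplication by elements of the first copy of `V`. -/
def opX : NatV k n →ₗ[k] Module.End k (SymT k n) :=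
  LinearMap.rTensorHom (SymAlg k n) ∘ₗ LinearMap.mul k (SymAlg k n) ∘ₗ symι k n

variable (k n) in
/-- Left multiplication by elements of the second copy of `V`, with the sign of the super
tensor product. -/
def opY : NatV k n →ₗ[k] Module.End k (SymT k n) :=
  ((TensorProduct.mapBilinear (.id k) _ _ _ _ (symTw 0).toLinearMap) ∘ₗ
    LinearMap.mul k (SymAlg k n) ∘ₗ symι k n ∘ₗ natProj 0) +
  ((TensorProduct.mapBilinear (.id k) _ _ _ _ (symTw 1).toLinearMap) ∘ₗ
    LinearMap.mul k (SymAlg k n) ∘ₗ symι k n ∘ₗ natProj 1)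

theorem opX_tmul (v : NatV k n) (x y : SymAlg k n) :
    opX k n v (x ⊗ₜ y) = (symι k n v * x) ⊗ₜ y := rfl

/-- Only one of the two parity components in `opY` survives for homogeneous `v`. The Koszul sign
`(-1)^{|v||x|}` is stored in `symTw p x`, so `x` need not be homogeneous. -/
theorem opY_tmul {p : ZMod 2} {v : NatV k n} (hv : v ∈ natGrade k n p) (x y : SymAlg k n) :
    opY k n v (x ⊗ₜ y) = symTw p x ⊗ₜ (symι k n v * y) := by
  have e : opY k n v (x ⊗ₜ y) = symTw 0 x ⊗ₜ[k] (symι k n (natProj 0 v) * y) +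
    symTw 1 x ⊗ₜ[k] (symι k n (natProj 1 v) * y) := rfl
  rcases zmod_cases p with rfl | rfl
  · rw [e, natProj_of_mem hv, natProj_of_mem_ne (by decide) hv, map_zero, zero_mul,
      TensorProduct.tmul_zero, add_zero]
  · rw [e, natProj_of_mem hv, natProj_of_mem_ne (by decide) hv, map_zero, zero_mul,
      TensorProduct.tmul_zero, zero_add]

/-- The relation `A_v B_w = (-1)^{|v||w|} B_w A_v`. -/
def SuperComm {M : Type v} [AddCommGroup M] [Module k M] (A B : NatV k n →ₗ[k] Module.End k M) :
    Prop :=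
  ∀ p q, ∀ v ∈ natGrade k n p, ∀ w ∈ natGrade k n q, A v * B w = sgn k (p * q) • (B w * A v)

theorem SuperComm.symm {M : Type v} [AddCommGroup M] [Module k M]
    {A B : NatV k n →ₗ[k] Module.End k M} (h : SuperComm A B) : SuperComm B A := by
  intro p q v hv w hw
  rw [h q p w hw v hv, smul_smul, mul_comm q p, sgn_mul_self, one_smul]

theorem opX_opX : SuperComm (M := SymT k n) (opX k n) (opX k n) := by
  intro p q v hv w hw
  refine TensorProduct.ext' fun x y => ?_
  simp only [Module.End.mul_apply, LinearMap.smul_apply, opX_tmul]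
  rw [← mul_assoc, ← mul_assoc, symι_mul_comm hv hw, smul_mul_assoc, TensorProduct.smul_tmul']

/-- The twist in `Y_w` sees the additional factor `v` on the left strand, and this produces exactly
the sign demanded by the Koszul rule. -/
theorem opX_opY : SuperComm (M := SymT k n) (opX k n) (opY k n) := by
  intro p q v hv w hw
  refine TensorProduct.ext' fun x y => ?_
  simp only [Module.End.mul_apply, LinearMap.smul_apply, opX_tmul, opY_tmul hw]
  rw [symTw_symι_mul q hv, ← TensorProduct.smul_tmul', smul_smul, mul_comm q p, sgn_mul_self,
    one_smul]

theorem opY_opY : SuperComm (M := SymT k n) (opY k n) (opY k n) := by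
  intro p q v hv w hw
  refine TensorProduct.ext' fun x y => ?_
  simp only [Module.End.mul_apply, LinearMap.smul_apply, opY_tmul hw, opY_tmul hv]
  rw [← mul_assoc, ← mul_assoc, symι_mul_comm hv hw, smul_mul_assoc, TensorProduct.tmul_smul,
    symTw_symTw]

/-- The operators `X_v` and `Y_v` generate `S(V) ⊗ S(V)` from `1 ⊗ 1`. -/
theorem symT_induction {C : SymT k n → Prop} (h₁ : C (1 ⊗ₜ 1))
    (ha : ∀ a b, C a → C b → C (a + b)) (hs : ∀ (c : k) a, C a → C (c • a))
    (hX : ∀ p, ∀ v ∈ natGrade k n p, ∀ a, C a → C (opX k n v a))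
    (hY : ∀ p, ∀ v ∈ natGrade k n p, ∀ a, C a → C (opY k n v a)) (z : SymT k n) : C z := by
  have h₀ : C 0 := by simpa using hs 0 _ h₁
  induction z using TensorProduct.induction_on with
  | zero => exact h₀
  | add x y hx hy => exact ha _ _ hx hy
  | tmul x y =>
    induction x using symAlg_left_induction with
    | h₁ =>
      induction y using symAlg_left_induction with
      | h₁ => exact h₁
      | ha a b ha' hb => rw [TensorProduct.tmul_add]; exact ha _ _ ha' hb
      | hs c a ha => rw [TensorProduct.tmul_smul]; exact hs _ _ ha
      | hm p v hv a h =>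
        have := hY p v hv _ h
        rwa [opY_tmul hv, map_one] at this
    | ha a b ha' hb => rw [TensorProduct.add_tmul]; exact ha _ _ ha' hb
    | hs c a ha => rw [← TensorProduct.smul_tmul']; exact hs _ _ ha
    | hm p v hv a h => exact hX p v hv _ h

/-- The subspace `S^a(V) ⊗ S^b(V)` of `S(V) ⊗ S(V)`. -/
def symTDeg (k : Type u) [Field k] (n a b : ℕ) : Submodule k (SymT k n) :=
  LinearMap.range (TensorProduct.map (SymPow k n a).subtype (SymPow k n b).subtype)

theorem tmul_mem_symTDeg {a b : ℕ} {x y : SymAlg k n} (hx : x ∈ SymPow k n a)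
    (hy : y ∈ SymPow k n b) : x ⊗ₜ[k] y ∈ symTDeg k n a b :=
  ⟨(⟨x, hx⟩ : SymPow k n a) ⊗ₜ (⟨y, hy⟩ : SymPow k n b), rfl⟩

theorem symTDeg_le {a b : ℕ} {N : Submodule k (SymT k n)}
    (h : ∀ x ∈ SymPow k n a, ∀ y ∈ SymPow k n b, x ⊗ₜ[k] y ∈ N) : symTDeg k n a b ≤ N := by
  rintro _ ⟨z, rfl⟩
  induction z using TensorProduct.induction_on with
  | zero => rw [map_zero]; exact zero_mem _
  | add x y hx hy => rw [map_add]; exact add_mem hx hy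
  | tmul x y => exact h _ x.2 _ y.2

theorem opX_mem {a b : ℕ} (v : NatV k n) {z : SymT k n} (hz : z ∈ symTDeg k n a b) :
    opX k n v z ∈ symTDeg k n (a + 1) b :=
  symTDeg_le (N := (symTDeg k n (a + 1) b).comap (opX k n v))
    (fun _ hx _ hy => tmul_mem_symTDeg (symι_mul_mem v hx) hy) hz

theorem opY_mem {a b : ℕ} {p : ZMod 2} {v : NatV k n} (hv : v ∈ natGrade k n p) {z : SymT k n}
    (hz : z ∈ symTDeg k n a b) : opY k n v z ∈ symTDeg k n a (b + 1) :=
  symTDeg_le (N := (symTDeg k n a (b + 1)).comap (opY k n v))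
    (fun x hx y hy => by
      rw [Submodule.mem_comap, opY_tmul hv]
      exact tmul_mem_symTDeg (symTw_mem p hx) (symι_mul_mem v hy)) hz

/-- Induction on the degree in `S^a(V) ⊗ S^b(V)`, with the factors of the first copy outside. -/
theorem symTDeg_induction {C : ℕ → ℕ → SymT k n → Prop} (h₁ : C 0 0 (1 ⊗ₜ 1))
    (ha : ∀ a b x y, C a b x → C a b y → C a b (x + y))
    (hs : ∀ a b (c : k) x, C a b x → C a b (c • x))
    (hX : ∀ a b p, ∀ v ∈ natGrade k n p, ∀ z ∈ symTDeg k n a b, C a b z →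
      C (a + 1) b (opX k n v z))
    (hY : ∀ b p, ∀ v ∈ natGrade k n p, ∀ z ∈ symTDeg k n 0 b, C 0 b z → C 0 (b + 1) (opY k n v z))
    {a b : ℕ} {z : SymT k n} (hz : z ∈ symTDeg k n a b) : C a b z := by
  -- The second factor is built first, while the first one is still `1`; there the twist in `Y_v` is
  -- invisible.
  have h₀ : ∀ b y, y ∈ SymPow k n b → C 0 b (1 ⊗ₜ y) := fun b y hy => by
    induction hy using symPow_induction with
    | h₁ => exact h₁
    | ha m x y _ _ hx hy => rw [TensorProduct.tmul_add]; exact ha _ _ _ _ hx hy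
    | hs m c x _ hx => rw [TensorProduct.tmul_smul]; exact hs _ _ _ _ hx
    | hm m p v hv x hx' hx =>
      have := hY m p v hv _ (tmul_mem_symTDeg one_mem_symPow hx') hx
      rwa [opY_tmul hv, map_one] at this
  have h₂ : ∀ a b x y, x ∈ SymPow k n a → y ∈ SymPow k n b → C a b (x ⊗ₜ y) := by
    intro a b x y hx hy
    induction hx using symPow_induction with
    | h₁ => exact h₀ b y hy
    | ha m x y _ _ hx hy => rw [TensorProduct.add_tmul]; exact ha _ _ _ _ hx hy
    | hs m c x _ hx => rw [← TensorProduct.smul_tmul']; exact hs _ _ _ _ hx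
    | hm m p v hv x hx' hx => exact hX m b p v hv _ (tmul_mem_symTDeg hx' hy) hx
  let N : Submodule k (SymT k n) :=
    { carrier := {z | C a b z}
      add_mem' := fun hx hy => ha _ _ _ _ hx hy
      zero_mem' := by
        have := hs a b 0 _ (h₂ a b 0 0 (zero_mem _) (zero_mem _))
        rwa [zero_smul] at this
      smul_mem' := fun c _ hx => hs _ _ c _ hx }
  exact symTDeg_le (N := N) (fun x hx y hy => h₂ a b x y hx hy) hz

/-! ### The comultiplication -/

section Gen

variable {M : Type v} [AddCommGroup M] [Module k M] (A B : NatV k n →ₗ[k] Module.End k M)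
  (hA : SuperComm A A) (hB : SuperComm B B) (hAB : SuperComm A B)

/-- Auxiliary: `v ↦ A_v + t B_v`. -/
def genLin : NatV k n →ₗ[k] Polynomial (Module.End k M) :=
  (Polynomial.monomial 0).restrictScalars k ∘ₗ A + (Polynomial.monomial 1).restrictScalars k ∘ₗ B

/-- The algebra homomorphism `v ↦ A_v + t B_v`. -/
def genHom : SymAlg k n →ₐ[k] Polynomial (Module.End k M) :=
  symLift (genLin A B) (by
    intro p q v hv w hw
    have e : ∀ v, genLin A B v = Polynomial.monomial 0 (A v) + Polynomial.monomial 1 (B v) :=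
      fun v => rfl
    rw [e, e]
    -- The relation is compared coefficientwise in `t`: the coefficient of `t^0` is the
    -- supercommutation of `A` with itself, that of `t^2` the one of `B`, and in the coefficient of
    -- `t` the products `A B` and `B A` change places.
    simp only [add_mul, mul_add, Polynomial.monomial_mul_monomial, hA p q v hv w hw,
      hB p q v hv w hw, hAB p q v hv w hw, hAB.symm p q v hv w hw, ← Polynomial.smul_monomial,
      smul_add]
    abel)

/-- The coefficient of `t^s` in the image of an element under `genHom`. -/
def genCoeff (s : ℤ) : SymAlg k n →ₗ[k] Module.End k M :=
  -- Integer indices with value zero below `0` let the recursion for left multiplication hold with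
  -- no boundary case.
  if 0 ≤ s then (Polynomial.lcoeff _ s.toNat).restrictScalars k ∘ₗ (genHom A B hA hB hAB).toLinearMap
  else 0

theorem genCoeff_one (s : ℤ) : genCoeff A B hA hB hAB s 1 = if s = 0 then 1 else 0 := by
  rw [genCoeff]
  split_ifs with h h' h'
  · subst h'; simp
  · have : s.toNat ≠ 0 := by omega
    simp [Polynomial.coeff_one, this]
  · omega
  · rfl

/-- This is the coefficient of `t^s` in `(A_v + t B_v) · x`. Together with the value at `1` and the
vanishing for negative `s`, it is all that is used about the generating polynomial. -/
theorem genCoeff_mul (s : ℤ) (v : NatV k n) (x : SymAlg k n) :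
    genCoeff A B hA hB hAB s (symι k n v * x) =
      A v * genCoeff A B hA hB hAB s x + B v * genCoeff A B hA hB hAB (s - 1) x := by
  have e : genHom A B hA hB hAB (symι k n v * x) = Polynomial.monomial 0 (A v) *
      genHom A B hA hB hAB x + Polynomial.monomial 1 (B v) * genHom A B hA hB hAB x := by
    rw [map_mul, genHom, symLift_symι, ← add_mul]; rfl
  rcases lt_trichotomy s 0 with h | rfl | h
  · simp [genCoeff, not_le.2 h, show ¬ 1 ≤ s by omega]
  · simp [genCoeff, e, ← Polynomial.C_mul_X_pow_eq_monomial, mul_assoc, Polynomial.mul_coeff_zero]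
  · obtain ⟨m, rfl⟩ : ∃ m : ℕ, s = m + 1 := ⟨(s - 1).toNat, by omega⟩
    have h1 : ((m : ℤ) + 1).toNat = m + 1 := by omega
    simp [genCoeff, e, h1, h.le, ← Polynomial.C_mul_X_pow_eq_monomial, mul_assoc]

end Gen

/-- The components of the comultiplication of `S(V)`, indexed by the degree of the right factor. -/
def comulR (s : ℤ) : SymAlg k n →ₗ[k] SymT k n :=
  LinearMap.applyₗ (1 ⊗ₜ 1) ∘ₗ genCoeff (M := SymT k n) (opX k n) (opY k n) opX_opX opY_opY opX_opY s

/-- The components of the comultiplication of `S(V)`, indexed by the degree of the left factor. -/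
def comulL (s : ℤ) : SymAlg k n →ₗ[k] SymT k n :=
  LinearMap.applyₗ (1 ⊗ₜ 1) ∘ₗ genCoeff (M := SymT k n) (opY k n) (opX k n) opY_opY opX_opX opX_opY.symm s

theorem comulR_one (s : ℤ) : comulR (k := k) (n := n) s 1 = if s = 0 then 1 ⊗ₜ 1 else 0 := by
  simp only [comulR, LinearMap.comp_apply, genCoeff_one]
  split_ifs <;> rfl

theorem comulL_one (s : ℤ) : comulL (k := k) (n := n) s 1 = if s = 0 then 1 ⊗ₜ 1 else 0 := by
  simp only [comulL, LinearMap.comp_apply, genCoeff_one]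
  split_ifs <;> rfl

/-- The coproduct of `v` is `v ⊗ 1 + 1 ⊗ v`, and only the second summand raises the degree of the
right factor. -/
theorem comulR_mul (s : ℤ) (v : NatV k n) (x : SymAlg k n) :
    comulR s (symι k n v * x) = opX k n v (comulR s x) + opY k n v (comulR (s - 1) x) := by
  simp only [comulR, LinearMap.comp_apply, genCoeff_mul]; rfl

theorem comulL_mul (s : ℤ) (v : NatV k n) (x : SymAlg k n) :
    comulL s (symι k n v * x) = opY k n v (comulL s x) + opX k n v (comulL (s - 1) x) := by
  simp only [comulL, LinearMap.comp_apply, genCoeff_mul]; rfl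

theorem comulR_neg {s : ℤ} (hs : s < 0) (x : SymAlg k n) : comulR s x = 0 := by
  simp [comulR, genCoeff, not_le.2 hs]

theorem comulL_neg {s : ℤ} (hs : s < 0) (x : SymAlg k n) : comulL s x = 0 := by
  simp [comulL, genCoeff, not_le.2 hs]

theorem comulR_zero (x : SymAlg k n) : comulR 0 x = x ⊗ₜ 1 := by
  induction x using symAlg_left_induction with
  | h₁ => simp [comulR_one]
  | ha a b ha hb => rw [map_add, ha, hb, TensorProduct.add_tmul]
  | hs c a ha => rw [map_smul, ha, TensorProduct.smul_tmul']
  | hm p v hv a ha => rw [comulR_mul, ha, comulR_neg (by norm_num), map_zero, add_zero, opX_tmul]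

theorem comulL_zero (x : SymAlg k n) : comulL 0 x = 1 ⊗ₜ x := by
  induction x using symAlg_left_induction with
  | h₁ => simp [comulL_one]
  | ha a b ha hb => rw [map_add, ha, hb, TensorProduct.tmul_add]
  | hs c a ha => rw [map_smul, ha, TensorProduct.tmul_smul]
  | hm p v hv a ha =>
    rw [comulL_mul, ha, comulL_neg (by norm_num), map_zero, add_zero, opY_tmul hv, map_one]

/-- Both families satisfy the same recursion with the two summands exchanged, and the indices add up
to the total degree. Two indexings are kept because a rightward rung fixes the degree of the right
part of a split and a leftward rung that of the left part, irrespective of the total degree. -/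
theorem comulR_eq_comulL {m : ℕ} {x : SymAlg k n} (hx : x ∈ SymPow k n m) :
    ∀ {s t : ℤ}, s + t = m → comulR s x = comulL t x := by
  induction hx using symPow_induction with
  | h₁ =>
    intro s t h
    rw [comulR_one, comulL_one]
    congr 1
    simp at h
    rw [eq_iff_iff]; omega
  | ha m x y _ _ hx hy => intro s t h; rw [map_add, map_add, hx h, hy h]
  | hs m c x _ hx => intro s t h; rw [map_smul, map_smul, hx h]
  | hm m p v hv x _ hx =>
    intro s t h
    push_cast at h
    rw [comulR_mul, comulL_mul, hx (s := s) (t := t - 1) (by omega),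
      hx (s := s - 1) (t := t) (by omega), add_comm]

theorem comulR_mem {c : ℕ} {x : SymAlg k n} (hx : x ∈ SymPow k n c) :
    ∀ {a b : ℕ}, a + b = c → comulR b x ∈ symTDeg k n a b := by
  induction hx using symPow_induction with
  | h₁ =>
    intro a b h
    obtain ⟨rfl, rfl⟩ : a = 0 ∧ b = 0 := by omega
    rw [comulR_one]
    exact tmul_mem_symTDeg one_mem_symPow one_mem_symPow
  | ha m x y _ _ hx hy => intro a b h; rw [map_add]; exact add_mem (hx h) (hy h)
  | hs m c x _ hx => intro a b h; rw [map_smul]; exact Submodule.smul_mem _ _ (hx h)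
  | hm m p v hv x hx' hx =>
    intro a b h
    rw [comulR_mul]
    refine add_mem ?_ ?_
    · rcases a with _ | a
      -- For `a = 0` the summand in which `v` goes to the left would require left degree `-1` in the
      -- coproduct of `x`, so it vanishes.
      · rw [comulR_eq_comulL hx' (t := -1) (by omega), comulL_neg (by norm_num), map_zero]
        exact zero_mem _
      · exact opX_mem v (hx (by omega))
    · rcases b with _ | b
      · rw [comulR_neg (by norm_num), map_zero]; exact zero_mem _
      · rw [show ((b + 1 : ℕ) : ℤ) - 1 = b by push_cast; omega]
        exact opY_mem hv (hx (by omega))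

theorem comulR_eq_zero {c : ℕ} {x : SymAlg k n} (hx : x ∈ SymPow k n c) {s : ℤ} (h : (c : ℤ) < s) :
    comulR s x = 0 := by
  rw [comulR_eq_comulL hx (t := c - s) (by omega), comulL_neg (by omega)]

theorem comulL_eq_zero {c : ℕ} {x : SymAlg k n} (hx : x ∈ SymPow k n c) {s : ℤ} (h : (c : ℤ) < s) :
    comulL s x = 0 := by
  rw [← comulR_eq_comulL hx (s := c - s) (by omega), comulR_neg (by omega)]

/-- The map `x ⊗ y ↦ (-1)^{q(|x| + |y|)} x ⊗ y`. -/
def twT (q : ZMod 2) : SymT k n →ₗ[k] SymT k n :=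
  TensorProduct.map (symTw q).toLinearMap (symTw q).toLinearMap

theorem twT_tmul (q : ZMod 2) (x y : SymAlg k n) :
    twT q (x ⊗ₜ[k] y) = symTw q x ⊗ₜ symTw q y := rfl

theorem twT_opX (q : ZMod 2) {p : ZMod 2} {v : NatV k n} (hv : v ∈ natGrade k n p) (z : SymT k n) :
    twT q (opX k n v z) = sgn k (q * p) • opX k n v (twT q z) := by
  induction z using TensorProduct.induction_on with
  | zero => simp
  | add x y hx hy => simp only [map_add, smul_add, hx, hy]
  | tmul x y => simp only [opX_tmul, twT_tmul, symTw_symι_mul q hv, TensorProduct.smul_tmul']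

theorem twT_opY (q : ZMod 2) {p : ZMod 2} {v : NatV k n} (hv : v ∈ natGrade k n p) (z : SymT k n) :
    twT q (opY k n v z) = sgn k (q * p) • opY k n v (twT q z) := by
  induction z using TensorProduct.induction_on with
  | zero => simp
  | add x y hx hy => simp only [map_add, smul_add, hx, hy]
  | tmul x y =>
    simp only [opY_tmul hv, twT_tmul, symTw_symι_mul q hv, TensorProduct.tmul_smul, symTw_symTw q p]

/-- The coproduct is even because `X_v` and `Y_v` both have the parity of `v`. The equation is
needed whenever a twist must be carried through a split. -/
theorem comulR_symTw (q : ZMod 2) (s : ℤ) (x : SymAlg k n) :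
    comulR s (symTw q x) = twT q (comulR s x) := by
  induction x using symAlg_left_induction generalizing s with
  | h₁ => rw [map_one, comulR_one]; split_ifs <;> simp [twT_tmul]
  | ha a b ha hb => simp only [map_add, ha, hb]
  | hs c a ha => simp only [map_smul, ha]
  | hm p v hv a ha =>
    rw [symTw_symι_mul q hv, map_smul, comulR_mul, comulR_mul, map_add, twT_opX q hv,
      twT_opY q hv, ha, ha, smul_add]

/-- Coassociativity. -/
theorem comulR_coassoc (b c : ℤ) (x : SymAlg k n) :
    TensorProduct.assoc k _ _ _ (TensorProduct.map (comulR b) LinearMap.id (comulR c x)) =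
      TensorProduct.map LinearMap.id (comulR c) (comulR (b + c) x) := by
  -- `F b` and `G c` apply the second comultiplication on the left and on the right. Both iterated
  -- coproducts `T_{b,c}` are shown to satisfy one recursion: a new factor `v` enters the first,
  -- second or third tensor factor, through `X v`, `op p (opX k n v)` or `op p (opY k n v)`, applied
  -- to `T_{b,c}`, `T_{b-1,c}` and `T_{b,c-1}` respectively.
  let op (p : ZMod 2) (f : Module.End k (SymT k n)) : Module.End k (SymAlg k n ⊗[k] SymT k n) :=
    TensorProduct.map (symTw p).toLinearMap f
  let X (v : NatV k n) : Module.End k (SymAlg k n ⊗[k] SymT k n) :=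
    TensorProduct.map (LinearMap.mulLeft k (symι k n v)) LinearMap.id
  let F (b : ℤ) : SymT k n →ₗ[k] SymAlg k n ⊗[k] SymT k n :=
    (TensorProduct.assoc k _ _ _).toLinearMap ∘ₗ TensorProduct.map (comulR b) LinearMap.id
  let G (c : ℤ) : SymT k n →ₗ[k] SymAlg k n ⊗[k] SymT k n :=
    TensorProduct.map LinearMap.id (comulR c)
  have hFX : ∀ b p v, v ∈ natGrade k n p → ∀ z, F b (opX k n v z) =
      X v (F b z) + op p (opX k n v) (F (b - 1) z) := by
    intro b p v hv z
    induction z using TensorProduct.induction_on with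
    | zero => simp
    | add x y hx hy => simp only [map_add, hx, hy]; abel
    | tmul x y =>
      have e : F b (opX k n v (x ⊗ₜ y)) = TensorProduct.assoc k _ _ _
        (comulR b (symι k n v * x) ⊗ₜ y) := rfl
      have e' : ∀ b, F b (x ⊗ₜ y) = TensorProduct.assoc k _ _ _ (comulR b x ⊗ₜ y) := fun _ => rfl
      rw [e, e', e', comulR_mul, TensorProduct.add_tmul, map_add]
      congr 1
      · induction comulR b x using TensorProduct.induction_on with
        | zero => simp
        | add x y hx hy => simp only [map_add, TensorProduct.add_tmul, hx, hy]
        | tmul x' y' => rfl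
      · induction comulR (b - 1) x using TensorProduct.induction_on with
        | zero => simp
        | add x y hx hy => simp only [map_add, TensorProduct.add_tmul, hx, hy]
        | tmul x' y' => rw [opY_tmul hv]; rfl
  have hFY : ∀ b p v, v ∈ natGrade k n p → ∀ z, F b (opY k n v z) = op p (opY k n v) (F b z) := by
    intro b p v hv z
    induction z using TensorProduct.induction_on with
    | zero => simp
    | add x y hx hy => simp only [map_add, hx, hy]
    | tmul x y =>
      have e' : ∀ x y, F b (x ⊗ₜ y) = TensorProduct.assoc k _ _ _ (comulR b x ⊗ₜ y) :=
        fun _ _ => rfl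
      rw [opY_tmul hv, e', e', comulR_symTw]
      induction comulR b x using TensorProduct.induction_on with
      | zero => simp
      | add x y hx hy => simp only [map_add, TensorProduct.add_tmul, hx, hy]
      | tmul x' y' =>
        have : op p (opY k n v) (x' ⊗ₜ[k] (y' ⊗ₜ[k] y)) = symTw p x' ⊗ₜ opY k n v (y' ⊗ₜ y) := rfl
        rw [TensorProduct.assoc_tmul, this, opY_tmul hv]; rfl
  have hGX : ∀ c v z, G c (opX k n v z) = X v (G c z) := by
    intro c v z
    induction z using TensorProduct.induction_on with
    | zero => simp
    | add x y hx hy => simp only [map_add, hx, hy]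
    | tmul x y => rfl
  have hGY : ∀ c p v, v ∈ natGrade k n p → ∀ z, G c (opY k n v z) =
      op p (opX k n v) (G c z) + op p (opY k n v) (G (c - 1) z) := by
    intro c p v hv z
    induction z using TensorProduct.induction_on with
    | zero => simp
    | add x y hx hy => simp only [map_add, hx, hy]; abel
    | tmul x y =>
      have e : G c (symTw p x ⊗ₜ (symι k n v * y)) = symTw p x ⊗ₜ comulR c (symι k n v * y) := rfl
      rw [opY_tmul hv, e, comulR_mul, TensorProduct.tmul_add]
      rfl
  change F b (comulR c x) = G c (comulR (b + c) x)
  induction x using symAlg_left_induction generalizing b c with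
  | h₁ =>
    have e : ∀ b, F b (1 ⊗ₜ 1) = if b = 0 then 1 ⊗ₜ (1 ⊗ₜ 1) else 0 := by
      intro b
      have : F b (1 ⊗ₜ 1) = TensorProduct.assoc k _ _ _ (comulR b 1 ⊗ₜ 1) := rfl
      rw [this, comulR_one]
      split_ifs <;> simp
    have e' : ∀ c, G c (1 ⊗ₜ 1) = if c = 0 then 1 ⊗ₜ (1 ⊗ₜ 1) else 0 := by
      intro c
      have : G c (1 ⊗ₜ 1) = 1 ⊗ₜ comulR c 1 := rfl
      rw [this, comulR_one]
      split_ifs <;> simp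
    rw [comulR_one, comulR_one]
    by_cases hc : c = 0
    · subst hc
      by_cases hb : b = 0 <;> simp [e, e', hb]
    · by_cases hb : b + c = 0 <;> simp [e', hb, hc]
  | ha x y hx hy => simp only [map_add, hx, hy]
  | hs a x hx => simp only [map_smul, hx]
  | hm p v hv x hx =>
    rw [comulR_mul, comulR_mul, map_add, map_add, hFX b p v hv, hFY b p v hv, hGX, hGY c p v hv,
      hx, hx, hx, show b - 1 + c = b + c - 1 by ring, show b + (c - 1) = b + c - 1 by ring, add_assoc]

end Operators

section Rungs

variable {k : Type u} [Field k] {n : ℕ}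

/-! ### Rungs -/

/-- The rightward rung `x ⊗ y ↦ ∑ x₁ ⊗ x₂ y`, with `x₂` of degree `s`. -/
def opR (s : ℤ) : Module.End k (SymT k n) :=
  TensorProduct.map LinearMap.id (LinearMap.mul' k (SymAlg k n)) ∘ₗ
    (TensorProduct.assoc k _ _ _).toLinearMap ∘ₗ TensorProduct.map (comulR s) LinearMap.id

/-- The leftward rung `x ⊗ y ↦ ∑ x y₁ ⊗ y₂`, with `y₁` of degree `r`. -/
def opL (r : ℤ) : Module.End k (SymT k n) :=
  TensorProduct.map (LinearMap.mul' k (SymAlg k n)) LinearMap.id ∘ₗ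
    (TensorProduct.assoc k _ _ _).symm.toLinearMap ∘ₗ TensorProduct.map LinearMap.id (comulL r)

theorem opR_tmul (s : ℤ) (x y : SymAlg k n) : opR s (x ⊗ₜ y) =
    TensorProduct.map LinearMap.id (LinearMap.mulRight k y) (comulR s x) := by
  change TensorProduct.map LinearMap.id (LinearMap.mul' k (SymAlg k n))
    (TensorProduct.assoc k _ _ _ (comulR s x ⊗ₜ y)) = _
  induction comulR s x using TensorProduct.induction_on with
  | zero => simp
  | add x y hx hy => simp only [map_add, TensorProduct.add_tmul, hx, hy]
  | tmul x' y' => simp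

theorem opL_tmul (r : ℤ) (x y : SymAlg k n) : opL r (x ⊗ₜ y) =
    TensorProduct.map (LinearMap.mulLeft k x) LinearMap.id (comulL r y) := by
  change TensorProduct.map (LinearMap.mul' k (SymAlg k n)) LinearMap.id
    ((TensorProduct.assoc k _ _ _).symm (x ⊗ₜ comulL r y)) = _
  induction comulL r y using TensorProduct.induction_on with
  | zero => simp
  | add x y hx hy => simp only [map_add, TensorProduct.tmul_add, hx, hy]
  | tmul x' y' => simp

/-- A factor `v` of the left strand either stays there or is one of the `s` factors that cross. This
is the Leibniz rule for the `s`-th divided power of the operator that moves one factor of `V` to the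
right. -/
theorem opR_opX (s : ℤ) {p : ZMod 2} {v : NatV k n} (hv : v ∈ natGrade k n p) (z : SymT k n) :
    opR s (opX k n v z) = opX k n v (opR s z) + opY k n v (opR (s - 1) z) := by
  induction z using TensorProduct.induction_on with
  | zero => simp
  | add x y hx hy => simp only [map_add, hx, hy]; abel
  | tmul x y =>
    rw [opX_tmul, opR_tmul, opR_tmul, opR_tmul, comulR_mul, map_add]
    congr 1
    · induction comulR s x using TensorProduct.induction_on with
      | zero => simp
      | add x y hx hy => simp only [map_add, hx, hy]
      | tmul x' y' => rfl
    · induction comulR (s - 1) x using TensorProduct.induction_on with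
      | zero => simp
      | add x y hx hy => simp only [map_add, hx, hy]
      | tmul x' y' => simp [opY_tmul hv, mul_assoc]

/-- A factor already on the right strand is not moved. The factors that arrive are multiplied from
the left of it, and supercommutativity brings `v` back to the front, using up the twist in `Y_v`. -/
theorem opR_opY (s : ℤ) {p : ZMod 2} {v : NatV k n} (hv : v ∈ natGrade k n p) (z : SymT k n) :
    opR s (opY k n v z) = opY k n v (opR s z) := by
  induction z using TensorProduct.induction_on with
  | zero => simp
  | add x y hx hy => simp only [map_add, hx, hy]
  | tmul x y =>
    rw [opY_tmul hv, opR_tmul, opR_tmul, comulR_symTw]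
    induction comulR s x using TensorProduct.induction_on with
    | zero => simp
    | add x y hx hy => simp only [map_add, hx, hy]
    | tmul x' y' =>
      simp [opY_tmul hv, twT_tmul, ← mul_assoc, mul_symι hv]

theorem opL_opX (s : ℤ) (v : NatV k n) (z : SymT k n) :
    opL s (opX k n v z) = opX k n v (opL s z) := by
  induction z using TensorProduct.induction_on with
  | zero => simp
  | add x y hx hy => simp only [map_add, hx, hy]
  | tmul x y =>
    rw [opX_tmul, opL_tmul, opL_tmul]
    induction comulL s y using TensorProduct.induction_on with
    | zero => simp
    | add x y hx hy => simp only [map_add, hx, hy]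
    | tmul x' y' => simp [opX_tmul]

/-- The mirror image of `opR_opX`: the factor `v` of the right strand stays or crosses to the left,
where `mul_symι` moves it in front of the left strand. -/
theorem opL_opY (s : ℤ) {p : ZMod 2} {v : NatV k n} (hv : v ∈ natGrade k n p) (z : SymT k n) :
    opL s (opY k n v z) = opY k n v (opL s z) + opX k n v (opL (s - 1) z) := by
  induction z using TensorProduct.induction_on with
  | zero => simp
  | add x y hx hy => simp only [map_add, hx, hy]; abel
  | tmul x y =>
    rw [opY_tmul hv, opL_tmul, opL_tmul, opL_tmul, comulL_mul, map_add]
    congr 1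
    · induction comulL s y using TensorProduct.induction_on with
      | zero => simp
      | add x y hx hy => simp only [map_add, hx, hy]
      | tmul x' y' => simp [opY_tmul hv]
    · induction comulL (s - 1) y using TensorProduct.induction_on with
      | zero => simp
      | add x y hx hy => simp only [map_add, hx, hy]
      | tmul x' y' => simp [opX_tmul, ← mul_assoc, mul_symι hv]

theorem opR_one (s : ℤ) : opR (k := k) (n := n) s (1 ⊗ₜ 1) = if s = 0 then 1 ⊗ₜ 1 else 0 := by
  rw [opR_tmul, comulR_one]
  split_ifs <;> simp

theorem opL_one (s : ℤ) : opL (k := k) (n := n) s (1 ⊗ₜ 1) = if s = 0 then 1 ⊗ₜ 1 else 0 := by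
  rw [opL_tmul, comulL_one]
  split_ifs <;> simp

theorem opR_neg {s : ℤ} (hs : s < 0) (z : SymT k n) : opR s z = 0 := by
  suffices opR (k := k) (n := n) s = 0 by rw [this]; rfl
  refine TensorProduct.ext' fun x y => ?_
  rw [opR_tmul, comulR_neg hs, map_zero]; rfl

theorem opL_neg {s : ℤ} (hs : s < 0) (z : SymT k n) : opL s z = 0 := by
  suffices opL (k := k) (n := n) s = 0 by rw [this]; rfl
  refine TensorProduct.ext' fun x y => ?_
  rw [opL_tmul, comulL_neg hs, map_zero]; rfl

/-- The operator counterpart of the convention that a diagram with a negatively labelled strand is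
zero. -/
theorem opR_eq_zero {a b : ℕ} {z : SymT k n} (hz : z ∈ symTDeg k n a b) {s : ℤ} (hs : (a : ℤ) < s) :
    opR s z = 0 :=
  symTDeg_le (N := LinearMap.ker (opR s)) (fun x hx y hy => by
    rw [LinearMap.mem_ker, opR_tmul, comulR_eq_zero hx hs, map_zero]) hz

theorem opL_eq_zero {a b : ℕ} {z : SymT k n} (hz : z ∈ symTDeg k n a b) {s : ℤ} (hs : (b : ℤ) < s) :
    opL s z = 0 :=
  symTDeg_le (N := LinearMap.ker (opL s)) (fun x hx y hy => by
    rw [LinearMap.mem_ker, opL_tmul, comulL_eq_zero hy hs, map_zero]) hz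

/-- Pascal's rule in summed form. The hypothesis at `m` makes the boundary term of the index shift
vanish, and `N` may be negative, as it must be for the weights of ladders. -/
theorem sum_choose_pascal {M : Type v} [AddCommGroup M] [Module k M] (N : ℤ) (f : ℕ → M) (m : ℕ)
    (hf : f m = 0) :
    ∑ t ∈ Finset.range m, ((Ring.choose (N + 1) t : ℤ) : k) • f t =
      ∑ t ∈ Finset.range m, ((Ring.choose N t : ℤ) : k) • f t +
        ∑ t ∈ Finset.range m, ((Ring.choose N t : ℤ) : k) • f (t + 1) := by
  -- The identity without the vanishing hypothesis carries the boundary term `f (m + 1)`; in this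
  -- form it can be proved by induction on `m`.
  suffices h : ∀ m, ∑ t ∈ Finset.range (m + 1), ((Ring.choose (N + 1) t : ℤ) : k) • f t +
      ((Ring.choose N m : ℤ) : k) • f (m + 1) =
      ∑ t ∈ Finset.range (m + 1), ((Ring.choose N t : ℤ) : k) • f t +
        ∑ t ∈ Finset.range (m + 1), ((Ring.choose N t : ℤ) : k) • f (t + 1) by
    rcases m with _ | m
    · simp
    · have := h m
      rwa [hf, smul_zero, add_zero] at this
  intro m
  induction m with
  | zero => simp
  | succ m ih =>
    rw [Finset.sum_range_succ _ (m + 1), Finset.sum_range_succ _ (m + 1),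
      Finset.sum_range_succ _ (m + 1), Ring.choose_succ_succ, Int.cast_add, add_smul]
    have h := congrArg (fun x => x + ((Ring.choose N (m + 1) : ℤ) : k) • f (m + 1) +
      ((Ring.choose N (m + 1) : ℤ) : k) • f (m + 1 + 1)) ih
    refine (Eq.trans ?_ h).trans ?_ <;> abel

/-- The rung swap relation. -/
theorem opL_opR {a b : ℕ} {z : SymT k n} (hz : z ∈ symTDeg k n a b) :
    ∀ (r s : ℤ) (m : ℕ), r < m → opL r (opR s z) =
      ∑ t ∈ Finset.range m, ((Ring.choose ((a : ℤ) - b + r - s) t : ℤ) : k) •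
        opR (s - t) (opL (r - t) z) := by
  -- The coefficients depend on the weight `a - b`, so the induction tracks both degrees. Any bound
  -- `m > r` is allowed because the terms with `t > r` contain a leftward rung of negative label;
  -- this freedom serves the hypotheses for `r - 1`.
  refine symTDeg_induction (C := fun a b z => ∀ (r s : ℤ) (m : ℕ), r < m → opL r (opR s z) =
      ∑ t ∈ Finset.range m, ((Ring.choose ((a : ℤ) - b + r - s) t : ℤ) : k) •
        opR (s - t) (opL (r - t) z)) ?_ ?_ ?_ ?_ ?_ hz
  · intro r s m hm
    by_cases h : r = 0 ∧ s = 0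
    · obtain ⟨rfl, rfl⟩ := h
      obtain ⟨m, rfl⟩ : ∃ m', m = m' + 1 := ⟨m - 1, by omega⟩
      rw [Finset.sum_eq_single 0]
      · simp [opR_one, opL_one]
      · intro t _ ht
        rw [opL_one, if_neg (by omega), map_zero, smul_zero]
      · simp
    · rw [Finset.sum_eq_zero, opR_one]
      · split_ifs with hs
        · rw [opL_one, if_neg (by tauto)]
        · rw [map_zero]
      · intro t _
        rw [opL_one]
        split_ifs with h₁
        · rw [opR_one]
          split_ifs with h₂
          -- On `1 ⊗ 1` a term can survive only for `r = s = t`. Then the upper entry of the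
          -- binomial coefficient is `0` while `t > 0`, so the coefficient vanishes.
          · rw [show ((0 : ℕ) : ℤ) - (0 : ℕ) + r - s = 0 by omega,
              Ring.choose_zero_pos ℤ (by omega), Int.cast_zero, zero_smul]
          · rw [smul_zero]
        · rw [map_zero, smul_zero]
  · intro a b x y hx hy r s m hm
    simp only [map_add, smul_add, Finset.sum_add_distrib, hx r s m hm, hy r s m hm]
  · intro a b c x hx r s m hm
    rw [map_smul, map_smul, hx r s m hm, Finset.smul_sum]
    simp only [map_smul, smul_comm c]
  · intro a b p v hv z hz ih r s m hm
    -- Moving `X_v` out on the left leaves three terms, for `(r, s)`, `(r, s - 1)` and `(r - 1, s -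
    -- 1)`, with upper entries `N`, `N + 1` and `N`. The target has upper entry `N + 1`: its terms
    -- with `Y_v` are those of the second, and Pascal's rule splits its terms with `X_v` into the
    -- first and the third.
    set N : ℤ := a - b + r - s with hN
    rw [opR_opX s hv, map_add, opL_opX r v, opL_opY r hv, ih r s m hm, ih r (s - 1) m hm,
      ih (r - 1) (s - 1) m (by omega), ← hN, show (a : ℤ) - b + r - (s - 1) = N + 1 by omega,
      show (a : ℤ) - b + (r - 1) - (s - 1) = N by omega,
      show ((a + 1 : ℕ) : ℤ) - b + r - s = N + 1 by push_cast; omega]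
    simp only [opL_opX _ v, opR_opX _ hv, smul_add, Finset.sum_add_distrib, map_smul, map_sum]
    rw [sum_choose_pascal N (fun t : ℕ => opX k n v (opR (s - t) (opL (r - t) z))) m
      (by rw [opL_neg (by omega), map_zero, map_zero])]
    simp only [ Nat.cast_add, Nat.cast_one, sub_add_eq_sub_sub, sub_right_comm _ _ (1 : ℤ)]
    abel
  · intro b p v hv z hz ih r s m hm
    -- Here the target has upper entry `N`. The terms for `(r, s)` and `(r - 1, s)` have upper
    -- entries `N + 1` and `N`, and Pascal's rule is applied to the terms with `Y_v`.
    obtain ⟨N, hN⟩ : ∃ N : ℤ, N = ((0 : ℕ) : ℤ) - (b + 1 : ℕ) + r - s := ⟨_, rfl⟩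
    rw [opR_opY s hv, opL_opY r hv, ih r s m hm, ih (r - 1) s m (by omega), ← hN,
      show ((0 : ℕ) : ℤ) - b + r - s = N + 1 by omega,
      show ((0 : ℕ) : ℤ) - b + (r - 1) - s = N by omega]
    simp only [opL_opY _ hv, map_add, opR_opY _ hv, opR_opX _ hv, smul_add, Finset.sum_add_distrib,
      map_smul, map_sum]
    rw [sum_choose_pascal N (fun t : ℕ => opY k n v (opR (s - t) (opL (r - t) z))) m
      (by rw [opL_neg (by omega), map_zero, map_zero])]
    simp only [ Nat.cast_add, Nat.cast_one, sub_add_eq_sub_sub, sub_right_comm _ _ (1 : ℤ)]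
    abel

/-! ### The crossing -/

section Crossing

/-- The alternating sum of ladders which gives the crossing. -/
def opCross (a b : ℕ) : Module.End k (SymT k n) :=
  ∑ s ∈ Finset.range (a + 1), (-1 : k) ^ (a - s) • (opL (b + s - a) ∘ₗ opR s)

theorem opCross_apply (a b : ℕ) (z : SymT k n) : opCross a b z =
    ∑ s ∈ Finset.range (a + 1), (-1 : k) ^ (a - s) • opL (b + s - a) (opR s z) := by
  simp [opCross, LinearMap.sum_apply]

/-- Passing `X_v` through `L_r R_s` gives `X_v L_r R_s + Y_v L_r R_{s-1} + X_v L_{r-1} R_{s-1}`. In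
the alternating sum the two families with `X_v` cancel after a shift of `s`, and the family with
`Y_v` is the crossing for one factor fewer. -/
theorem opCross_opX {a b : ℕ} {z : SymT k n} (hz : z ∈ symTDeg k n a b) {p : ZMod 2}
    {v : NatV k n} (hv : v ∈ natGrade k n p) :
    opCross (a + 1) b (opX k n v z) = opY k n v (opCross a b z) := by
  rw [opCross_apply, opCross_apply]
  simp only [opR_opX _ hv, map_add, opL_opX _ v, opL_opY _ hv, smul_add, Finset.sum_add_distrib]
  -- The boundary terms of the shift vanish: `R_{a+1}` kills left degree `a`, and `R_{-1}` is zero.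
  rw [Finset.sum_range_succ (n := a + 1), opR_eq_zero hz (by push_cast; omega), map_zero, map_zero,
    smul_zero, add_zero, Finset.sum_range_succ' (n := a + 1), Finset.sum_range_succ' (n := a + 1),
    opR_neg (by simp)]
  simp only [map_zero, smul_zero, add_zero, map_sum, map_smul]
  rw [add_comm, add_assoc, ← Finset.sum_add_distrib]
  refine (congrArg₂ (· + ·) ?_ ?_).trans (add_zero _)
  · refine Finset.sum_congr rfl fun s hs => ?_
    rw [Nat.add_sub_add_right, show ((s + 1 : ℕ) : ℤ) - 1 = s by push_cast; omega,
      show (b : ℤ) + (s + 1 : ℕ) - (a + 1 : ℕ) = b + s - a by push_cast; omega]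
  · refine Finset.sum_eq_zero fun s hs => ?_
    have hs : s ≤ a := by simpa [Nat.lt_succ_iff] using hs
    rw [Nat.add_sub_add_right, show ((s + 1 : ℕ) : ℤ) - 1 = s by push_cast; omega,
      show (b : ℤ) + (s + 1 : ℕ) - (a + 1 : ℕ) - 1 = b + s - (a + 1 : ℕ) by push_cast; omega,
      show a + 1 - s = a - s + 1 by omega, pow_succ]
    module

variable [NeZero (2 : k)]

/-- The projection to the component of parity `q`. -/
def symPr (q : ZMod 2) : SymAlg k n →ₗ[k] SymAlg k n :=
  (2 : k)⁻¹ • (LinearMap.id + sgn k q • (symTw 1).toLinearMap)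

theorem symPr_apply (q : ZMod 2) (x : SymAlg k n) :
    symPr q x = (2 : k)⁻¹ • (x + sgn k q • symTw 1 x) := rfl

theorem symPr_one (q : ZMod 2) : symPr (k := k) (n := n) q 1 = if q = 0 then 1 else 0 := by
  have h2 : (2 : k) ≠ 0 := NeZero.ne _
  rw [symPr_apply, map_one]
  rcases zmod_cases q with rfl | rfl
  · rw [sgn_zero, one_smul, ← two_smul k (1 : SymAlg k n), smul_smul, inv_mul_cancel₀ h2, one_smul]
    rfl
  · rw [sgn_one, if_neg (by decide)]
    have e : (2 : k)⁻¹ • ((1 : SymAlg k n) + (-1 : k) • (1 : SymAlg k n)) = 0 := by module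
    exact e

theorem symPr_symι_mul {p : ZMod 2} {v : NatV k n} (hv : v ∈ natGrade k n p) (q : ZMod 2)
    (x : SymAlg k n) : symPr q (symι k n v * x) = symι k n v * symPr (p + q) x := by
  rw [symPr_apply, symPr_apply, symTw_symι_mul 1 hv, smul_smul, one_mul, mul_smul_comm, mul_add,
    mul_smul_comm, sgn_add, mul_comm (sgn k q)]

/-- The super swap `x ⊗ y ↦ (-1)^{|x||y|} y ⊗ x`. -/
def swapT : Module.End k (SymT k n) :=
  (TensorProduct.comm k _ _).toLinearMap ∘ₗ
    (TensorProduct.map (symPr 0) LinearMap.id + TensorProduct.map (symPr 1) (symTw 1).toLinearMap)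

theorem swapT_tmul (x y : SymAlg k n) :
    swapT (x ⊗ₜ y) = y ⊗ₜ[k] symPr 0 x + symTw 1 y ⊗ₜ[k] symPr 1 x := rfl

/-- The factor `v` changes the parity of the left element by `p`, which interchanges the two parity
components when `v` is odd; this is compensated by the twist in `Y_v`. -/
theorem swapT_opX {p : ZMod 2} {v : NatV k n} (hv : v ∈ natGrade k n p) (z : SymT k n) :
    swapT (opX k n v z) = opY k n v (swapT z) := by
  induction z using TensorProduct.induction_on with
  | zero => simp
  | add x y hx hy => simp only [map_add, hx, hy]
  | tmul x y =>
    rw [opX_tmul, swapT_tmul, swapT_tmul, symPr_symι_mul hv, symPr_symι_mul hv, map_add,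
      opY_tmul hv, opY_tmul hv]
    rcases zmod_cases p with rfl | rfl
    · simp [symTw_zero]
    · rw [add_zero, CharTwo.add_self_eq_zero, symTw_self, add_comm]

/-- Both operators turn `X_v` into `Y_v`, so it suffices to compare them on `1 ⊗ y`. There the sum
has the single term `s = 0`, a leftward rung that carries all of `y` across. -/
theorem opCross_eq_swapT {a b : ℕ} {z : SymT k n} (hz : z ∈ symTDeg k n a b) :
    opCross a b z = swapT z := by
  suffices h : ∀ {a b} {x y : SymAlg k n}, x ∈ SymPow k n a → y ∈ SymPow k n b →
      opCross a b (x ⊗ₜ y) = swapT (x ⊗ₜ y) from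
    symTDeg_le (N := LinearMap.eqLocus (opCross a b) swapT) (fun x hx y hy => h hx hy) hz
  intro a b x y hx hy
  induction hx using symPow_induction with
  | h₁ =>
    rw [opCross_apply, swapT_tmul, symPr_one, symPr_one, if_pos rfl, if_neg (by decide),
      TensorProduct.tmul_zero, add_zero, zero_add, Finset.sum_range_one, Nat.cast_zero, opR_tmul,
      comulR_zero, TensorProduct.map_tmul, LinearMap.id_apply, LinearMap.mulRight_apply, one_mul,
      opL_tmul, ← comulR_eq_comulL hy (s := 0) (by omega), comulR_zero, TensorProduct.map_tmul,
      LinearMap.id_apply, LinearMap.mulLeft_apply, one_mul, Nat.sub_zero, pow_zero, one_smul]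
  | ha m x y _ _ hx hy => rw [TensorProduct.add_tmul, map_add, map_add, hx, hy]
  | hs m c x _ hx => rw [← TensorProduct.smul_tmul', map_smul, map_smul, hx]
  | hm m p v hv x hx' hx =>
    rw [← opX_tmul, opCross_opX (tmul_mem_symTDeg hx' hy) hv, hx, swapT_opX hv]

end Crossing

end Rungs

/-! ### Caps, cups and antennas -/

section Caps

variable {k : Type u} [Field k] {n : ℕ}

theorem form_comm (v w : NatV k n) : form k n v w = form k n w v := by
  unfold form
  refine Fintype.sum_equiv (Equiv.sumComm _ _) _ _ fun i => ?_
  rcases i with i | i <;> simp [mul_comm]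

theorem par_swap (i : Ix n) : Ix.par i.swap = i.par + 1 := by
  rcases i with i | i <;> simp [Ix.par, CharTwo.add_self_eq_zero]

theorem form_eq_zero {p q : ZMod 2} {v w : NatV k n} (hv : v ∈ natGrade k n p)
    (hw : w ∈ natGrade k n q) (h : q ≠ p + 1) : form k n v w = 0 := by
  refine Finset.sum_eq_zero fun i _ => ?_
  by_cases hi : i.par = p
  · have : Ix.par i.swap ≠ q := by
      rintro rfl
      exact h (by rw [par_swap, hi])
    rw [hw _ this, mul_zero]
  · rw [hv _ hi, zero_mul]

variable (k n) in
/-- The bilinear form as a bilinear map. -/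
def formLin : NatV k n →ₗ[k] NatV k n →ₗ[k] k :=
  LinearMap.mk₂ k (form k n) (fun a b w => by simp [form, add_mul, Finset.sum_add_distrib])
    (fun c a w => form_smul_left k n c a w)
    (fun w a b => by simp [form, mul_add, Finset.sum_add_distrib])
    (fun c w a => form_smul_right k n c a w)

@[simp] theorem formLin_apply (v w : NatV k n) : formLin k n v w = form k n v w := rfl

/-- Since the form is odd, only the component of `w` of parity `p + 1` pairs with `u`, and on it the
twist is a scalar. -/
theorem form_natTw (q : ZMod 2) {p : ZMod 2} {u : NatV k n} (hu : u ∈ natGrade k n p)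
    (w : NatV k n) : form k n u (natTw q w) = sgn k (q * (p + 1)) * form k n u w := by
  suffices h : formLin k n u ∘ₗ natTw q = sgn k (q * (p + 1)) • formLin k n u from
    LinearMap.congr_fun h w
  refine nat_ext fun r w hw => ?_
  simp only [LinearMap.comp_apply, natTw_apply q hw, map_smul, LinearMap.smul_apply]
  by_cases h : r = p + 1
  · rw [h]
  · simp [form_eq_zero hu hw h]

/-- The algebra homomorphism to the quotient of `S(V)` by the elements of degree at least two. -/
def symTriv : SymAlg k n →ₐ[k] TrivSqZeroExt k (NatV k n) :=
  symLift (TrivSqZeroExt.inrHom k (NatV k n)) (by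
    intro p q v _ w _
    simp)

/-- The augmentation. -/
def symAug : SymAlg k n →ₗ[k] k := (TrivSqZeroExt.fstHom k k (NatV k n)).toLinearMap ∘ₗ symTriv.toLinearMap

/-- The component of degree one. -/
def symOne : SymAlg k n →ₗ[k] NatV k n := TrivSqZeroExt.sndHom k (NatV k n) ∘ₗ symTriv.toLinearMap

@[simp] theorem symAug_one : symAug (1 : SymAlg k n) = 1 := by simp [symAug]

@[simp] theorem symOne_one : symOne (1 : SymAlg k n) = 0 := by simp [symOne]

@[simp] theorem symAug_symι_mul (v : NatV k n) (x : SymAlg k n) : symAug (symι k n v * x) = 0 := by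
  simp [symAug, symTriv]

@[simp] theorem symOne_symι_mul (v : NatV k n) (x : SymAlg k n) :
    symOne (symι k n v * x) = symAug x • v := by
  simp [symAug, symOne, symTriv]

@[simp] theorem symOne_symι (v : NatV k n) : symOne (symι k n v) = v := by
  simpa using symOne_symι_mul v 1

theorem symAug_symTw (q : ZMod 2) (x : SymAlg k n) : symAug (symTw q x) = symAug x := by
  induction x using symAlg_left_induction with
  | h₁ => simp
  | ha a b ha hb => simp only [map_add, ha, hb]
  | hs c a ha => simp only [map_smul, ha]
  | hm p v hv a ha => rw [symTw_symι_mul q hv, map_smul, symAug_symι_mul, smul_zero, symAug_symι_mul]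

theorem symOne_symTw (q : ZMod 2) (x : SymAlg k n) : symOne (symTw q x) = natTw q (symOne x) := by
  induction x using symAlg_left_induction with
  | h₁ => simp
  | ha a b ha hb => simp only [map_add, ha, hb]
  | hs c a ha => simp only [map_smul, ha]
  | hm p v hv a ha =>
    rw [symTw_symι_mul q hv, map_smul, symOne_symι_mul, symOne_symι_mul, symAug_symTw, map_smul,
      natTw_apply q hv, smul_comm]

variable (k n) in
/-- The pairing of the components of degree one. -/
def symForm : SymAlg k n →ₗ[k] SymAlg k n →ₗ[k] k := (formLin k n).compl₁₂ symOne symOne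

theorem symForm_apply (x y : SymAlg k n) : symForm k n x y = form k n (symOne x) (symOne y) := rfl

theorem symForm_symTw (q : ZMod 2) {p : ZMod 2} {u : NatV k n} (hu : u ∈ natGrade k n p)
    (x : SymAlg k n) :
    form k n u (symOne (symTw q x)) = sgn k (q * (p + 1)) * form k n u (symOne x) := by
  rw [symOne_symTw, form_natTw q hu]

/-- The contraction of `S(V)` with `(u, -)` for `u ∈ V`. -/
def contr : NatV k n →ₗ[k] Module.End k (SymAlg k n) :=
  LinearMap.mk₂ k (fun u y => TensorProduct.lift
      ((LinearMap.lsmul k (SymAlg k n)) ∘ₗ formLin k n u ∘ₗ symOne) (comulL 1 y))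
    (fun u u' y => by
      simp only [map_add, LinearMap.add_comp, LinearMap.comp_add]
      induction comulL 1 y using TensorProduct.induction_on with
      | zero => simp
      | add x y hx hy => simp only [map_add, hx, hy]; abel
      | tmul x y => simp)
    (fun c u y => by
      induction comulL 1 y using TensorProduct.induction_on with
      | zero => simp
      | add x y hx hy => simp only [map_add, hx, hy, smul_add]
      | tmul x y => simp [mul_smul])
    (fun u y y' => by simp only [map_add])
    (fun c u y => by simp only [map_smul])

theorem contr_apply (u : NatV k n) (y : SymAlg k n) : contr u y = TensorProduct.lift
    ((LinearMap.lsmul k (SymAlg k n)) ∘ₗ formLin k n u ∘ₗ symOne) (comulL 1 y) := rfl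

@[simp] theorem contr_one (u : NatV k n) : contr u (1 : SymAlg k n) = 0 := by
  rw [contr_apply, comulL_one, if_neg (by decide), map_zero]

/-- `contr u` is the superderivation that extends the functional `(u, -)`: the extracted factor is
either `w` itself or lies in `y`, and in the latter case it passes `w`. The sign uses `p + 1`, the
parity of the functional. -/
theorem contr_symι_mul {p q : ZMod 2} {u w : NatV k n} (hu : u ∈ natGrade k n p)
    (hw : w ∈ natGrade k n q) (y : SymAlg k n) : contr u (symι k n w * y) =
      form k n u w • y + sgn k (q * (p + 1)) • (symι k n w * contr u y) := by
  rw [contr_apply, contr_apply, comulL_mul, map_add, add_comm]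
  congr 1
  · rw [show (1 : ℤ) - 1 = 0 by norm_num, comulL_zero, opX_tmul]
    simp
  · induction comulL 1 y using TensorProduct.induction_on with
    | zero => simp
    | add x y hx hy => simp only [map_add, hx, hy, mul_add, smul_add]
    | tmul x y =>
      rw [opY_tmul hw]
      simp [symForm_symTw q hu, mul_smul]

/-- The contraction has parity `p + 1`; the term in which `w` is contracted is consistent with this
because it vanishes unless `w` has that parity. -/
theorem contr_symTw {p : ZMod 2} {u : NatV k n} (hu : u ∈ natGrade k n p) (q : ZMod 2)
    (y : SymAlg k n) : contr u (symTw q y) = sgn k (q * (p + 1)) • symTw q (contr u y) := by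
  induction y using symAlg_left_induction with
  | h₁ => simp
  | ha a b ha hb => simp only [map_add, ha, hb, smul_add]
  | hs c a ha => simp only [map_smul, ha, smul_comm c]
  | hm r w hw a ha =>
    rw [symTw_symι_mul q hw, map_smul, contr_symι_mul hu hw, contr_symι_mul hu hw, ha, map_add,
      map_smul, map_smul, symTw_symι_mul q hw, smul_add, smul_add, mul_smul_comm]
    congr 1
    · by_cases h : r = p + 1
      · subst h
        rw [smul_comm]
      · rw [form_eq_zero hu hw h, zero_smul, smul_zero, smul_zero]
    · simp only [smul_smul]
      congr 1
      ring

/-- The contraction computed with the comultiplication on the other side. -/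
theorem contr_eq_comulR {p : ZMod 2} {u : NatV k n} (hu : u ∈ natGrade k n p) (x : SymAlg k n) :
    contr u x = TensorProduct.lift ((LinearMap.lsmul k (SymAlg k n)) ∘ₗ formLin k n u ∘ₗ symOne)
      (TensorProduct.comm k _ _ (TensorProduct.map (symTw (p + 1)).toLinearMap LinearMap.id
        (comulR 1 x))) := by
  induction x using symAlg_left_induction with
  | h₁ => rw [contr_one, comulR_one, if_neg (by decide)]; simp
  | ha a b ha hb => simp only [map_add, ha, hb]
  | hs c a ha => simp only [map_smul, ha]
  | hm q w hw a ha =>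
    rw [contr_symι_mul hu hw, ha, comulR_mul, map_add, map_add, map_add, add_comm]
    congr 1
    · induction comulR 1 a using TensorProduct.induction_on with
      | zero => simp
      | add x y hx hy => simp only [map_add, ← hx, ← hy, mul_add (symι k n w), smul_add]
      | tmul x y =>
        simp only [opX_tmul, TensorProduct.map_tmul, TensorProduct.comm_tmul,
          AlgHom.toLinearMap_apply, symTw_symι_mul _ hw, TensorProduct.lift.tmul,
          LinearMap.comp_apply, LinearMap.lsmul_apply, LinearMap.id_apply, mul_smul_comm]
        rw [smul_comm, mul_comm q]
    · rw [show (1 : ℤ) - 1 = 0 by norm_num, comulR_zero, opY_tmul hw]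
      -- When `w` can be contracted, its parity is `p + 1` and the twist of the rearrangement
      -- cancels the twist in `Y_w`; otherwise both sides are zero.
      by_cases h : q = p + 1
      · subst h
        simp [symTw_self]
      · simp [form_eq_zero hu hw h]

/-- The operator `c_u ⊗ 1`. -/
def opB (u : NatV k n) : Module.End k (SymT k n) := TensorProduct.map (contr u) LinearMap.id

/-- The operator `1 ⊗ c_u`, where `c_u` has parity `p`. -/
def opB' (p : ZMod 2) (u : NatV k n) : Module.End k (SymT k n) :=
  TensorProduct.map (symTw p).toLinearMap (contr u)

theorem opB_tmul (u : NatV k n) (x y : SymAlg k n) : opB u (x ⊗ₜ y) = contr u x ⊗ₜ y := rfl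

theorem opB'_tmul (p : ZMod 2) (u : NatV k n) (x y : SymAlg k n) :
    opB' p u (x ⊗ₜ y) = symTw p x ⊗ₜ contr u y := rfl

/-! ### Contractions on the two strands and their commutation with multiplications and rungs -/

section

variable {p q : ZMod 2} {u w : NatV k n}

/-- This and the next three relations say that `opB` differentiates in the left variables and `opB'`
in the right ones, both with parity `p + 1`. With the vanishing on `1 ⊗ 1` they suffice for every
later commutation of contractions with rungs. -/
theorem opB_opX (hu : u ∈ natGrade k n p) (hw : w ∈ natGrade k n q) (z : SymT k n) :
    opB u (opX k n w z) = form k n u w • z + sgn k (q * (p + 1)) • opX k n w (opB u z) := by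
  induction z using TensorProduct.induction_on with
  | zero => simp
  | add x y hx hy => simp only [map_add, hx, hy, smul_add]; abel
  | tmul x y =>
    rw [opX_tmul, opB_tmul, opB_tmul, opX_tmul, contr_symι_mul hu hw, TensorProduct.add_tmul,
      TensorProduct.smul_tmul', TensorProduct.smul_tmul']

theorem opB_opY (hu : u ∈ natGrade k n p) (hw : w ∈ natGrade k n q) (z : SymT k n) :
    opB u (opY k n w z) = sgn k (q * (p + 1)) • opY k n w (opB u z) := by
  induction z using TensorProduct.induction_on with
  | zero => simp
  | add x y hx hy => simp only [map_add, hx, hy, smul_add]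
  | tmul x y =>
    rw [opY_tmul hw, opB_tmul, opB_tmul, opY_tmul hw, contr_symTw hu, TensorProduct.smul_tmul']

theorem opB'_opX (hw : w ∈ natGrade k n q) (z : SymT k n) :
    opB' (p + 1) u (opX k n w z) = sgn k (q * (p + 1)) • opX k n w (opB' (p + 1) u z) := by
  induction z using TensorProduct.induction_on with
  | zero => simp
  | add x y hx hy => simp only [map_add, hx, hy, smul_add]
  | tmul x y =>
    rw [opX_tmul, opB'_tmul, opB'_tmul, opX_tmul, symTw_symι_mul _ hw, mul_comm q,
      TensorProduct.smul_tmul']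

theorem opB'_opY (hu : u ∈ natGrade k n p) (hw : w ∈ natGrade k n q) (z : SymT k n) :
    opB' (p + 1) u (opY k n w z) =
      form k n u w • z + sgn k (q * (p + 1)) • opY k n w (opB' (p + 1) u z) := by
  induction z using TensorProduct.induction_on with
  | zero => simp
  | add x y hx hy => simp only [map_add, hx, hy, smul_add]; abel
  | tmul x y =>
    rw [opY_tmul hw, opB'_tmul, opB'_tmul, opY_tmul hw, contr_symι_mul hu hw,
      TensorProduct.tmul_add, TensorProduct.tmul_smul, TensorProduct.tmul_smul, symTw_symTw q]
    congr 1
    -- The twists by `p + 1` and by `q` must cancel on the left factor; they do exactly in the only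
    -- case in which `w` pairs nontrivially with `u`.
    by_cases h : q = p + 1
    · rw [h, symTw_self]
    · rw [form_eq_zero hu hw h, zero_smul, zero_smul]

theorem opB_one : opB u (1 ⊗ₜ 1) = 0 := by rw [opB_tmul, contr_one, TensorProduct.zero_tmul]

theorem opB'_one : opB' p u (1 ⊗ₜ 1) = 0 := by rw [opB'_tmul, contr_one, TensorProduct.tmul_zero]

/-- With `R_r` the divided power of `∑ y ∂/∂x`, this says that `∂/∂x` commutes with it. -/
theorem opB_opR (hu : u ∈ natGrade k n p) (r : ℤ) (z : SymT k n) :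
    opB u (opR r z) = opR r (opB u z) := by
  induction z using symT_induction generalizing r with
  | h₁ => rw [opR_one, opB_one, map_zero]; split_ifs <;> simp [opB_one]
  | ha a b ha hb => simp only [map_add, ha, hb]
  | hs c a ha => simp only [map_smul, ha]
  | hX q w hw a h =>
    simp only [opR_opX _ hw, opR_opY _ hw, opB_opX hu hw, opB_opY hu hw,
      map_add, map_smul, h]
    module
  | hY q w hw a h =>
    simp only [opR_opX _ hw, opR_opY _ hw, opB_opX hu hw, opB_opY hu hw,
      map_add, map_smul, h]

/-- The commutator of `∂/∂y` with `∑ y ∂/∂x` is `∂/∂x`; on the `r`-th divided power it becomes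
`R_{r-1} ∂/∂x`. -/
theorem opB'_opR (hu : u ∈ natGrade k n p) (r : ℤ) (z : SymT k n) :
    opB' (p + 1) u (opR r z) = opR r (opB' (p + 1) u z) + opR (r - 1) (opB u z) := by
  induction z using symT_induction generalizing r with
  | h₁ => rw [opR_one, opB_one, opB'_one, map_zero, map_zero]; split_ifs <;> simp [opB'_one]
  | ha a b ha hb => simp only [map_add, ha, hb]; abel
  | hs c a ha => simp only [map_smul, ha, smul_add]
  | hX q w hw a h =>
    simp only [opR_opX _ hw, opR_opY _ hw, opB_opX hu hw, opB_opY hu hw,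
      opB'_opX hw, opB'_opY hu hw, map_add, map_smul, h]
    module
  | hY q w hw a h =>
    simp only [opR_opX _ hw, opR_opY _ hw, opB_opX hu hw, opB_opY hu hw,
      opB'_opX hw, opB'_opY hu hw, map_add, map_smul, h]
    module

theorem opB'_opL (hu : u ∈ natGrade k n p) (r : ℤ) (z : SymT k n) :
    opB' (p + 1) u (opL r z) = opL r (opB' (p + 1) u z) := by
  induction z using symT_induction generalizing r with
  | h₁ => rw [opL_one, opB'_one, map_zero]; split_ifs <;> simp [opB'_one]
  | ha a b ha hb => simp only [map_add, ha, hb]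
  | hs c a ha => simp only [map_smul, ha]
  | hX q w hw a h =>
    simp only [opL_opX, opL_opY _ hw, opB'_opX hw, opB'_opY hu hw,
      map_add, map_smul, h]
  | hY q w hw a h =>
    simp only [opL_opX, opL_opY _ hw, opB'_opX hw, opB'_opY hu hw,
      map_add, map_smul, h]
    module

/-- Now the left strand receives factors, so differentiating there may hit a factor that came across
the rung; this leaves one crossing fewer and a contraction on the right strand. -/
theorem opB_opL (hu : u ∈ natGrade k n p) (r : ℤ) (z : SymT k n) :
    opB u (opL r z) = opL r (opB u z) + opL (r - 1) (opB' (p + 1) u z) := by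
  induction z using symT_induction generalizing r with
  | h₁ => rw [opL_one, opB_one, opB'_one, map_zero, map_zero]; split_ifs <;> simp [opB_one]
  | ha a b ha hb => simp only [map_add, ha, hb]; abel
  | hs c a ha => simp only [map_smul, ha, smul_add]
  | hX q w hw a h =>
    simp only [opL_opX, opL_opY _ hw, opB_opX hu hw, opB_opY hu hw,
      opB'_opX hw, opB'_opY hu hw, map_add, map_smul, h]
    module
  | hY q w hw a h =>
    simp only [opL_opX, opL_opY _ hw, opB_opX hu hw, opB_opY hu hw,
      opB'_opX hw, opB'_opY hu hw, map_add, map_smul, h]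
    module

end

/-- The cap between two strands. -/
def opC : Module.End k (SymT k n) :=
  TensorProduct.lift (LinearMap.mk₂ k (fun x y => TensorProduct.map (symTw 1).toLinearMap
      ((contr.flip y) ∘ₗ symOne) (comulR 1 x))
    (fun x x' y => by simp only [map_add]) (fun c x y => by simp only [map_smul])
    (fun x y y' => by simp only [map_add, LinearMap.add_comp, TensorProduct.map_add_right,
      LinearMap.add_apply])
    (fun c x y => by simp only [map_smul, LinearMap.smul_comp, TensorProduct.map_smul_right,
      LinearMap.smul_apply]))

theorem opC_tmul (x y : SymAlg k n) : opC (x ⊗ₜ y) = TensorProduct.map (symTw 1).toLinearMap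
    ((contr.flip y) ∘ₗ symOne) (comulR 1 x) := rfl

theorem opC_one : opC (k := k) (n := n) (1 ⊗ₜ 1) = 0 := by
  rw [opC_tmul, comulR_one, if_neg (by decide), map_zero]

/-- The cap pairs a factor of the left strand with one of the right. The outermost left factor `u`
is either passed by the odd cap, with its sign, or is the left leg, and then the right strand is
contracted with `u`. -/
theorem opC_opX {p : ZMod 2} {u : NatV k n} (hu : u ∈ natGrade k n p) (z : SymT k n) :
    opC (opX k n u z) = sgn k p • opX k n u (opC z) + opB' (p + 1) u z := by
  induction z using TensorProduct.induction_on with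
  | zero => simp
  | add x y hx hy => simp only [map_add, hx, hy, smul_add]; abel
  | tmul x y =>
    rw [opX_tmul, opC_tmul, opC_tmul, comulR_mul, map_add]
    congr 1
    · induction comulR 1 x using TensorProduct.induction_on with
      | zero => simp
      | add x y hx hy => simp only [map_add, hx, hy, smul_add]
      | tmul x' y' =>
        simp [opX_tmul, symTw_symι 1 hu, TensorProduct.smul_tmul']
    · rw [show (1 : ℤ) - 1 = 0 by norm_num, comulR_zero, opY_tmul hu, opB'_tmul]
      simp [symTw_add, symTw_symTw 1]

/-- The same dichotomy for the outermost right factor. The case in which `w` is the right leg is a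
contraction of the left strand computed from its right end, which `contr_eq_comulR` compares with
`contr`; the symmetry of the form exchanges the two legs. -/
theorem opC_opY {q : ZMod 2} {w : NatV k n} (hw : w ∈ natGrade k n q) (z : SymT k n) :
    opC (opY k n w z) = sgn k q • opY k n w (opC z) + opB w z := by
  induction z using TensorProduct.induction_on with
  | zero => simp
  | add x y hx hy => simp only [map_add, hx, hy, smul_add]; abel
  | tmul x y =>
    rw [opY_tmul hw, opC_tmul, opC_tmul, comulR_symTw, opB_tmul, contr_eq_comulR hw]
    induction comulR 1 x using TensorProduct.induction_on with
    | zero => simp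
    | add x' y' hx hy =>
      simp only [map_add, hx, hy, smul_add, TensorProduct.add_tmul]; abel
    | tmul x' y' =>
      -- The split-off factor `y'` enters only through its component of degree one, so it is
      -- replaced by an arbitrary vector `v`; by linearity `v` may then be taken homogeneous.
      suffices h : ∀ v : NatV k n, symTw 1 (symTw q x') ⊗ₜ[k] contr (natTw q v) (symι k n w * y) =
          sgn k q • (symTw q (symTw 1 x') ⊗ₜ[k] (symι k n w * contr v y)) +
            form k n w v • (symTw (q + 1) x' ⊗ₜ[k] y) by
        simpa [twT_tmul, opY_tmul hw, TensorProduct.smul_tmul', symOne_symTw] using h (symOne y')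
      intro v
      suffices h : ∀ p, ∀ v ∈ natGrade k n p, symTw 1 (symTw q x') ⊗ₜ[k]
          contr (natTw q v) (symι k n w * y) =
          sgn k q • (symTw q (symTw 1 x') ⊗ₜ[k] (symι k n w * contr v y)) +
            form k n w v • (symTw (q + 1) x' ⊗ₜ[k] y) by
        rw [← natProj_add v]
        simp only [map_add, LinearMap.add_apply, TensorProduct.tmul_add, mul_add, smul_add,
          h 0 _ (natProj_mem 0 v), h 1 _ (natProj_mem 1 v), ← formLin_apply, add_smul]
        abel
      intro p v hv
      rw [natTw_apply q hv, map_smul, LinearMap.smul_apply, contr_symι_mul hv hw, symTw_add,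
        symTw_symTw 1, form_comm v w]
      -- A nonzero value of the form forces `p = q + 1`, and `q (q + 1)` is even.
      have e : form k n w v * sgn k (q * p) = form k n w v := by
        by_cases h : p = q + 1
        · subst h
          rcases zmod_cases q with rfl | rfl <;> simp [CharTwo.add_self_eq_zero]
        · rw [form_eq_zero hw hv h, zero_mul]
      simp only [TensorProduct.tmul_smul, TensorProduct.tmul_add, smul_add, smul_smul]
      rw [mul_comm, e, add_comm, mul_add, mul_one, sgn_add, ← mul_assoc, sgn_mul_self, one_mul]

/-! ### The antenna and the relations between caps and rungs -/

section Antenna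

variable [NeZero (2 : k)]

/-- The antenna. -/
def symAnt : SymAlg k n →ₗ[k] k :=
  (2 : k)⁻¹ • (TensorProduct.lift (symForm k n) ∘ₗ comulR 1)

theorem symAnt_apply (x : SymAlg k n) :
    symAnt x = (2 : k)⁻¹ * TensorProduct.lift (symForm k n) (comulR 1 x) := rfl

/-- The counit axiom read in degree one: the augmentation removes every term that keeps a factor on
the left. -/
theorem counit_comulR (y : SymAlg k n) :
    TensorProduct.lift (LinearMap.lsmul k (NatV k n) ∘ₗ symAug) (TensorProduct.map LinearMap.id
      symOne (comulR 1 y)) = symOne y := by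
  induction y using symAlg_left_induction with
  | h₁ => rw [comulR_one, if_neg (by decide)]; simp
  | ha a b ha hb => simp only [map_add, ha, hb]
  | hs c a ha => simp only [map_smul, ha]
  | hm q w hw a ha =>
    rw [comulR_mul, map_add, map_add, show (1 : ℤ) - 1 = 0 by norm_num, comulR_zero, opY_tmul hw]
    have e : TensorProduct.lift (LinearMap.lsmul k (NatV k n) ∘ₗ symAug) (TensorProduct.map
        LinearMap.id symOne (opX k n w (comulR 1 a))) = 0 := by
      induction comulR 1 a using TensorProduct.induction_on with
      | zero => simp
      | add x y hx hy => simp only [map_add, hx, hy, add_zero]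
      | tmul x' y' => simp [opX_tmul]
    rw [e]
    simp [symAug_symTw]

/-- In bidegree `(1, 1)` the coproduct of `u y` has a term with `u` on the left and one with `u` on
the right. As the form is symmetric and odd, both contribute `(u, y)`, and the factor one half in
the antenna restores the form. This is the source of antenna retraction. -/
theorem symAnt_symι_mul {p : ZMod 2} {u : NatV k n} (hu : u ∈ natGrade k n p) (y : SymAlg k n) :
    symAnt (symι k n u * y) = form k n u (symOne y) := by
  have h2 : (2 : k) ≠ 0 := NeZero.ne _
  rw [symAnt_apply, comulR_mul, map_add, show (1 : ℤ) - 1 = 0 by norm_num, comulR_zero,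
    opY_tmul hu, TensorProduct.lift.tmul, symForm_apply, mul_one, symOne_symι, form_comm _ u,
    symForm_symTw p hu]
  have e : TensorProduct.lift (symForm k n) (opX k n u (comulR 1 y)) = form k n u (symOne y) := by
    conv_rhs => rw [← counit_comulR y]
    induction comulR 1 y using TensorProduct.induction_on with
    | zero => simp [form]
    | add x y hx hy => simp only [map_add, hx, hy, ← formLin_apply]
    | tmul x' y' => simp [opX_tmul, symForm_apply, form_smul_left, form_smul_right]
  -- The sign of moving `u` past its partner is trivial, because partners have opposite parities.
  have e' : sgn k (p * (p + 1)) = 1 := by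
    rcases zmod_cases p with rfl | rfl <;> simp [CharTwo.add_self_eq_zero]
  rw [e, e', one_mul, ← two_mul, ← mul_assoc, inv_mul_cancel₀ h2, one_mul]

theorem symAnt_symTw (q : ZMod 2) (x : SymAlg k n) : symAnt (symTw q x) = sgn k q * symAnt x := by
  induction x using symAlg_left_induction with
  | h₁ => simp [symAnt_apply, comulR_one]
  | ha a b ha hb => simp only [map_add, ha, hb, mul_add]
  | hs c a ha => simp only [map_smul, ha, smul_eq_mul]; ring
  | hm p v hv a ha =>
    rw [symTw_symι_mul q hv, map_smul, symAnt_symι_mul hv, symAnt_symι_mul hv, symForm_symTw q hv,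
      smul_eq_mul, ← mul_assoc, mul_add, mul_one, sgn_add, ← mul_assoc, sgn_mul_self, one_mul]

/-- The antenna on the right of a strand. -/
def antLin : Module.End k (SymAlg k n) :=
  (TensorProduct.rid k (SymAlg k n)).toLinearMap ∘ₗ
    TensorProduct.map (symTw 1).toLinearMap symAnt ∘ₗ comulR 2

/-- The antenna on the left of a strand. -/
def antLin' : Module.End k (SymAlg k n) :=
  (TensorProduct.lid k (SymAlg k n)).toLinearMap ∘ₗ
    TensorProduct.map symAnt LinearMap.id ∘ₗ comulL 2

theorem antLin_one : antLin (1 : SymAlg k n) = 0 := by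
  simp [antLin, comulR_one]

theorem antLin'_one : antLin' (1 : SymAlg k n) = 0 := by
  simp [antLin', comulL_one]

/-- The antenna is a second-order odd operator: the factor `u` is either passed, with a sign, or is
a leg of the antenna, and then the rest is contracted with `u`. -/
theorem antLin_symι_mul {p : ZMod 2} {u : NatV k n} (hu : u ∈ natGrade k n p) (x : SymAlg k n) :
    antLin (symι k n u * x) = sgn k p • (symι k n u * antLin x) + contr u x := by
  simp only [antLin, LinearMap.comp_apply, comulR_mul, map_add]
  congr 1
  · induction comulR 2 x using TensorProduct.induction_on with
    | zero => simp
    | add x y hx hy => simp only [map_add, hx, hy, mul_add, smul_add]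
    | tmul x' y' => simp [opX_tmul, symTw_symι 1 hu, smul_comm (symAnt y')]
  · rw [contr_eq_comulR hu, show (2 : ℤ) - 1 = 1 by norm_num]
    induction comulR 1 x using TensorProduct.induction_on with
    | zero => simp
    | add x y hx hy => simp only [map_add, hx, hy]
    | tmul x' y' => simp [opY_tmul hu, symAnt_symι_mul hu, symTw_add, symTw_symTw 1]

/-- The recursion has the same form as that of `antLin`: the side from which the antenna is attached
leaves no trace in it. -/
theorem antLin'_symι_mul {p : ZMod 2} {u : NatV k n} (hu : u ∈ natGrade k n p) (x : SymAlg k n) :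
    antLin' (symι k n u * x) = sgn k p • (symι k n u * antLin' x) + contr u x := by
  simp only [antLin', LinearMap.comp_apply, comulL_mul, map_add]
  congr 1
  · induction comulL 2 x using TensorProduct.induction_on with
    | zero => simp
    | add x y hx hy => simp only [map_add, hx, hy, mul_add, smul_add]
    | tmul x' y' => simp [opY_tmul hu, symAnt_symTw, mul_smul]
  · rw [contr_apply, show (2 : ℤ) - 1 = 1 by norm_num]
    induction comulL 1 x using TensorProduct.induction_on with
    | zero => simp
    | add x y hx hy => simp only [map_add, hx, hy]
    | tmul x' y' => simp [opX_tmul, symAnt_symι_mul hu]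

theorem antLin_symTw (q : ZMod 2) (x : SymAlg k n) :
    antLin (symTw q x) = sgn k q • symTw q (antLin x) := by
  simp only [antLin, LinearMap.comp_apply, comulR_symTw]
  induction comulR 2 x using TensorProduct.induction_on with
  | zero => simp
  | add x y hx hy => simp only [map_add, hx, hy, smul_add]
  | tmul x' y' => simp [twT_tmul, symAnt_symTw, mul_smul, symTw_symTw 1]

/-- The antenna on the right of the left strand. -/
def opA : Module.End k (SymT k n) := TensorProduct.map antLin LinearMap.id

/-- The antenna on the left of the right strand. -/
def opA' : Module.End k (SymT k n) := TensorProduct.map (symTw 1).toLinearMap antLin'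

theorem opA_opX {p : ZMod 2} {u : NatV k n} (hu : u ∈ natGrade k n p) (z : SymT k n) :
    opA (opX k n u z) = sgn k p • opX k n u (opA z) + opB u z := by
  induction z using TensorProduct.induction_on with
  | zero => simp
  | add x y hx hy => simp only [map_add, hx, hy, smul_add]; abel
  | tmul x y =>
    simp [opA, opX_tmul, opB_tmul, antLin_symι_mul hu, TensorProduct.add_tmul,
      TensorProduct.smul_tmul']

theorem opA_opY {p : ZMod 2} {u : NatV k n} (hu : u ∈ natGrade k n p) (z : SymT k n) :
    opA (opY k n u z) = sgn k p • opY k n u (opA z) := by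
  induction z using TensorProduct.induction_on with
  | zero => simp
  | add x y hx hy => simp only [map_add, hx, hy, smul_add]
  | tmul x y => simp [opA, opY_tmul hu, antLin_symTw, TensorProduct.smul_tmul']

theorem opA'_opY {p : ZMod 2} {u : NatV k n} (hu : u ∈ natGrade k n p) (z : SymT k n) :
    opA' (opY k n u z) = sgn k p • opY k n u (opA' z) + opB' (p + 1) u z := by
  induction z using TensorProduct.induction_on with
  | zero => simp
  | add x y hx hy => simp only [map_add, hx, hy, smul_add]; abel
  | tmul x y =>
    simp [opA', opY_tmul hu, opB'_tmul, antLin'_symι_mul hu, TensorProduct.tmul_add,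
      symTw_add, symTw_symTw 1]

theorem opA'_opX {p : ZMod 2} {u : NatV k n} (hu : u ∈ natGrade k n p) (z : SymT k n) :
    opA' (opX k n u z) = sgn k p • opX k n u (opA' z) := by
  induction z using TensorProduct.induction_on with
  | zero => simp
  | add x y hx hy => simp only [map_add, hx, hy, smul_add]
  | tmul x y => simp [opA', opX_tmul, symTw_symι 1 hu, TensorProduct.smul_tmul']

theorem opA_one : opA (k := k) (n := n) (1 ⊗ₜ 1) = 0 := by simp [opA, antLin_one]

theorem opA'_one : opA' (k := k) (n := n) (1 ⊗ₜ 1) = 0 := by simp [opA', antLin'_one]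

/-- The cap/rung swap relation. -/
theorem opC_opR (r : ℤ) (z : SymT k n) :
    opC (opR r z) = opR r (opC z) + (2 : k) • opR (r - 1) (opA z) := by
  induction z using symT_induction generalizing r with
  | h₁ => rw [opR_one, opC_one, opA_one, map_zero, map_zero]; split_ifs <;> simp [opC_one]
  | ha a b ha hb => simp only [map_add, ha, hb, smul_add]; abel
  | hs c a ha => simp only [map_smul, ha, smul_add, smul_comm c]
  | hX q w hw a h =>
    -- The coefficient `2` is the sum of two equal contributions `R_{r-1} opB`: one from commuting
    -- `opB'` past the rung, the other from the cap meeting the copy of `w` that crossed. On the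
    -- other side `opA` produces this term once.
    simp only [opR_opX _ hw, opR_opY _ hw, opC_opX hw, opC_opY hw, opA_opX hw,
      opA_opY hw, opB'_opR hw, opB_opR hw, map_add, map_smul, h]
    module
  | hY q w hw a h =>
    simp only [opR_opX _ hw, opR_opY _ hw, opC_opX hw, opC_opY hw, opA_opX hw,
      opA_opY hw, opB'_opR hw, opB_opR hw, map_add, map_smul, h]
    module

theorem opC_opL (r : ℤ) (z : SymT k n) :
    opC (opL r z) = opL r (opC z) + (2 : k) • opL (r - 1) (opA' z) := by
  induction z using symT_induction generalizing r with
  | h₁ => rw [opL_one, opC_one, opA'_one, map_zero, map_zero]; split_ifs <;> simp [opC_one]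
  | ha a b ha hb => simp only [map_add, ha, hb, smul_add]; abel
  | hs c a ha => simp only [map_smul, ha, smul_add, smul_comm c]
  | hX q w hw a h =>
    -- In this mirror image a factor on the left is not moved by the rung, and the doubled term
    -- arises for factors on the right, in the remaining case.
    simp only [opL_opX, opL_opY _ hw, opC_opX hw, opC_opY hw, opA'_opX hw,
      opA'_opY hw, opB'_opL hw, opB_opL hw, map_add, map_smul, h]
    module
  | hY q w hw a h =>
    simp only [opL_opX, opL_opY _ hw, opC_opX hw, opC_opY hw, opA'_opX hw,
      opA'_opY hw, opB'_opL hw, opB_opL hw, map_add, map_smul, h]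
    module

end Antenna

/-! ### Cups -/

variable (k) in
/-- The basis vector `v_i`. -/
def natVec (i : Ix n) : NatV k n := Pi.single i 1

theorem natVec_mem (i : Ix n) : natVec k i ∈ natGrade k n i.par := by
  intro j hj
  have : j ≠ i := by rintro rfl; exact hj rfl
  simp [natVec, this]

/-- The cup between two strands. -/
def opU : Module.End k (SymT k n) :=
  ∑ i : Ix n, sgn k i.par • (opX k n (natVec k i) ∘ₗ opY k n (natVec k i.swap))

theorem opU_apply (z : SymT k n) : opU z =
    ∑ i : Ix n, sgn k i.par • opX k n (natVec k i) (opY k n (natVec k i.swap) z) := by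
  simp [opU, LinearMap.sum_apply]

/-- The terms of `i` and `-i` cancel: one of `v_i`, `v_{-i}` is even, so the operators commute
without a sign, while the coefficients are `1` and `-1`. -/
theorem sum_cup_eq_zero {M : Type v} [AddCommGroup M] [Module k M]
    {A : NatV k n →ₗ[k] Module.End k M} (hA : SuperComm A A) (z : M) :
    ∑ i : Ix n, sgn k i.par • A (natVec k i) (A (natVec k i.swap) z) = 0 := by
  rw [Fintype.sum_sum_type, ← Finset.sum_add_distrib]
  refine Finset.sum_eq_zero fun i _ => ?_
  have h := LinearMap.congr_fun (hA 0 1 _ (natVec_mem (Sum.inl i)) _ (natVec_mem (Sum.inr i))) z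
  simp only [Module.End.mul_apply, LinearMap.smul_apply, zero_mul, sgn_zero, one_smul] at h
  simp [Ix.par, h]

/-- The rung could also carry the left leg of the cup to the right strand. Both legs would then be
multiplied on one strand, and the sum of these terms vanishes. -/
theorem opU_opR (r : ℤ) (z : SymT k n) : opU (opR r z) = opR r (opU z) := by
  simp only [opU_apply, map_sum, map_smul, opR_opX r (natVec_mem _), opR_opY _ (natVec_mem _),
    smul_add, Finset.sum_add_distrib]
  rw [sum_cup_eq_zero (M := SymT k n) opY_opY, add_zero]

theorem opU_opL (r : ℤ) (z : SymT k n) : opU (opL r z) = opL r (opU z) := by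
  simp only [opU_apply, map_sum, map_smul, opL_opX, opL_opY _ (natVec_mem _), map_add,
    smul_add, Finset.sum_add_distrib]
  rw [sum_cup_eq_zero (M := SymT k n) opX_opX, add_zero]

end Caps

end

end TypeP

namespace TypeP

noncomputable section

/-! ## Equivariance of the comultiplication -/

section Equivariance

variable {k : Type u} [Field k] {n : ℕ}

/-- The action of `𝔭(n)` on `S(V) ⊗ S(V)`. -/
def symDerT {p : ZMod 2} (ξ : typeP k n p) : Module.End k (SymT k n) :=
  TensorProduct.map (symDer ξ) LinearMap.id + TensorProduct.map (symTw p).toLinearMap (symDer ξ)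

theorem symDerT_tmul {p : ZMod 2} (ξ : typeP k n p) (x y : SymAlg k n) :
    symDerT ξ (x ⊗ₜ y) = symDer ξ x ⊗ₜ y + symTw p x ⊗ₜ symDer ξ y := rfl

theorem symDer_symι_mul {p q : ZMod 2} (ξ : typeP k n p) {v : NatV k n} (hv : v ∈ natGrade k n q)
    (x : SymAlg k n) : symDer ξ (symι k n v * x) =
      symι k n (ξ.1 v) * x + sgn k (p * q) • (symι k n v * symDer ξ x) := by
  rw [symDer_mul, symTw_symι p hv, symDer_symι, smul_mul_assoc, add_comm]

/-- The assignment `v ↦ X_v` is itself equivariant, and so is `v ↦ Y_v` below; this reduces the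
equivariance of anything built from `X` and `Y` to its value on `1 ⊗ 1`. -/
theorem symDerT_opX {p q : ZMod 2} (ξ : typeP k n p) {v : NatV k n} (hv : v ∈ natGrade k n q)
    (z : SymT k n) : symDerT ξ (opX k n v z) =
      opX k n (ξ.1 v) z + sgn k (p * q) • opX k n v (symDerT ξ z) := by
  induction z using TensorProduct.induction_on with
  | zero => simp
  | add x y hx hy => simp only [map_add, hx, hy, smul_add]; abel
  | tmul x y =>
    simp only [opX_tmul, symDerT_tmul, symDer_symι_mul ξ hv, symTw_symι_mul p hv, map_add,
      TensorProduct.add_tmul, ← TensorProduct.smul_tmul', smul_add]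
    abel

theorem symDerT_opY {p q : ZMod 2} (ξ : typeP k n p) {v : NatV k n} (hv : v ∈ natGrade k n q)
    (z : SymT k n) : symDerT ξ (opY k n v z) =
      opY k n (ξ.1 v) z + sgn k (p * q) • opY k n v (symDerT ξ z) := by
  induction z using TensorProduct.induction_on with
  | zero => simp
  | add x y hx hy => simp only [map_add, hx, hy, smul_add]; abel
  | tmul x y =>
    have e : symDer ξ (symTw q x) = sgn k (p * q) • symTw q (symDer ξ x) := by
      rw [symDer_symTw, smul_smul, mul_comm q p, sgn_mul_self, one_smul]
    simp only [opY_tmul hv, opY_tmul (ξ.2.1 q v hv), symDerT_tmul, symDer_symι_mul ξ hv, e, map_add,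
      TensorProduct.tmul_add, ← TensorProduct.smul_tmul', TensorProduct.tmul_smul, smul_add,
      symTw_add, symTw_symTw q p]
    abel

/-- Both sides satisfy the recursion obtained by commuting the action past `X_v` and `Y_v`, and both
vanish at `1`. -/
theorem comulR_symDer {p : ZMod 2} (ξ : typeP k n p) (s : ℤ) (x : SymAlg k n) :
    comulR s (symDer ξ x) = symDerT ξ (comulR s x) := by
  induction x using symAlg_left_induction generalizing s with
  | h₁ =>
    have e : symDer ξ (1 : SymAlg k n) = 0 := by
      rw [← map_one (algebraMap k (SymAlg k n)), symDer_algebraMap]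
    rw [e, comulR_one, map_zero]
    split_ifs
    · rw [symDerT_tmul, e]; simp
    · simp
  | ha a b ha hb => simp only [map_add, ha, hb]
  | hs c a ha => simp only [map_smul, ha]
  | hm q v hv a ha =>
    simp only [symDer_symι_mul ξ hv, map_add, map_smul, comulR_mul, symDerT_opX ξ hv,
      symDerT_opY ξ hv, ha, smul_add]
    abel

end Equivariance

/-! ## The comultiplication of a product -/

section Shuffle

variable {k : Type u} [Field k] {n : ℕ}

/-- The product of the `x_t` for `t` in `T`, in increasing order. -/
def finProd {m : ℕ} (x : Fin m → NatV k n) (T : Finset (Fin m)) : SymAlg k n :=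
  (((List.finRange m).filter (· ∈ T)).map fun i => symι k n (x i)).prod

theorem finProd_image_succ {m : ℕ} (x : Fin (m + 1) → NatV k n) (T : Finset (Fin m)) :
    finProd x (T.image Fin.succ) = finProd (fun i => x i.succ) T := by
  rw [finProd, finProd, List.finRange_succ, List.filter_cons_of_neg (by simp), List.filter_map,
    List.map_map]
  congr 3
  ext i
  simp

theorem finProd_insert {m : ℕ} (x : Fin (m + 1) → NatV k n) (T : Finset (Fin m)) :
    finProd x (insert 0 (T.image Fin.succ)) =
      symι k n (x 0) * finProd (fun i => x i.succ) T := by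
  rw [finProd, finProd, List.finRange_succ, List.filter_cons_of_pos (by simp), List.filter_map,
    List.map_cons, List.prod_cons, List.map_map]
  congr 4
  ext i
  simp

theorem compl_image_succ {m : ℕ} (T : Finset (Fin m)) :
    (T.image Fin.succ)ᶜ = insert 0 (Tᶜ.image Fin.succ) := by
  ext i
  cases i using Fin.cases <;> simp

theorem compl_insert_image_succ {m : ℕ} (T : Finset (Fin m)) :
    (insert 0 (T.image Fin.succ))ᶜ = Tᶜ.image Fin.succ := by
  rw [← compl_compl T, ← compl_image_succ, compl_compl, compl_compl]

theorem sum_finset_fin_succ {M : Type v} [AddCommMonoid M] {m : ℕ} (f : Finset (Fin (m + 1)) → M) :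
    ∑ T, f T = ∑ T : Finset (Fin m), f (T.image Fin.succ) +
      ∑ T : Finset (Fin m), f (insert 0 (T.image Fin.succ)) := by
  have e : (Finset.univ : Finset (Fin (m + 1))) = insert 0 (Finset.univ.image Fin.succ) := by
    ext i
    cases i using Fin.cases <;> simp
  rw [← Finset.powerset_univ, e, Finset.sum_powerset_insert (by simp), Finset.powerset_image,
    Finset.powerset_univ, Finset.sum_image, Finset.sum_image] <;>
  exact fun a _ b _ h => Finset.image_injective (Fin.succ_injective m) h

/-- As a product over pairs the sign can be split according to the position of the first index. -/
theorem splSign_eq {m : ℕ} (p : Fin m → ZMod 2) (T : Finset (Fin m)) : splSign k p T =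
    ∏ t ∈ T, ∏ u ∈ Tᶜ, if u < t then sgn k (p u * p t) else 1 := by
  rw [← Finset.prod_product', splSign, ← Finset.prod_const, Finset.prod_filter]
  refine Finset.prod_congr rfl fun z _ => ?_
  rcases zmod_cases (p z.1) with h | h <;> rcases zmod_cases (p z.2) with h' | h' <;>
    simp [h, h']

theorem splSign_insert {m : ℕ} (p : Fin (m + 1) → ZMod 2) (T : Finset (Fin m)) :
    splSign k p (insert 0 (T.image Fin.succ)) = splSign k (fun i => p i.succ) T := by
  rw [splSign_eq, splSign_eq, compl_insert_image_succ, Finset.prod_insert (by simp),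
    Finset.prod_image (fun a _ b _ h => Fin.succ_injective m h)]
  simp [Finset.prod_image (fun a _ b _ h => Fin.succ_injective m h)]

/-- Here the first index lies in the complement. It precedes every element of `T`, and the resulting
factor is the one by which the twist in `Y_{x_0}` acts on `x_T`. If the first index lies in `T`, it
exceeds nothing and no sign appears. -/
theorem splSign_image_succ {m : ℕ} (p : Fin (m + 1) → ZMod 2) (T : Finset (Fin m)) :
    splSign k p (T.image Fin.succ) =
      (∏ t ∈ T, sgn k (p 0 * p t.succ)) * splSign k (fun i => p i.succ) T := by
  rw [splSign_eq, splSign_eq, compl_image_succ,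
    Finset.prod_image (fun a _ b _ h => Fin.succ_injective m h), ← Finset.prod_mul_distrib]
  refine Finset.prod_congr rfl fun t _ => ?_
  rw [Finset.prod_insert (by simp), Finset.prod_image (fun a _ b _ h => Fin.succ_injective m h)]
  simp

theorem symTw_finProd {m : ℕ} {x : Fin m → NatV k n} {p : Fin m → ZMod 2}
    (hx : ∀ i, x i ∈ natGrade k n (p i)) (q : ZMod 2) (T : Finset (Fin m)) :
    symTw q (finProd x T) = (∏ t ∈ T, sgn k (q * p t)) • finProd x T := by
  have h : ∀ l : List (Fin m), symTw q (l.map fun i => symι k n (x i)).prod =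
      (l.map fun t => sgn k (q * p t)).prod • (l.map fun i => symι k n (x i)).prod := by
    intro l
    induction l with
    | nil => simp
    | cons a l ih =>
      simp only [List.map_cons, List.prod_cons, symTw_symι_mul q (hx a), ih, mul_smul_comm,
        smul_smul]
  rw [finProd, h]
  congr 1
  have hT : T = ((List.finRange m).filter (· ∈ T)).toFinset := by ext i; simp
  conv_rhs => rw [hT]
  rw [List.prod_toFinset _ ((List.nodup_finRange m).filter _)]

/-- Unfolding the recursion of the coproduct, each factor goes to the left or to the right, so the
terms are indexed by subsets. The signs of the shuffles are created by `Y`, when a factor sent to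
the right passes the later ones that stayed on the left. -/
theorem comulR_prod {m : ℕ} {x : Fin m → NatV k n} {p : Fin m → ZMod 2}
    (hx : ∀ i, x i ∈ natGrade k n (p i)) (s : ℤ) :
    comulR s (List.ofFn fun i => symι k n (x i)).prod = ∑ T : Finset (Fin m),
      if (Tᶜ.card : ℤ) = s then splSign k p T • finProd x T ⊗ₜ[k] finProd x Tᶜ else 0 := by
  induction m generalizing s with
  | zero =>
    rw [Fintype.sum_unique, List.ofFn_zero, List.prod_nil, comulR_one,
      show (default : Finset (Fin 0)) = ∅ from rfl]
    simp [finProd, splSign, eq_comm]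
  | succ m ih =>
    rw [List.ofFn_succ, List.prod_cons, comulR_mul, ih (fun i => hx i.succ),
      ih (fun i => hx i.succ), sum_finset_fin_succ, map_sum, map_sum, add_comm]
    congr 1
    · refine Finset.sum_congr rfl fun T _ => ?_
      rw [compl_image_succ, Finset.card_insert_of_notMem (by simp),
        Finset.card_image_of_injective _ (Fin.succ_injective m), finProd_image_succ, finProd_insert,
        splSign_image_succ]
      have e : ((Tᶜ.card : ℤ) = s - 1) ↔ ((Tᶜ.card + 1 : ℕ) : ℤ) = s := by
        push_cast; omega
      simp only [e]
      split_ifs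
      · rw [map_smul, opY_tmul (hx 0), symTw_finProd (fun i => hx i.succ), ← TensorProduct.smul_tmul',
          smul_smul, mul_comm]
      · rw [map_zero]
    · refine Finset.sum_congr rfl fun T _ => ?_
      rw [compl_insert_image_succ, Finset.card_image_of_injective _ (Fin.succ_injective m),
        finProd_image_succ, finProd_insert, splSign_insert]
      split_ifs
      · rw [map_smul, opX_tmul]
      · rw [map_zero]

theorem subProd_val {m a : ℕ} [NeZero (2 : k)] (x : Fin m → NatV k n) (T : Finset (Fin m))
    (h : T.card = a) : (show SymPow k n a from subProd x T h).1 = finProd x T := by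
  change (List.ofFn fun i => symι k n (x (T.orderEmbOfFin h i))).prod = _
  rw [finProd, List.ofFn_eq_map]
  -- Both sides are the increasing enumeration of `T`.
  have e : (List.finRange a).map (T.orderEmbOfFin h) = (List.finRange m).filter (· ∈ T) := by
    rw [Finset.listMap_orderEmbOfFin_finRange]
    refine T.sortedLT_sort.eq_of_mem_iff ((List.sortedLT_finRange m).pairwise.filter _).sortedLT fun i => ?_
    simp
  rw [← e, List.map_map]
  rfl

end Shuffle

end

end TypeP

namespace TypeP

noncomputable section

/-! ## The supertrace of the symmetric powers -/

section Supertrace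

variable {k : Type u} [Field k] {n : ℕ}

/-- The algebra endomorphism of `S(V)` induced by an even endomorphism of `V`. -/
def symMap (c : NatV k n →ₗ[k] NatV k n) (hc : ∀ p, ∀ v ∈ natGrade k n p, c v ∈ natGrade k n p) :
    SymAlg k n →ₐ[k] SymAlg k n :=
  symLift (symι k n ∘ₗ c) fun p q v hv w hw => symι_mul_comm (hc p v hv) (hc q w hw)

theorem symMap_symι_mul (c : NatV k n →ₗ[k] NatV k n)
    (hc : ∀ p, ∀ v ∈ natGrade k n p, c v ∈ natGrade k n p) (v : NatV k n) (x : SymAlg k n) :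
    symMap c hc (symι k n v * x) = symι k n (c v) * symMap c hc x := by
  rw [map_mul, symMap, symLift_symι]; rfl

/-- Endomorphisms `a`, `b`, `c` of `V` such that `v ↦ [[a v, b v], [0, c v]]` extends to `S(V)`. -/
structure SkewData (k : Type u) [Field k] (n : ℕ) where
  (a b c : NatV k n →ₗ[k] NatV k n)
  ha : ∀ p, ∀ v ∈ natGrade k n p, a v ∈ natGrade k n p
  hc : ∀ p, ∀ v ∈ natGrade k n p, c v ∈ natGrade k n p
  comm : ∀ p q, ∀ v ∈ natGrade k n p, ∀ w ∈ natGrade k n q,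
    symι k n (a v) * symι k n (b w) + symι k n (b v) * symι k n (c w) =
      sgn k (p * q) • (symι k n (a w) * symι k n (b v) + symι k n (b w) * symι k n (c v))

/-- Auxiliary: `v ↦ [[a v, b v], [0, c v]]`. -/
def SkewData.lin (d : SkewData k n) : NatV k n →ₗ[k] Matrix (Fin 2) (Fin 2) (SymAlg k n) where
  toFun v := !![symι k n (d.a v), symι k n (d.b v); 0, symι k n (d.c v)]
  map_add' v w := by ext i j; fin_cases i <;> fin_cases j <;> simp
  map_smul' c v := by ext i j; fin_cases i <;> fin_cases j <;> simp

/-- Auxiliary: the extension of `v ↦ [[a v, b v], [0, c v]]` to `S(V)`. -/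
def SkewData.hom (d : SkewData k n) : SymAlg k n →ₐ[k] Matrix (Fin 2) (Fin 2) (SymAlg k n) :=
  symLift d.lin (by
    intro p q v hv w hw
    ext i j
    fin_cases i <;> fin_cases j
    · simpa [lin, Matrix.mul_apply] using symι_mul_comm (d.ha p v hv) (d.ha q w hw)
    · simpa [lin, Matrix.mul_apply] using d.comm p q v hv w hw
    · simp [lin, Matrix.mul_apply]
    · simpa [lin, Matrix.mul_apply] using symι_mul_comm (d.hc p v hv) (d.hc q w hw))

theorem SkewData.hom_symι_mul (d : SkewData k n) (v : NatV k n) (x : SymAlg k n) :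
    d.hom (symι k n v * x) = d.lin v * d.hom x := by
  rw [map_mul]; congr 1; rw [hom, symLift_symι]

/-- The skew derivation with `v x ↦ a(v) δ(x) + b(v) c(x)`. -/
def SkewData.der (d : SkewData k n) : Module.End k (SymAlg k n) where
  toFun x := d.hom x 0 1
  map_add' a b := by simp
  map_smul' c a := by simp

theorem SkewData.der_one (d : SkewData k n) : d.der 1 = 0 := by simp [der]

theorem SkewData.hom_one_one (d : SkewData k n) (x : SymAlg k n) :
    d.hom x 1 1 = symMap d.c d.hc x := by
  induction x using symAlg_left_induction with
  | h₁ => simp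
  | ha a b ha hb => simp [ha, hb]
  | hs c a ha => simp [ha]
  | hm p v hv a ha =>
    rw [hom_symι_mul, symMap_symι_mul, ← ha]
    simp [Matrix.mul_apply, lin]

theorem SkewData.der_symι_mul (d : SkewData k n) (v : NatV k n) (x : SymAlg k n) :
    d.der (symι k n v * x) = symι k n (d.a v) * d.der x + symι k n (d.b v) * symMap d.c d.hc x := by
  rw [← hom_one_one]
  change d.hom (symι k n v * x) 0 1 = _
  rw [hom_symι_mul]
  simp [Matrix.mul_apply, lin, der]

theorem symMap_mem (c : NatV k n →ₗ[k] NatV k n)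
    (hc : ∀ p, ∀ v ∈ natGrade k n p, c v ∈ natGrade k n p) {m : ℕ} {x : SymAlg k n}
    (hx : x ∈ SymPow k n m) : symMap c hc x ∈ SymPow k n m := by
  induction hx using symPow_induction with
  | h₁ => rw [map_one]; exact one_mem_symPow
  | ha m a b _ _ ha hb => rw [map_add]; exact add_mem ha hb
  | hs m c a _ ha => rw [map_smul]; exact Submodule.smul_mem _ _ ha
  | hm m p v hv x _ hx => rw [symMap_symι_mul]; exact symι_mul_mem _ hx

theorem SkewData.der_mem (d : SkewData k n) {m : ℕ} {x : SymAlg k n} (hx : x ∈ SymPow k n m) :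
    d.der x ∈ SymPow k n m := by
  induction hx using symPow_induction with
  | h₁ => rw [der_one]; exact zero_mem _
  | ha m a b _ _ ha hb => rw [map_add]; exact add_mem ha hb
  | hs m c a _ ha => rw [map_smul]; exact Submodule.smul_mem _ _ ha
  | hm m p v hv x hx' hx =>
    rw [der_symι_mul]
    exact add_mem (symι_mul_mem _ hx) (symι_mul_mem _ (symMap_mem _ _ hx'))

/-- The projection of `V` to the span of the `v_i`, `v_{-i}` with `i` in `s`. -/
def pairProj (s : Set (Fin n)) [DecidablePred (· ∈ s)] : NatV k n →ₗ[k] NatV k n where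
  toFun v i := if Sum.elim id id i ∈ s then v i else 0
  map_add' v w := by ext i; by_cases h : Sum.elim id id i ∈ s <;> simp [h]
  map_smul' c v := by ext i; by_cases h : Sum.elim id id i ∈ s <;> simp [h]

theorem pairProj_apply (s : Set (Fin n)) [DecidablePred (· ∈ s)] (v : NatV k n) (i : Ix n) :
    pairProj s v i = if Sum.elim id id i ∈ s then v i else 0 := rfl

theorem pairProj_mem (s : Set (Fin n)) [DecidablePred (· ∈ s)] (p : ZMod 2) :
    ∀ v ∈ natGrade k n p, pairProj s v ∈ natGrade k n p := by
  intro v hv i hi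
  rw [pairProj_apply, hv i hi, ite_self]

variable (k) in
/-- The basis vector `v_i`, for `i > 0`. -/
def evVec (i : Fin n) : NatV k n := natVec k (Sum.inl i)

variable (k) in
/-- The basis vector `v_{-i}`, for `i > 0`. -/
def odVec (i : Fin n) : NatV k n := natVec k (Sum.inr i)

theorem evVec_mem (i : Fin n) : evVec k i ∈ natGrade k n 0 := natVec_mem (Sum.inl i)

theorem odVec_mem (i : Fin n) : odVec k i ∈ natGrade k n 1 := natVec_mem (Sum.inr i)

theorem pair_comm (p : ZMod 2) {v w : NatV k n} (hv : v ∈ natGrade k n 0) (hw : w ∈ natGrade k n p) :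
    symι k n v * symι k n w = symι k n w * symι k n v := by
  rw [symι_mul_comm hv hw, zero_mul, sgn_zero, one_smul]

theorem odd_comm {v w : NatV k n} (hv : v ∈ natGrade k n 1) (hw : w ∈ natGrade k n 1) :
    symι k n v * symι k n w = (-1 : k) • (symι k n w * symι k n v) := by
  rw [symι_mul_comm hv hw, one_mul, sgn_one]

theorem odd_apply_inl {v : NatV k n} (hv : v ∈ natGrade k n 1) (i : Fin n) : v (Sum.inl i) = 0 :=
  hv _ (by simp [Ix.par])

theorem even_apply_inr {v : NatV k n} (hv : v ∈ natGrade k n 0) (i : Fin n) : v (Sum.inr i) = 0 :=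
  hv _ (by simp [Ix.par])

theorem even_sub_pairProj {v : NatV k n} (hv : v ∈ natGrade k n 0) (i : Fin n) :
    pairProj {i}ᶜ v = v - v (Sum.inl i) • evVec k i := by
  ext j
  rcases j with j | j
  · by_cases h : j = i
    · subst h; simp [pairProj_apply, evVec, natVec]
    · simp [pairProj_apply, evVec, natVec, h]
  · simp [pairProj_apply, evVec, natVec, even_apply_inr hv]

theorem odd_sub_pairProj {v : NatV k n} (hv : v ∈ natGrade k n 1) (i : Fin n) :
    pairProj {i}ᶜ v = v - v (Sum.inr i) • odVec k i := by
  ext j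
  rcases j with j | j
  · simp [pairProj_apply, odVec, natVec, odd_apply_inl hv]
  · by_cases h : j = i
    · subst h; simp [pairProj_apply, odVec, natVec]
    · simp [pairProj_apply, odVec, natVec, h]

theorem natTw_mem (q p : ZMod 2) : ∀ v ∈ natGrade k n p, natTw q v ∈ natGrade k n p := by
  intro v hv
  rw [natTw_apply q hv]
  exact Submodule.smul_mem _ _ hv

variable (k) in
/-- The derivation with `v_{-i} ↦ v_i`. -/
def koszulD (i : Fin n) : SkewData k n where
  a := natTw 1
  b := (LinearMap.proj (Sum.inr i)).smulRight (evVec k i)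
  c := LinearMap.id
  ha p := natTw_mem 1 p
  hc p v hv := hv
  comm := by
    intro p q v hv w hw
    have hx := evVec_mem (k := k) i
    simp only [natTw_apply 1 hv, natTw_apply 1 hw, map_smul, LinearMap.smulRight_apply,
      LinearMap.proj_apply, LinearMap.id_apply, smul_mul_assoc, mul_smul_comm,
      pair_comm p hx hv, pair_comm q hx hw]
    -- Only two odd vectors give a nontrivial condition; there the two terms change places, because
    -- `v_i` is even and commutes with everything.
    rcases zmod_cases p with rfl | rfl <;> rcases zmod_cases q with rfl | rfl
    · simp [even_apply_inr hv, even_apply_inr hw]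
    · simp [even_apply_inr hv]
    · simp [even_apply_inr hw]
    · simp only [one_mul, sgn_one]; module

variable (k) in
/-- The homotopy, with `v_i^m x ↦ v_{-i} v_i^{m-1} x`. -/
def koszulH (i : Fin n) : SkewData k n where
  -- An ordinary derivation `v_i ↦ v_{-i}` would yield the degree in the homotopy relation, which
  -- need not be invertible. The asymmetric choice of `a` and `c` replaces it by a divided
  -- difference, which avoids division by the degree: `a` removes `v_{-i}` from the odd vectors, and
  -- `c` removes the pair from what follows the replaced factor.
  a := natProj 0 - natProj 1 ∘ₗ pairProj {i}ᶜ
  b := (LinearMap.proj (Sum.inl i)).smulRight (odVec k i)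
  c := pairProj {i}ᶜ
  ha := by
    intro p v hv
    rcases zmod_cases p with rfl | rfl
    · rw [LinearMap.sub_apply, LinearMap.comp_apply,
        natProj_of_mem_ne (by decide) (pairProj_mem _ 0 v hv), sub_zero]
      exact natProj_mem 0 v
    · rw [LinearMap.sub_apply, natProj_of_mem_ne (by decide) hv, zero_sub]
      exact neg_mem (natProj_mem 1 _)
  hc p := pairProj_mem _ p
  comm := by
    intro p q v hv w hw
    have hx := odVec_mem (k := k) i
    have ev : ∀ v ∈ natGrade k n 0, (natProj 0 - natProj 1 ∘ₗ pairProj {i}ᶜ : NatV k n →ₗ[k] NatV k n) v = v := by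
      intro v hv
      rw [LinearMap.sub_apply, LinearMap.comp_apply, natProj_of_mem hv,
        natProj_of_mem_ne (by decide) (pairProj_mem _ 0 v hv), sub_zero]
    have od : ∀ v ∈ natGrade k n 1, (natProj 0 - natProj 1 ∘ₗ pairProj {i}ᶜ : NatV k n →ₗ[k] NatV k n) v =
        (-1 : k) • pairProj {i}ᶜ v := by
      intro v hv
      rw [LinearMap.sub_apply, LinearMap.comp_apply, natProj_of_mem_ne (by decide) hv, zero_sub,
        natProj_of_mem (pairProj_mem _ 1 v hv), neg_one_smul]
    rcases zmod_cases p with rfl | rfl <;> rcases zmod_cases q with rfl | rfl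
    · rw [ev v hv, ev w hw]
      simp only [even_sub_pairProj hv, even_sub_pairProj hw, LinearMap.smulRight_apply,
        LinearMap.proj_apply, map_smul, map_sub, mul_sub, smul_mul_assoc, mul_smul_comm,
        pair_comm 1 hv hx, pair_comm 1 hw hx, smul_sub, zero_mul, sgn_zero, one_smul]
      rw [smul_comm]
      abel
    · rw [ev v hv, od w hw]
      simp only [LinearMap.smulRight_apply, LinearMap.proj_apply, odd_apply_inl hw, zero_smul,
        map_zero, mul_zero, zero_mul, sgn_zero, one_smul, zero_add, add_zero, map_smul,
        smul_mul_assoc, mul_smul_comm, odd_comm (pairProj_mem _ 1 w hw) hx,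
        smul_comm (v (Sum.inl i)), smul_smul, neg_mul_neg, mul_one, one_smul, one_mul]
    · rw [od v hv, ev w hw]
      simp only [LinearMap.smulRight_apply, LinearMap.proj_apply, odd_apply_inl hv, zero_smul,
        map_zero, mul_zero, zero_mul, sgn_zero, one_smul, zero_add, add_zero, map_smul,
        smul_mul_assoc, mul_smul_comm, odd_comm (pairProj_mem _ 1 v hv) hx,
        smul_comm (w (Sum.inl i)), smul_smul, neg_mul_neg, mul_one, one_smul, one_mul]
    · simp [odd_apply_inl hv, odd_apply_inl hw]

/-! ### The Koszul homotopy for one pair of basis vectors -/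

theorem koszulH_a_even {v : NatV k n} (hv : v ∈ natGrade k n 0) (i : Fin n) :
    (koszulH k i).a v = v := by
  change natProj 0 v - natProj 1 (pairProj {i}ᶜ v) = v
  rw [natProj_of_mem hv, natProj_of_mem_ne (by decide) (pairProj_mem _ 0 v hv), sub_zero]

theorem koszulH_a_odd {v : NatV k n} (hv : v ∈ natGrade k n 1) (i : Fin n) :
    (koszulH k i).a v = (-1 : k) • pairProj {i}ᶜ v := by
  change natProj 0 v - natProj 1 (pairProj {i}ᶜ v) = _
  rw [natProj_of_mem_ne (by decide) hv, natProj_of_mem (pairProj_mem _ 1 v hv), zero_sub,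
    neg_one_smul]

theorem symMap_id (x : SymAlg k n) : symMap LinearMap.id (fun _ _ h => h) x = x := by
  induction x using symAlg_left_induction with
  | h₁ => simp
  | ha a b ha hb => simp only [map_add, ha, hb]
  | hs c a ha => simp only [map_smul, ha]
  | hm p v hv a ha => rw [symMap_symι_mul, ha]; rfl

theorem koszulD_symι_mul {p : ZMod 2} {v : NatV k n} (hv : v ∈ natGrade k n p) (i : Fin n)
    (x : SymAlg k n) : (koszulD k i).der (symι k n v * x) =
      sgn k p • (symι k n v * (koszulD k i).der x) + v (Sum.inr i) • (symι k n (evVec k i) * x) := by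
  have e₁ : (koszulD k i).a v = sgn k p • v := by
    rw [← one_mul p]; exact natTw_apply 1 hv
  have e₂ : (koszulD k i).b v = v (Sum.inr i) • evVec k i := rfl
  have e₃ : symMap (koszulD k i).c (koszulD k i).hc x = x := symMap_id x
  rw [SkewData.der_symι_mul, e₁, e₂, e₃, map_smul, map_smul, smul_mul_assoc, smul_mul_assoc]

/-- The endomorphism of `S(V)` which kills `v_i` and `v_{-i}`. -/
def symKill (i : Fin n) : SymAlg k n →ₐ[k] SymAlg k n := symMap (pairProj {i}ᶜ) (pairProj_mem _)

theorem koszulH_even {v : NatV k n} (hv : v ∈ natGrade k n 0) (i : Fin n)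
    (x : SymAlg k n) : (koszulH k i).der (symι k n v * x) =
      symι k n v * (koszulH k i).der x + v (Sum.inl i) • (symι k n (odVec k i) * symKill i x) := by
  have e₂ : (koszulH k i).b v = v (Sum.inl i) • odVec k i := rfl
  have e₃ : symMap (koszulH k i).c (koszulH k i).hc x = symKill i x := rfl
  rw [SkewData.der_symι_mul, koszulH_a_even hv, e₂, e₃, map_smul, smul_mul_assoc]

theorem koszulH_odd {v : NatV k n} (hv : v ∈ natGrade k n 1) (i : Fin n)
    (x : SymAlg k n) : (koszulH k i).der (symι k n v * x) =
      (-1 : k) • (symι k n (pairProj {i}ᶜ v) * (koszulH k i).der x) := by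
  have e₂ : (koszulH k i).b v = v (Sum.inl i) • odVec k i := rfl
  rw [SkewData.der_symι_mul, koszulH_a_odd hv, e₂, odd_apply_inl hv, zero_smul, map_zero, zero_mul,
    add_zero, map_smul, smul_mul_assoc]

theorem symKill_evVec_mul (i : Fin n) (x : SymAlg k n) :
    symKill i (symι k n (evVec k i) * x) = 0 := by
  have : pairProj {i}ᶜ (evVec k i) = 0 := by
    rw [even_sub_pairProj (evVec_mem i)]; simp [evVec, natVec]
  rw [symKill, symMap_symι_mul, this, map_zero, zero_mul]

/-- Every term that the derivation produces contains a factor `v_i`, and such terms are killed. -/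
theorem symKill_koszulD (i : Fin n) (x : SymAlg k n) : symKill i ((koszulD k i).der x) = 0 := by
  induction x using symAlg_left_induction with
  | h₁ => rw [SkewData.der_one, map_zero]
  | ha a b ha hb => rw [map_add, map_add, ha, hb, add_zero]
  | hs c a ha => rw [map_smul, map_smul, ha, smul_zero]
  | hm p v hv a ha =>
    rw [koszulD_symι_mul hv, map_add, map_smul, map_smul, symKill_evVec_mul, symKill,
      symMap_symι_mul, ← symKill, ha, mul_zero, smul_zero, smul_zero, add_zero]

theorem koszulD_symKill (i : Fin n) (x : SymAlg k n) : (koszulD k i).der (symKill i x) = 0 := by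
  induction x using symAlg_left_induction with
  | h₁ => rw [map_one, SkewData.der_one]
  | ha a b ha hb => rw [map_add, map_add, ha, hb, add_zero]
  | hs c a ha => rw [map_smul, map_smul, ha, smul_zero]
  | hm p v hv a ha =>
    have : pairProj {i}ᶜ v (Sum.inr i) = 0 := by simp [pairProj_apply]
    rw [symKill, symMap_symι_mul, ← symKill, koszulD_symι_mul (pairProj_mem _ p v hv), ha, this,
      mul_zero, smul_zero, zero_smul, add_zero]

theorem odVec_mul_self [NeZero (2 : k)] (i : Fin n) :
    symι k n (odVec k i) * symι k n (odVec k i) = 0 := by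
  have h := odd_comm (odVec_mem (k := k) i) (odVec_mem i)
  have h' : (2 : k) • (symι k n (odVec k i) * symι k n (odVec k i)) = 0 := by
    rw [two_smul]
    nth_rewrite 1 [h]
    module
  exact (smul_eq_zero.1 h').resolve_left (NeZero.ne _)

theorem symKill_even {v : NatV k n} (hv : v ∈ natGrade k n 0) (i : Fin n) (x : SymAlg k n) :
    symKill i (symι k n v * x) =
      symι k n v * symKill i x - v (Sum.inl i) • (symι k n (evVec k i) * symKill i x) := by
  rw [symKill, symMap_symι_mul, even_sub_pairProj hv, map_sub, map_smul, sub_mul, smul_mul_assoc]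

theorem symKill_odd (v : NatV k n) (i : Fin n) (x : SymAlg k n) :
    symKill i (symι k n v * x) = symι k n (pairProj {i}ᶜ v) * symKill i x := by
  rw [symKill, symMap_symι_mul]

variable [NeZero (2 : k)]

/-- The homotopy trades one `v_i` for `v_{-i}`, so multiplying back by `v_i` gives `v_{-i}` times
the part containing `v_i`. The part free of the pair is supplied by `symKill`, and terms containing
`v_{-i}` die because `v_{-i}` squares to zero; this last point needs `2 ≠ 0`. -/
theorem evVec_mul_koszulH (i : Fin n) (x : SymAlg k n) :
    symι k n (evVec k i) * (koszulH k i).der x + symι k n (odVec k i) * symKill i x =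
      symι k n (odVec k i) * x := by
  have hx := evVec_mem (k := k) i
  have hy := odVec_mem (k := k) i
  induction x using symAlg_left_induction with
  | h₁ => rw [SkewData.der_one, map_one, mul_zero, zero_add]
  | ha a b ha hb => simp only [map_add, mul_add, ← ha, ← hb]; abel
  | hs c a ha => simp only [map_smul, mul_smul_comm, ← ha, smul_add]
  | hm p v hv a ha =>
    rcases zmod_cases p with rfl | rfl
    · have e : symι k n (odVec k i) * (symι k n v * a) = symι k n v * (symι k n (odVec k i) * a) := by
        rw [← mul_assoc, ← pair_comm 1 hv hy, mul_assoc]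
      have e₁ (y : SymAlg k n) : symι k n (odVec k i) * (symι k n v * y) =
          symι k n v * (symι k n (odVec k i) * y) := by
        rw [← mul_assoc, ← pair_comm 1 hv hy, mul_assoc]
      have e₂ (y : SymAlg k n) : symι k n (evVec k i) * (symι k n v * y) =
          symι k n v * (symι k n (evVec k i) * y) := by
        rw [← mul_assoc, pair_comm 0 hx hv, mul_assoc]
      have e₃ (y : SymAlg k n) : symι k n (evVec k i) * (symι k n (odVec k i) * y) =
          symι k n (odVec k i) * (symι k n (evVec k i) * y) := by
        rw [← mul_assoc, pair_comm 1 hx hy, mul_assoc]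
      rw [koszulH_even hv, symKill_even hv, mul_add, mul_sub, e₁, e₁, e₂, mul_smul_comm,
        mul_smul_comm, e₃, ← ha, mul_add]
      abel
    · have e₁ (y : SymAlg k n) : symι k n (odVec k i) * (symι k n (pairProj {i}ᶜ v) * y) =
          (-1 : k) • (symι k n (pairProj {i}ᶜ v) * (symι k n (odVec k i) * y)) := by
        rw [← mul_assoc, odd_comm hy (pairProj_mem _ 1 v hv), smul_mul_assoc, mul_assoc]
      have e₂ (y : SymAlg k n) : symι k n (evVec k i) * (symι k n (pairProj {i}ᶜ v) * y) =
          symι k n (pairProj {i}ᶜ v) * (symι k n (evVec k i) * y) := by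
        rw [← mul_assoc, pair_comm 1 hx (pairProj_mem _ 1 v hv), mul_assoc]
      -- Up to the square of `v_{-i}`, which is zero, the odd vector `v` may be replaced by its part
      -- away from the pair.
      have e : symι k n (odVec k i) * (symι k n v * a) =
          symι k n (odVec k i) * (symι k n (pairProj {i}ᶜ v) * a) := by
        rw [← mul_assoc, ← mul_assoc, odd_sub_pairProj hv, map_sub, map_smul, mul_sub, mul_smul_comm,
          odVec_mul_self, smul_zero, sub_zero]
      rw [koszulH_odd hv, symKill_odd, e, e₁, e₁, mul_smul_comm, e₂, ← smul_add, ← mul_add, ha]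

/-- The homotopy relation. -/
theorem koszul_homotopy (i : Fin n) (x : SymAlg k n) :
    (koszulD k i).der ((koszulH k i).der x) + (koszulH k i).der ((koszulD k i).der x) +
      symKill i x = x := by
  have hx := evVec_mem (k := k) i
  have hy := odVec_mem (k := k) i
  have exi : evVec k i (Sum.inr i) = 0 := by simp [evVec, natVec]
  have exi' : evVec k i (Sum.inl i) = 1 := by simp [evVec, natVec]
  have eyi : odVec k i (Sum.inr i) = 1 := by simp [odVec, natVec]
  induction x using symAlg_left_induction with
  | h₁ => simp [SkewData.der_one]
  | ha a b ha hb => simp only [map_add]; nth_rewrite 4 [← ha]; nth_rewrite 4 [← hb]; abel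
  | hs c a ha => simp only [map_smul]; rw [← smul_add, ← smul_add, ha]
  | hm p v hv a ha =>
    rcases zmod_cases p with rfl | rfl
    · rw [koszulH_even hv, map_add, koszulD_symι_mul hv, koszulD_symι_mul hv, even_apply_inr hv, map_smul,
        koszulD_symι_mul hy, eyi, koszulD_symKill, symKill_even hv, zero_smul, add_zero, zero_smul, add_zero,
        sgn_zero, one_smul, one_smul, one_smul, koszulH_even hv, symKill_koszulD]
      rw [show symι k n v * a = symι k n v * _ from congrArg _ ha.symm]
      simp only [mul_zero, smul_zero, zero_add, add_zero, mul_add]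
      abel
    · have hc : pairProj {i}ᶜ v (Sum.inr i) = 0 := by simp [pairProj_apply]
      -- An odd vector is split into its part away from the pair and its multiple of `v_{-i}`. The
      -- first part is carried through the three operators to the induction hypothesis. On the
      -- second the derivation produces `v_i`, and `evVec_mul_koszulH` turns the result back into
      -- `v_{-i} a`.
      have e : symι k n v * a = symι k n (pairProj {i}ᶜ v) * a + v (Sum.inr i) •
          (symι k n (odVec k i) * a) := by
        rw [odd_sub_pairProj hv, map_sub, map_smul, sub_mul, smul_mul_assoc, sub_add_cancel]
      rw [koszulH_odd hv, map_smul, koszulD_symι_mul (pairProj_mem _ 1 v hv), hc, zero_smul, add_zero,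
        koszulD_symι_mul hv, map_add, map_smul, map_smul, koszulH_odd hv, koszulH_even hx, exi', one_smul,
        evVec_mul_koszulH, symKill_odd, e]
      rw [show symι k n (pairProj {i}ᶜ v) * a = symι k n (pairProj {i}ᶜ v) * _ from congrArg _ ha.symm]
      simp only [sgn_one, mul_add]
      module

/-! ### Removing the pairs one at a time -/

theorem koszulD_symTw (i : Fin n) (x : SymAlg k n) :
    (koszulD k i).der (symTw 1 x) = (-1 : k) • symTw 1 ((koszulD k i).der x) := by
  induction x using symAlg_left_induction with
  | h₁ => simp [SkewData.der_one]
  | ha a b ha hb => simp only [map_add, smul_add, ha, hb]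
  | hs c a ha => simp only [map_smul, ha, smul_comm c]
  | hm p v hv a ha =>
    rw [symTw_symι_mul 1 hv, map_smul, koszulD_symι_mul hv, koszulD_symι_mul hv, map_add, map_smul,
      map_smul, symTw_symι_mul 1 hv, symTw_symι_mul 1 (evVec_mem i), ha, mul_smul_comm, one_mul]
    rcases zmod_cases p with rfl | rfl
    · rw [even_apply_inr hv]; simp only [sgn_zero]; module
    · simp only [sgn_one, mul_zero, sgn_zero]; module

/-- The endomorphism of `S(V)` which kills `v_i` and `v_{-i}` for the first `j` indices `i`. -/
def symTail (j : ℕ) : SymAlg k n →ₐ[k] SymAlg k n :=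
  symMap (pairProj {i : Fin n | j ≤ i}) (pairProj_mem _)

theorem symTail_zero (x : SymAlg k n) : symTail 0 x = x := by
  induction x using symAlg_left_induction with
  | h₁ => simp
  | ha a b ha hb => simp only [map_add, ha, hb]
  | hs c a ha => simp only [map_smul, ha]
  | hm p v hv a ha =>
    have : pairProj {i : Fin n | 0 ≤ (i : ℕ)} v = v := by ext; simp [pairProj_apply]
    rw [symTail, symMap_symι_mul, this, ← symTail, ha]

theorem symTail_succ (i : Fin n) (x : SymAlg k n) :
    symTail (i + 1) x = symTail i (symKill i x) := by
  induction x using symAlg_left_induction with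
  | h₁ => simp
  | ha a b ha hb => simp only [map_add, ha, hb]
  | hs c a ha => simp only [map_smul, ha]
  | hm p v hv a ha =>
    have : pairProj {j : Fin n | (i : ℕ) + 1 ≤ j} v =
        pairProj {j : Fin n | (i : ℕ) ≤ j} (pairProj {i}ᶜ v) := by
      ext j
      simp only [pairProj_apply, Set.mem_ofPred_eq, Set.mem_compl_iff, Set.mem_singleton_iff, Fin.ext_iff]
      split_ifs <;> first | rfl | omega
    rw [symTail, symMap_symι_mul, this, ← symTail, ha, symTail, symKill_odd, symMap_symι_mul]

/-- Only the pairs with smaller index have been killed, so both `v_i` and the coordinate at `v_{-i}`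
are still untouched. -/
theorem symTail_koszulD (i : Fin n) (x : SymAlg k n) :
    symTail i ((koszulD k i).der x) = (koszulD k i).der (symTail i x) := by
  induction x using symAlg_left_induction with
  | h₁ => simp [SkewData.der_one]
  | ha a b ha hb => simp only [map_add, ha, hb]
  | hs c a ha => simp only [map_smul, ha]
  | hm p v hv a ha =>
    have e₁ : pairProj {j : Fin n | (i : ℕ) ≤ j} (evVec k i) = evVec k i := by
      ext j
      rcases j with j | j
      · by_cases h : j = i <;> simp [pairProj_apply, evVec, natVec, h]
      · simp [pairProj_apply, evVec, natVec]
    have e₂ : pairProj {j : Fin n | (i : ℕ) ≤ j} v (Sum.inr i) = v (Sum.inr i) := by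
      simp [pairProj_apply]
    have e₃ (v : NatV k n) (x) : symTail i (symι k n v * x) =
      symι k n (pairProj {j : Fin n | (i : ℕ) ≤ j} v) * symTail i x := symMap_symι_mul _ _ _ _
    rw [koszulD_symι_mul hv, map_add, map_smul, map_smul, e₃, e₃, e₃, e₁, ha,
      koszulD_symι_mul (pairProj_mem _ p v hv), e₂]

theorem symTail_eq_zero {a : ℕ} {x : SymAlg k n} (hx : x ∈ SymPow k n (a + 1)) :
    symTail n x = 0 := by
  suffices h : ∀ m, ∀ x ∈ SymPow k n m, m ≠ 0 → symTail n x = 0 from h _ x hx (by omega)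
  intro m x hx
  induction hx using symPow_induction with
  | h₁ => intro h; exact absurd rfl h
  | ha m a b _ _ ha hb => intro h; rw [map_add, ha h, hb h, add_zero]
  | hs m c a _ ha => intro h; rw [map_smul, ha h, smul_zero]
  | hm m p v hv a _ ha =>
    intro _
    have : pairProj {i : Fin n | n ≤ (i : ℕ)} v = 0 := by
      ext j
      have := (Sum.elim id id j).2
      simp [pairProj_apply]
    rw [symTail, symMap_symι_mul, this, map_zero, zero_mul]

/-- The parity operator of `S^a(V)`. -/
def symParity (k : Type u) [Field k] (n a : ℕ) : Module.End k (SymPow k n a) :=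
  (symTw 1).toLinearMap.restrict fun _ h => symTw_mem 1 h

/-- The supertrace of the identity of `S^a(V)` vanishes for `a > 0`. -/
theorem trace_symParity (a : ℕ) : LinearMap.trace k _ (symParity k n (a + 1)) = 0 := by
  let P := symParity k n (a + 1)
  let E (j : ℕ) : Module.End k (SymPow k n (a + 1)) :=
    (symTail j).toLinearMap.restrict fun _ h => symMap_mem _ _ h
  let D (i : Fin n) : Module.End k (SymPow k n (a + 1)) :=
    (koszulD k i).der.restrict fun _ h => SkewData.der_mem _ h
  let H (i : Fin n) : Module.End k (SymPow k n (a + 1)) :=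
    (koszulH k i).der.restrict fun _ h => SkewData.der_mem _ h
  -- By the homotopy relation, removing the pair `i` changes the trace by those of `P E D H` and `P
  -- E H D`. These are negatives of each other, since the trace is cyclic and the odd `D`
  -- anticommutes with the parity operator.
  have step : ∀ i : Fin n, LinearMap.trace k _ (P * E i) = LinearMap.trace k _ (P * E (i + 1)) := by
    intro i
    have e₁ : P * E i = P * E i * D i * H i + P * E i * H i * D i + P * E (i + 1) := by
      refine LinearMap.ext fun x => Subtype.ext ?_
      change symTw 1 (symTail i x.1) = symTw 1 (symTail i ((koszulD k i).der ((koszulH k i).der x.1)))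
        + symTw 1 (symTail i ((koszulH k i).der ((koszulD k i).der x.1)))
        + symTw 1 (symTail (i + 1) x.1)
      rw [symTail_succ, ← map_add, ← map_add, ← map_add, ← map_add, koszul_homotopy]
    have e₂ : D i * (P * E i) = (-1 : k) • (P * E i * D i) := by
      refine LinearMap.ext fun x => Subtype.ext ?_
      change (koszulD k i).der (symTw 1 (symTail i x.1)) =
        (-1 : k) • symTw 1 (symTail i ((koszulD k i).der x.1))
      rw [koszulD_symTw, symTail_koszulD]
    have e₃ : LinearMap.trace k _ (P * E i * H i * D i) =
        -LinearMap.trace k _ (P * E i * D i * H i) := by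
      rw [LinearMap.trace_mul_comm, ← mul_assoc, e₂, smul_mul_assoc, map_smul, neg_smul, one_smul]
    rw [e₁, map_add, map_add, e₃, add_neg_cancel, zero_add]
  have all : ∀ j ≤ n, LinearMap.trace k _ P = LinearMap.trace k _ (P * E j) := by
    intro j
    induction j with
    | zero =>
      intro _
      congr 1
      refine LinearMap.ext fun x => Subtype.ext ?_
      change symTw 1 x.1 = symTw 1 (symTail 0 x.1)
      rw [symTail_zero]
    | succ j ih => intro h; rw [ih (by omega)]; exact step ⟨j, h⟩
  rw [all n le_rfl]
  -- When all pairs are removed, nothing is left in positive degree.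
  have : P * E n = 0 := by
    refine LinearMap.ext fun x => Subtype.ext ?_
    change symTw 1 (symTail n x.1) = 0
    rw [symTail_eq_zero x.2, map_zero]
  rw [this, map_zero]

end Supertrace

end

end TypeP

namespace TypeP

noncomputable section

/-! ## Homomorphisms of supermodules -/

namespace PMod

variable {k : Type u} [Field k] {n : ℕ}

theorem tw_zero (M : PMod k n) : M.tw 0 = LinearMap.id := if_pos rfl

theorem tw_one (M : PMod k n) : M.tw 1 = M.par := if_neg (by decide)

theorem tw_tw (M : PMod k n) (q : ZMod 2) (m : M.carrier) : M.tw q (M.tw q m) = m := by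
  rw [← M.tw_add, CharTwo.add_self_eq_zero, tw_zero, LinearMap.id_apply]

theorem hom_tw {M N : PMod k n} {f : M.carrier →ₗ[k] N.carrier} (hf : f ∈ homGrade M N 0)
    (q : ZMod 2) (m : M.carrier) : f (M.tw q m) = N.tw q (f m) := by
  suffices h : f ∘ₗ M.tw q = N.tw q ∘ₗ f from LinearMap.congr_fun h m
  refine lin_ext fun p m hm => ?_
  have := hf.1 p m hm
  rw [zero_add] at this
  simp only [LinearMap.comp_apply, M.tw_apply q hm, N.tw_apply q this, map_smul]

/-- Since `2 ≠ 0`, the eigenvalues `1` and `-1` of the parity operator are distinct and its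
eigenspaces are the homogeneous components. Parity of a map thereby becomes a commutation relation
with one operator. -/
theorem mem_grade_iff [NeZero (2 : k)] {M : PMod k n} {p : ZMod 2} {m : M.carrier} :
    m ∈ M.grade p ↔ M.par m = sgn k p • m := by
  refine ⟨M.par_apply, fun h => ?_⟩
  obtain ⟨a, ha, b, hb, rfl⟩ := M.exists_add m
  rw [map_add, M.par_apply ha, M.par_apply hb] at h
  have h2 : (2 : k) ≠ 0 := NeZero.ne _
  rcases zmod_cases p with rfl | rfl
  · have e : (2 : k) • b = 0 := by
      have : (2 : k) • b = (sgn k 0 • (a + b)) - (sgn k 0 • a + sgn k 1 • b) := by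
        simp only [sgn_zero, sgn_one]; module
      rw [this, h, sub_self]
    rw [(smul_eq_zero.1 e).resolve_left h2, add_zero]
    exact ha
  · have e : (2 : k) • a = 0 := by
      have : (2 : k) • a = (sgn k 0 • a + sgn k 1 • b) - (sgn k 1 • (a + b)) := by
        simp only [sgn_zero, sgn_one]; module
      rw [this, h, sub_self]
    rw [(smul_eq_zero.1 e).resolve_left h2, zero_add]
    exact hb

section Tensor

variable [NeZero (2 : k)]

/-- A map which commutes with the parity operators and with the action is an even homomorphism. -/
theorem mem_homGrade_zero {M N : PMod k n} {f : M.carrier →ₗ[k] N.carrier}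
    (h : f ∘ₗ M.tw 1 = N.tw 1 ∘ₗ f) (h' : ∀ q (x : typeP k n q),
      f ∘ₗ M.act q x = N.act q x ∘ₗ f) : f ∈ homGrade M N 0 := by
  refine ⟨fun s m hm => ?_, fun q x m => ?_⟩
  · have e := LinearMap.congr_fun h m
    rw [LinearMap.comp_apply, LinearMap.comp_apply, M.tw_apply 1 hm, map_smul, one_mul] at e
    rw [zero_add, mem_grade_iff, ← tw_one, ← e]
  · rw [mul_zero, sgn_zero, one_smul]
    exact LinearMap.congr_fun (h' q x) m

/-! ### Pure tensors -/

/-- Pure tensors, as a bilinear map. -/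
def tmL (M N : PMod k n) : M.carrier →ₗ[k] N.carrier →ₗ[k] (M.tensor N).carrier :=
  TensorProduct.mk k M.carrier N.carrier

section

variable {M N : PMod k n}

theorem add_tm (m m' : M.carrier) (l : N.carrier) : tm (m + m') l = tm m l + tm m' l :=
  TensorProduct.add_tmul m m' l

theorem tm_add (m : M.carrier) (l l' : N.carrier) : tm m (l + l') = tm m l + tm m l' :=
  TensorProduct.tmul_add m l l'

theorem tm_zero (m : M.carrier) : tm m (0 : N.carrier) = 0 := TensorProduct.tmul_zero _ m

theorem tm_induction {C : (M.tensor N).carrier → Prop} (h : ∀ m l, C (tm m l))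
    (ha : ∀ s t, C s → C t → C (s + t)) (t : (M.tensor N).carrier) : C t := by
  have h0 : C 0 := by rw [← tm_zero (N := N) (0 : M.carrier)]; exact h _ _
  exact TensorProduct.induction_on (motive := C) t h0 h ha

/-- The linear map on a tensor product given by a bilinear map. -/
def tlift {P : Type v} [AddCommGroup P] [Module k P] (f : M.carrier →ₗ[k] N.carrier →ₗ[k] P) :
    (M.tensor N).carrier →ₗ[k] P := TensorProduct.lift f

theorem tm_ext {P : Type v} [AddCommGroup P] [Module k P] {f g : (M.tensor N).carrier →ₗ[k] P}
    (h : ∀ m l, f (tm m l) = g (tm m l)) : f = g := TensorProduct.ext' h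

theorem tm_ext_left {P : Type v} [AddCommGroup P] [Module k P] {f g : (M.tensor N).carrier →ₗ[k] P}
    (h : ∀ p, ∀ m ∈ M.grade p, ∀ l, f (tm m l) = g (tm m l)) : f = g :=
  TensorProduct.ext (lin_ext fun p m hm => LinearMap.ext fun l => h p m hm l)

theorem tensor_tw (q : ZMod 2) (m : M.carrier) (l : N.carrier) :
    (M.tensor N).tw q (tm m l) = tm (M.tw q m) (N.tw q l) := by
  suffices h : (M.tensor N).tw q = tlift ((tmL M N).compl₁₂ (M.tw q) (N.tw q)) by rw [h]; rfl
  refine tensor_ext fun a b m hm l hl => ?_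
  refine ((M.tensor N).tw_apply q (tm_mem hm hl)).trans ?_
  change _ = tm (M.tw q m) (N.tw q l)
  rw [M.tw_apply q hm, N.tw_apply q hl, smul_tm, tm_smul, smul_smul, mul_add, sgn_add]

theorem tensor_act {q : ZMod 2} (x : typeP k n q) (m : M.carrier) (l : N.carrier) :
    (M.tensor N).act q x (tm m l) = tm (M.act q x m) l + tm (M.tw q m) (N.act q x l) := rfl

end

/-! ### The trivial module and duals -/

theorem triv_tw (q : ZMod 2) (c : (triv k n).carrier) : (triv k n).tw q c = c := by
  suffices h : (triv k n).tw q = LinearMap.id from LinearMap.congr_fun h c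
  refine triv_ext ?_
  rw [tw_apply _ q trivOne_mem, mul_zero, sgn_zero, one_smul]; rfl

theorem triv_act {q : ZMod 2} (x : typeP k n q) (c : (triv k n).carrier) :
    (triv k n).act q x c = 0 := rfl

/-- The element `c` of the trivial module. -/
def trivMk (k : Type u) [Field k] (n : ℕ) : k →ₗ[k] (triv k n).carrier := LinearMap.id

theorem trivMk_apply (c : k) : trivMk k n c = c • trivOne := by
  change c = c * 1
  rw [mul_one]

theorem triv_exists (c : (triv k n).carrier) : ∃ a : k, c = a • trivOne := ⟨c, trivMk_apply (k := k) c⟩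

/-- The value of a functional. -/
def dapp (M : PMod k n) : M.dual.carrier →ₗ[k] M.carrier →ₗ[k] k := LinearMap.id

/-- A functional, as an element of the dual. -/
def dmk (M : PMod k n) (f : M.carrier →ₗ[k] k) : M.dual.carrier := f

@[simp] theorem dapp_dmk (M : PMod k n) (f : M.carrier →ₗ[k] k) : dapp M (dmk M f) = f := rfl

theorem dual_ext {M : PMod k n} {f g : M.dual.carrier} (h : ∀ m, dapp M f m = dapp M g m) : f = g :=
  LinearMap.ext h

theorem dapp_act {M : PMod k n} {q : ZMod 2} (x : typeP k n q) (f : M.dual.carrier)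
    (m : M.carrier) : dapp M (M.dual.act q x f) m = -dapp M f (M.tw q (M.act q x m)) := rfl

theorem dapp_of_ne {M : PMod k n} {p q : ZMod 2} {f : M.dual.carrier} (hf : f ∈ M.dual.grade p)
    {m : M.carrier} (hm : m ∈ M.grade q) (h : q ≠ p) : dapp M f m = 0 := hf q h m hm

theorem dapp_tw {M : PMod k n} (q : ZMod 2) (f : M.dual.carrier) (m : M.carrier) :
    dapp M (M.dual.tw q f) m = dapp M f (M.tw q m) := by
  suffices h : dapp M ∘ₗ M.dual.tw q = (dapp M).compl₂ (M.tw q) from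
    LinearMap.congr_fun (LinearMap.congr_fun h f) m
  refine lin_ext fun p f hf => lin_ext fun s m hm => ?_
  rw [LinearMap.comp_apply, LinearMap.compl₂_apply, M.dual.tw_apply q hf, M.tw_apply q hm, map_smul,
    map_smul, LinearMap.smul_apply]
  by_cases h : s = p
  · rw [h]
  · rw [dapp_of_ne hf hm h, smul_zero, smul_zero]

/-! ### Evaluation and coevaluation -/

/-- The evaluation `M^* ⊗ M → k`. -/
def evalLin (M : PMod k n) : (M.dual.tensor M).carrier →ₗ[k] (triv k n).carrier :=
  trivMk k n ∘ₗ tlift (dapp M)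

theorem evalLin_tm (M : PMod k n) (f : M.dual.carrier) (m : M.carrier) :
    evalLin M (tm f m) = trivMk k n (dapp M f m) := rfl

/-- The action on the dual is defined so that the two terms of the action on `M^* ⊗ M` evaluate to
opposite scalars. -/
theorem evalLin_mem (M : PMod k n) : evalLin M ∈ homGrade (M.dual.tensor M) (triv k n) 0 := by
  refine mem_homGrade_zero (tm_ext fun f m => ?_) fun q x => tm_ext fun f m => ?_
  · rw [LinearMap.comp_apply, LinearMap.comp_apply, tensor_tw, triv_tw, evalLin_tm, evalLin_tm,
      dapp_tw, tw_tw]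
  · rw [LinearMap.comp_apply, LinearMap.comp_apply, tensor_act, triv_act, map_add, evalLin_tm,
      evalLin_tm, dapp_tw, dapp_act, ← map_add, neg_add_cancel, map_zero]

/-- The evaluation, as a homomorphism. -/
def evalHom (M : PMod k n) : M.dual.tensor M ⟶ triv k n := ofMem _ (evalLin_mem M)

/-- The map `M ⊗ M^* → End M`. -/
def tensorEnd (M : PMod k n) : (M.tensor M.dual).carrier →ₗ[k] (M.carrier →ₗ[k] M.carrier) :=
  tlift (LinearMap.mk₂ k (fun m f => (dapp M f).smulRight m)
    (fun m m' f => by ext y; simp) (fun c m f => by ext y; simp [smul_comm c])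
    (fun m f f' => by ext y; simp [add_smul]) (fun c m f => by ext y; simp [mul_smul]))

theorem tensorEnd_tm (M : PMod k n) (m : M.carrier) (f : M.dual.carrier) (y : M.carrier) :
    tensorEnd M (tm m f) y = dapp M f y • m := rfl

/-- Finite dimension makes `M ⊗ M^* → End M` bijective, so statements about the canonical element
can be checked on the identity of `M`, with no basis. -/
theorem tensorEnd_injective (M : PMod k n) [FiniteDimensional k M.carrier] :
    Function.Injective (tensorEnd M) := by
  have e : tensorEnd M = dualTensorHom k M.carrier M.carrier ∘ₗ
      (TensorProduct.comm k M.carrier (Module.Dual k M.carrier)).toLinearMap := tm_ext fun m f => rfl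
  have h : Function.Injective (dualTensorHom k M.carrier M.carrier) := by
    intro x y hxy
    apply (dualTensorHomEquiv k M.carrier M.carrier).injective
    simpa using hxy
  rw [e]
  exact h.comp (TensorProduct.comm k M.carrier (Module.Dual k M.carrier)).injective

/-- The canonical element of `M ⊗ M^*`. -/
def coevElt (M : PMod k n) [FiniteDimensional k M.carrier] : (M.tensor M.dual).carrier :=
  coevaluation k M.carrier 1

theorem coevElt_eq (M : PMod k n) [FiniteDimensional k M.carrier] :
    ∃ (ι : Type u) (_ : Fintype ι) (b : Module.Basis ι k M.carrier),
      coevElt M = ∑ i, tm (b i) (dmk M (b.coord i)) := by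
  refine ⟨_, inferInstance, Module.Basis.ofVectorSpace k M.carrier, ?_⟩
  exact coevaluation_apply_one k M.carrier

theorem tensorEnd_coevElt (M : PMod k n) [FiniteDimensional k M.carrier] :
    tensorEnd M (coevElt M) = LinearMap.id := by
  obtain ⟨ι, _, b, h⟩ := coevElt_eq M
  rw [h, map_sum]
  refine LinearMap.ext fun y => ?_
  rw [LinearMap.sum_apply]
  simp only [tensorEnd_tm, dapp_dmk, Module.Basis.coord_apply, b.sum_repr, LinearMap.id_apply]

theorem tensorEnd_tw (M : PMod k n) (q : ZMod 2) (t : (M.tensor M.dual).carrier) :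
    tensorEnd M ((M.tensor M.dual).tw q t) = M.tw q ∘ₗ tensorEnd M t ∘ₗ M.tw q := by
  induction t using tm_induction with
  | ha x y hx hy => simp only [map_add, hx, hy, LinearMap.add_comp, LinearMap.comp_add]
  | h m f =>
    refine LinearMap.ext fun y => ?_
    rw [tensor_tw, tensorEnd_tm, LinearMap.comp_apply, LinearMap.comp_apply, tensorEnd_tm, dapp_tw,
      map_smul]

/-- Under this map the action becomes the supercommutator with `x`, which annihilates the identity;
hence the coevaluation is a homomorphism. -/
theorem tensorEnd_act (M : PMod k n) {q : ZMod 2} (x : typeP k n q) (t : (M.tensor M.dual).carrier) :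
    tensorEnd M ((M.tensor M.dual).act q x t) =
      M.act q x ∘ₗ tensorEnd M t - M.tw q ∘ₗ tensorEnd M t ∘ₗ M.tw q ∘ₗ M.act q x := by
  induction t using tm_induction with
  | ha x y hx hy => simp only [map_add, hx, hy, LinearMap.add_comp, LinearMap.comp_add]; abel
  | h m f =>
    refine LinearMap.ext fun y => ?_
    simp only [tensor_act, map_add, LinearMap.add_apply, tensorEnd_tm, LinearMap.sub_apply,
      LinearMap.comp_apply, map_smul, dapp_act]
    rw [neg_smul, sub_eq_add_neg]

/-- The coevaluation `k → M ⊗ M^*`. -/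
def coevLin (M : PMod k n) [FiniteDimensional k M.carrier] :
    (triv k n).carrier →ₗ[k] (M.tensor M.dual).carrier :=
  LinearMap.toSpanSingleton k (M.tensor M.dual).carrier (coevElt M)

theorem coevLin_trivOne (M : PMod k n) [FiniteDimensional k M.carrier] :
    coevLin M trivOne = coevElt M := one_smul k (coevElt M)

theorem coevLin_mem (M : PMod k n) [FiniteDimensional k M.carrier] :
    coevLin M ∈ homGrade (triv k n) (M.tensor M.dual) 0 := by
  refine mem_homGrade_zero (triv_ext ?_) fun q x => triv_ext ?_
  · rw [LinearMap.comp_apply, LinearMap.comp_apply, triv_tw, coevLin_trivOne]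
    apply tensorEnd_injective M
    rw [tensorEnd_tw, tensorEnd_coevElt]
    refine LinearMap.ext fun y => ?_
    simp [M.tw_tw]
  · rw [LinearMap.comp_apply, LinearMap.comp_apply, triv_act, coevLin_trivOne, map_zero]
    apply tensorEnd_injective M
    rw [tensorEnd_act, tensorEnd_coevElt, map_zero, LinearMap.id_comp]
    refine LinearMap.ext fun y => ?_
    simp [M.tw_tw]

/-- The coevaluation, as a homomorphism. -/
def coevHom (M : PMod k n) [FiniteDimensional k M.carrier] : triv k n ⟶ M.tensor M.dual :=
  ofMem _ (coevLin_mem M)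

/-! ### The swap -/

/-- The component of parity `p`. -/
def proj (M : PMod k n) (p : ZMod 2) : M.carrier →ₗ[k] M.carrier :=
  (2 : k)⁻¹ • (LinearMap.id + sgn k p • M.tw 1)

theorem proj_of_mem {M : PMod k n} {p : ZMod 2} {m : M.carrier} (hm : m ∈ M.grade p) :
    M.proj p m = m := by
  have h2 : (2 : k) ≠ 0 := NeZero.ne _
  rw [proj, LinearMap.smul_apply, LinearMap.add_apply, LinearMap.smul_apply, M.tw_apply 1 hm,
    one_mul, smul_smul, sgn_mul_self, one_smul, LinearMap.id_apply, ← two_smul k m, smul_smul,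
    inv_mul_cancel₀ h2, one_smul]

theorem proj_of_mem_ne {M : PMod k n} {p q : ZMod 2} {m : M.carrier} (hm : m ∈ M.grade p)
    (h : q ≠ p) : M.proj q m = 0 := by
  have e : sgn k q * sgn k p = -1 := by
    rcases zmod_cases p with rfl | rfl <;> rcases zmod_cases q with rfl | rfl <;> simp at h ⊢
  rw [proj, LinearMap.smul_apply, LinearMap.add_apply, LinearMap.smul_apply, M.tw_apply 1 hm,
    one_mul, smul_smul, e, LinearMap.id_apply, neg_one_smul, add_neg_cancel, smul_zero]

/-- The tensor swap `m ⊗ l ↦ (-1)^{|m||l|} l ⊗ m`. -/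
def swapLin (M N : PMod k n) : (M.tensor N).carrier →ₗ[k] (N.tensor M).carrier :=
  tlift ((tmL N M).flip ∘ₗ M.proj 0 + (tmL N M).flip.compl₁₂ (M.proj 1) (N.tw 1))

/-- Writing the sign as a twist of `l` leaves `m` as the only element that must be homogeneous. -/
theorem swapLin_tm {M N : PMod k n} {p : ZMod 2} {m : M.carrier} (hm : m ∈ M.grade p)
    (l : N.carrier) : swapLin M N (tm m l) = tm (N.tw p l) m := by
  have e : swapLin M N (tm m l) = tm l (M.proj 0 m) + tm (N.tw 1 l) (M.proj 1 m) := rfl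
  rcases zmod_cases p with rfl | rfl
  · rw [e, proj_of_mem hm, proj_of_mem_ne hm (by decide), tm_zero, add_zero, tw_zero,
      LinearMap.id_apply]
  · rw [e, proj_of_mem hm, proj_of_mem_ne hm (by decide), tm_zero, zero_add]

theorem swapLin_apply {M N : PMod k n} {p q : ZMod 2} {m : M.carrier} {l : N.carrier}
    (hm : m ∈ M.grade p) (hl : l ∈ N.grade q) :
    swapLin M N (tm m l) = sgn k (p * q) • tm l m := by
  rw [swapLin_tm hm, N.tw_apply p hl, smul_tm]

theorem swapLin_mem (M N : PMod k n) :
    swapLin M N ∈ homGrade (M.tensor N) (N.tensor M) 0 := by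
  refine mem_homGrade_zero (tm_ext_left fun p m hm l => ?_) fun q x => tm_ext_left fun p m hm l => ?_
  · rw [LinearMap.comp_apply, LinearMap.comp_apply, tensor_tw, swapLin_tm hm, tensor_tw,
      M.tw_apply 1 hm, smul_tm, map_smul, swapLin_tm hm, ← tw_add, ← tw_add, add_comm, tm_smul]
  · rw [LinearMap.comp_apply, LinearMap.comp_apply, tensor_act, swapLin_tm hm, tensor_act, map_add,
      swapLin_tm (M.act_mem x hm), M.tw_apply q hm, smul_tm, map_smul, swapLin_tm hm, N.tw_act,
      smul_tm, smul_smul, mul_comm q p, sgn_mul_self, one_smul, tw_add, add_comm]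

/-- The tensor swap, as a homomorphism. -/
def swapHom (M N : PMod k n) : M.tensor N ⟶ N.tensor M := ofMem _ (swapLin_mem M N)

end Tensor

end PMod

end

end TypeP

namespace TypeP

noncomputable section

/-! ## Homomorphisms between symmetric powers -/

namespace PMod

variable {k : Type u} [Field k] [NeZero (2 : k)] {n : ℕ}

/-- A criterion for odd homomorphisms. -/
theorem mem_homGrade_one {M N : PMod k n} {f : M.carrier →ₗ[k] N.carrier}
    (h : ∀ m, f (M.tw 1 m) = (-1 : k) • N.tw 1 (f m)) (h' : ∀ q (x : typeP k n q) m,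
      f (M.act q x m) = sgn k q • N.act q x (f m)) : f ∈ homGrade M N 1 := by
  refine ⟨fun s m hm => ?_, fun q x m => ?_⟩
  · have e := h m
    rw [M.tw_apply 1 hm, map_smul, one_mul] at e
    rw [mem_grade_iff, ← tw_one, sgn_add, sgn_one, mul_smul, e, smul_smul, neg_mul_neg, one_mul,
      one_smul]
  · rw [mul_one]
    exact h' q x m

theorem odd_tw {M N : PMod k n} {f : M.carrier →ₗ[k] N.carrier} (hf : f ∈ homGrade M N 1)
    (m : M.carrier) : f (M.tw 1 m) = (-1 : k) • N.tw 1 (f m) := by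
  suffices h : f ∘ₗ M.tw 1 = (-1 : k) • (N.tw 1 ∘ₗ f) from LinearMap.congr_fun h m
  refine lin_ext fun p m hm => ?_
  rw [LinearMap.comp_apply, LinearMap.smul_apply, LinearMap.comp_apply, M.tw_apply 1 hm,
    N.tw_apply 1 (hf.1 p m hm), map_smul, smul_smul, one_mul, one_mul, sgn_add, sgn_one, ← mul_assoc,
    neg_mul_neg, one_mul, one_mul]

theorem symm_mem_one {M N : PMod k n} (e : M.carrier ≃ₗ[k] N.carrier)
    (h : e.toLinearMap ∈ homGrade M N 1) : e.symm.toLinearMap ∈ homGrade N M 1 := by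
  refine mem_homGrade_one (fun m => ?_) fun q x m => ?_
  · apply e.injective
    have := odd_tw h (e.symm m)
    simp only [LinearEquiv.coe_coe, e.apply_symm_apply, map_smul] at this ⊢
    rw [this, smul_smul, neg_mul_neg, one_mul, one_smul]
  · apply e.injective
    have := h.2 q x (e.symm m)
    simp only [LinearEquiv.coe_coe, e.apply_symm_apply, map_smul, mul_one] at this ⊢
    rw [this, smul_smul, sgn_mul_self, one_smul]

end PMod

open PMod

section SymHom

variable {k : Type u} [Field k] [NeZero (2 : k)] {n : ℕ}

instance (a : ℕ) : FiniteDimensional k (symObj k n a).carrier :=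
  inferInstanceAs (FiniteDimensional k (SymPow k n a))

/-- The inclusion of `S^a(V)` into `S(V)`. -/
def sval (a : ℕ) : (symObj k n a).carrier →ₗ[k] SymAlg k n := (SymPow k n a).subtype

/-- An element of `S(V)` of degree `a`, as an element of `S^a(V)`. -/
def smk {a : ℕ} (x : SymAlg k n) (hx : x ∈ SymPow k n a) : (symObj k n a).carrier := ⟨x, hx⟩

@[simp] theorem sval_smk {a : ℕ} (x : SymAlg k n) (hx : x ∈ SymPow k n a) :
    sval a (smk x hx) = x := rfl

theorem sval_mem {a : ℕ} (x : (symObj k n a).carrier) : sval a x ∈ SymPow k n a := x.2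

theorem sval_injective (a : ℕ) : Function.Injective (sval (k := k) (n := n) a) :=
  Subtype.val_injective

theorem sval_act {a : ℕ} {q : ZMod 2} (ξ : typeP k n q) (x : (symObj k n a).carrier) :
    sval a ((symObj k n a).act q ξ x) = symDer ξ (sval a x) := rfl

theorem sval_tw {a : ℕ} (q : ZMod 2) (x : (symObj k n a).carrier) :
    sval a ((symObj k n a).tw q x) = symTw q (sval a x) := by
  rcases zmod_cases q with rfl | rfl
  · rw [tw_zero, symTw_zero]; rfl
  · suffices h : sval a ∘ₗ (symObj k n a).tw 1 = (symTw 1).toLinearMap ∘ₗ sval a from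
      LinearMap.congr_fun h x
    refine lin_ext fun p x hx => ?_
    have hx' : symTw 1 (sval a x) = sgn k p • sval a x := hx
    rw [LinearMap.comp_apply, LinearMap.comp_apply, tw_apply _ 1 hx, one_mul, map_smul]
    exact hx'.symm

/-- The inclusion of `S^a(V) ⊗ S^b(V)` into `S(V) ⊗ S(V)`. -/
def tval (a b : ℕ) : ((symObj k n a).tensor (symObj k n b)).carrier →ₗ[k] SymT k n :=
  TensorProduct.map (sval a) (sval b)

@[simp] theorem tval_tm {a b : ℕ} (x : (symObj k n a).carrier) (y : (symObj k n b).carrier) :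
    tval a b (tm x y) = sval a x ⊗ₜ sval b y := rfl

/-- Over a field a tensor product of injections is injective. This is what allows all ladder
relations to be verified in `S(V) ⊗ S(V)`. -/
theorem tval_injective (a b : ℕ) : Function.Injective (tval (k := k) (n := n) a b) :=
  TensorProduct.map_injective_of_flat_flat _ _ (sval_injective a) (sval_injective b)

theorem tval_mem {a b : ℕ} (t : ((symObj k n a).tensor (symObj k n b)).carrier) :
    tval a b t ∈ symTDeg k n a b := ⟨t, rfl⟩

theorem tval_tw {a b : ℕ} (q : ZMod 2) (t : ((symObj k n a).tensor (symObj k n b)).carrier) :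
    tval a b (((symObj k n a).tensor (symObj k n b)).tw q t) = twT q (tval a b t) := by
  induction t using tm_induction with
  | h m l => rw [tensor_tw, tval_tm, tval_tm, twT_tmul, sval_tw, sval_tw]
  | ha s t hs ht => simp only [map_add, hs, ht]

theorem tval_act {a b : ℕ} {q : ZMod 2} (ξ : typeP k n q)
    (t : ((symObj k n a).tensor (symObj k n b)).carrier) :
    tval a b (((symObj k n a).tensor (symObj k n b)).act q ξ t) = symDerT ξ (tval a b t) := by
  induction t using tm_induction with
  | h m l => rw [tensor_act, map_add, tval_tm, tval_tm, tval_tm, symDerT_tmul, sval_tw, sval_act, sval_act]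
  | ha s t hs ht => simp only [map_add, hs, ht]

/-! ### Merges and splits -/

/-- The multiplication `S^a(V) ⊗ S^b(V) → S^c(V)`. -/
def mergeLin (a b c : ℕ) (h : a + b = c) :
    ((symObj k n a).tensor (symObj k n b)).carrier →ₗ[k] (symObj k n c).carrier :=
  tlift (LinearMap.mk₂ k (fun x y => smk (sval a x * sval b y) (by
      subst h; rw [SymPow, pow_add]; exact Submodule.mul_mem_mul (sval_mem x) (sval_mem y)))
    (fun x x' y => sval_injective _ (by simp [add_mul]))
    (fun c x y => sval_injective _ (by simp))
    (fun x y y' => sval_injective _ (by simp [mul_add]))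
    (fun c x y => sval_injective _ (by simp)))

theorem sval_mergeLin {a b c : ℕ} (h : a + b = c) (x : (symObj k n a).carrier)
    (y : (symObj k n b).carrier) : sval c (mergeLin a b c h (tm x y)) = sval a x * sval b y := rfl

theorem mergeLin_mem (a b c : ℕ) (h : a + b = c) :
    mergeLin a b c h ∈ homGrade ((symObj k n a).tensor (symObj k n b)) (symObj k n c) 0 := by
  refine mem_homGrade_zero (tm_ext fun x y => sval_injective _ ?_) fun q ξ => tm_ext fun x y =>
    sval_injective _ ?_
  · rw [LinearMap.comp_apply, LinearMap.comp_apply, tensor_tw, sval_tw, sval_mergeLin, sval_mergeLin,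
      sval_tw, sval_tw, map_mul]
  · rw [LinearMap.comp_apply, LinearMap.comp_apply, tensor_act, sval_act, map_add, map_add,
      sval_mergeLin, sval_mergeLin, sval_mergeLin, sval_tw, sval_act, sval_act, symDer_mul, add_comm]

/-- The multiplication, as a homomorphism. -/
def mergeHom (a b c : ℕ) (h : a + b = c) :
    (symObj k n a).tensor (symObj k n b) ⟶ symObj k n c := ofMem _ (mergeLin_mem a b c h)

/-- The comultiplication `S^c(V) → S^a(V) ⊗ S^b(V)`. -/
def splitLin (a b c : ℕ) (h : a + b = c) :
    (symObj k n c).carrier →ₗ[k] ((symObj k n a).tensor (symObj k n b)).carrier :=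
  -- The component of bidegree `(a, b)` lies in the range of `tval a b`, which is `symTDeg` by
  -- definition, so it can be pulled back.
  (LinearEquiv.ofInjective (tval a b) (tval_injective a b)).symm.toLinearMap ∘ₗ
    LinearMap.codRestrict (LinearMap.range (tval a b)) (comulR b ∘ₗ sval c)
      (fun x => comulR_mem (sval_mem x) h)

theorem tval_splitLin {a b c : ℕ} (h : a + b = c) (x : (symObj k n c).carrier) :
    tval a b (splitLin a b c h x) = comulR b (sval c x) := by
  have := LinearEquiv.apply_symm_apply (LinearEquiv.ofInjective (tval (k := k) (n := n) a b)
    (tval_injective a b)) (LinearMap.codRestrict (LinearMap.range (tval a b)) (comulR b ∘ₗ sval c)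
      (fun x => comulR_mem (sval_mem x) h) x)
  exact congrArg Subtype.val this

theorem splitLin_mem (a b c : ℕ) (h : a + b = c) :
    splitLin a b c h ∈ homGrade (symObj k n c) ((symObj k n a).tensor (symObj k n b)) 0 := by
  refine mem_homGrade_zero (LinearMap.ext fun x => tval_injective _ _ ?_) fun q ξ =>
    LinearMap.ext fun x => tval_injective _ _ ?_
  · rw [LinearMap.comp_apply, LinearMap.comp_apply, tval_tw, tval_splitLin, tval_splitLin, sval_tw,
      comulR_symTw]
  · rw [LinearMap.comp_apply, LinearMap.comp_apply, tval_act, tval_splitLin, tval_splitLin, sval_act,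
      comulR_symDer]

/-- The comultiplication, as a homomorphism. -/
def splitHom (a b c : ℕ) (h : a + b = c) :
    symObj k n c ⟶ (symObj k n a).tensor (symObj k n b) := ofMem _ (splitLin_mem a b c h)

/-! ### The duality of the natural module -/

theorem symAug_symDer {p : ZMod 2} (ξ : typeP k n p) (x : SymAlg k n) : symAug (symDer ξ x) = 0 := by
  induction x using symAlg_left_induction with
  | h₁ => rw [← map_one (algebraMap k (SymAlg k n)), symDer_algebraMap, map_zero]
  | ha a b ha hb => rw [map_add, map_add, ha, hb, add_zero]
  | hs c a ha => rw [map_smul, map_smul, ha, smul_zero]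
  | hm p v hv a ha =>
    rw [symDer_symι_mul ξ hv, map_add, map_smul, symAug_symι_mul, symAug_symι_mul, smul_zero, add_zero]

theorem symOne_symDer {p : ZMod 2} (ξ : typeP k n p) (x : SymAlg k n) :
    symOne (symDer ξ x) = ξ.1 (symOne x) := by
  induction x using symAlg_left_induction with
  | h₁ => rw [← map_one (algebraMap k (SymAlg k n)), symDer_algebraMap, map_one, symOne_one,
      map_zero, map_zero]
  | ha a b ha hb => rw [map_add, map_add, ha, hb, map_add, map_add]
  | hs c a ha => rw [map_smul, map_smul, ha, map_smul, map_smul]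
  | hm p v hv a ha =>
    rw [symDer_symι_mul ξ hv, map_add, map_smul, symOne_symι_mul, symOne_symι_mul, symOne_symι_mul,
      symAug_symDer, zero_smul, smul_zero, add_zero, map_smul]

theorem symι_mem (v : NatV k n) : symι k n v ∈ SymPow k n 1 := by
  rw [SymPow, pow_one]; exact ⟨v, rfl⟩

theorem symι_symOne {x : SymAlg k n} (hx : x ∈ SymPow k n 1) : symι k n (symOne x) = x := by
  rw [SymPow, pow_one] at hx
  obtain ⟨v, rfl⟩ := hx
  rw [symOne_symι]

theorem form_natTw_left (v w : NatV k n) :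
    form k n (natTw 1 v) w = -form k n v (natTw 1 w) := by
  suffices h : formLin k n ∘ₗ natTw 1 = -(formLin k n).compl₂ (natTw 1) from
    LinearMap.congr_fun (LinearMap.congr_fun h v) w
  refine nat_ext fun p v hv => LinearMap.ext fun w => ?_
  change form k n (natTw 1 v) w = -form k n v (natTw 1 w)
  rw [form_natTw 1 hv, natTw_apply 1 hv, form_smul_left, one_mul, one_mul, sgn_add, sgn_one]
  ring

/-- The defining condition of `𝔭(n)` with the parity of `v` eliminated: since the form is odd, that
sign can be moved to a twist of the second argument. -/
theorem form_typeP {q : ZMod 2} (ξ : typeP k n q) (v w : NatV k n) :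
    form k n (ξ.1 v) w = -(sgn k q * form k n v (natTw q (ξ.1 w))) := by
  suffices h : formLin k n ∘ₗ ξ.1 = -(sgn k q • (formLin k n).compl₂ (natTw q ∘ₗ ξ.1)) from
    LinearMap.congr_fun (LinearMap.congr_fun h v) w
  refine nat_ext fun p v hv => LinearMap.ext fun w => ?_
  change form k n (ξ.1 v) w = -(sgn k q * form k n v (natTw q (ξ.1 w)))
  have h := ξ.2.2 p v hv w
  rw [form_natTw q hv, mul_add, mul_one, sgn_add]
  linear_combination h + sgn k (q * p) * form k n v (ξ.1 w) * sgn_mul_self k q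

/-- The isomorphism `D : V → V^*`. -/
def dualEquiv (k : Type u) [Field k] [NeZero (2 : k)] (n : ℕ) :
    (symObj k n 1).carrier ≃ₗ[k] (symObj k n 1).dual.carrier where
  toFun x := dmk _ (symForm k n (sval 1 x) ∘ₗ sval 1)
  map_add' x y := dual_ext fun m => by simp
  map_smul' c x := dual_ext fun m => by simp
  -- The coordinate of a vector at `v_i` is its pairing with `v_{-i}`, so the vector representing
  -- `f` has the coordinates `f (v_{-i})`.
  invFun f := smk (symι k n (∑ i, dapp _ f (smk _ (symι_mem (natVec k i.swap))) • natVec k i))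
    (symι_mem _)
  left_inv x := by
    apply sval_injective
    rw [sval_smk]
    conv_rhs => rw [← symι_symOne (sval_mem x)]
    congr 1
    ext j
    have e : ∀ v : NatV k n, ∀ i : Ix n, form k n v (natVec k i.swap) = v i := by
      intro v i
      rw [form, Finset.sum_eq_single i]
      · simp [natVec]
      · intro j _ hj
        have : j.swap ≠ i.swap := fun h => hj (by rw [← Sum.swap_swap j, h, Sum.swap_swap])
        simp [natVec, this]
      · simp
    simp only [dapp_dmk, LinearMap.comp_apply, sval_smk, symForm_apply, symOne_symι, e]
    simp [natVec, Pi.single_apply]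
  right_inv f := by
    refine dual_ext fun m => ?_
    have hm : m = smk _ (symι_mem (symOne (sval 1 m))) :=
      sval_injective _ (symι_symOne (sval_mem m)).symm
    rw [dapp_dmk, LinearMap.comp_apply, sval_smk, symForm_apply, symOne_symι]
    conv_rhs => rw [hm]
    generalize symOne (sval 1 m) = w
    let g : NatV k n →ₗ[k] k := dapp _ f ∘ₗ (LinearMap.codRestrict _ (symι k n) symι_mem)
    have hg : ∀ w, dapp _ f (smk _ (symι_mem w)) = g w := fun w => rfl
    simp only [hg]
    have : formLin k n (∑ i, g (natVec k i.swap) • natVec k i) = g := by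
      refine LinearMap.pi_ext' fun j => LinearMap.ext_ring ?_
      change form k n (∑ i, g (natVec k i.swap) • natVec k i) (natVec k j) = g (natVec k j)
      rw [form, Finset.sum_eq_single j.swap]
      · simp [natVec, Pi.single_apply]
      · intro i _ hi
        have : i.swap ≠ j := fun h => hi (by rw [← h, Sum.swap_swap])
        simp [natVec, this]
      · simp
    exact LinearMap.congr_fun this w

theorem dapp_dualEquiv (x y : (symObj k n 1).carrier) :
    dapp _ (dualEquiv k n x) y = symForm k n (sval 1 x) (sval 1 y) := rfl

/-- Oddness of `D` is oddness of the form, and its equivariance is the invariance of the form that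
defines `𝔭(n)`. -/
theorem dualEquiv_mem : (dualEquiv k n).toLinearMap ∈ homGrade (symObj k n 1) (symObj k n 1).dual 1 := by
  refine mem_homGrade_one (fun x => dual_ext fun y => ?_) fun q ξ x => dual_ext fun y => ?_
  · simp only [LinearEquiv.coe_coe, map_smul, LinearMap.smul_apply, dapp_tw, dapp_dualEquiv, sval_tw,
      symForm_apply, symOne_symTw]
    rw [form_natTw_left, smul_eq_mul, neg_one_mul]
  · simp only [LinearEquiv.coe_coe, map_smul, LinearMap.smul_apply, dapp_act, dapp_dualEquiv, sval_tw,
      sval_act, symForm_apply, symOne_symTw, symOne_symDer]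
    rw [form_typeP, smul_eq_mul, mul_neg]

variable (k n) in
/-- The odd isomorphism `D : V → V^*`. -/
def dualHom : symObj k n 1 ⟶ (symObj k n 1).dual := ofMem _ dualEquiv_mem

variable (k n) in
/-- The inverse of `D`. -/
def dualInv : (symObj k n 1).dual ⟶ symObj k n 1 := ofMem _ (symm_mem_one _ dualEquiv_mem)

/-! ### The symmetric power of degree zero -/

theorem symAug_smul_one {x : SymAlg k n} (hx : x ∈ SymPow k n 0) : symAug x • (1 : SymAlg k n) = x := by
  rw [SymPow, pow_zero] at hx
  obtain ⟨c, rfl⟩ := Submodule.mem_one.1 hx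
  rw [Algebra.algebraMap_eq_smul_one, map_smul, symAug_one, smul_eq_mul, mul_one]

/-- The linear map from the trivial module with a given value at the basis vector. -/
def trivLift {P : Type u} [AddCommGroup P] [Module k P] (x : P) : (triv k n).carrier →ₗ[k] P :=
  LinearMap.toSpanSingleton k P x

theorem trivLift_trivOne {P : Type u} [AddCommGroup P] [Module k P] (x : P) :
    trivLift (n := n) x (trivOne : (triv k n).carrier) = x := one_smul k x

/-- The identification of the trivial module with `S^0(V)`. -/
def unitEquiv (k : Type u) [Field k] [NeZero (2 : k)] (n : ℕ) :
    (triv k n).carrier ≃ₗ[k] (symObj k n 0).carrier :=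
  LinearEquiv.ofLinearMap
    (trivLift (smk 1 one_mem_symPow))
    (trivMk k n ∘ₗ symAug ∘ₗ sval 0)
    (LinearMap.ext fun x => sval_injective _ (symAug_smul_one (sval_mem x)))
    (triv_ext (by
      rw [LinearMap.comp_apply, LinearMap.comp_apply, LinearMap.comp_apply, trivLift_trivOne,
        sval_smk, symAug_one]
      rfl))

theorem unitEquiv_trivOne : unitEquiv k n trivOne = smk 1 one_mem_symPow := one_smul k _

theorem unitEquiv_mem : (unitEquiv k n).toLinearMap ∈ homGrade (triv k n) (symObj k n 0) 0 := by
  refine mem_homGrade_zero (triv_ext (sval_injective _ ?_)) fun q ξ => triv_ext (sval_injective _ ?_)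
  · rw [LinearMap.comp_apply, LinearMap.comp_apply, triv_tw, sval_tw]
    change sval 0 (unitEquiv k n trivOne) = symTw 1 (sval 0 (unitEquiv k n trivOne))
    rw [unitEquiv_trivOne, sval_smk, map_one]
  · rw [LinearMap.comp_apply, LinearMap.comp_apply, triv_act, sval_act, map_zero, map_zero]
    change 0 = symDer ξ (sval 0 (unitEquiv k n trivOne))
    rw [unitEquiv_trivOne, sval_smk, ← map_one (algebraMap k (SymAlg k n)), symDer_algebraMap]

/-- The identification of the trivial module with `S^0(V)^*`. -/
def unitDualEquiv (k : Type u) [Field k] [NeZero (2 : k)] (n : ℕ) :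
    (triv k n).carrier ≃ₗ[k] (symObj k n 0).dual.carrier :=
  LinearEquiv.ofLinearMap
    (trivLift (dmk _ (symAug ∘ₗ sval 0)))
    (trivMk k n ∘ₗ (dapp (symObj k n 0)).flip (smk 1 one_mem_symPow))
    (LinearMap.ext fun f => dual_ext fun x => by
      have hx : x = symAug (sval 0 x) • smk 1 one_mem_symPow :=
        sval_injective _ (symAug_smul_one (sval_mem x)).symm
      change dapp _ (dapp _ f (smk 1 one_mem_symPow) • dmk _ (symAug ∘ₗ sval 0)) x = dapp _ f x
      conv_rhs => rw [hx]
      rw [map_smul, map_smul, LinearMap.smul_apply, dapp_dmk, LinearMap.comp_apply, smul_eq_mul,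
        smul_eq_mul, mul_comm])
    (triv_ext (by
      rw [LinearMap.comp_apply, LinearMap.comp_apply, trivLift_trivOne, LinearMap.flip_apply,
        dapp_dmk, LinearMap.comp_apply, sval_smk, symAug_one]
      rfl))

theorem unitDualEquiv_trivOne : unitDualEquiv k n trivOne = dmk _ (symAug ∘ₗ sval 0) := one_smul k _

theorem unitDualEquiv_mem :
    (unitDualEquiv k n).toLinearMap ∈ homGrade (triv k n) (symObj k n 0).dual 0 := by
  refine mem_homGrade_zero (triv_ext (dual_ext fun x => ?_)) fun q ξ => triv_ext (dual_ext fun x => ?_)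
  · rw [LinearMap.comp_apply, LinearMap.comp_apply, triv_tw, dapp_tw]
    change dapp _ (unitDualEquiv k n trivOne) x = dapp _ (unitDualEquiv k n trivOne) _
    rw [unitDualEquiv_trivOne, dapp_dmk, LinearMap.comp_apply, LinearMap.comp_apply, sval_tw,
      symAug_symTw]
  · rw [LinearMap.comp_apply, LinearMap.comp_apply, triv_act, dapp_act, map_zero, map_zero]
    change 0 = -dapp _ (unitDualEquiv k n trivOne) _
    rw [unitDualEquiv_trivOne, dapp_dmk, LinearMap.comp_apply, sval_tw, symAug_symTw, sval_act,
      symAug_symDer, neg_zero]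

variable (k n) in
/-- The identification of the trivial module with `S^0(V)`, as an isomorphism. -/
def unitIso : triv k n ≅ symObj k n 0 :=
  isoOfEquiv (unitEquiv k n) unitEquiv_mem (symm_mem _ unitEquiv_mem)

variable (k n) in
/-- The identification of the trivial module with `S^0(V)^*`, as an isomorphism. -/
def unitDualIso : triv k n ≅ (symObj k n 0).dual :=
  isoOfEquiv (unitDualEquiv k n) unitDualEquiv_mem (symm_mem _ unitDualEquiv_mem)

end SymHom

end

end TypeP

namespace TypeP

noncomputable section

namespace PMod

variable {k : Type u} [Field k] [NeZero (2 : k)] {n : ℕ}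

/-! ### Tensor products of words -/

/-- With one of the two crossing morphisms even, the interchange law has no sign, and by additivity
the other one need not be homogeneous. -/
theorem tensorMor_comp_of_even {X₁ Y₁ Z₁ X₂ Y₂ Z₂ : PMod k n} {f : X₁ ⟶ Y₁} (g : X₂ ⟶ Y₂)
    (h : Y₁ ⟶ Z₁) (l : Y₂ ⟶ Z₂) (hf : lin f ∈ homGrade X₁ Y₁ 0) :
    tensorMor f g ≫ tensorMor h l = tensorMor (f ≫ h) (g ≫ l) := by
  obtain ⟨l₀, l₁, h₀, h₁, rfl⟩ := hom_exists_add l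
  rw [map_add, Preadditive.comp_add, tensorMor_interchange g h hf h₀,
    tensorMor_interchange g h hf h₁, mul_zero, mul_zero, sgn_zero, one_smul, one_smul,
    Preadditive.comp_add, map_add]

theorem tensorMor_comp_of_even' {X₁ Y₁ Z₁ X₂ Y₂ Z₂ : PMod k n} (f : X₁ ⟶ Y₁) (g : X₂ ⟶ Y₂)
    (h : Y₁ ⟶ Z₁) {l : Y₂ ⟶ Z₂} (hl : lin l ∈ homGrade Y₂ Z₂ 0) :
    tensorMor f g ≫ tensorMor h l = tensorMor (f ≫ h) (g ≫ l) := by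
  obtain ⟨f₀, f₁, h₀, h₁, rfl⟩ := hom_exists_add f
  rw [map_add, LinearMap.add_apply, Preadditive.add_comp, tensorMor_interchange g h h₀ hl,
    tensorMor_interchange g h h₁ hl, zero_mul, zero_mul, sgn_zero, one_smul, one_smul,
    Preadditive.add_comp, map_add, LinearMap.add_apply]

theorem inv_mem {M N : PMod k n} {e : M ≅ N} (h : lin e.hom ∈ homGrade M N 0) :
    lin e.inv ∈ homGrade N M 0 :=
  symm_mem (LinearEquiv.ofLinearMap (lin e.hom) (lin e.inv)
    (congrArg lin e.inv_hom_id) (congrArg lin e.hom_inv_id)) h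

theorem even_comp {M N P : PMod k n} {f : M ⟶ N} {g : N ⟶ P} (hf : lin f ∈ homGrade M N 0)
    (hg : lin g ∈ homGrade N P 0) : lin (f ≫ g) ∈ homGrade M P 0 := by
  have := comp_mem hf hg
  rwa [add_zero] at this

theorem even_tensor {M M' N N' : PMod k n} {f : M ⟶ M'} {g : N ⟶ N'} (hf : lin f ∈ homGrade M M' 0)
    (hg : lin g ∈ homGrade N N' 0) :
    lin (tensorMor f g) ∈ homGrade (M.tensor N) (M'.tensor N') 0 := by
  have := tensorLin_mem hf hg
  rwa [add_zero] at this

/-- An isomorphism tensored with an object from the left. -/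
def tensorIsoRight (M : PMod k n) {N P : PMod k n} (e : N ≅ P) : M.tensor N ≅ M.tensor P where
  hom := tensorMor (𝟙 M) e.hom
  inv := tensorMor (𝟙 M) e.inv
  hom_inv_id := by
    rw [tensorMor_comp_of_even _ _ _ (id_mem M), Category.comp_id, e.hom_inv_id]
    exact tensorHom_id (k := k) M N
  inv_hom_id := by
    rw [tensorMor_comp_of_even _ _ _ (id_mem M), Category.comp_id, e.inv_hom_id]
    exact tensorHom_id (k := k) M P

/-- The tensor product of two even isomorphisms. -/
def tensorIso {M N P Q : PMod k n} (e : M ≅ N) (e' : P ≅ Q) (he : lin e.hom ∈ homGrade M N 0) :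
    M.tensor P ≅ N.tensor Q where
  hom := tensorMor e.hom e'.hom
  inv := tensorMor e.inv e'.inv
  hom_inv_id := by
    rw [tensorMor_comp_of_even _ _ _ he, e.hom_inv_id, e'.hom_inv_id]
    exact tensorHom_id (k := k) M P
  inv_hom_id := by
    rw [tensorMor_comp_of_even _ _ _ (inv_mem he), e.inv_hom_id, e'.inv_hom_id]
    exact tensorHom_id (k := k) N Q

/-- Transport of elements along an equality of words. -/
def castL (F : Word → PMod k n) {x y : Word} (h : x = y) : (F x).carrier →ₗ[k] (F y).carrier :=
  lin (eqToHom (congrArg F h))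

@[simp] theorem castL_rfl (F : Word → PMod k n) {x : Word} (h : x = x) (s : (F x).carrier) :
    castL F h s = s := rfl

theorem castL_castL (F : Word → PMod k n) {x y z : Word} (h : x = y) (h' : y = z)
    (s : (F x).carrier) : castL F h' (castL F h s) = castL F (h.trans h') s := by
  subst h h'
  rfl

theorem eqToHom_mem {M N : PMod k n} (h : M = N) : lin (eqToHom h) ∈ homGrade M N 0 := by
  subst h
  exact id_mem M

variable (k n) in
/-- The supermodule of a generating object. -/
def arrObj : Arrow → PMod k n
  | .up a => symObj k n a
  | .down a => (symObj k n a).dual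

variable (k n) in
/-- The right-nested tensor product of the supermodules of a word, with a trivial factor at the
end. -/
def tobj : Word → PMod k n
  | [] => triv k n
  | x :: l => (arrObj k n x).tensor (tobj l)

/-- The tensor product of two words is their concatenation. -/
def tobjμ : ∀ x y : Word, (tobj k n x).tensor (tobj k n y) ≅ tobj k n (x ++ y)
  | [], y => tensorLeft (tobj k n y)
  | a :: x, y => tensorAssoc (arrObj k n a) (tobj k n x) (tobj k n y) ≪≫
      tensorIsoRight (arrObj k n a) (tobjμ x y)

theorem tobjμ_mem (x y : Word) : lin (tobjμ (k := k) (n := n) x y).hom ∈ homGrade _ _ 0 := by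
  induction x with
  | nil => exact tensorLeft_mem _
  | cons a x ih =>
    exact even_comp (tensorAssoc_mem _ _ _) (even_tensor (f := 𝟙 (arrObj k n a)) (id_mem _) ih)

/-- The concatenation of elements. -/
def tcat {x y : Word} (s : (tobj k n x).carrier) (t : (tobj k n y).carrier) :
    (tobj k n (x ++ y)).carrier := lin (tobjμ x y).hom (tm s t)

theorem tcat_add_left {x y : Word} (s s' : (tobj k n x).carrier) (t : (tobj k n y).carrier) :
    tcat (s + s') t = tcat s t + tcat s' t := by
  rw [tcat, add_tm, map_add]; rfl

/-- The basis vector of the empty tensor product. -/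
def tstar : (tobj k n []).carrier := (trivOne : (triv k n).carrier)

theorem tcat_nil {y : Word} (t : (tobj k n y).carrier) :
    tcat tstar t = t := one_smul k t

/-- The element of the tensor product of a word, from its first factor and the rest. -/
def tcons {a : Arrow} {x : Word} (m : (arrObj k n a).carrier) (s : (tobj k n x).carrier) :
    (tobj k n (a :: x)).carrier := tm m s

theorem tcat_tcons {a : Arrow} {x y : Word} (m : (arrObj k n a).carrier) (s : (tobj k n x).carrier)
    (t : (tobj k n y).carrier) : tcat (tcons m s) t = tcons (x := x ++ y) m (tcat s t) := by
  have := tensorMor_tm_of_even (𝟙 (arrObj k n a)) (tobjμ_mem (k := k) (n := n) x y) m (tm s t)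
  exact this

theorem tobj_nil_induction {C : (tobj k n []).carrier → Prop} (h₁ : C tstar)
    (hs : ∀ (c : k) s, C s → C (c • s)) (s : (tobj k n []).carrier) : C s := by
  obtain ⟨c, rfl⟩ := triv_exists (k := k) (n := n) s
  exact hs c _ h₁

theorem tobj_cons_induction {a : Arrow} {x : Word} {C : (tobj k n (a :: x)).carrier → Prop}
    (h : ∀ m s, C (tcons m s)) (ha : ∀ s t, C s → C t → C (s + t)) (s : (tobj k n (a :: x)).carrier) :
    C s := tm_induction (M := arrObj k n a) (N := tobj k n x) h ha s

theorem castL_tcons {a : Arrow} {x y : Word} (h : a :: x = a :: y) (m : (arrObj k n a).carrier)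
    (s : (tobj k n x).carrier) :
    castL (tobj k n) h (tcons m s) = tcons m (castL (tobj k n) (List.cons.inj h).2 s) := by
  obtain rfl := (List.cons.inj h).2
  rfl

theorem tcat_smul_left {x y : Word} (c : k) (s : (tobj k n x).carrier) (t : (tobj k n y).carrier) :
    tcat (c • s) t = c • tcat s t := by
  rw [tcat, smul_tm, map_smul]; rfl

/-- On right-nested products concatenation is recursive in the first word, so associativity and the
unit law are proved on elements as for lists. The transport along equal words is the only
bookkeeping. -/
theorem tcat_assoc {x y z : Word} (s : (tobj k n x).carrier) (t : (tobj k n y).carrier)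
    (r : (tobj k n z).carrier) (h : x ++ y ++ z = x ++ (y ++ z)) :
    castL (tobj k n) h (tcat (tcat s t) r) = tcat s (tcat t r) := by
  induction x with
  | nil =>
    induction s using tobj_nil_induction with
    | h₁ => rw [tcat_nil, tcat_nil]; rfl
    | hs c s ih => rw [tcat_smul_left, tcat_smul_left, tcat_smul_left, map_smul, ih]
  | cons a x ih =>
    induction s using tobj_cons_induction with
    | h m s =>
      rw [tcat_tcons]
      have := tcat_tcons (x := x ++ y) (y := z) m (tcat s t) r
      refine (congrArg (castL (tobj k n) h) this).trans ?_
      rw [tcat_tcons]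
      refine (castL_tcons (x := x ++ y ++ z) (y := x ++ (y ++ z)) h m _).trans ?_
      exact congrArg (tcons m) (ih s (List.append_assoc _ _ _))
    | ha s s' e e' => rw [tcat_add_left, tcat_add_left, tcat_add_left, map_add, e, e']

theorem tcat_nil_right {x : Word} (s : (tobj k n x).carrier) (h : x ++ [] = x) :
    castL (tobj k n) h (tcat s tstar) = s := by
  induction x with
  | nil =>
    induction s using tobj_nil_induction with
    | h₁ => rw [tcat_nil]; rfl
    | hs c s ih => rw [tcat_smul_left, map_smul, ih]
  | cons a x ih =>
    induction s using tobj_cons_induction with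
    | h m s =>
      rw [tcat_tcons]
      refine (castL_tcons (congrArg (List.cons a) (List.append_nil x)) m _).trans ?_
      exact congrArg (tcons m) (ih s (List.append_nil _))
    | ha s s' e e' => rw [tcat_add_left, map_add, e, e']

variable (k n) in
/-- The supermodule of a word. It is the supermodule of the generating object for a word of
length one. -/
def wobj : Word → PMod k n
  | [] => triv k n
  | [x] => arrObj k n x
  | x :: y :: l => tobj k n (x :: y :: l)

/-- The comparison of the supermodules of a word. -/
def wobjIso : ∀ x : Word, wobj k n x ≅ tobj k n x
  | [] => Iso.refl _
  | [x] => (tensorRight (arrObj k n x)).symm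
  | _ :: _ :: _ => Iso.refl _

theorem wobjIso_mem (x : Word) : lin (wobjIso (k := k) (n := n) x).hom ∈ homGrade _ _ 0 := by
  match x with
  | [] => exact id_mem _
  | [_] => exact inv_mem (tensorRight_mem _)
  | _ :: _ :: _ => exact id_mem _

theorem wobjIso_injective (x : Word) : Function.Injective (lin (wobjIso (k := k) (n := n) x).hom) :=
  Function.LeftInverse.injective (g := lin (wobjIso x).inv)
    (LinearMap.congr_fun (congrArg lin (wobjIso (k := k) (n := n) x).hom_inv_id))

theorem wobjIso_castL {x y : Word} (h : x = y) (s : (wobj k n x).carrier) :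
    lin (wobjIso y).hom (castL (wobj k n) h s) = castL (tobj k n) h (lin (wobjIso x).hom s) := by
  subst h
  rfl

/-- The tensor product of two words is their concatenation. -/
def wobjμ (x y : Word) : (wobj k n x).tensor (wobj k n y) ≅ wobj k n (x ++ y) :=
  tensorIso (wobjIso x) (wobjIso y) (wobjIso_mem x) ≪≫ tobjμ x y ≪≫ (wobjIso (x ++ y)).symm

theorem wobjμ_mem (x y : Word) : lin (wobjμ (k := k) (n := n) x y).hom ∈ homGrade _ _ 0 :=
  even_comp (even_tensor (wobjIso_mem x) (wobjIso_mem y))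
    (even_comp (tobjμ_mem x y) (inv_mem (wobjIso_mem _)))

/-- The concatenation of elements. -/
def cat {x y : Word} (s : (wobj k n x).carrier) (t : (wobj k n y).carrier) :
    (wobj k n (x ++ y)).carrier := lin (wobjμ x y).hom (tm s t)

theorem wobjIso_cat {x y : Word} (s : (wobj k n x).carrier) (t : (wobj k n y).carrier) :
    lin (wobjIso (x ++ y)).hom (cat s t) =
      tcat (lin (wobjIso x).hom s) (lin (wobjIso y).hom t) := by
  have e : ∀ r, lin (wobjIso (k := k) (n := n) (x ++ y)).hom (lin (wobjIso (x ++ y)).inv r) = r :=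
    LinearMap.congr_fun (congrArg lin (wobjIso (x ++ y)).inv_hom_id)
  refine (e _).trans ?_
  exact congrArg (lin (tobjμ x y).hom) (tensorMor_tm_of_even _ (wobjIso_mem y) s t)

/-- Transported from the right-nested products, for which the statement is proved by recursion; the
exceptional form of one-letter words is hidden in `wobjIso`. -/
theorem cat_assoc {x y z : Word} (s : (wobj k n x).carrier) (t : (wobj k n y).carrier)
    (r : (wobj k n z).carrier) (h : x ++ y ++ z = x ++ (y ++ z)) :
    castL (wobj k n) h (cat (cat s t) r) = cat s (cat t r) := by
  apply wobjIso_injective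
  rw [wobjIso_castL, wobjIso_cat, wobjIso_cat, wobjIso_cat, wobjIso_cat, tcat_assoc]

/-- The basis vector of the supermodule of the empty word. -/
def star : (wobj k n []).carrier := (trivOne : (triv k n).carrier)

theorem cat_nil {x : Word} (t : (wobj k n x).carrier) : cat star t = t := by
  apply wobjIso_injective
  exact (wobjIso_cat star t).trans (tcat_nil _)

theorem cat_nil_right {x : Word} (s : (wobj k n x).carrier) (h : x ++ [] = x) :
    castL (wobj k n) h (cat s star) = s := by
  apply wobjIso_injective
  rw [wobjIso_castL, wobjIso_cat]
  exact tcat_nil_right _ h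

theorem cat_add_left {x y : Word} (s s' : (wobj k n x).carrier) (t : (wobj k n y).carrier) :
    cat (s + s') t = cat s t + cat s' t := by
  rw [cat, add_tm, map_add]; rfl

theorem cat_add_right {x y : Word} (s : (wobj k n x).carrier) (t t' : (wobj k n y).carrier) :
    cat s (t + t') = cat s t + cat s t' := by
  rw [cat, tm_add, map_add]; rfl

theorem cat_smul_left {x y : Word} (c : k) (s : (wobj k n x).carrier) (t : (wobj k n y).carrier) :
    cat (c • s) t = c • cat s t := by
  rw [cat, smul_tm, map_smul]; rfl

theorem cat_smul_right {x y : Word} (c : k) (s : (wobj k n x).carrier) (t : (wobj k n y).carrier) :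
    cat s (c • t) = c • cat s t := by
  rw [cat, tm_smul, map_smul]; rfl

/-- The concatenation of elements, as a bilinear map. -/
def catL (x y : Word) :
    (wobj k n x).carrier →ₗ[k] (wobj k n y).carrier →ₗ[k] (wobj k n (x ++ y)).carrier :=
  LinearMap.mk₂ k cat cat_add_left cat_smul_left cat_add_right cat_smul_right

theorem catL_apply {x y : Word} (s : (wobj k n x).carrier) (t : (wobj k n y).carrier) :
    catL x y s t = cat s t := rfl

theorem wobjμ_inv_cat {x y : Word} (s : (wobj k n x).carrier) (t : (wobj k n y).carrier) :
    lin (wobjμ x y).inv (cat s t) = tm s t :=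
  LinearMap.congr_fun (congrArg lin (wobjμ x y).hom_inv_id) (tm s t)

theorem cat_induction {x y : Word} {C : (wobj k n (x ++ y)).carrier → Prop}
    (h : ∀ s t, C (cat s t)) (ha : ∀ s t, C s → C t → C (s + t))
    (s : (wobj k n (x ++ y)).carrier) : C s := by
  have e : lin (wobjμ x y).hom (lin (wobjμ x y).inv s) = s :=
    LinearMap.congr_fun (congrArg lin (wobjμ x y).inv_hom_id) s
  rw [← e]
  induction lin (wobjμ x y).inv s using tm_induction with
  | h m l => exact h m l
  | ha s t hs ht => rw [map_add]; exact ha _ _ hs ht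

end PMod

end

end TypeP

namespace TypeP

noncomputable section

open PMod

section Evaluation

variable {k : Type u} [Field k] [NeZero (2 : k)] {n : ℕ}

/-! ### The evaluation of diagrams -/

theorem up_succ (a : ℕ) : up (a + 1) = [Arrow.up ⟨a + 1, a.succ_pos⟩] := dif_pos a.succ_pos

theorem down_succ (a : ℕ) : down (a + 1) = [Arrow.down ⟨a + 1, a.succ_pos⟩] := dif_pos a.succ_pos

/-- One-letter words carry no trivial factor, so this is an equality of supermodules and the
identification at positive labels can be an `eqToIso`. -/
theorem wobj_up_succ (a : ℕ) : wobj k n (up (a + 1)) = symObj k n (a + 1) := by rw [up_succ]; rfl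

theorem wobj_down_succ (a : ℕ) : wobj k n (down (a + 1)) = (symObj k n (a + 1)).dual := by
  rw [down_succ]; rfl

/-- The identification of the supermodule of `↑_a` with `S^a(V)`. -/
def upIso : ∀ a : ℕ, wobj k n (up a) ≅ symObj k n a
  | 0 => unitIso k n
  | a + 1 => eqToIso (wobj_up_succ a)

/-- The identification of the supermodule of `↓_a` with `S^a(V)^*`. -/
def downIso : ∀ a : ℕ, wobj k n (down a) ≅ (symObj k n a).dual
  | 0 => unitDualIso k n
  | a + 1 => eqToIso (wobj_down_succ a)

theorem upIso_mem : ∀ a : ℕ, lin (upIso (k := k) (n := n) a).hom ∈ homGrade _ _ 0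
  | 0 => unitEquiv_mem
  | a + 1 => eqToHom_mem (wobj_up_succ a)

theorem downIso_mem : ∀ a : ℕ, lin (downIso (k := k) (n := n) a).hom ∈ homGrade _ _ 0
  | 0 => unitDualEquiv_mem
  | a + 1 => eqToHom_mem (wobj_down_succ a)

/-- The elements of the supermodule of `↑_a`. -/
def eu (a : ℕ) : (symObj k n a).carrier →ₗ[k] (wobj k n (up a)).carrier := lin (upIso a).inv

/-- The elements of the supermodule of `↓_a`. -/
def ed (a : ℕ) : (symObj k n a).dual.carrier →ₗ[k] (wobj k n (down a)).carrier :=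
  lin (downIso a).inv

theorem upIso_eu (a : ℕ) (x : (symObj k n a).carrier) : lin (upIso a).hom (eu a x) = x :=
  LinearMap.congr_fun (congrArg lin (upIso a).inv_hom_id) x

theorem downIso_ed (a : ℕ) (x : (symObj k n a).dual.carrier) : lin (downIso a).hom (ed a x) = x :=
  LinearMap.congr_fun (congrArg lin (downIso a).inv_hom_id) x

theorem eu_upIso (a : ℕ) (x : (wobj k n (up a)).carrier) : eu a (lin (upIso a).hom x) = x :=
  LinearMap.congr_fun (congrArg lin (upIso a).hom_inv_id) x

theorem ed_downIso (a : ℕ) (x : (wobj k n (down a)).carrier) : ed a (lin (downIso a).hom x) = x :=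
  LinearMap.congr_fun (congrArg lin (downIso a).hom_inv_id) x

theorem eu_tw (a : ℕ) (q : ZMod 2) (x : (symObj k n a).carrier) :
    (wobj k n (up a)).tw q (eu a x) = eu a ((symObj k n a).tw q x) :=
  (hom_tw (inv_mem (upIso_mem a)) q x).symm

/-- The concatenation of the images of two linear maps. -/
def pairL {M N : PMod k n} {x y : Word} (f : M.carrier →ₗ[k] (wobj k n x).carrier)
    (g : N.carrier →ₗ[k] (wobj k n y).carrier) :
    (M.tensor N).carrier →ₗ[k] (wobj k n (x ++ y)).carrier := tlift ((catL x y).compl₁₂ f g)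

theorem pairL_tm {M N : PMod k n} {x y : Word} (f : M.carrier →ₗ[k] (wobj k n x).carrier)
    (g : N.carrier →ₗ[k] (wobj k n y).carrier) (m : M.carrier) (l : N.carrier) :
    pairL f g (tm m l) = cat (f m) (g l) := rfl

theorem lin_tensorMor_wobjμ {M N : PMod k n} {x y : Word} (f : M ⟶ wobj k n x) {g : N ⟶ wobj k n y}
    (hg : lin g ∈ homGrade N (wobj k n y) 0) :
    lin (tensorMor f g ≫ (wobjμ x y).hom) = pairL (lin f) (lin g) :=
  tm_ext fun m l => congrArg (lin (wobjμ x y).hom) (tensorMor_tm_of_even f hg m l)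

/-- The homomorphisms of the generating diagrams. -/
def evGen : ∀ {x y : Word}, Gen x y → (wobj k n x ⟶ wobj k n y)
  | _, _, .split a b c h => (upIso c).hom ≫ splitHom a b c h ≫
      tensorMor (upIso a).inv (upIso b).inv ≫ (wobjμ (up a) (up b)).hom
  | _, _, .merge a b c h => (wobjμ (up a) (up b)).inv ≫ tensorMor (upIso a).hom (upIso b).hom ≫
      mergeHom a b c h ≫ (upIso c).inv
  | _, _, .lcap a => (wobjμ (down a) (up a)).inv ≫ tensorMor (downIso a).hom (upIso a).hom ≫
      evalHom (symObj k n a)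
  | _, _, .lcup a => coevHom (symObj k n a) ≫ tensorMor (upIso a).inv (downIso a).inv ≫
      (wobjμ (up a) (down a)).hom
  | _, _, .tagIn => (upIso 1).hom ≫ dualHom k n ≫ (downIso 1).inv
  | _, _, .tagOut => (downIso 1).hom ≫ dualInv k n ≫ (upIso 1).inv
  | _, _, .cross a b => (wobjμ (up a) (down b)).inv ≫ tensorMor (upIso a).hom (downIso b).hom ≫
      swapHom (symObj k n a) (symObj k n b).dual ≫ tensorMor (downIso b).inv (upIso a).inv ≫
      (wobjμ (down b) (up a)).hom

theorem odd_comp {M N P Q : PMod k n} {f : M ⟶ N} {g : N ⟶ P} {h : P ⟶ Q}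
    (hf : lin f ∈ homGrade M N 0) (hg : lin g ∈ homGrade N P 1) (hh : lin h ∈ homGrade P Q 0) :
    lin (f ≫ g ≫ h) ∈ homGrade M Q 1 := by
  have := comp_mem hf (comp_mem hg hh)
  rwa [add_zero, zero_add] at this

theorem evGen_mem {x y : Word} (g : Gen x y) :
    lin (evGen (k := k) (n := n) g) ∈ homGrade (wobj k n x) (wobj k n y) g.par := by
  cases g with
  | split a b c h =>
    exact even_comp (upIso_mem c) (even_comp (splitLin_mem a b c h)
      (even_comp (even_tensor (inv_mem (upIso_mem a)) (inv_mem (upIso_mem b))) (wobjμ_mem _ _)))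
  | merge a b c h =>
    exact even_comp (inv_mem (wobjμ_mem _ _)) (even_comp (even_tensor (upIso_mem a) (upIso_mem b))
      (even_comp (mergeLin_mem a b c h) (inv_mem (upIso_mem c))))
  | lcap a =>
    exact even_comp (inv_mem (wobjμ_mem _ _)) (even_comp (even_tensor (downIso_mem a) (upIso_mem a))
      (evalLin_mem _))
  | lcup a =>
    exact even_comp (f := coevHom (symObj k n a)) (coevLin_mem _)
      (even_comp (even_tensor (inv_mem (upIso_mem a)) (inv_mem (downIso_mem a))) (wobjμ_mem _ _))
  | tagIn => exact odd_comp (upIso_mem 1) dualEquiv_mem (inv_mem (downIso_mem 1))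
  | tagOut =>
    exact odd_comp (downIso_mem 1) (symm_mem_one _ dualEquiv_mem) (inv_mem (upIso_mem 1))
  | cross a b =>
    exact even_comp (inv_mem (wobjμ_mem _ _)) (even_comp (even_tensor (upIso_mem a) (downIso_mem b))
      (even_comp (swapLin_mem _ _) (even_comp (even_tensor (inv_mem (downIso_mem b))
        (inv_mem (upIso_mem a))) (wobjμ_mem _ _))))

variable (n) in
/-- The homomorphisms of the formal linear combinations of diagrams. -/
def ev : ∀ {x y : Word}, Tm k x y → (wobj k n x ⟶ wobj k n y)
  | _, _, .gen g => evGen g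
  | _, _, .cast h => eqToHom (congrArg (wobj k n) h)
  | _, _, .comp f g => ev f ≫ ev g
  | _, _, .tens (x := x) (y := y) (x' := x') (y' := y') f g =>
      (wobjμ x x').inv ≫ tensorMor (ev f) (ev g) ≫ (wobjμ y y').hom
  | _, _, .zero => 0
  | _, _, .sum f g => ev f + ev g
  | _, _, .smul c f => c • ev f

theorem comp_mem_of_even {M N P Q : PMod k n} {p : ZMod 2} {f : M ⟶ N} {g : N ⟶ P} {h : P ⟶ Q}
    (hf : lin f ∈ homGrade M N 0) (hg : lin g ∈ homGrade N P p) (hh : lin h ∈ homGrade P Q 0) :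
    lin (f ≫ g ≫ h) ∈ homGrade M Q p := by
  have := comp_mem hf (comp_mem hg hh)
  rwa [add_zero, zero_add] at this

theorem ev_mem {x y : Word} {p : ZMod 2} {f : Tm k x y} (h : Tm.Homog p f) :
    lin (ev n f) ∈ homGrade (wobj k n x) (wobj k n y) p := by
  induction h with
  | gen g => exact evGen_mem g
  | cast h => exact eqToHom_mem _
  | comp _ _ h₁ h₂ => exact comp_mem h₁ h₂
  | tens _ _ h₁ h₂ =>
    exact comp_mem_of_even (inv_mem (wobjμ_mem _ _)) (tensorLin_mem h₁ h₂) (wobjμ_mem _ _)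
  | zero p => exact zero_mem _
  | sum _ _ h₁ h₂ => exact add_mem h₁ h₂
  | smul c _ h => exact Submodule.smul_mem _ c h

variable (n) in
/-- The linear maps of the formal linear combinations of diagrams. -/
def el {x y : Word} (f : Tm k x y) : (wobj k n x).carrier →ₗ[k] (wobj k n y).carrier := lin (ev n f)

theorem el_comp {x y z : Word} (f : Tm k x y) (g : Tm k y z) (s : (wobj k n x).carrier) :
    el n (.comp f g) s = el n g (el n f s) := rfl

theorem el_cast {x y : Word} (h : x = y) : el n (.cast h : Tm k x y) = castL (wobj k n) h := rfl

theorem el_seq {x y y' z : Word} (f : Tm k x y) (g : Tm k y' z) (h : y = y')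
    (s : (wobj k n x).carrier) :
    el n (Tm.seq f g h) s = el n g (castL (wobj k n) h (el n f s)) := rfl

theorem el_zero {x y : Word} (s : (wobj k n x).carrier) : el n (.zero : Tm k x y) s = 0 := rfl

theorem el_sum {x y : Word} (f g : Tm k x y) (s : (wobj k n x).carrier) :
    el n (.sum f g) s = el n f s + el n g s := rfl

theorem el_smul {x y : Word} (c : k) (f : Tm k x y) (s : (wobj k n x).carrier) :
    el n (.smul c f) s = c • el n f s := rfl

theorem el_bigSum {x y : Word} (m : ℕ) (f : ℕ → Tm k x y) (s : (wobj k n x).carrier) :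
    el n (Tm.bigSum m f) s = ∑ i ∈ Finset.range m, el n (f i) s := by
  induction m with
  | zero => rw [Finset.sum_range_zero]; rfl
  | succ m ih => rw [Finset.sum_range_succ, ← ih]; rfl

/-- The sign of an odd `g` passing `s` is recorded as a twist of `s`, so that no element has to be
homogeneous. -/
theorem el_tens {x y x' y' : Word} (f : Tm k x y) {g : Tm k x' y'} {q : ZMod 2}
    (hg : Tm.Homog q g) (s : (wobj k n x).carrier) (t : (wobj k n x').carrier) :
    el n (.tens f g) (cat s t) = cat (el n f ((wobj k n x).tw q s)) (el n g t) := by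
  have e : lin (tensorMor (ev n f) (ev n g)) =
      tlift ((tmL _ _).compl₁₂ (el n f ∘ₗ (wobj k n x).tw q) (el n g)) := by
    refine tm_ext_left fun p m hm l => ?_
    rw [tensorMor_tm _ (ev_mem hg) hm]
    change _ = tm (el n f ((wobj k n x).tw q m)) (el n g l)
    rw [tw_apply _ q hm, map_smul, smul_tm]; rfl
  change lin (wobjμ y y').hom (lin (tensorMor (ev n f) (ev n g)) (lin (wobjμ x x').inv (cat s t))) = _
  rw [wobjμ_inv_cat, e]
  rfl

theorem el_tens_even {x y x' y' : Word} (f : Tm k x y) {g : Tm k x' y'}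
    (hg : Tm.Homog 0 g) (s : (wobj k n x).carrier) (t : (wobj k n x').carrier) :
    el n (.tens f g) (cat s t) = cat (el n f s) (el n g t) := by
  rw [el_tens f hg, tw_zero]; rfl

theorem el_tens_one {x y x' : Word} (f : Tm k x y) (s : (wobj k n x).carrier)
    (t : (wobj k n x').carrier) :
    el n (.tens f (Tm.one k x')) (cat s t) = cat (el n f s) t := el_tens_even f (.one _) s t

theorem el_one_tens {x x' y' : Word} {g : Tm k x' y'} {q : ZMod 2}
    (hg : Tm.Homog q g) (s : (wobj k n x).carrier) (t : (wobj k n x').carrier) :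
    el n (.tens (Tm.one k x) g) (cat s t) = cat ((wobj k n x).tw q s) (el n g t) := el_tens _ hg s t

theorem castL_cat_right {x y z : Word} (h : y = z) (s : (wobj k n x).carrier)
    (t : (wobj k n y).carrier) (h' : x ++ y = x ++ z) :
    castL (wobj k n) h' (cat s t) = cat s (castL (wobj k n) h t) := by
  subst h; rfl

theorem castL_injective {x y : Word} (h : x = y) : Function.Injective (castL (wobj k n) h) := by
  subst h
  exact fun _ _ h => h

/-- Brings the two inner factors together, which is the bracketing in which a diagram between two
strands can be applied. -/
theorem castL_cat_cat {x y z w : Word} (s : (wobj k n x).carrier) (t : (wobj k n y).carrier)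
    (r : (wobj k n z).carrier) (q : (wobj k n w).carrier)
    (h : (x ++ y) ++ (z ++ w) = x ++ ((y ++ z) ++ w)) :
    castL (wobj k n) h (cat (cat s t) (cat r q)) = cat s (cat (cat t r) q) := by
  have h' : x ++ ((y ++ z) ++ w) = x ++ (y ++ (z ++ w)) := by simp
  apply castL_injective h'
  rw [castL_castL, cat_assoc, castL_cat_right (List.append_assoc y z w), cat_assoc]

/-! The generators on elements -/

theorem el_split {a b c : ℕ} (h : a + b = c) (x : (symObj k n c).carrier) :
    el n (Tm.split k a b c h) (eu c x) = pairL (eu a) (eu b) (splitLin a b c h x) := by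
  have e := lin_tensorMor_wobjμ (upIso (k := k) (n := n) a).inv (inv_mem (upIso_mem (k := k) (n := n) b))
  change lin (tensorMor (upIso a).inv (upIso b).inv ≫ (wobjμ (up a) (up b)).hom)
    (splitLin a b c h (lin (upIso c).hom (eu c x))) = _
  rw [e, upIso_eu]
  rfl

theorem el_merge {a b c : ℕ} (h : a + b = c) (x : (symObj k n a).carrier)
    (y : (symObj k n b).carrier) :
    el n (Tm.merge k a b c h) (cat (eu a x) (eu b y)) = eu c (mergeLin a b c h (tm x y)) := by
  change eu c (mergeLin a b c h (lin (tensorMor (upIso a).hom (upIso b).hom)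
    (lin (wobjμ (up a) (up b)).inv (cat (eu a x) (eu b y))))) = _
  rw [wobjμ_inv_cat, tensorMor_tm_of_even _ (upIso_mem b), upIso_eu, upIso_eu]

theorem el_lcap {a : ℕ} (f : (symObj k n a).dual.carrier) (x : (symObj k n a).carrier) :
    el n (Tm.lcap k a) (cat (ed a f) (eu a x)) = dapp _ f x • PMod.star := by
  change evalLin (symObj k n a) (lin (tensorMor (downIso a).hom (upIso a).hom)
    (lin (wobjμ (down a) (up a)).inv (cat (ed a f) (eu a x)))) = _
  rw [wobjμ_inv_cat, tensorMor_tm_of_even _ (upIso_mem a), upIso_eu, downIso_ed, evalLin_tm,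
    trivMk_apply]
  rfl

theorem el_lcup {a : ℕ} :
    el n (Tm.lcup k a) PMod.star = pairL (eu a) (ed a) (coevElt (symObj k n a)) := by
  have e := lin_tensorMor_wobjμ (upIso (k := k) (n := n) a).inv
    (inv_mem (downIso_mem (k := k) (n := n) a))
  change lin (tensorMor (upIso a).inv (downIso a).inv ≫ (wobjμ (up a) (down a)).hom)
    (coevLin (symObj k n a) trivOne) = _
  rw [e, coevLin_trivOne]
  rfl

theorem el_tagIn (x : (symObj k n 1).carrier) :
    el n (.gen .tagIn : Tm k _ _) (eu 1 x) = ed 1 (dualEquiv k n x) := by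
  change ed 1 (dualEquiv k n (lin (upIso 1).hom (eu 1 x))) = _
  rw [upIso_eu]

theorem el_tagOut (f : (symObj k n 1).dual.carrier) :
    el n (.gen .tagOut : Tm k _ _) (ed 1 f) = eu 1 ((dualEquiv k n).symm f) := by
  change eu 1 ((dualEquiv k n).symm (lin (downIso 1).hom (ed 1 f))) = _
  rw [downIso_ed]

theorem el_rcross {a b : ℕ} (x : (symObj k n a).carrier) (f : (symObj k n b).dual.carrier) :
    el n (Tm.rcross k a b) (cat (eu a x) (ed b f)) = pairL (ed b) (eu a) (swapLin _ _ (tm x f)) := by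
  have e := lin_tensorMor_wobjμ (downIso (k := k) (n := n) b).inv
    (inv_mem (upIso_mem (k := k) (n := n) a))
  change lin (tensorMor (downIso b).inv (upIso a).inv ≫ (wobjμ (down b) (up a)).hom)
    (swapLin _ _ (lin (tensorMor (upIso a).hom (downIso b).hom)
    (lin (wobjμ (up a) (down b)).inv (cat (eu a x) (ed b f))))) = _
  rw [wobjμ_inv_cat, tensorMor_tm_of_even _ (downIso_mem b), upIso_eu, downIso_ed, e]
  rfl

/-! ### Invariance under the axioms of a monoidal supercategory -/

theorem ev_tens {x y x' y' : Word} (f : Tm k x y) (g : Tm k x' y') :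
    ev n (.tens f g) = (wobjμ x x').inv ≫ tensorMor (ev n f) (ev n g) ≫ (wobjμ y y').hom := rfl

theorem wobjμ_assoc (x x' x'' : Word) : tensorMor (wobjμ x x').hom (𝟙 (wobj k n x'')) ≫
      (wobjμ (x ++ x') x'').hom ≫ eqToHom (congrArg (wobj k n) (List.append_assoc x x' x'')) =
      (tensorAssoc _ _ _).hom ≫ tensorMor (𝟙 (wobj k n x)) (wobjμ x' x'').hom ≫
        (wobjμ x (x' ++ x'')).hom := by
  refine tm_hom_ext₃ fun _ _ _ m _ l _ o _ => ?_
  rw [lin_comp, LinearMap.comp_apply, tensorMor_id_tm, lin_comp, LinearMap.comp_apply, lin_comp,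
    LinearMap.comp_apply, tensorAssoc_tm, lin_comp, LinearMap.comp_apply,
    tensorMor_tm_of_even _ (wobjμ_mem x' x'')]
  exact cat_assoc m l o (List.append_assoc x x' x'')

theorem wobjμ_nil (x : Word) : (wobjμ [] x).hom ≫ eqToHom (congrArg (wobj k n) (List.nil_append x)) =
    (tensorLeft (wobj k n x)).hom := by
  refine hom_ext (TensorProduct.ext (triv_ext (LinearMap.ext fun m => ?_)))
  refine (cat_nil m).trans (tensorLeft_tm _ m).symm

theorem wobjμ_nil_right (x : Word) :
    (wobjμ x []).hom ≫ eqToHom (congrArg (wobj k n) (List.append_nil x)) =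
      (tensorRight (wobj k n x)).hom := by
  refine hom_ext (TensorProduct.ext (LinearMap.ext fun m => triv_ext ?_))
  exact (cat_nil_right m (List.append_nil x)).trans (tensorRight_tm _ m).symm

theorem ev_tens_assoc {x y x' y' x'' y'' : Word} (f : Tm k x y) (g : Tm k x' y')
    (h : Tm k x'' y'') :
    ev n (.comp (.tens (.tens f g) h) (.cast (List.append_assoc y y' y''))) =
      ev n (.comp (.cast (List.append_assoc x x' x'')) (.tens f (.tens g h))) := by
  have key := wobjμ_assoc (k := k) (n := n) x x' x''
  have key' := wobjμ_assoc (k := k) (n := n) y y' y''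
  -- Both sides are precomposed with the isomorphism from the triple tensor product. The inverse
  -- coherence maps then cancel, and what remains is the naturality of the associator of
  -- supermodules.
  let E := tensorIso (wobjμ x x') (Iso.refl (wobj k n x'')) (wobjμ_mem x x') ≪≫ wobjμ (x ++ x') x''
  have hE : E.hom = tensorMor (wobjμ x x').hom (𝟙 (wobj k n x'')) ≫ (wobjμ (x ++ x') x'').hom := rfl
  rw [← cancel_epi E.hom, hE, Category.assoc, Category.assoc]
  change _ ≫ _ ≫ (_ ≫ tensorMor (_ ≫ tensorMor (ev n f) (ev n g) ≫ _) (ev n h) ≫ _) ≫ eqToHom _ =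
    _ ≫ _ ≫ eqToHom _ ≫ (_ ≫ tensorMor (ev n f) (_ ≫ tensorMor (ev n g) (ev n h) ≫ _) ≫ _)
  rw [reassoc_of% key, Iso.hom_inv_id_assoc, Category.assoc, Iso.hom_inv_id_assoc, Category.assoc,
    ← Category.assoc (tensorMor (wobjμ x x').hom _), tensorMor_comp_of_even _ _ _ (wobjμ_mem x x'),
    Iso.hom_inv_id_assoc, Category.id_comp,
    ← Category.assoc (tensorMor (𝟙 _) (wobjμ x' x'').hom), tensorMor_comp_of_even _ _ _ (PMod.id_mem _),
    Iso.hom_inv_id_assoc, Category.id_comp]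
  -- The coherence maps and the identities are even, so separating them from `f`, `g`, `h` costs no
  -- sign.
  have e₁ := tensorMor_comp_of_even' (tensorMor (ev n f) (ev n g)) (ev n h) (wobjμ y y').hom
    (l := 𝟙 (wobj k n y'')) (PMod.id_mem (wobj k n y''))
  have e₂ := tensorMor_comp_of_even' (ev n f) (tensorMor (ev n g) (ev n h)) (𝟙 _)
    (wobjμ_mem (k := k) (n := n) y' y'')
  rw [Category.comp_id] at e₁ e₂
  rw [← e₁, ← e₂, Category.assoc, Category.assoc, key', ← Category.assoc, tensorMor_assoc,
    Category.assoc]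

theorem ev_one_tens {x y : Word} (f : Tm k x y) :
    ev n (.comp (.tens (Tm.one k []) f) (.cast (List.nil_append y))) =
      ev n (.comp (.cast (List.nil_append x)) f) := by
  rw [← cancel_epi (wobjμ [] x).hom]
  change _ ≫ (_ ≫ tensorMor (𝟙 _) (ev n f) ≫ _) ≫ eqToHom _ = _ ≫ eqToHom _ ≫ ev n f
  rw [Category.assoc, Category.assoc, Iso.hom_inv_id_assoc, ← Category.assoc (wobjμ [] x).hom]
  refine (congrArg (fun t => tensorMor (𝟙 _) (ev n f) ≫ t) (wobjμ_nil y)).trans ?_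
  refine (lunit_naturality (k := k) (ev n f)).trans ?_
  exact (congrArg (fun t => t ≫ ev n f) (wobjμ_nil x)).symm

theorem ev_tens_one {x y : Word} (f : Tm k x y) :
    ev n (.comp (.tens f (Tm.one k [])) (.cast (List.append_nil y))) =
      ev n (.comp (.cast (List.append_nil x)) f) := by
  rw [← cancel_epi (wobjμ x []).hom]
  change _ ≫ (_ ≫ tensorMor (ev n f) (𝟙 _) ≫ _) ≫ eqToHom _ = _ ≫ eqToHom _ ≫ ev n f
  rw [Category.assoc, Category.assoc, Iso.hom_inv_id_assoc, ← Category.assoc (wobjμ x []).hom]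
  refine (congrArg (fun t => tensorMor (ev n f) (𝟙 _) ≫ t) (wobjμ_nil_right y)).trans ?_
  refine (runit_naturality (k := k) (ev n f)).trans ?_
  exact (congrArg (fun t => t ≫ ev n f) (wobjμ_nil_right x)).symm

/-- The defining relations enter as a hypothesis; the remaining generators of the congruence are
axioms that hold in every monoidal supercategory, up to the coherence maps for concatenation. -/
theorem ev_rel (hdef : ∀ {x y : Word} {f g : Tm k x y}, Tm.DefRel k f g → el n f = el n g)
    {x y : Word} {f g : Tm k x y} (h : Tm.Rel k f g) : ev n f = ev n g := by
  induction h with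
  | of h => exact hom_ext (hdef h)
  | refl f => rfl
  | symm _ h => exact h.symm
  | trans _ _ h₁ h₂ => exact h₁.trans h₂
  | comp _ _ h₁ h₂ => exact congrArg₂ (fun f g => f ≫ g) h₁ h₂
  | tens _ _ h₁ h₂ => rw [ev_tens, ev_tens, h₁, h₂]
  | sum _ _ h₁ h₂ => exact congrArg₂ (fun f g => f + g) h₁ h₂
  | smul c _ h => exact congrArg (fun f => c • f) h
  | sum_assoc f g h => exact add_assoc _ _ _
  | sum_comm f g => exact add_comm _ _
  | zero_sum f => exact zero_add _
  | neg_sum f =>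
    change (-1 : k) • ev n f + ev n f = 0
    rw [neg_one_smul, neg_add_cancel]
  | smul_sum c f g => exact smul_add _ _ _
  | sum_smul c d f => exact add_smul _ _ _
  | mul_smul c d f => exact mul_smul _ _ _
  | one_smul f => exact one_smul _ _
  | sum_comp f f' g => exact Preadditive.add_comp _ _ _ _ _ _
  | comp_sum f g g' => exact Preadditive.comp_add _ _ _ _ _ _
  | smul_comp c f g => exact Linear.smul_comp _ _ _ _ _ _
  | comp_smul c f g => exact Linear.comp_smul _ _ _ _ _ _
  | sum_tens f f' g =>
    change _ ≫ tensorMor (ev n f + ev n f') (ev n g) ≫ _ = ev n (.tens f g) + ev n (.tens f' g)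
    rw [map_add, LinearMap.add_apply, Preadditive.add_comp, Preadditive.comp_add]; rfl
  | tens_sum f g g' =>
    change _ ≫ tensorMor (ev n f) (ev n g + ev n g') ≫ _ = ev n (.tens f g) + ev n (.tens f g')
    rw [map_add, Preadditive.add_comp, Preadditive.comp_add]; rfl
  | smul_tens c f g =>
    change _ ≫ tensorMor (c • ev n f) (ev n g) ≫ _ = c • ev n (.tens f g)
    rw [map_smul, LinearMap.smul_apply, Linear.smul_comp, Linear.comp_smul]; rfl
  | tens_smul c f g =>
    change _ ≫ tensorMor (ev n f) (c • ev n g) ≫ _ = c • ev n (.tens f g)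
    rw [map_smul, Linear.smul_comp, Linear.comp_smul]; rfl
  | one_comp f => exact Category.id_comp _
  | comp_one f => exact Category.comp_id _
  | comp_assoc f g h => exact Category.assoc _ _ _
  | one_tens_one x y =>
    change (wobjμ x y).inv ≫ tensorMor (𝟙 _) (𝟙 _) ≫ (wobjμ x y).hom = 𝟙 _
    have e : tensorMor (𝟙 (wobj k n x)) (𝟙 (wobj k n y)) = 𝟙 _ := tensorHom_id (k := k) _ _
    rw [e, Category.id_comp, Iso.inv_hom_id]
  | @interchange x y z x' y' z' p q f g h l hf hl =>
    change (_ ≫ tensorMor (ev n f) (ev n g) ≫ _) ≫ _ ≫ tensorMor (ev n h) (ev n l) ≫ _ =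
      sgn k (q * p) • (_ ≫ tensorMor (ev n f ≫ ev n h) (ev n g ≫ ev n l) ≫ _)
    rw [Category.assoc, Category.assoc, Iso.hom_inv_id_assoc, ← Category.assoc (tensorMor _ _),
      tensorMor_interchange _ _ (ev_mem hf) (ev_mem hl), Linear.smul_comp, Linear.comp_smul]
  | tens_assoc f g h => exact ev_tens_assoc f g h
  | one_tens f => exact ev_one_tens f
  | tens_one f => exact ev_tens_one f

end Evaluation

end

end TypeP

namespace TypeP

noncomputable section

open PMod

section Rungs

variable {k : Type u} [Field k] [NeZero (2 : k)] {n : ℕ}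

/-! ### The evaluation of ladders -/

theorem eu_induction {a : ℕ} {C : (wobj k n (up a)).carrier → Prop} (h : ∀ x, C (eu a x))
    (s : (wobj k n (up a)).carrier) : C s := eu_upIso a s ▸ h _

theorem ed_induction {a : ℕ} {C : (wobj k n (down a)).carrier → Prop} (h : ∀ x, C (ed a x))
    (s : (wobj k n (down a)).carrier) : C s := ed_downIso a s ▸ h _

theorem eu_ext {a : ℕ} {P : Type v} [AddCommMonoid P] [Module k P]
    {f g : (wobj k n (up a)).carrier →ₗ[k] P} (h : ∀ x, f (eu a x) = g (eu a x)) : f = g :=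
  LinearMap.ext fun s => eu_induction (C := fun s => f s = g s) h s

theorem ed_ext {a : ℕ} {P : Type v} [AddCommMonoid P] [Module k P]
    {f g : (wobj k n (down a)).carrier →ₗ[k] P} (h : ∀ x, f (ed a x) = g (ed a x)) : f = g :=
  LinearMap.ext fun s => ed_induction (C := fun s => f s = g s) h s

theorem cat_ext {x y : Word} {P : Type v} [AddCommMonoid P] [Module k P]
    {f g : (wobj k n (x ++ y)).carrier →ₗ[k] P} (h : ∀ s t, f (cat s t) = g (cat s t)) : f = g := by
  refine LinearMap.ext fun s => ?_
  induction s using cat_induction with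
  | h s t => exact h s t
  | ha s t hs ht => rw [map_add, map_add, hs, ht]

theorem uu_ext {a b : ℕ} {P : Type v} [AddCommMonoid P] [Module k P]
    {f g : (wobj k n (up a ++ up b)).carrier →ₗ[k] P}
    (h : ∀ x y, f (cat (eu a x) (eu b y)) = g (cat (eu a x) (eu b y))) : f = g :=
  cat_ext fun s t => eu_induction (C := fun s => f (cat s t) = g (cat s t)) (fun x =>
    eu_induction (C := fun t => f (cat (eu a x) t) = g (cat (eu a x) t)) (h x) t) s

/-- The inclusion of the supermodule of `↑_a ↑_b` into `S(V) ⊗ S(V)`. -/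
def jT (a b : ℕ) : (wobj k n (up a ++ up b)).carrier →ₗ[k] SymT k n :=
  tval a b ∘ₗ lin ((wobjμ (up a) (up b)).symm ≪≫ tensorIso (upIso a) (upIso b) (upIso_mem a)).hom

theorem jT_cat (a b : ℕ) (x : (symObj k n a).carrier) (y : (symObj k n b).carrier) :
    jT a b (cat (eu a x) (eu b y)) = sval a x ⊗ₜ sval b y := by
  change tval a b (lin (tensorMor (upIso a).hom (upIso b).hom)
    (lin (wobjμ (up a) (up b)).inv (cat (eu a x) (eu b y)))) = _
  rw [wobjμ_inv_cat, tensorMor_tm_of_even _ (upIso_mem b), upIso_eu, upIso_eu, tval_tm]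

theorem iso_injective {M N : PMod k n} (e : M ≅ N) : Function.Injective (lin e.hom) :=
  Function.LeftInverse.injective (g := lin e.inv) (LinearMap.congr_fun (congrArg lin e.hom_inv_id))

theorem jT_injective (a b : ℕ) : Function.Injective (jT (k := k) (n := n) a b) :=
  (tval_injective a b).comp (iso_injective _)

theorem jT_mem (a b : ℕ) (z : (wobj k n (up a ++ up b)).carrier) : jT a b z ∈ symTDeg k n a b :=
  tval_mem _

/-- The diagram is a split followed by a merge, which is how `opR` is built. Such comparison lemmas
turn each relation of ladders into an identity of operators. -/
theorem jT_rungR {a b s a' b' : ℕ} (h : a' + s = a) (h' : s + b = b')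
    (z : (wobj k n (up a ++ up b)).carrier) :
    jT a' b' (el n (Tm.rungR k a b s a' b') z) = opR s (jT a b z) := by
  suffices e : jT a' b' ∘ₗ el n (Tm.rungR k a b s a' b') = opR s ∘ₗ jT a b from
    LinearMap.congr_fun e z
  apply uu_ext
  intro x y
  rw [LinearMap.comp_apply, LinearMap.comp_apply, Tm.rungR, dif_pos ⟨h, h'⟩, el_seq, el_tens_one,
    el_split, jT_cat, opR_tmul, ← tval_splitLin h]
  induction splitLin a' s a h x using tm_induction with
  | ha w w' hw hw' => simp only [map_add, cat_add_left, hw, hw']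
  | h p q =>
    rw [pairL_tm, cat_assoc, el_one_tens (.merge _ _ _ _), tw_zero, LinearMap.id_apply, el_merge,
      jT_cat, sval_mergeLin, tval_tm, TensorProduct.map_tmul]
    rfl

theorem jT_rungL {a b r a' b' : ℕ} (h : r + b' = b) (h' : a + r = a')
    (z : (wobj k n (up a ++ up b)).carrier) :
    jT a' b' (el n (Tm.rungL k a b r a' b') z) = opL r (jT a b z) := by
  suffices e : jT a' b' ∘ₗ el n (Tm.rungL k a b r a' b') = opL r ∘ₗ jT a b from
    LinearMap.congr_fun e z
  apply uu_ext
  intro x y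
  rw [LinearMap.comp_apply, LinearMap.comp_apply, Tm.rungL, dif_pos ⟨h, h'⟩, el_seq,
    el_one_tens (.split _ _ _ _), tw_zero, LinearMap.id_apply, el_split, jT_cat, opL_tmul,
    -- `splitLin` is indexed by the degree of the right part and `opL` by that of the left part.
    ← comulR_eq_comulL (sval_mem y) (s := b') (t := r) (by omega), ← tval_splitLin h]
  induction splitLin r b' b h y using tm_induction with
  | ha w w' hw hw' => simp only [map_add, cat_add_right, hw, hw']
  | h p q =>
    rw [pairL_tm, ← cat_assoc _ _ _ (List.append_assoc _ _ _), castL_castL, castL_rfl, el_tens_one,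
      el_merge, jT_cat, sval_mergeLin, tval_tm, TensorProduct.map_tmul]
    rfl

/-! ### Caps, cups and antennas as operators -/

theorem el_ucap (x y : (symObj k n 1).carrier) :
    el n (Tm.ucap k) (cat (eu 1 x) (eu 1 y)) = symForm k n (sval 1 x) (sval 1 y) • PMod.star := by
  rw [Tm.ucap, el_comp, el_tens_one, el_tagIn, el_lcap, dapp_dualEquiv]

/-- The basis vectors of `S^1(V)`. -/
def symVec (i : Ix n) : (symObj k n 1).carrier := smk (symι k n (natVec k i)) (symι_mem _)

theorem sval_symVec (i : Ix n) : sval 1 (symVec (k := k) i) = symι k n (natVec k i) := rfl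

theorem form_natVec_swap (v : NatV k n) (i : Ix n) : form k n v (natVec k i.swap) = v i := by
  rw [form, Finset.sum_eq_single i]
  · simp [natVec]
  · intro j _ hj
    have : j.swap ≠ i.swap := fun h => hj (by rw [← Sum.swap_swap j, h, Sum.swap_swap])
    simp [natVec, this]
  · simp

/-- The dual basis of the `v_i` consists of the `D(v_{-i})`. In this form the tag-out can be applied
to the second factors. -/
theorem coevElt_symObj_one : coevElt (symObj k n 1) =
    ∑ i : Ix n, tm (symVec i) (dualEquiv k n (symVec i.swap)) := by
  apply tensorEnd_injective
  rw [tensorEnd_coevElt, map_sum]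
  refine LinearMap.ext fun y => sval_injective _ ?_
  rw [LinearMap.sum_apply, map_sum, LinearMap.id_apply]
  simp only [tensorEnd_tm, dapp_dualEquiv, map_smul, sval_symVec, symForm_apply, symOne_symι]
  conv_lhs => rw [← symι_symOne (sval_mem y)]
  have e : ∀ i : Ix n, form k n (natVec k i.swap) (symOne (sval 1 y)) = symOne (sval 1 y) i :=
    fun i => by rw [form_comm, form_natVec_swap]
  simp only [e, ← map_smul, ← map_sum]
  congr 1
  ext j
  simp [natVec, Pi.single_apply]

theorem symVec_tw (q : ZMod 2) (i : Ix n) :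
    (symObj k n 1).tw q (symVec i) = sgn k (q * i.par) • symVec i := by
  apply sval_injective
  rw [sval_tw, map_smul, sval_symVec, symTw_symι q (natVec_mem i)]

/-- The coefficient arises because the odd tag-out passes `v_i`. -/
theorem el_ucup : el n (Tm.ucup k) PMod.star =
    ∑ i : Ix n, sgn k i.par • cat (eu 1 (symVec i)) (eu 1 (symVec i.swap)) := by
  rw [Tm.ucup, el_comp, el_lcup, coevElt_symObj_one, map_sum, map_sum]
  refine Finset.sum_congr rfl fun i _ => ?_
  rw [pairL_tm, el_one_tens (.gen .tagOut), el_tagOut, LinearEquiv.symm_apply_apply, eu_tw,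
    symVec_tw, map_smul, cat_smul_left]
  congr 2
  exact one_mul _

/-- A diagram to the unit object between two words. -/
def closeD (x y : Word) {w : Word} (f : Tm k w []) : Tm k (x ++ (w ++ y)) (x ++ y) :=
  -- The word `[] ++ y` reduces to `y`, which gives the target its stated form.
  @Tm.tens k x x (w ++ y) y (Tm.one k x) (@Tm.tens k w [] y y f (Tm.one k y))

/-- A diagram from the unit object between two words. -/
def openD (x y : Word) {w : Word} (f : Tm k [] w) : Tm k (x ++ y) (x ++ (w ++ y)) :=
  @Tm.tens k x x y (w ++ y) (Tm.one k x) (@Tm.tens k [] w y y f (Tm.one k y))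

/-- A diagram that ends in the unit object acts by a scalar; its parity is felt only as a twist of
the strands on its left. -/
theorem el_closeD {x y w : Word} {f : Tm k w []} {q : ZMod 2} (hf : Tm.Homog q f) {c : k}
    {t : (wobj k n w).carrier} (ht : el n f t = c • PMod.star) (s : (wobj k n x).carrier)
    (r : (wobj k n y).carrier) :
    el n (closeD x y f) (cat s (cat t r)) = c • cat ((wobj k n x).tw q s) r := by
  have e := el_one_tens (n := n) (x := x) (Tm.Homog.of_eq (.tens hf (.one y)) (add_zero q)) s
    (cat t r)
  rw [el_tens_one, ht, cat_smul_left, cat_smul_right, cat_nil] at e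
  exact e

theorem el_openD {x y w : Word} {f : Tm k [] w} {q : ZMod 2} (hf : Tm.Homog q f)
    (s : (wobj k n x).carrier) (r : (wobj k n y).carrier) :
    el n (openD x y f) (cat s r) = cat ((wobj k n x).tw q s) (cat (el n f PMod.star) r) := by
  have e := el_one_tens (n := n) (x := x) (Tm.Homog.of_eq (.tens hf (.one y)) (add_zero q)) s
    (cat PMod.star r)
  rw [el_tens_one, cat_nil] at e
  exact e

theorem antR_eq {a b a' : ℕ} (h : a' + 2 = a) : Tm.antR k a b a' =
    Tm.seq (.tens (Tm.split k a' 2 a h) (Tm.one k (up b)))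
      (closeD (up a') (up b) (Tm.antenna k)) (List.append_assoc _ _ _) := dif_pos h

theorem antL_eq {a b b' : ℕ} (h : 2 + b' = b) : Tm.antL k a b b' =
    Tm.seq (.tens (Tm.one k (up a)) (Tm.split k 2 b' b h))
      (closeD (up a) (up b') (Tm.antenna k)) rfl := dif_pos h

theorem capRung_eq {a b a' b' : ℕ} (h : a' + 1 = a) (h' : 1 + b' = b) : Tm.capRung k a b a' b' =
    Tm.seq (.tens (Tm.split k a' 1 a h) (Tm.split k 1 b' b h'))
      (closeD (up a') (up b') (Tm.ucap k)) (by simp) := dif_pos ⟨h, h'⟩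

theorem cupRung_eq {a b a' b' : ℕ} (h : a + 1 = a') (h' : 1 + b = b') : Tm.cupRung k a b a' b' =
    Tm.seq (openD (up a) (up b) (Tm.ucup k))
      (.tens (Tm.merge k a 1 a' h) (Tm.merge k 1 b b' h')) (by simp) := dif_pos ⟨h, h'⟩

theorem el_antenna (x : (symObj k n 2).carrier) :
    el n (Tm.antenna k) (eu 2 x) = symAnt (sval 2 x) • PMod.star := by
  rw [Tm.antenna, el_smul, el_comp, el_split, symAnt_apply, mul_smul]
  congr 1
  rw [show (1 : ℤ) = ((1 : ℕ) : ℤ) from rfl, ← tval_splitLin (show 1 + 1 = 2 from rfl)]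
  induction splitLin 1 1 2 rfl x using tm_induction with
  | ha w w' hw hw' => simp only [map_add, add_smul, hw, hw']
  | h p q => rw [pairL_tm, el_ucap, tval_tm, TensorProduct.lift.tmul]

theorem jT_antR {a b a' : ℕ} (h : a' + 2 = a) (z : (wobj k n (up a ++ up b)).carrier) :
    jT a' b (el n (Tm.antR k a b a') z) = opA (jT a b z) := by
  suffices e : jT a' b ∘ₗ el n (Tm.antR k a b a') = opA ∘ₗ jT a b from
    LinearMap.congr_fun e z
  apply uu_ext
  intro x y
  rw [LinearMap.comp_apply, LinearMap.comp_apply, antR_eq h, el_seq, el_tens_one,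
    el_split, jT_cat, opA, TensorProduct.map_tmul, antLin, LinearMap.comp_apply,
    LinearMap.comp_apply, show (2 : ℤ) = ((2 : ℕ) : ℤ) from rfl, ← tval_splitLin h]
  induction splitLin a' 2 a h x using tm_induction with
  | ha w w' hw hw' => simp only [map_add, cat_add_left, hw, hw', TensorProduct.add_tmul]
  | h p q =>
    rw [pairL_tm, cat_assoc, el_closeD .antenna (el_antenna q), eu_tw, map_smul]
    rw [jT_cat, tval_tm, TensorProduct.map_tmul, sval_tw, TensorProduct.smul_tmul',
      LinearEquiv.coe_coe, TensorProduct.rid_tmul]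
    rfl

theorem jT_antL {a b b' : ℕ} (h : 2 + b' = b) (z : (wobj k n (up a ++ up b)).carrier) :
    jT a b' (el n (Tm.antL k a b b') z) = opA' (jT a b z) := by
  suffices e : jT a b' ∘ₗ el n (Tm.antL k a b b') = opA' ∘ₗ jT a b from
    LinearMap.congr_fun e z
  apply uu_ext
  intro x y
  rw [LinearMap.comp_apply, LinearMap.comp_apply, antL_eq h, el_seq,
    el_one_tens (.split _ _ _ _), tw_zero, LinearMap.id_apply,
    el_split, jT_cat, opA', TensorProduct.map_tmul, antLin', LinearMap.comp_apply,
    LinearMap.comp_apply, ← comulR_eq_comulL (sval_mem y) (s := b') (t := 2) (by omega),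
    ← tval_splitLin h]
  induction splitLin 2 b' b h y using tm_induction with
  | ha w w' hw hw' => simp only [map_add, cat_add_right, hw, hw', TensorProduct.tmul_add]
  | h p q =>
    rw [pairL_tm, castL_rfl, el_closeD .antenna (el_antenna p), eu_tw, map_smul]
    rw [jT_cat, tval_tm, TensorProduct.map_tmul, sval_tw, ← TensorProduct.tmul_smul,
      LinearEquiv.coe_coe, TensorProduct.lid_tmul]
    rfl

theorem jT_capRung {a b a' b' : ℕ} (h : a' + 1 = a) (h' : 1 + b' = b)
    (z : (wobj k n (up a ++ up b)).carrier) :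
    jT a' b' (el n (Tm.capRung k a b a' b') z) = opC (jT a b z) := by
  suffices e : jT a' b' ∘ₗ el n (Tm.capRung k a b a' b') = opC ∘ₗ jT a b from
    LinearMap.congr_fun e z
  apply uu_ext
  intro x y
  -- The contraction is rewritten through the split of the right strand that occurs in the diagram,
  -- whose index is the degree of the remaining part.
  have hy : ∀ u, contr u (sval b y) = TensorProduct.lift
      (LinearMap.lsmul k (SymAlg k n) ∘ₗ formLin k n u ∘ₗ symOne) (tval 1 b' (splitLin 1 b' b h' y)) := by
    intro u
    rw [contr_apply, tval_splitLin, comulR_eq_comulL (sval_mem y) (s := b') (t := 1) (by omega)]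
  rw [LinearMap.comp_apply, LinearMap.comp_apply, capRung_eq h h', el_seq,
    el_tens_even _ (.split _ _ _ _), el_split, el_split, jT_cat, opC_tmul,
    show (1 : ℤ) = ((1 : ℕ) : ℤ) from rfl, ← tval_splitLin h]
  induction splitLin a' 1 a h x using tm_induction with
  | ha w w' hw hw' => simp only [map_add, cat_add_left, hw, hw']
  | h p q =>
    rw [tval_tm, TensorProduct.map_tmul, LinearMap.comp_apply, LinearMap.flip_apply, hy]
    induction splitLin 1 b' b h' y using tm_induction with
    | ha w w' hw hw' => simp only [map_add, cat_add_right, hw, hw', TensorProduct.tmul_add]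
    | h r t =>
      rw [pairL_tm, pairL_tm, castL_cat_cat, el_closeD .ucap (el_ucap q r), eu_tw, map_smul, jT_cat, tval_tm,
        TensorProduct.lift.tmul, sval_tw, ← TensorProduct.tmul_smul]
      rfl

theorem castL_cat_cat' {x y z w : Word} (s : (wobj k n x).carrier) (t : (wobj k n y).carrier)
    (r : (wobj k n z).carrier) (q : (wobj k n w).carrier)
    (h : x ++ ((y ++ z) ++ w) = (x ++ y) ++ (z ++ w)) :
    castL (wobj k n) h (cat s (cat (cat t r) q)) = cat (cat s t) (cat r q) := by
  rw [← castL_cat_cat s t r q h.symm, castL_castL, castL_rfl]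

theorem jT_cupRung {a b a' b' : ℕ} (h : a + 1 = a') (h' : 1 + b = b')
    (z : (wobj k n (up a ++ up b)).carrier) :
    jT a' b' (el n (Tm.cupRung k a b a' b') z) = opU (jT a b z) := by
  suffices e : jT a' b' ∘ₗ el n (Tm.cupRung k a b a' b') = opU ∘ₗ jT a b from
    LinearMap.congr_fun e z
  apply uu_ext
  intro x y
  rw [LinearMap.comp_apply, LinearMap.comp_apply, cupRung_eq h h', el_seq, jT_cat, opU_apply,
    el_openD .ucup, el_ucup]
  have e₂ : ∀ (s : (wobj k n (up a)).carrier) (t : (wobj k n (up b)).carrier)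
      (f : Ix n → (wobj k n (up 1 ++ up 1)).carrier),
      cat s (cat (∑ i, f i) t) = ∑ i, cat s (cat (f i) t) := fun s t f => by
    simp only [← catL_apply, map_sum, LinearMap.sum_apply]
  rw [e₂, map_sum, map_sum, map_sum]
  refine Finset.sum_congr rfl fun i _ => ?_
  -- The odd cup twists `x` once, and moving `v_i` from the right of `x` to its left twists it by
  -- the parity of `v_i`. Together this is the twist by the parity of `v_{-i}` contained in `Y`.
  rw [cat_smul_left, cat_smul_right, map_smul, map_smul, map_smul, castL_cat_cat',
    el_tens_even _ (.merge _ _ _ _), eu_tw, el_merge, el_merge, jT_cat, sval_mergeLin,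
    sval_mergeLin, sval_tw, sval_symVec, sval_symVec, opY_tmul (natVec_mem _), opX_tmul, par_swap,
    symTw_add, ← mul_symι (natVec_mem i) (symTw i.par _), symTw_self]

/-- The terms omitted from the diagrammatic sum are those with `r` negative, whose operators vanish,
so the sum is `opCross`. -/
theorem jT_ucross (a b : ℕ) (z : (wobj k n (up a ++ up b)).carrier) :
    jT b a (el n (Tm.ucross k a b) z) = swapT (jT a b z) := by
  rw [← opCross_eq_swapT (jT_mem a b z), opCross_apply, Tm.ucross, el_bigSum, map_sum]
  refine Finset.sum_congr rfl fun s hs => ?_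
  have hs' := Finset.mem_range.1 hs
  by_cases h : a ≤ b + s
  · rw [if_pos h, el_smul, map_smul, el_comp, jT_rungL (by omega) (by omega),
      jT_rungR (by omega) (by omega), show ((b + s - a : ℕ) : ℤ) = b + s - a by omega]
  · rw [if_neg h, el_zero, map_zero, opL_neg (by omega)]; simp

/-- On a homogeneous first factor one of the two parity projections in the swap is the identity and
the other is zero, so the whole sign is a twist of the second factor. -/
theorem el_ucross {a b : ℕ} {p : ZMod 2} {x : (symObj k n a).carrier}
    (hx : x ∈ (symObj k n a).grade p) (y : (symObj k n b).carrier) :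
    el n (Tm.ucross k a b) (cat (eu a x) (eu b y)) =
      cat (eu b ((symObj k n b).tw p y)) (eu a x) := by
  have h2 : (2 : k) ≠ 0 := NeZero.ne _
  have hx' : symTw 1 (sval a x) = sgn k p • sval a x := hx
  apply jT_injective
  rw [jT_ucross, jT_cat, jT_cat, swapT_tmul, symPr_apply, symPr_apply, hx', sval_tw]
  rcases zmod_cases p with rfl | rfl
  · simp [symTw_zero, ← two_smul k (sval a x), smul_smul, h2]
  · simp [← two_smul k (sval a x), smul_smul, h2]

end Rungs

end

end TypeP

namespace TypeP

noncomputable section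

open PMod

section Relations

variable {k : Type u} [Field k] [NeZero (2 : k)] {n : ℕ}

/-! ### Strands labelled by zero -/

theorem ud_ext {a b : ℕ} {P : Type v} [AddCommMonoid P] [Module k P]
    {f g : (wobj k n (up a ++ down b)).carrier →ₗ[k] P}
    (h : ∀ p, ∀ x ∈ (symObj k n a).grade p, ∀ y,
      f (cat (eu a x) (ed b y)) = g (cat (eu a x) (ed b y))) : f = g := by
  refine cat_ext fun s t => ?_
  induction s using eu_induction with
  | h x =>
    induction t using ed_induction with
    | h y =>
      obtain ⟨x₀, h₀, x₁, h₁, rfl⟩ := (symObj k n a).exists_add x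
      rw [map_add, cat_add_left, map_add, map_add, h 0 x₀ h₀, h 1 x₁ h₁]

theorem du_ext {a b : ℕ} {P : Type v} [AddCommMonoid P] [Module k P]
    {f g : (wobj k n (down a ++ up b)).carrier →ₗ[k] P}
    (h : ∀ p, ∀ y ∈ (symObj k n b).grade p, ∀ x,
      f (cat (ed a x) (eu b y)) = g (cat (ed a x) (eu b y))) : f = g := by
  refine cat_ext fun s t => ?_
  induction s using ed_induction with
  | h x =>
    induction t using eu_induction with
    | h y =>
      obtain ⟨x₀, h₀, x₁, h₁, rfl⟩ := (symObj k n b).exists_add y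
      rw [map_add, cat_add_right, map_add, map_add, h 0 x₀ h₀, h 1 x₁ h₁]

theorem star_ext {P : Type v} [AddCommMonoid P] [Module k P] {f g : (wobj k n []).carrier →ₗ[k] P}
    (h : f PMod.star = g PMod.star) : f = g := by
  refine LinearMap.ext fun s => ?_
  obtain ⟨c, rfl⟩ := triv_exists (k := k) (n := n) s
  exact (map_smul f c PMod.star).trans ((congrArg (c • ·) h).trans (map_smul g c PMod.star).symm)

theorem star_cat_ext {x : Word} {P : Type v} [AddCommMonoid P] [Module k P]
    {f g : (wobj k n ([] ++ x)).carrier →ₗ[k] P}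
    (h : ∀ t, f (cat PMod.star t) = g (cat PMod.star t)) : f = g := by
  refine cat_ext fun s t => ?_
  have e : f ∘ₗ (catL [] x).flip t = g ∘ₗ (catL [] x).flip t := star_ext (h t)
  exact LinearMap.congr_fun e s

theorem cat_star_ext {x : Word} {P : Type v} [AddCommMonoid P] [Module k P]
    {f g : (wobj k n (x ++ [])).carrier →ₗ[k] P}
    (h : ∀ t, f (cat t PMod.star) = g (cat t PMod.star)) : f = g := by
  refine cat_ext fun s t => ?_
  have e : f ∘ₗ catL x [] s = g ∘ₗ catL x [] s := star_ext (h s)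
  exact LinearMap.congr_fun e t

variable (k n) in
/-- The unit of the symmetric superalgebra. -/
def symUnit : (symObj k n 0).carrier := smk 1 one_mem_symPow

variable (k n) in
/-- The counit of the symmetric superalgebra. -/
def symCounit : (symObj k n 0).dual.carrier := dmk _ (symAug ∘ₗ sval 0)

theorem eq_smul_symUnit (x : (symObj k n 0).carrier) : x = symAug (sval 0 x) • symUnit k n :=
  sval_injective _ (symAug_smul_one (sval_mem x)).symm

theorem dapp_symCounit (x : (symObj k n 0).carrier) :
    dapp _ (symCounit k n) x = symAug (sval 0 x) := rfl

theorem sval_symUnit : sval 0 (symUnit k n) = 1 := rfl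

theorem eq_smul_symCounit (f : (symObj k n 0).dual.carrier) :
    f = dapp _ f (symUnit k n) • symCounit k n := by
  refine dual_ext fun x => ?_
  conv_lhs => rw [eq_smul_symUnit x]
  rw [map_smul, map_smul, LinearMap.smul_apply, dapp_symCounit, smul_eq_mul, smul_eq_mul, mul_comm]

theorem eu_symUnit : eu 0 (symUnit k n) = (PMod.star : (wobj k n []).carrier) := by
  have := congrArg (lin (unitIso k n).inv) (unitEquiv_trivOne (k := k) (n := n))
  exact this.symm.trans ((unitEquiv k n).symm_apply_apply trivOne)

theorem ed_symCounit : ed 0 (symCounit k n) = (PMod.star : (wobj k n []).carrier) := by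
  have := congrArg (lin (unitDualIso k n).inv) (unitDualEquiv_trivOne (k := k) (n := n))
  exact this.symm.trans ((unitDualEquiv k n).symm_apply_apply trivOne)

theorem castL_cat_symUnit {x : Word} (s : (wobj k n x).carrier) (h : x ++ up 0 = x) :
    castL (wobj k n) h (cat s (eu 0 (symUnit k n))) = s := by
  rw [eu_symUnit]
  exact cat_nil_right s h

theorem castL_symUnit_cat {x : Word} (s : (wobj k n x).carrier) (h : up 0 ++ x = x) :
    castL (wobj k n) h (cat (eu 0 (symUnit k n)) s) = s := by
  rw [eu_symUnit]
  exact cat_nil s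

theorem castL_cat_symCounit {x : Word} (s : (wobj k n x).carrier) (h : x ++ down 0 = x) :
    castL (wobj k n) h (cat s (ed 0 (symCounit k n))) = s := by
  rw [ed_symCounit]
  exact cat_nil_right s h

theorem castL_symCounit_cat {x : Word} (s : (wobj k n x).carrier) (h : down 0 ++ x = x) :
    castL (wobj k n) h (cat (ed 0 (symCounit k n)) s) = s := by
  rw [ed_symCounit]
  exact cat_nil s

theorem eq_castL_iff {x y : Word} (h : x = y) (s : (wobj k n x).carrier) (t : (wobj k n y).carrier) :
    t = castL (wobj k n) h s ↔ castL (wobj k n) h.symm t = s := by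
  subst h; rfl

theorem el_split_right_zero (a : ℕ) (h : up a = up a ++ up 0) :
    el n (Tm.split k a 0 a (add_zero a)) = el n (.cast h) := by
  refine eu_ext fun x => ?_
  have e : splitLin a 0 a (add_zero a) x = tm x (symUnit k n) := by
    apply tval_injective
    rw [tval_splitLin, tval_tm, Nat.cast_zero, comulR_zero, sval_symUnit]
  rw [el_split, e, pairL_tm, el_cast, eq_castL_iff, castL_cat_symUnit]

theorem el_split_left_zero (a : ℕ) (h : up a = up 0 ++ up a) :
    el n (Tm.split k 0 a a (zero_add a)) = el n (.cast h) := by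
  refine eu_ext fun x => ?_
  have e : splitLin 0 a a (zero_add a) x = tm (symUnit k n) x := by
    apply tval_injective
    rw [tval_splitLin, tval_tm, comulR_eq_comulL (sval_mem x) (add_zero _), comulL_zero,
      sval_symUnit]
  rw [el_split, e, pairL_tm, el_cast, eq_castL_iff, castL_symUnit_cat]

theorem el_merge_right_zero (a : ℕ) (h : up a ++ up 0 = up a) :
    el n (Tm.merge k a 0 a (add_zero a)) = el n (.cast h) := by
  refine uu_ext fun x y => ?_
  rw [el_merge, el_cast, eq_smul_symUnit y, map_smul, cat_smul_right, map_smul, castL_cat_symUnit,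
    tm_smul, map_smul, map_smul]
  congr 2
  apply sval_injective
  rw [sval_mergeLin, sval_symUnit, mul_one]

theorem el_merge_left_zero (a : ℕ) (h : up 0 ++ up a = up a) :
    el n (Tm.merge k 0 a a (zero_add a)) = el n (.cast h) := by
  refine uu_ext fun x y => ?_
  rw [el_merge, el_cast, eq_smul_symUnit x, map_smul, cat_smul_left, map_smul, castL_symUnit_cat,
    smul_tm, map_smul, map_smul]
  congr 2
  apply sval_injective
  rw [sval_mergeLin, sval_symUnit, one_mul]

theorem el_lcap_zero (h : down 0 ++ up 0 = []) : el n (Tm.lcap k 0) = el n (.cast h) := by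
  refine du_ext fun p y _ f => ?_
  rw [el_lcap, el_cast, eq_smul_symUnit y, eq_smul_symCounit f, map_smul (eu 0), map_smul (ed 0),
    cat_smul_left, cat_smul_right, map_smul, map_smul, map_smul, map_smul, LinearMap.smul_apply,
    dapp_symCounit, sval_symUnit, symAug_one, smul_eq_mul, smul_eq_mul, mul_one, mul_comm, mul_smul]
  congr 2
  exact ((castL_cat_symUnit (ed 0 (symCounit k n)) h).trans ed_symCounit).symm

theorem coevElt_symObj_zero : coevElt (symObj k n 0) = tm (symUnit k n) (symCounit k n) := by
  apply tensorEnd_injective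
  rw [tensorEnd_coevElt]
  refine LinearMap.ext fun x => ?_
  rw [tensorEnd_tm, dapp_symCounit, ← eq_smul_symUnit]; rfl

theorem el_lcup_zero (h : [] = up 0 ++ down 0) : el n (Tm.lcup k 0) = el n (.cast h) := by
  refine star_ext ?_
  rw [el_lcup, coevElt_symObj_zero, pairL_tm, el_cast, eq_castL_iff]
  exact (castL_cat_symCounit (eu 0 (symUnit k n)) h.symm).trans eu_symUnit

theorem el_rcross_apply {a b : ℕ} {p : ZMod 2} {x : (symObj k n a).carrier}
    (hx : x ∈ (symObj k n a).grade p) (f : (symObj k n b).dual.carrier) :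
    el n (Tm.rcross k a b) (cat (eu a x) (ed b f)) =
      cat (ed b ((symObj k n b).dual.tw p f)) (eu a x) := by
  rw [el_rcross, swapLin_tm hx, pairL_tm]

theorem symUnit_tw (p : ZMod 2) : (symObj k n 0).tw p (symUnit k n) = symUnit k n :=
  sval_injective _ (by rw [sval_tw, sval_symUnit, map_one])

theorem symCounit_tw (p : ZMod 2) : (symObj k n 0).dual.tw p (symCounit k n) = symCounit k n :=
  dual_ext fun x => by rw [dapp_tw, dapp_symCounit, dapp_symCounit, sval_tw, symAug_symTw]

theorem el_rcross_right_zero (a : ℕ) (h : up a ++ down 0 = down 0 ++ up a) :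
    el n (Tm.rcross k a 0) = el n (.cast h) := by
  refine ud_ext fun p x hx f => ?_
  rw [el_rcross_apply hx, el_cast, eq_smul_symCounit f, map_smul, map_smul, map_smul, cat_smul_left,
    cat_smul_right, map_smul, symCounit_tw]
  congr 1
  have h' : down 0 ++ up a = up a := List.nil_append _
  apply castL_injective h'
  rw [castL_castL, castL_symCounit_cat, castL_cat_symCounit]

theorem el_rcross_left_zero (b : ℕ) (h : up 0 ++ down b = down b ++ up 0) :
    el n (Tm.rcross k 0 b) = el n (.cast h) := by
  refine ud_ext fun p x hx f => ?_
  have hu : symUnit k n ∈ (symObj k n 0).grade 0 := by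
    rw [mem_grade_iff, ← tw_one, symUnit_tw, sgn_zero, one_smul]
  rw [el_cast, eq_smul_symUnit x, map_smul, cat_smul_left, map_smul, map_smul, el_rcross_apply hu,
    tw_zero, LinearMap.id_apply]
  congr 1
  have h' : down b ++ up 0 = down b := List.append_nil _
  apply castL_injective h'
  rw [castL_castL, castL_symUnit_cat, castL_cat_symUnit]

end Relations

end

end TypeP

namespace TypeP

noncomputable section

open PMod

section Relations

variable {k : Type u} [Field k] [NeZero (2 : k)] {n : ℕ}

/-! ### Web-associativity -/

/-- The inclusion of a triple tensor product of symmetric powers. -/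
def tval₃ (a b c : ℕ) : ((symObj k n a).tensor ((symObj k n b).tensor (symObj k n c))).carrier →ₗ[k]
    SymAlg k n ⊗[k] SymT k n := TensorProduct.map (sval a) (tval b c)

theorem tval₃_tm {a b c : ℕ} (x : (symObj k n a).carrier)
    (y : ((symObj k n b).tensor (symObj k n c)).carrier) :
    tval₃ a b c (tm x y) = sval a x ⊗ₜ tval b c y := rfl

theorem tval₃_injective (a b c : ℕ) : Function.Injective (tval₃ (k := k) (n := n) a b c) :=
  TensorProduct.map_injective_of_flat_flat _ _ (sval_injective a) (tval_injective b c)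

/-- Coassociativity of `S(V)`, restricted to its components: the triple products embed into those of
`S(V)`, where both sides are iterated components of the coproduct. -/
theorem splitLin_coassoc (a b c : ℕ) (x : (symObj k n (a + b + c)).carrier) :
    lin (tensorMor (splitHom a b (a + b) rfl) (𝟙 _) ≫ (tensorAssoc _ _ _).hom)
        (splitLin (a + b) c (a + b + c) rfl x) =
      lin (tensorMor (𝟙 _) (splitHom b c (b + c) rfl))
        (splitLin a (b + c) (a + b + c) (add_assoc a b c).symm x) := by
  apply tval₃_injective
  have e₁ : ∀ w, tval₃ a b c (lin (tensorMor (splitHom a b (a + b) rfl) (𝟙 (symObj k n c)) ≫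
      (tensorAssoc _ _ _).hom) w) = TensorProduct.assoc k _ _ _
        (TensorProduct.map (comulR b) LinearMap.id (tval (a + b) c w)) := by
    intro w
    induction w using tm_induction with
    | ha w w' hw hw' => simp only [map_add, hw, hw']
    | h p q =>
      rw [lin_comp, LinearMap.comp_apply, tensorMor_id_tm, tval_tm, TensorProduct.map_tmul,
        ← tval_splitLin rfl]
      change tval₃ a b c (lin (tensorAssoc _ _ _).hom (tm (splitLin a b (a + b) rfl p) q)) = _
      induction splitLin a b (a + b) rfl p using tm_induction with
      | ha w w' hw hw' => simp only [add_tm, map_add, hw, hw', TensorProduct.add_tmul]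
      | h r s =>
        rw [tensorAssoc_tm, tval_tm, tval₃_tm, tval_tm]; rfl
  have e₂ : ∀ w, tval₃ a b c (lin (tensorMor (𝟙 (symObj k n a)) (splitHom b c (b + c) rfl)) w) =
      TensorProduct.map LinearMap.id (comulR c) (tval a (b + c) w) := by
    intro w
    induction w using tm_induction with
    | ha w w' hw hw' => simp only [map_add, hw, hw']
    | h p q =>
      rw [tensorMor_tm_of_even _ (splitLin_mem b c (b + c) rfl), tval₃_tm, tval_tm,
        TensorProduct.map_tmul, ← tval_splitLin rfl]
      rfl
  rw [e₁, e₂, tval_splitLin, tval_splitLin, comulR_coassoc, Nat.cast_add]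

theorem el_split_assoc (a b c : ℕ) : el n
      (Tm.seq (.comp (Tm.split k (a + b) c (a + b + c) rfl)
        (.tens (Tm.split k a b (a + b) rfl) (Tm.one k (up c)))) (.cast rfl)
        (List.append_assoc _ _ _)) =
      el n (.comp (Tm.split k a (b + c) (a + b + c) (add_assoc a b c).symm)
        (.tens (Tm.one k (up a)) (Tm.split k b c (b + c) rfl))) := by
  refine eu_ext fun x => ?_
  rw [el_seq, el_comp, el_comp, el_split, el_split, el_cast, castL_rfl]
  have e₁ : ∀ w, castL (wobj k n) (List.append_assoc _ _ _)
      (el n (.tens (Tm.split k a b (a + b) rfl) (Tm.one k (up c))) (pairL (eu (a + b)) (eu c) w)) =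
      pairL (eu a) (pairL (eu b) (eu c))
        (lin (tensorMor (splitHom a b (a + b) rfl) (𝟙 _) ≫ (tensorAssoc _ _ _).hom) w) := by
    intro w
    induction w using tm_induction with
    | ha w w' hw hw' => simp only [map_add, hw, hw']
    | h p q =>
      rw [lin_comp, LinearMap.comp_apply, tensorMor_id_tm, pairL_tm, el_tens_one, el_split]
      change _ = pairL _ _ (lin (tensorAssoc _ _ _).hom (tm (splitLin a b (a + b) rfl p) q))
      induction splitLin a b (a + b) rfl p using tm_induction with
      | ha w w' hw hw' => simp only [add_tm, map_add, cat_add_left, hw, hw']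
      | h r s => rw [tensorAssoc_tm, pairL_tm, pairL_tm, pairL_tm, cat_assoc]
  have e₂ : ∀ w, el n (.tens (Tm.one k (up a)) (Tm.split k b c (b + c) rfl))
      (pairL (eu a) (eu (b + c)) w) = pairL (eu a) (pairL (eu b) (eu c))
        (lin (tensorMor (𝟙 _) (splitHom b c (b + c) rfl)) w) := by
    intro w
    induction w using tm_induction with
    | ha w w' hw hw' => simp only [map_add, hw, hw']
    | h p q =>
      rw [tensorMor_tm_of_even _ (splitLin_mem b c (b + c) rfl), pairL_tm, pairL_tm,
        el_one_tens (.split _ _ _ _), tw_zero, el_split]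
      rfl
  rw [e₁, e₂, splitLin_coassoc]

theorem el_merge_assoc (a b c : ℕ) : el n
      (.comp (.tens (Tm.merge k a b (a + b) rfl) (Tm.one k (up c)))
        (Tm.merge k (a + b) c (a + b + c) rfl)) =
      el n (Tm.seq (.cast rfl) (.comp (.tens (Tm.one k (up a)) (Tm.merge k b c (b + c) rfl))
        (Tm.merge k a (b + c) (a + b + c) (add_assoc a b c).symm)) (List.append_assoc _ _ _)) := by
  refine cat_ext fun s t => ?_
  induction s using cat_induction with
  | ha s s' h h' => simp only [map_add, cat_add_left, h, h']
  | h s r =>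
    induction s using eu_induction with | h x => ?_
    induction r using eu_induction with | h y => ?_
    induction t using eu_induction with | h z => ?_
    rw [el_comp, el_tens_one, el_merge, el_merge, el_seq, el_cast, castL_rfl, cat_assoc, el_comp,
      el_one_tens (.merge _ _ _ _), tw_zero, LinearMap.id_apply, el_merge, el_merge]
    congr 1
    apply sval_injective
    rw [sval_mergeLin, sval_mergeLin, sval_mergeLin, sval_mergeLin, mul_assoc]

/-! ### Ladder relations -/

theorem el_rung_swap (a b r s c d : ℕ) (hc : c + s = a + r) (hd : d + r = b + s) : el n
      (.comp (Tm.rungR k a b s (a - s) (b + s)) (Tm.rungL k (a - s) (b + s) r c d)) =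
      el n (Tm.bigSum (min r s + 1) fun t =>
        .smul ((Ring.choose ((a : ℤ) - b + r - s) t : ℤ) : k)
          (.comp (Tm.rungL k a b (r - t) (a + (r - t)) (b - (r - t)))
            (Tm.rungR k (a + (r - t)) (b - (r - t)) (s - t) c d))) := by
  refine LinearMap.ext fun z => ?_
  apply jT_injective
  -- If `s > a`, the diagram is zero by the convention on labels, and the operator `R_s` kills left
  -- degree `a`.
  have hl : jT c d (el n (.comp (Tm.rungR k a b s (a - s) (b + s))
      (Tm.rungL k (a - s) (b + s) r c d)) z) = opL r (opR s (jT a b z)) := by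
    by_cases h : s ≤ a
    · rw [el_comp, jT_rungL (by omega) (by omega), jT_rungR (by omega) (by omega)]
    · rw [el_comp, Tm.rungR, dif_neg (by omega), el_zero, map_zero, map_zero,
        opR_eq_zero (jT_mem a b z) (by omega), map_zero]
  have hr : ∀ t ∈ Finset.range (min r s + 1),
      jT c d (el n (.comp (Tm.rungL k a b (r - t) (a + (r - t)) (b - (r - t)))
        (Tm.rungR k (a + (r - t)) (b - (r - t)) (s - t) c d)) z) =
      opR (s - t) (opL (r - t) (jT a b z)) := by
    intro t ht
    have ht := Finset.mem_range.1 ht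
    have e₁ : ((r - t : ℕ) : ℤ) = (r : ℤ) - t := by omega
    have e₂ : ((s - t : ℕ) : ℤ) = (s : ℤ) - t := by omega
    -- The same comparison for the leftward rungs, which vanish on both sides when too many strands
    -- would leave the right.
    by_cases h : r - t ≤ b
    · rw [el_comp, jT_rungR (by omega) (by omega), jT_rungL (by omega) (by omega), e₁, e₂]
    · rw [el_comp, Tm.rungL, dif_neg (by omega), el_zero, map_zero, map_zero,
        opL_eq_zero (jT_mem a b z) (by omega), map_zero]
  rw [hl, el_bigSum, map_sum, opL_opR (jT_mem a b z) r s (r + 1) (by omega)]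
  have hsub : Finset.range (min r s + 1) ⊆ Finset.range (r + 1) :=
    Finset.range_subset_range.2 (by omega)
  -- The operator identity is summed up to `r`; the terms with `t > s` contain a rightward rung of
  -- negative label and drop out.
  rw [← Finset.sum_subset hsub]
  · refine Finset.sum_congr rfl fun t ht => ?_
    rw [el_smul, map_smul, hr t ht]
  · intro t ht ht'
    rw [Finset.mem_range] at ht ht'
    rw [opR_neg (by omega), smul_zero]

/-- A cap needs a factor on each strand. This covers the degenerate diagrams in which the label `b -
1` would be negative. -/
theorem opC_eq_zero_right {a : ℕ} {z : SymT k n} (hz : z ∈ symTDeg k n a 0) : opC z = 0 :=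
  symTDeg_le (N := LinearMap.ker opC) (fun x hx y hy => by
    rw [LinearMap.mem_ker, opC_tmul]
    have : contr.flip y = 0 := LinearMap.ext fun u => by
      rw [LinearMap.flip_apply, contr_apply, comulL_eq_zero hy (by norm_num), map_zero]; rfl
    rw [this, LinearMap.zero_comp, TensorProduct.map_zero_right]; rfl) hz

theorem opC_eq_zero_left {b : ℕ} {z : SymT k n} (hz : z ∈ symTDeg k n 0 b) : opC z = 0 :=
  symTDeg_le (N := LinearMap.ker opC) (fun x hx y hy => by
    rw [LinearMap.mem_ker, opC_tmul, comulR_eq_zero hx (by norm_num), map_zero]) hz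

theorem el_cap_rung_right (a b r c d : ℕ) (hc : c + r + 1 = a) (hd : d + 1 = b + r) : el n
      (.comp (Tm.rungR k a b r (c + 1) (b + r)) (Tm.capRung k (c + 1) (b + r) c d)) =
      el n (.sum (.comp (Tm.capRung k a b (a - 1) (b - 1)) (Tm.rungR k (a - 1) (b - 1) r c d))
        (.smul 2 (if 1 ≤ r then
          .comp (Tm.antR k a b (a - 2)) (Tm.rungR k (a - 2) b (r - 1) c d) else .zero))) := by
  refine LinearMap.ext fun z => ?_
  apply jT_injective
  rw [el_comp, jT_capRung rfl (by omega), jT_rungR (by omega) (by omega), opC_opR, el_sum, map_add,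
    el_smul, map_smul, el_comp]
  congr 1
  · by_cases hb : b = 0
    · subst hb
      -- For `b = 0` the natural number `b - 1` is again `0`, so the condition on the labels fails
      -- and the diagram is zero.
      rw [Tm.capRung, dif_neg (by omega), el_zero, map_zero, map_zero,
        opC_eq_zero_right (jT_mem a 0 z), map_zero]
    · rw [jT_rungR (by omega) (by omega), jT_capRung (by omega) (by omega)]
  · congr 1
    by_cases hr : 1 ≤ r
    · rw [if_pos hr, el_comp, jT_rungR (by omega) (by omega), jT_antR (by omega),
        show ((r - 1 : ℕ) : ℤ) = (r : ℤ) - 1 by omega]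
    · rw [if_neg hr, el_zero, map_zero, opR_neg (by omega)]

theorem el_cap_rung_left (a b r c d : ℕ) (hc : c + 1 = a + r) (hd : d + r + 1 = b) : el n
      (.comp (Tm.rungL k a b r (a + r) (d + 1)) (Tm.capRung k (a + r) (d + 1) c d)) =
      el n (.sum (.comp (Tm.capRung k a b (a - 1) (b - 1)) (Tm.rungL k (a - 1) (b - 1) r c d))
        (.smul 2 (if 1 ≤ r then
          .comp (Tm.antL k a b (b - 2)) (Tm.rungL k a (b - 2) (r - 1) c d) else .zero))) := by
  refine LinearMap.ext fun z => ?_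
  apply jT_injective
  rw [el_comp, jT_capRung (by omega) (by omega), jT_rungL (by omega) (by omega), opC_opL, el_sum,
    map_add, el_smul, map_smul, el_comp]
  congr 1
  · by_cases ha : a = 0
    · subst ha
      rw [Tm.capRung, dif_neg (by omega), el_zero, map_zero, map_zero,
        opC_eq_zero_left (jT_mem 0 b z), map_zero]
    · rw [jT_rungL (by omega) (by omega), jT_capRung (by omega) (by omega)]
  · congr 1
    by_cases hr : 1 ≤ r
    · rw [if_pos hr, el_comp, jT_rungL (by omega) (by omega), jT_antL (by omega),
        show ((r - 1 : ℕ) : ℤ) = (r : ℤ) - 1 by omega]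
    · rw [if_neg hr, el_zero, map_zero, opL_neg (by omega)]

theorem el_cup_rung_right (a b r c d : ℕ) (hc : c + r = a + 1) (hd : d = b + r + 1) : el n
      (.comp (Tm.cupRung k a b (a + 1) (b + 1)) (Tm.rungR k (a + 1) (b + 1) r c d)) =
      el n (.comp (Tm.rungR k a b r (a - r) (b + r)) (Tm.cupRung k (a - r) (b + r) c d)) := by
  refine LinearMap.ext fun z => ?_
  apply jT_injective
  rw [el_comp, jT_rungR (by omega) (by omega), jT_cupRung (by omega) (by omega), ← opU_opR, el_comp]
  by_cases h : r ≤ a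
  · rw [jT_cupRung (by omega) (by omega), jT_rungR (by omega) (by omega)]
  · rw [Tm.rungR, dif_neg (by omega), el_zero, map_zero, map_zero,
      opR_eq_zero (jT_mem a b z) (by omega), map_zero]

theorem el_cup_rung_left (a b r c d : ℕ) (hc : c = a + r + 1) (hd : d + r = b + 1) : el n
      (.comp (Tm.cupRung k a b (a + 1) (b + 1)) (Tm.rungL k (a + 1) (b + 1) r c d)) =
      el n (.comp (Tm.rungL k a b r (a + r) (b - r)) (Tm.cupRung k (a + r) (b - r) c d)) := by
  refine LinearMap.ext fun z => ?_
  apply jT_injective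
  rw [el_comp, jT_rungL (by omega) (by omega), jT_cupRung (by omega) (by omega), ← opU_opL, el_comp]
  by_cases h : r ≤ b
  · rw [jT_cupRung (by omega) (by omega), jT_rungL (by omega) (by omega)]
  · rw [Tm.rungL, dif_neg (by omega), el_zero, map_zero, map_zero,
      opL_eq_zero (jT_mem a b z) (by omega), map_zero]

end Relations

end

end TypeP

namespace TypeP

noncomputable section

open PMod

section Relations

variable {k : Type u} [Field k] [NeZero (2 : k)] {n : ℕ}

/-! ### Straightening -/

theorem castL_star_cat {x : Word} (t : (wobj k n x).carrier) (h : [] ++ x = x ++ []) :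
    castL (wobj k n) h (cat PMod.star t) = cat t PMod.star := by
  rw [cat_nil]
  exact ((eq_castL_iff h t _).2 (cat_nil_right t h.symm)).symm

theorem castL_cat_star {x : Word} (t : (wobj k n x).carrier) (h : x ++ [] = [] ++ x) :
    castL (wobj k n) h (cat t PMod.star) = cat PMod.star t := by
  rw [cat_nil]
  exact cat_nil_right t h

theorem castL_cat_cat_symm {x y z : Word} (s : (wobj k n x).carrier) (t : (wobj k n y).carrier)
    (r : (wobj k n z).carrier) (h : x ++ (y ++ z) = (x ++ y) ++ z) :
    castL (wobj k n) h (cat s (cat t r)) = cat (cat s t) r := by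
  rw [← cat_assoc s t r h.symm, castL_castL, castL_rfl]

theorem sum_natVec (v : NatV k n) : ∑ i : Ix n, v i • natVec k i = v := by
  ext j
  simp [natVec, Pi.single_apply]

theorem eq_sum_symVec (x : (symObj k n 1).carrier) :
    x = ∑ i : Ix n, symOne (sval 1 x) i • symVec i := by
  apply sval_injective
  simp only [map_sum, map_smul, sval_symVec]
  rw [← symι_symOne (sval_mem x)]
  simp only [← map_smul, ← map_sum, symOne_symι, sum_natVec]

/-- The expansion `x = ∑ (v_{-i}, x) v_i` in the basis. The sign of the cup and the sign of the odd
cap passing `v_i` are equal and cancel. -/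
theorem el_straight_left (h : [] ++ up 1 = up 1 ++ []) : el n
      (Tm.seq (x := [] ++ up 1) (z := up 1 ++ []) (.tens (Tm.ucup k) (Tm.one k (up 1)))
        (.tens (Tm.one k (up 1)) (Tm.ucap k))) = el n (.cast h) := by
  refine star_cat_ext fun t => ?_
  induction t using eu_induction with | h x => ?_
  have e : ∀ i : Ix n, symForm k n (sval 1 (symVec (k := k) i.swap)) (sval 1 x) =
      symOne (sval 1 x) i := fun i => by
    rw [sval_symVec, symForm_apply, symOne_symι, form_comm, form_natVec_swap]
  have hx := eq_sum_symVec x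
  rw [el_seq, el_tens_one, el_ucup, el_cast, castL_star_cat, ← catL_apply, map_sum,
    LinearMap.sum_apply, map_sum, map_sum]
  conv_rhs => rw [hx, map_sum, ← catL_apply, map_sum, LinearMap.sum_apply]
  refine Finset.sum_congr rfl fun i _ => ?_
  rw [catL_apply, cat_smul_left, map_smul, map_smul, cat_assoc, el_one_tens .ucap, el_ucap, e,
    eu_tw, symVec_tw, map_smul, one_mul, cat_smul_left, cat_smul_right, smul_smul, smul_smul,
    sgn_mul_self, one_mul, map_smul, catL_apply, cat_smul_left]

/-- Here the odd cup passes `x`. As the form is odd, twisting its first argument is minus twisting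
its second; the remaining twist cancels the sign of the cup, and `-1` is left over. -/
theorem el_straight_right (h : up 1 ++ [] = [] ++ up 1) : el n (.cast h) =
    el n (.smul (-1) (Tm.seq (x := up 1 ++ []) (z := [] ++ up 1)
      (.tens (Tm.one k (up 1)) (Tm.ucup k)) (.tens (Tm.ucap k) (Tm.one k (up 1))))) := by
  refine cat_star_ext fun t => ?_
  induction t using eu_induction with | h x => ?_
  have e : ∀ i : Ix n, symForm k n (symTw 1 (sval 1 x)) (sval 1 (symVec (k := k) i)) =
      -(sgn k i.par * symOne (sval 1 x) i.swap) := fun i => by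
    have h := form_natVec_swap (symOne (sval 1 x)) i.swap
    rw [Sum.swap_swap] at h
    rw [sval_symVec, symForm_apply, symOne_symι, symOne_symTw, form_natTw_left,
      natTw_apply 1 (natVec_mem i), form_smul_right, h, one_mul]
  have hx : x = ∑ i : Ix n, symOne (sval 1 x) i.swap • symVec i.swap :=
    (eq_sum_symVec x).trans ((Equiv.sumComm (Fin n) (Fin n)).sum_comp
      fun i => symOne (sval 1 x) i • symVec i).symm
  rw [el_smul, el_seq, el_one_tens .ucup, el_ucup, el_cast, castL_cat_star, ← catL_apply,
    ← catL_apply, map_sum, map_sum, map_sum, Finset.smul_sum]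
  conv_lhs => rw [hx, map_sum, map_sum]
  refine Finset.sum_congr rfl fun i _ => ?_
  rw [catL_apply, catL_apply, cat_smul_right, map_smul, map_smul, map_smul, castL_cat_cat_symm,
    el_tens_one, eu_tw, el_ucap, sval_tw, e, cat_smul_left, cat_smul_right, smul_smul, smul_smul,
    mul_neg, neg_one_mul, neg_mul, neg_neg, ← mul_assoc, sgn_mul_self, one_mul]

/-- A product of two vectors is the case covered by `symAnt_symι_mul`, extended linearly to an
inhomogeneous first vector. -/
theorem el_antenna_retract :
    el n (.comp (Tm.merge k 1 1 2 rfl) (Tm.antenna k)) = el n (Tm.ucap k) := by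
  refine uu_ext fun x y => ?_
  rw [el_comp, el_merge, el_antenna, el_ucap, sval_mergeLin]
  congr 1
  conv_lhs => rw [← symι_symOne (sval_mem x)]
  rw [symForm_apply]
  suffices h : symAnt ∘ₗ LinearMap.mulRight k (sval 1 y) ∘ₗ symι k n =
      (formLin k n).flip (symOne (sval 1 y)) from LinearMap.congr_fun h (symOne (sval 1 x))
  exact nat_ext fun p v hv => symAnt_symι_mul hv _

/-! ### Leftward straightening -/

/-- For any element of `M ⊗ M^*` in place of the coevaluation, the zigzag acts by the corresponding
endomorphism. The canonical element corresponds to the identity. -/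
theorem el_left_straight_up (a : ℕ) (h : [] ++ up a = up a ++ []) : el n
      (Tm.seq (x := [] ++ up a) (z := up a ++ []) (.tens (Tm.lcup k a) (Tm.one k (up a)))
        (.tens (Tm.one k (up a)) (Tm.lcap k a))) = el n (.cast h) := by
  refine star_cat_ext fun t => ?_
  induction t using eu_induction with | h x => ?_
  rw [el_seq, el_tens_one, el_lcup, el_cast, castL_star_cat]
  have e : ∀ (w : ((symObj k n a).tensor (symObj k n a).dual).carrier)
      (h : (up a ++ down a) ++ up a = up a ++ (down a ++ up a)),
      el n (.tens (Tm.one k (up a)) (Tm.lcap k a)) (castL (wobj k n) h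
        (cat (pairL (eu a) (ed a) w) (eu a x))) = cat (eu a (tensorEnd _ w x)) PMod.star := by
    intro w h
    induction w using tm_induction with
    | ha w w' hw hw' => simp only [map_add, cat_add_left, hw, hw', LinearMap.add_apply]
    | h m f =>
      rw [pairL_tm, cat_assoc, el_one_tens (.lcap _), tw_zero, LinearMap.id_apply, el_lcap,
        tensorEnd_tm, map_smul, cat_smul_left, cat_smul_right]
  rw [e, tensorEnd_coevElt, LinearMap.id_apply]

/-- The functional obtained from an element of `M ⊗ M^*` by the contraction with `f`. -/
def contrDual {M : PMod k n} (f : M.dual.carrier) (w : (M.tensor M.dual).carrier) :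
    M.dual.carrier := dmk M (dapp M f ∘ₗ tensorEnd M w)

theorem contrDual_add {M : PMod k n} (f : M.dual.carrier) (w w' : (M.tensor M.dual).carrier) :
    contrDual f (w + w') = contrDual f w + contrDual f w' := by
  refine dual_ext fun m => ?_
  simp [contrDual]

theorem contrDual_tm {M : PMod k n} (f : M.dual.carrier) (m : M.carrier) (g : M.dual.carrier) :
    contrDual f (tm m g) = dapp M f m • g := by
  refine dual_ext fun y => ?_
  rw [contrDual, dapp_dmk, LinearMap.comp_apply, tensorEnd_tm, map_smul, map_smul,
    LinearMap.smul_apply, smul_eq_mul, smul_eq_mul, mul_comm]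

theorem contrDual_coevElt {M : PMod k n} [FiniteDimensional k M.carrier] (f : M.dual.carrier) :
    contrDual f (coevElt M) = f := by
  rw [contrDual, tensorEnd_coevElt, LinearMap.comp_id]
  rfl

theorem el_left_straight_down (a : ℕ) (h : down a ++ [] = [] ++ down a) : el n
      (Tm.seq (x := down a ++ []) (z := [] ++ down a) (.tens (Tm.one k (down a)) (Tm.lcup k a))
        (.tens (Tm.lcap k a) (Tm.one k (down a)))) = el n (.cast h) := by
  refine cat_star_ext fun t => ?_
  induction t using ed_induction with | h f => ?_
  rw [el_seq, el_one_tens (.lcup _), tw_zero, LinearMap.id_apply, el_lcup, el_cast, castL_cat_star]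
  have e : ∀ (w : ((symObj k n a).tensor (symObj k n a).dual).carrier)
      (h : down a ++ (up a ++ down a) = (down a ++ up a) ++ down a),
      el n (.tens (Tm.lcap k a) (Tm.one k (down a))) (castL (wobj k n) h
        (cat (ed a f) (pairL (eu a) (ed a) w))) = cat PMod.star (ed a (contrDual f w)) := by
    intro w h
    induction w using tm_induction with
    | ha w w' hw hw' => simp only [map_add, cat_add_right, hw, hw', contrDual_add]
    | h m g =>
      rw [pairL_tm, castL_cat_cat_symm, el_tens_one, el_lcap, contrDual_tm, map_smul,
        cat_smul_left, cat_smul_right]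
  rw [e, contrDual_coevElt]

/-! ### The leftward crossing -/

/-- The leftward crossing is the upward one, already known to be the swap, bent by a cup and a cap.
For any element of `M ⊗ M^*` at the cup, the result is the contraction of that element with a twist
of `f`; the canonical element returns the twisted `f`. -/
theorem el_lcross {a b : ℕ} {p : ZMod 2} (f : (symObj k n a).dual.carrier)
    {y : (symObj k n b).carrier} (hy : y ∈ (symObj k n b).grade p) :
    el n (Tm.lcross k a b) (cat (ed a f) (eu b y)) =
      cat (eu b y) (ed a ((symObj k n a).dual.tw p f)) := by
  have e₀ : ∀ h : down a ++ up b = (down a ++ up b) ++ [],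
      castL (wobj k n) h (cat (ed a f) (eu b y)) = cat (cat (ed a f) (eu b y)) PMod.star :=
    fun h => ((eq_castL_iff h _ _).2 (cat_nil_right _ _)).symm
  have e : ∀ (w : ((symObj k n a).tensor (symObj k n a).dual).carrier) h h',
      el n (.tens (Tm.lcap k a) (.tens (Tm.one k (up b)) (Tm.one k (down a))))
        (castL (wobj k n) h'
          (el n (.tens (Tm.one k (down a)) (.tens (Tm.ucross k b a) (Tm.one k (down a))))
            (castL (wobj k n) h (cat (cat (ed a f) (eu b y)) (pairL (eu a) (ed a) w))))) =
      cat PMod.star (cat (eu b y) (ed a (contrDual ((symObj k n a).dual.tw p f) w))) := by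
    intro w h h'
    induction w using tm_induction with
    | ha w w' hw hw' => simp only [map_add, cat_add_right, hw, hw', contrDual_add]
    | h m g =>
      rw [pairL_tm, castL_cat_cat, el_one_tens (.tens (.ucross _ _) (.one _)), add_zero, tw_zero,
        LinearMap.id_apply, el_tens_one, el_ucross hy, castL_cat_cat',
        el_tens_even _ (.tens (.one _) (.one _)), el_lcap, el_tens_one, contrDual_tm, map_smul,
        cat_smul_left, cat_smul_right, cat_smul_right, dapp_tw]
      rfl
  rw [Tm.lcross, el_comp, el_cast, e₀, el_seq, el_seq, el_tens_even _ (.lcup _), el_tens_one,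
    el_lcup]
  refine (e _ _ _).trans ?_
  rw [contrDual_coevElt, cat_nil]

theorem el_cross_inv_left (a b : ℕ) :
    el n (.comp (Tm.lcross k a b) (Tm.rcross k b a)) = el n (.cast rfl) := by
  refine du_ext fun p y hy f => ?_
  rw [el_comp, el_lcross f hy, el_rcross_apply hy, tw_tw]
  rfl

theorem el_cross_inv_right (a b : ℕ) :
    el n (.comp (Tm.rcross k a b) (Tm.lcross k b a)) = el n (.cast rfl) := by
  refine ud_ext fun p x hx f => ?_
  rw [el_comp, el_rcross_apply hx, el_lcross _ hx, tw_tw]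
  rfl

/-- The swap followed by the evaluation inserts `(-1)^{|x||x|} = (-1)^{|x|}`. Consequently a bubble
computes a supertrace. -/
theorem el_rcross_lcap {a : ℕ} (x : (symObj k n a).carrier) (f : (symObj k n a).dual.carrier) :
    el n (Tm.lcap k a) (el n (Tm.rcross k a a) (cat (eu a x) (ed a f))) =
      dapp _ f ((symObj k n a).tw 1 x) • PMod.star := by
  obtain ⟨x₀, h₀, x₁, h₁, rfl⟩ := (symObj k n a).exists_add x
  have h : ∀ p, ∀ x ∈ (symObj k n a).grade p,
      el n (Tm.lcap k a) (el n (Tm.rcross k a a) (cat (eu a x) (ed a f))) =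
        dapp _ f ((symObj k n a).tw 1 x) • PMod.star := by
    intro p x hx
    rw [el_rcross_apply hx, el_lcap, dapp_tw, (symObj k n a).tw_apply p hx,
      (symObj k n a).tw_apply 1 hx, one_mul]
    rcases zmod_cases p with rfl | rfl <;> rfl
  rw [map_add, cat_add_left, map_add, map_add, h 0 _ h₀, h 1 _ h₁, map_add, map_add, add_smul]

theorem trace_symObj_tw (a : ℕ) :
    LinearMap.trace k (symObj k n (a + 1)).carrier ((symObj k n (a + 1)).tw 1) = 0 := by
  have h : (symObj k n (a + 1)).tw 1 = symParity k n (a + 1) :=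
    LinearMap.ext fun x => sval_injective _ (sval_tw 1 x)
  rw [h]
  exact trace_symParity a

/-- Summing over a basis and its dual basis, the bubble is the trace of the parity operator of
`S^a(V)`, which vanishes in positive degree. -/
theorem el_bubble {a : ℕ} (ha : 0 < a) :
    el n (.comp (Tm.lcup k a) (.comp (Tm.rcross k a a) (Tm.lcap k a))) = el n .zero := by
  classical
  refine star_ext ?_
  obtain ⟨ι, _, b, hb⟩ := coevElt_eq (symObj k n a)
  obtain ⟨a, rfl⟩ := Nat.exists_eq_succ_of_ne_zero ha.ne'
  rw [el_comp, el_comp, el_lcup, hb, map_sum, map_sum, map_sum, el_zero]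
  simp only [pairL_tm, el_rcross_lcap, dapp_dmk, ← Finset.sum_smul]
  have h := trace_symObj_tw (k := k) (n := n) a
  rw [LinearMap.trace_eq_matrix_trace k b, Matrix.trace] at h
  simp only [Matrix.diag_apply, LinearMap.toMatrix_apply] at h
  refine (congrArg (· • _) h).trans (zero_smul _ _)

theorem el_defRel {x y : Word} {f g : Tm k x y} (h : Tm.DefRel k f g) : el n f = el n g := by
  cases h with
  | split_right_zero a => exact el_split_right_zero a _
  | split_left_zero a => exact el_split_left_zero a _
  | merge_right_zero a => exact el_merge_right_zero a _
  | merge_left_zero a => exact el_merge_left_zero a _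
  | lcap_zero => exact el_lcap_zero _
  | lcup_zero => exact el_lcup_zero _
  | cross_right_zero a => exact el_rcross_right_zero a _
  | cross_left_zero b => exact el_rcross_left_zero b _
  | split_assoc a b c => exact el_split_assoc a b c
  | merge_assoc a b c => exact el_merge_assoc a b c
  | rung_swap a b r s c d hc hd => exact el_rung_swap a b r s c d hc hd
  | straight_left => exact el_straight_left _
  | straight_right => exact el_straight_right _
  | antenna_retract => exact el_antenna_retract
  | cap_rung_right a b r c d hc hd => exact el_cap_rung_right a b r c d hc hd
  | cap_rung_left a b r c d hc hd => exact el_cap_rung_left a b r c d hc hd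
  | cup_rung_right a b r c d hc hd => exact el_cup_rung_right a b r c d hc hd
  | cup_rung_left a b r c d hc hd => exact el_cup_rung_left a b r c d hc hd
  | left_straight_up a => exact el_left_straight_up a _
  | left_straight_down a => exact el_left_straight_down a _
  | cross_inv_left a b => exact el_cross_inv_left a b
  | cross_inv_right a b => exact el_cross_inv_right a b
  | bubble a ha => exact el_bubble ha

theorem ev_eq_of_rel {x y : Word} {f g : Tm k x y} (h : Tm.Rel k f g) : ev n f = ev n g :=
  ev_rel el_defRel h

end Relations

end

end TypeP

namespace TypeP

noncomputable section

open PMod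

section Superfunctor

variable {k : Type u} [Field k] [NeZero (2 : k)] {n : ℕ}

/-! ### The superfunctor -/

theorem arrObj_isSS : ∀ x : Arrow, IsSS k n (arrObj k n x)
  | .up a => .sym a
  | .down a => .dual a

theorem tobj_isSS : ∀ x : Word, IsSS k n (tobj k n x)
  | [] => .triv
  | x :: l => .tensor (arrObj_isSS x) (tobj_isSS l)

theorem wobj_isSS : ∀ x : Word, IsSS k n (wobj k n x)
  | [] => .triv
  | [x] => arrObj_isSS x
  | x :: y :: l => tobj_isSS (x :: y :: l)

variable (n) in
/-- The evaluation of webs. -/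
def evHom {x y : Word} (f : WebHom k x y) : wobj k n x ⟶ wobj k n y :=
  Quotient.lift (ev n) (fun _ _ h => ev_eq_of_rel h) f

variable (k n) in
/-- The supermodule of a word, as an object of the monoidal subcategory. -/
def ssObj (x : Word) : ModSS k n := ⟨wobj k n x, wobj_isSS x⟩

variable (k n) in
/-- The functor from oriented webs to supermodules. -/
def webFun : PWebUD k ⥤ ModSS k n where
  obj x := ssObj k n x.word
  map {x y} f := evHom n (x := x.word) (y := y.word) f
  map_id _ := rfl
  map_comp := by rintro x y z ⟨f⟩ ⟨g⟩; rfl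

variable (k n) in
/-- The comparison of the tensor product of the supermodules of two words with the supermodule of
their concatenation. -/
def webμ (x y : PWebUD k) : tensorObj k ((webFun k n).obj x) ((webFun k n).obj y) ≅
    (webFun k n).obj (tensorObj k x y) := ModSS.mkIso (wobjμ x.word y.word)

theorem ModSS.lin_comp {L M N : ModSS k n} (f : L ⟶ M) (g : M ⟶ N) :
    ModSS.lin (f ≫ g) = ModSS.lin g ∘ₗ ModSS.lin f := rfl

theorem ModSS.hom_ext {M N : ModSS k n} {f g : M ⟶ N} (h : ModSS.lin f = ModSS.lin g) : f = g :=
  PMod.hom_ext (M := M.obj) (N := N.obj) h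

theorem webμ_assoc (x y z : PWebUD k) :
    tensorHom (k := k) (webμ k n x y).hom (𝟙 ((webFun k n).obj z)) ≫
        (webμ k n (tensorObj k x y) z).hom ≫ (webFun k n).map (assoc (k := k) x y z).hom =
      (assoc (k := k) ((webFun k n).obj x) ((webFun k n).obj y) ((webFun k n).obj z)).hom ≫
        tensorHom (k := k) (𝟙 ((webFun k n).obj x)) (webμ k n y z).hom ≫
          (webμ k n x (tensorObj k y z)).hom := by
  have key := congrArg PMod.lin (wobjμ_assoc (k := k) (n := n) x.word y.word z.word)
  have e₁ : ModSS.lin (tensorHom (k := k) (webμ k n x y).hom (𝟙 ((webFun k n).obj z))) =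
    PMod.lin (tensorMor (wobjμ x.word y.word).hom (𝟙 (wobj k n z.word))) := rfl
  have e₂ : ModSS.lin (tensorHom (k := k) (𝟙 ((webFun k n).obj x)) (webμ k n y z).hom) =
    PMod.lin (tensorMor (𝟙 (wobj k n x.word)) (wobjμ y.word z.word).hom) := rfl
  rw [PMod.lin_comp, PMod.lin_comp, PMod.lin_comp, PMod.lin_comp] at key
  apply ModSS.hom_ext
  rw [ModSS.lin_comp, ModSS.lin_comp, ModSS.lin_comp, ModSS.lin_comp, e₁, e₂]
  exact key

theorem webμ_natural {x y x' y' : PWebUD k} (f : x ⟶ y) (g : x' ⟶ y') :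
    tensorHom (k := k) ((webFun k n).map f) ((webFun k n).map g) ≫ (webμ k n y y').hom =
      (webμ k n x x').hom ≫ (webFun k n).map (tensorHom (k := k) f g) := by
  obtain ⟨f, rfl⟩ := PWebUD.diag_surjective f
  obtain ⟨g, rfl⟩ := PWebUD.diag_surjective g
  exact ((wobjμ x.word x'.word).hom_inv_id_assoc _).symm

theorem webμ_lunit (x : PWebUD k) : (lunit (k := k) ((webFun k n).obj x)).hom =
    tensorHom (k := k) (𝟙 (unit k)) (𝟙 ((webFun k n).obj x)) ≫
      (webμ k n (unit k) x).hom ≫ (webFun k n).map (lunit (k := k) x).hom := by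
  have h := tensorHom_id (k := k) (unit k : ModSS k n) ((webFun k n).obj x)
  rw [h, Category.id_comp]
  exact (wobjμ_nil x.word).symm

theorem webμ_runit (x : PWebUD k) : (runit (k := k) ((webFun k n).obj x)).hom =
    tensorHom (k := k) (𝟙 ((webFun k n).obj x)) (𝟙 (unit k)) ≫
      (webμ k n x (unit k)).hom ≫ (webFun k n).map (runit (k := k) x).hom := by
  have h := tensorHom_id (k := k) ((webFun k n).obj x) (unit k : ModSS k n)
  rw [h, Category.id_comp]
  exact (wobjμ_nil_right x.word).symm

variable (k n) in
/-- The monoidal superfunctor from oriented webs to supermodules. -/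
def webFunctor : MonoidalSuperfunctor k (PWebUD k) (ModSS k n) where
  toFunctor := webFun k n
  map_add := by rintro x y ⟨f⟩ ⟨g⟩; rfl
  map_smul := by rintro x y c ⟨f⟩; rfl
  map_mem := by
    rintro x y p _ ⟨f, hf, rfl⟩
    exact ev_mem hf
  μ := webμ k n
  μ_mem x y := wobjμ_mem x.word y.word
  μ_naturality := webμ_natural
  ε := Iso.refl _
  ε_mem := PMod.id_mem _
  associativity := webμ_assoc
  left_unitality := webμ_lunit
  right_unitality := webμ_runit

variable (k n) in
/-- The identification of the value at `↑_a` with `S^a(V)`. -/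
def upSS (a : ℕ) : (webFunctor k n).obj (PWebUD.up k a) ≅ ModSS.sym k n a := ModSS.mkIso (upIso a)

variable (k n) in
/-- The identification of the value at `↓_a` with `S^a(V)^*`. -/
def downSS (a : ℕ) : (webFunctor k n).obj (PWebUD.down k a) ≅ ModSS.symDual k n a :=
  ModSS.mkIso (downIso a)

/-- An object of the full subcategory is a supermodule with a proof, so equal supermodules give
equal objects. -/
theorem ModSS.mkIso_eqToIso {M N : ModSS k n} (h : M.obj = N.obj) :
    ∃ h' : M = N, ModSS.mkIso (eqToIso h) = eqToIso h' := by
  obtain ⟨M, hM⟩ := M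
  obtain ⟨N, hN⟩ := N
  obtain rfl : M = N := h
  exact ⟨rfl, rfl⟩

theorem upSS_eq {a : ℕ} (ha : 0 < a) :
    ∃ h : (webFunctor k n).obj (PWebUD.up k a) = ModSS.sym k n a, upSS k n a = eqToIso h := by
  obtain ⟨a, rfl⟩ := Nat.exists_eq_succ_of_ne_zero ha.ne'
  exact ModSS.mkIso_eqToIso _

theorem downSS_eq {a : ℕ} (ha : 0 < a) :
    ∃ h : (webFunctor k n).obj (PWebUD.down k a) = ModSS.symDual k n a,
      downSS k n a = eqToIso h := by
  obtain ⟨a, rfl⟩ := Nat.exists_eq_succ_of_ne_zero ha.ne'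
  exact ModSS.mkIso_eqToIso _

/-! ### The values of the functor on the generators -/

theorem tensorMor_wobjμ_inv {M N : PMod k n} {x y : Word} (e : wobj k n x ≅ M) (e' : wobj k n y ≅ N)
    (he' : lin e'.hom ∈ homGrade _ _ 0) (w : (M.tensor N).carrier) :
    lin (tensorMor e.hom e'.hom) (lin (wobjμ x y).inv (pairL (lin e.inv) (lin e'.inv) w)) = w := by
  induction w using tm_induction with
  | ha w w' hw hw' => simp only [map_add, hw, hw']
  | h m l =>
    rw [pairL_tm, wobjμ_inv_cat, tensorMor_tm_of_even _ he']
    exact congrArg₂ tm (LinearMap.congr_fun (congrArg lin e.inv_hom_id) m)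
      (LinearMap.congr_fun (congrArg lin e'.inv_hom_id) l)

theorem wobjμ_tensorMor_inv {M N : PMod k n} {x y : Word} (e : wobj k n x ≅ M) (e' : wobj k n y ≅ N)
    (he' : lin e'.hom ∈ homGrade _ _ 0) (m : M.carrier) (l : N.carrier) :
    lin (wobjμ x y).hom (lin (tensorMor e.inv e'.inv) (tm m l)) = cat (lin e.inv m) (lin e'.inv l) :=
  LinearMap.congr_fun (lin_tensorMor_wobjμ e.inv (inv_mem he')) (tm m l)

theorem splitLin_symProd {a b : ℕ} {x : Fin (a + b) → NatV k n} {p : Fin (a + b) → ZMod 2}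
    (hx : ∀ i, x i ∈ natGrade k n (p i)) :
    splitLin a b (a + b) rfl (symProd x) = ∑ T : {T : Finset (Fin (a + b)) // T.card = a},
      splSign k p T.1 • PMod.tm (subProd x T.1 T.2) (subProd x T.1ᶜ
        (by rw [Finset.card_compl, Fintype.card_fin, T.2, Nat.add_sub_cancel_left])) := by
  apply tval_injective
  refine ((tval_splitLin _ _).trans (comulR_prod hx b)).trans ?_
  rw [map_sum, ← Finset.sum_filter]
  -- The coproduct formula selects the subsets by the size of the complement, the split by the size
  -- of the subset.
  have hc : ∀ T : Finset (Fin (a + b)), (Tᶜ.card : ℤ) = b ↔ T.card = a := fun T => by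
    have := T.card_add_card_compl
    rw [Fintype.card_fin] at this
    omega
  refine Finset.sum_bij' (fun T hT => ⟨T, (hc T).1 (Finset.mem_filter.1 hT).2⟩) (fun T _ => T.1)
    (fun _ _ => Finset.mem_univ _)
    (fun T _ => Finset.mem_filter.2 ⟨Finset.mem_univ _, (hc _).2 T.2⟩) (fun _ _ => rfl)
    (fun _ _ => rfl) fun T hT => ?_
  rw [map_smul, tval_tm]
  exact congrArg _ (congrArg₂ _ (subProd_val x T _).symm (subProd_val x Tᶜ _).symm)

theorem webFunctor_split (a b : ℕ) : IsSpl a b ((upSS k n (a + b)).inv ≫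
    (webFunctor k n).map (PWebUD.split k a b) ≫ ((webFunctor k n).μ _ _).inv ≫
      tensorHom (k := k) (upSS k n a).hom (upSS k n b).hom) := by
  intro x p hx
  refine Eq.trans ?_ (splitLin_symProd hx)
  refine Eq.trans ?_ (tensorMor_wobjμ_inv (upIso a) (upIso b) (upIso_mem b) _)
  exact congrArg (fun w => PMod.lin (tensorMor (upIso a).hom (upIso b).hom)
    (PMod.lin (wobjμ (up a) (up b)).inv w)) (el_split rfl (symProd x))

theorem webFunctor_merge (a b : ℕ) : IsMer a b
    (tensorHom (k := k) (upSS k n a).inv (upSS k n b).inv ≫ ((webFunctor k n).μ _ _).hom ≫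
      (webFunctor k n).map (PWebUD.merge k a b) ≫ (upSS k n (a + b)).hom) := by
  intro x y
  refine (congrArg (fun w => PMod.lin (upIso (a + b)).hom (el n (Tm.merge k a b _ rfl) w))
    (wobjμ_tensorMor_inv (upIso a) (upIso b) (upIso_mem b) x y)).trans ?_
  exact (congrArg (PMod.lin (upIso (a + b)).hom) (el_merge rfl x y)).trans (upIso_eu _ _)

theorem webFunctor_lcap (a : ℕ) : IsEval a
    (tensorHom (k := k) (downSS k n a).inv (upSS k n a).inv ≫ ((webFunctor k n).μ _ _).hom ≫
      (webFunctor k n).map (PWebUD.lcap k a) ≫ (webFunctor k n).ε.inv) := by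
  intro f x
  exact (congrArg (el n (Tm.lcap k a))
    (wobjμ_tensorMor_inv (downIso a) (upIso a) (upIso_mem a) f x)).trans (el_lcap f x)

theorem webFunctor_lcup (a : ℕ) : IsCoeval a
    ((webFunctor k n).ε.hom ≫ (webFunctor k n).map (PWebUD.lcup k a) ≫
      ((webFunctor k n).μ _ _).inv ≫ tensorHom (k := k) (upSS k n a).hom (downSS k n a).hom) := by
  refine Eq.trans ?_ (tensorMor_wobjμ_inv (upIso a) (downIso a) (downIso_mem a) _)
  exact congrArg (fun w => PMod.lin (tensorMor (upIso a).hom (downIso a).hom)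
    (PMod.lin (wobjμ (up a) (down a)).inv w)) el_lcup

theorem webFunctor_tagIn : IsD
    ((upSS k n 1).inv ≫ (webFunctor k n).map (PWebUD.tagIn k) ≫ (downSS k n 1).hom) := by
  intro v w
  have e : PMod.lin (downIso 1).hom (el n (.gen .tagIn : Tm k _ _) (eu 1 (symProd fun _ => v))) =
      dualEquiv k n (symProd fun _ => v) :=
    (congrArg (PMod.lin (downIso 1).hom) (el_tagIn (k := k) (n := n) _)).trans (downIso_ed _ _)
  have hv : ∀ v : NatV k n, (symProd fun _ : Fin 1 => v).1 = symι k n v := fun v => by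
    change (List.ofFn fun _ : Fin 1 => symι k n v).prod = _
    simp
  refine (congrArg (fun f => symEval f (symProd fun _ => w)) e).trans ?_
  refine (dapp_dualEquiv _ _).trans ?_
  refine (congrArg₂ (fun a b => symForm k n a b) (hv v) (hv w)).trans ?_
  rw [symForm_apply, symOne_symι, symOne_symι]

theorem webFunctor_tagIn_tagOut :
    (webFunctor k n).map (PWebUD.tagIn k) ≫ (webFunctor k n).map (PWebUD.tagOut k) = 𝟙 _ := by
  refine PMod.hom_ext (M := wobj k n (up 1)) (N := wobj k n (up 1)) (eu_ext fun x => ?_)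
  refine (congrArg (el n (.gen .tagOut : Tm k _ _)) (el_tagIn x)).trans ?_
  rw [el_tagOut, LinearEquiv.symm_apply_apply]
  rfl

theorem webFunctor_tagOut_tagIn :
    (webFunctor k n).map (PWebUD.tagOut k) ≫ (webFunctor k n).map (PWebUD.tagIn k) = 𝟙 _ := by
  refine PMod.hom_ext (M := wobj k n (down 1)) (N := wobj k n (down 1)) (ed_ext fun x => ?_)
  refine (congrArg (el n (.gen .tagIn : Tm k _ _)) (el_tagOut x)).trans ?_
  rw [el_tagIn, LinearEquiv.apply_symm_apply]
  rfl

theorem webFunctor_rcross (a b : ℕ) : IsSwap a b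
    (tensorHom (k := k) (upSS k n a).inv (downSS k n b).inv ≫ ((webFunctor k n).μ _ _).hom ≫
      (webFunctor k n).map (PWebUD.rcross k a b) ≫ ((webFunctor k n).μ _ _).inv ≫
        tensorHom (k := k) (downSS k n b).hom (upSS k n a).hom) := by
  intro p q x hx f hf
  refine Eq.trans ?_ (swapLin_apply hx hf)
  refine Eq.trans ?_ (tensorMor_wobjμ_inv (downIso b) (upIso a) (upIso_mem a) _)
  exact congrArg (fun w => PMod.lin (tensorMor (downIso b).hom (upIso a).hom)
    (PMod.lin (wobjμ (down b) (up a)).inv w)) ((congrArg (el n (Tm.rcross k a b))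
      (wobjμ_tensorMor_inv (upIso a) (downIso b) (downIso_mem b) x f)).trans (el_rcross x f))

end Superfunctor

end

end TypeP

theorem mainTheorem6 (k : Type u) [Field k] [NeZero (2 : k)] (n : ℕ) :
    ∃ (G : MonoidalSuperfunctor k (PWebUD k) (ModSS k n))
      (θ : ∀ a : ℕ, G.obj (PWebUD.up k a) ≅ ModSS.sym k n a)
      (η : ∀ a : ℕ, G.obj (PWebUD.down k a) ≅ ModSS.symDual k n a),
      (∀ a : ℕ, 0 < a → ∃ h : G.obj (PWebUD.up k a) = ModSS.sym k n a, θ a = eqToIso h) ∧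
      (∀ a : ℕ, 0 < a → ∃ h : G.obj (PWebUD.down k a) = ModSS.symDual k n a, η a = eqToIso h) ∧
      ModSS.lin (G.ε.hom ≫ (θ 0).hom) PMod.trivOne = symProd (Fin.elim0 : Fin 0 → NatV k n) ∧
      symEval (ModSS.lin (G.ε.hom ≫ (η 0).hom) PMod.trivOne)
        (symProd (Fin.elim0 : Fin 0 → NatV k n)) = 1 ∧
      (∀ a b : ℕ, IsSpl a b ((θ (a + b)).inv ≫ G.map (PWebUD.split k a b) ≫
        (G.μ _ _).inv ≫ tensorHom (k := k) (θ a).hom (θ b).hom)) ∧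
      (∀ a b : ℕ, IsMer a b (tensorHom (k := k) (θ a).inv (θ b).inv ≫ (G.μ _ _).hom ≫
        G.map (PWebUD.merge k a b) ≫ (θ (a + b)).hom)) ∧
      (∀ a : ℕ, IsEval a (tensorHom (k := k) (η a).inv (θ a).inv ≫ (G.μ _ _).hom ≫
        G.map (PWebUD.lcap k a) ≫ G.ε.inv)) ∧
      (∀ a : ℕ, IsCoeval a (G.ε.hom ≫ G.map (PWebUD.lcup k a) ≫ (G.μ _ _).inv ≫
        tensorHom (k := k) (θ a).hom (η a).hom)) ∧
      IsD ((θ 1).inv ≫ G.map (PWebUD.tagIn k) ≫ (η 1).hom) ∧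
      (G.map (PWebUD.tagIn k) ≫ G.map (PWebUD.tagOut k) = 𝟙 _ ∧
        G.map (PWebUD.tagOut k) ≫ G.map (PWebUD.tagIn k) = 𝟙 _) ∧
      (∀ a b : ℕ, IsSwap a b (tensorHom (k := k) (θ a).inv (η b).inv ≫ (G.μ _ _).hom ≫
        G.map (PWebUD.rcross k a b) ≫ (G.μ _ _).inv ≫
        tensorHom (k := k) (η b).hom (θ a).hom)) := by
  refine ⟨webFunctor k n, upSS k n, downSS k n, fun a ha => upSS_eq ha, fun a ha => downSS_eq ha,
    unitEquiv_trivOne, ?_, webFunctor_split, webFunctor_merge, webFunctor_lcap, webFunctor_lcup,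
    webFunctor_tagIn, ⟨webFunctor_tagIn_tagOut, webFunctor_tagOut_tagIn⟩, webFunctor_rcross⟩
  -- The unit of the dual side is the augmentation, and the empty product is the unit of `S(V)`,
  -- where it takes the value `1`.
  exact (congrArg (fun f => symEval f _) unitDualEquiv_trivOne).trans symAug_one
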